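/- \textbf{Theorem (first-order rate under bounded total variation).} Let $d\in\{1,2,3\}$, $\gamma\in(1,2]$, $C_v=\frac1{\gamma-1}$. For $U=(\varrho,m,E)\in\mathbb R\times\mathbb R^d\times\mathbb R$ put $u=m/\varrho$, $p=(\gamma-1)\left(E-\frac{|m|^2}{2\varrho}\right)$, $F(U)=(m,\ u\otimes m+p\,\mathbb I,\ u(E+p))$, $\eta=C_v\varrho S$ with $S=\ln(p/\varrho^\gamma)$, $\vartheta=p/\varrho$, $\varrho e=p/(\gamma-1)$; $\varrho e$ and $\vartheta$ are also regarded as functions of $(\varrho,\eta)$. The relative energy is $$\mathbb E(\varrho,m,\eta\,|\,\tilde\varrho,\tilde u,\tilde\eta)=\tfrac12\varrho\left|\tfrac m\varrho-\tilde u\right|^2+\varrho e-\tfrac{\partial(\varrho e)}{\partial\varrho}\Big|_{(\tilde\varrho,\tilde\eta)}(\varrho-\tilde\varrho)-\tfrac{\partial(\varrho e)}{\partial\eta}\Big|_{(\tilde\varrho,\tilde\eta)}(\eta-\tilde\eta)-\tilde\varrho\tilde e .$$ Let $\Omega\subset\mathbb R^d$ be a bounded domain with $\Omega=\operatorname{int}\overline\Omega$.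 A \emph{mesh of size at most $h$} is a finite set of closed axis-parallel boxes $K$ with pairwise disjoint interiors, edges of length at most $h$, and union $\overline\Omega$. Interior faces are the sets $K\cap L$ ($K\neq L$ cells) of positive $(d-1)$-measure; boundary faces are the parts of the sides of cells that lie on $\partial\Omega$. (All statements below concern domains that have such meshes.) A \emph{strong solution} on $[0,T]$ is a triple $(\tilde\varrho,\tilde u,\tilde\eta)$ of functions in $W^{1,\infty}((0,T)\times\Omega)\cap C^0([0,T]\times\overline\Omega)$ with $\tilde\varrho>0$ and $\tilde\vartheta=\vartheta(\tilde\varrho,\tilde\eta)>0$ on $[0,T]\times\overline\Omega$, such that $\tilde U=(\tilde\varrho,\tilde\varrho\tilde u,\frac12\tilde\varrho|\tilde u|^2+\tilde\varrho\tilde e)$ satisfies $\partial_t\tilde U+\operatorname{div}_xF(\tilde U)=0$ a.e.\ in $(0,T)\times\Omega$, and $\tilde u\cdot n=0$ on $\partial\Omega$. Its initial value is $U_0=\tilde U(0,\cdot)$. The \emph{Godunov solution} $U_h=(\varrho_h,m_h,E_h)$ on a mesh is constant on each cell, differentiable in $t\in[0,T]$, with $U_h(0)|_K=\frac1{|K|}\int_KU_0\,dx$,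 and for every function $\phi$ that is constant on each cell $$\int_\Omega\phi\,\frac{d}{dt}U_h\,dx-\sum_{\sigma\ \mathrm{interior}}\int_\sigma F(U^{RP}_\sigma)\cdot n\,[\![\phi]\!]\,dS+\sum_{\sigma\subset\partial\Omega}\int_\sigma F(U^{RP}_\sigma)\cdot n\,\phi\,dS=0 ,$$ where $n$ is a unit normal of $\sigma$ (the outer one on $\partial\Omega$), $[\![\phi]\!]$ is the jump across $\sigma$ in the direction of $n$, and $U^{RP}_\sigma$ is the value on $\sigma$ of the exact (self-similar, piecewise $C^1$, possibly with vacuum) entropy solution of the Riemann problem in direction $n$ between the two adjacent states; on boundary faces, in accordance with the impermeability condition, the outer state is the mirror image of the inner one, with reversed normal momentum. Write $\eta_h=\eta(U_h)$. Given $d,\gamma,\Omega$ and constants $M$, $r>0$, there is a constant $c\ge0$ such that for all $\underline\varrho>0$, $\overline E>0$, $C_0$, $B$ there is a constant $C>0$ with the following property. Let $T>0$, let $(\tilde\varrho,\tilde u,\tilde\eta)$ be a strong solution on $[0,T]$ with $\|\tilde U\|_{W^{1,\infty}((0,T)\times\Omega)}\le M$, $\tilde\varrho\ge r$ and $\tilde\vartheta\ge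 r$, and let $U_h$ be a Godunov solution with initial value from $U_0=\tilde U(0,\cdot)$ on a mesh of size at most $h$, such that for all $t\in[0,T]$ $$\underline\varrho\le\varrho_h,\qquad 0<E_h\le\overline E,\qquad \sum_{\sigma\ \mathrm{interior}}\int_\sigma|[\![U_h]\!]|\,dS\le B,$$ and $\|U_h(0)-U_0\|_{L^2(\Omega)}\le C_0h^{1/2}$. Then for every $\tau\in[0,T]$ $$\left\|\mathbb E(\varrho_h,m_h,\eta_h\,|\,\tilde\varrho,\tilde u,\tilde\eta)(\tau,\cdot)\right\|_{L^1(\Omega)}\le C\,h\,\exp(\tau c),$$ and each of $\|(\varrho_h-\tilde\varrho)(\tau,\cdot)\|_{L^2(\Omega)}$, $\|(m_h-\tilde\varrho\tilde u)(\tau,\cdot)\|_{L^2(\Omega)}$, $\|(\eta_h-\tilde\eta)(\tau,\cdot)\|_{L^2(\Omega)}$ is at most $C\,h^{1/2}\exp(\tau c/2)$. -/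

import Mathlib

open Set Filter Topology MeasureTheory
open scoped ContDiff

noncomputable section

namespace GodunovEuler

/-! ### The Euler system of a perfect gas -/

/-- Conserved variables `U = (ρ, m, E)`: density, momentum, total energy. -/
abbrev State (d : ℕ) : Type := ℝ × (Fin d → ℝ) × ℝ

/-- Euclidean length of a state. -/
def stateNorm {d : ℕ} (U : State d) : ℝ :=
  Real.sqrt (U.1 ^ 2 + ∑ j, U.2.1 j ^ 2 + U.2.2 ^ 2)

/-- Pressure `p = (γ - 1) ρ e` with `ρ e = E - |m|² / (2 ρ)`. -/
def pressure {d : ℕ} (γ : ℝ) (U : State d) : ℝ :=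
  (γ - 1) * (U.2.2 - (∑ j, U.2.1 j ^ 2) / (2 * U.1))

/-- The `i`-th column `(m_i, u_i m + p e_i, u_i (E + p))` of the flux. -/
def flux {d : ℕ} (γ : ℝ) (i : Fin d) (U : State d) : State d :=
  (U.2.1 i,
   fun j => U.2.1 i / U.1 * U.2.1 j + (if j = i then pressure γ U else 0),
   U.2.1 i / U.1 * (U.2.2 + pressure γ U))

/-- Total entropy `η = C_v ρ S`, with `C_v = 1 / (γ - 1)` and `S = log (p / ρ ^ γ)`. -/
def entropy {d : ℕ} (γ : ℝ) (U : State d) : ℝ :=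
  1 / (γ - 1) * U.1 * Real.log (pressure γ U / U.1 ^ γ)

/-- The `i`-th component of the entropy flux `q = η u`. -/
def entropyFlux {d : ℕ} (γ : ℝ) (i : Fin d) (U : State d) : ℝ :=
  entropy γ U * (U.2.1 i / U.1)

/-- A gas state (positive density and pressure) or the vacuum. On the vacuum state `U = 0` the
pressure, the flux, the entropy and the entropy flux above all vanish, as they should. -/
def Admissible {d : ℕ} (γ : ℝ) (U : State d) : Prop :=
  (0 < U.1 ∧ 0 < pressure γ U) ∨ U = 0

/-! ### Thermodynamic functions of `(ρ, η)`; relative energy -/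

/-- `ρ e` as a function of `(ρ, η)`: `ρ e = p / (γ - 1)` with `p = ρ ^ γ exp S`, `S = η / (C_v ρ)`. -/
def intEnergy (γ ρ η : ℝ) : ℝ := ρ ^ γ * Real.exp ((γ - 1) * η / ρ) / (γ - 1)

/-- Temperature `ϑ = p / ρ` as a function of `(ρ, η)`. -/
def temperature (γ ρ η : ℝ) : ℝ := (γ - 1) * intEnergy γ ρ η / ρ

/-- Conserved variables belonging to density, velocity and total entropy. -/
def conserved {d : ℕ} (γ ρ : ℝ) (u : Fin d → ℝ) (η : ℝ) : State d :=
  (ρ, ρ • u, 1 / 2 * ρ * ∑ j, u j ^ 2 + intEnergy γ ρ η)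

/-- Relative energy of `(ρ, m, η)` with respect to `(ρ', u', η')`. -/
def relEnergy {d : ℕ} (γ ρ : ℝ) (m : Fin d → ℝ) (η ρ' : ℝ) (u' : Fin d → ℝ) (η' : ℝ) : ℝ :=
  1 / 2 * ρ * ∑ j, (m j / ρ - u' j) ^ 2 + intEnergy γ ρ η
    - deriv (fun r => intEnergy γ r η') ρ' * (ρ - ρ')
    - deriv (fun s => intEnergy γ ρ' s) η' * (η - η')
    - intEnergy γ ρ' η'

/-! ### Strong solutions -/

/-- `g` is the weak derivative of `f` in the direction `v` on the open set `Q`. -/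
def HasWeakDeriv {X V : Type*} [NormedAddCommGroup X] [NormedSpace ℝ X] [MeasureSpace X]
    [NormedAddCommGroup V] [NormedSpace ℝ V] (Q : Set X) (v : X) (f g : X → V) : Prop :=
  LocallyIntegrableOn f Q ∧ LocallyIntegrableOn g Q ∧
    ∀ φ : X → ℝ, ContDiff ℝ ∞ φ → HasCompactSupport φ → tsupport φ ⊆ Q →
      ∫ z in Q, fderiv ℝ φ z v • f z = - ∫ z in Q, φ z • g z

/-- The open space-time cylinder `(0, T) × Ω`. -/
def cylinder {d : ℕ} (T : ℝ) (Ω : Set (Fin d → ℝ)) : Set (ℝ × (Fin d → ℝ)) := Ioo 0 T ×ˢ Ω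

/-- The direction of `t`. -/
def dirT (d : ℕ) : ℝ × (Fin d → ℝ) := (1, 0)

/-- The direction of `x_i`. -/
def dirX {d : ℕ} (i : Fin d) : ℝ × (Fin d → ℝ) := (0, Pi.single i 1)

/-- `f` is in `W^{1,∞}((0,T) × Ω)` and continuous on the closed cylinder, and its
`W^{1,∞}` norm (largest sup norm of `f` and of its first weak derivatives) is at most `M`. -/
def W1InfNormLE {d : ℕ} {V : Type*} [NormedAddCommGroup V] [NormedSpace ℝ V]
    (T : ℝ) (Ω : Set (Fin d → ℝ)) (f : ℝ × (Fin d → ℝ) → V) (M : ℝ) : Prop :=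
  ContinuousOn f (Icc 0 T ×ˢ closure Ω) ∧
  (∀ z ∈ cylinder T Ω, ‖f z‖ ≤ M) ∧
  (∃ g, HasWeakDeriv (cylinder T Ω) (dirT d) f g ∧
    ∀ᵐ z ∂(volume.restrict (cylinder T Ω)), ‖g z‖ ≤ M) ∧
  (∀ i : Fin d, ∃ g, HasWeakDeriv (cylinder T Ω) (dirX i) f g ∧
    ∀ᵐ z ∂(volume.restrict (cylinder T Ω)), ‖g z‖ ≤ M)

/-- Near `x` the boundary of `Ω` is a piece of the hyperplane `y_i = x_i`, with `Ω` on one side: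
the outer normal at `x` is `e_i` or `-e_i`. For a domain that is tiled by finitely many boxes
this holds, for some `i`, at every boundary point off a set of dimension `d - 2`. -/
def HasNormalAlong {d : ℕ} (Ω : Set (Fin d → ℝ)) (i : Fin d) (x : Fin d → ℝ) : Prop :=
  (∀ᶠ y in 𝓝 x, y ∈ Ω ↔ y i < x i) ∨ (∀ᶠ y in 𝓝 x, y ∈ Ω ↔ x i < y i)

/-- Strong solution `(ρ, u, η)` of the Euler system with the impermeability condition. -/
structure IsStrongSolution {d : ℕ} (γ T : ℝ) (Ω : Set (Fin d → ℝ))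
    (ρ : ℝ × (Fin d → ℝ) → ℝ) (u : ℝ × (Fin d → ℝ) → Fin d → ℝ)
    (η : ℝ × (Fin d → ℝ) → ℝ) : Prop where
  density_regular : ∃ M, W1InfNormLE T Ω ρ M
  velocity_regular : ∃ M, W1InfNormLE T Ω u M
  entropy_regular : ∃ M, W1InfNormLE T Ω η M
  density_pos : ∀ z ∈ Icc 0 T ×ˢ closure Ω, 0 < ρ z
  temperature_pos : ∀ z ∈ Icc 0 T ×ˢ closure Ω, 0 < temperature γ (ρ z) (η z)
  /-- `∂_t U + ∑ i, ∂_i F_i(U) = 0` almost everywhere. -/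
  euler : ∃ (Gt : ℝ × (Fin d → ℝ) → State d) (G : Fin d → ℝ × (Fin d → ℝ) → State d),
    HasWeakDeriv (cylinder T Ω) (dirT d) (fun z => conserved γ (ρ z) (u z) (η z)) Gt ∧
    (∀ i, HasWeakDeriv (cylinder T Ω) (dirX i)
      (fun z => flux γ i (conserved γ (ρ z) (u z) (η z))) (G i)) ∧
    ∀ᵐ z ∂(volume.restrict (cylinder T Ω)), Gt z + ∑ i, G i z = 0
  /-- `u · n = 0` on the boundary. -/
  impermeable : ∀ t ∈ Icc 0 T, ∀ x ∈ frontier Ω, ∀ i, HasNormalAlong Ω i x → u (t, x) i = 0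

/-! ### Exact Riemann solutions -/

/-- `V` is the trace of `W` along the filter `l` (with the traces of flux, entropy and entropy
flux, which is automatic unless `V` is the vacuum). -/
def HasTrace {d : ℕ} (γ : ℝ) (i : Fin d) (W : ℝ → State d) (l : Filter ℝ) (V : State d) : Prop :=
  Tendsto W l (𝓝 V) ∧ Tendsto (fun ξ => flux γ i (W ξ)) l (𝓝 (flux γ i V)) ∧
  Tendsto (fun ξ => entropy γ (W ξ)) l (𝓝 (entropy γ V)) ∧
  Tendsto (fun ξ => entropyFlux γ i (W ξ)) l (𝓝 (entropyFlux γ i V))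

/-- `(t, x) ↦ W (x / t)` is the self-similar entropy solution of the one-dimensional Riemann
problem `∂_t U + ∂_x F_i(U) = 0`, `U = UL` for `x < 0` and `U = UR` for `x > 0` at `t = 0`. It is
piecewise `C¹` with finitely many break points (jumps and edges of rarefaction waves), satisfies
`-ξ W' + F_i(W)' = 0` between them, and the Rankine-Hugoniot relation and the entropy inequality
at each of them. Vacuum may appear. -/
def IsRiemannSolution {d : ℕ} (γ : ℝ) (i : Fin d) (UL UR : State d) (W : ℝ → State d) : Prop :=
  (∀ᶠ ξ in atBot, W ξ = UL) ∧ (∀ᶠ ξ in atTop, W ξ = UR) ∧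
  ∃ B : Finset ℝ,
    (∀ ξ, ξ ∉ B → Admissible γ (W ξ) ∧ ContDiffAt ℝ 1 W ξ ∧
      HasDerivAt (fun ζ => flux γ i (W ζ)) (ξ • deriv W ξ) ξ) ∧
    (∀ b ∈ B, ∃ Vl Vr : State d, Admissible γ Vl ∧ Admissible γ Vr ∧
      HasTrace γ i W (𝓝[<] b) Vl ∧ HasTrace γ i W (𝓝[>] b) Vr ∧
      flux γ i Vr - flux γ i Vl = b • (Vr - Vl) ∧
      b * (entropy γ Vr - entropy γ Vl) ≤ entropyFlux γ i Vr - entropyFlux γ i Vl)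

/-- `V` is the value on the interface `x = 0` of the exact solution of the Riemann problem. If
the solution jumps there, the left trace is taken; both traces then have the same flux. -/
def IsInterfaceState {d : ℕ} (γ : ℝ) (i : Fin d) (UL UR V : State d) : Prop :=
  ∃ W : ℝ → State d, IsRiemannSolution γ i UL UR W ∧ Tendsto W (𝓝[<] 0) (𝓝 V)

/-- Mirror state with respect to a wall with normal `e_i`: the normal momentum is reversed. -/
def reflect {d : ℕ} (i : Fin d) (U : State d) : State d :=
  (U.1, Function.update U.2.1 i (- U.2.1 i), U.2.2)

/-! ### Rectangular meshes and the Godunov method -/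

/-- A mesh of `Ω` by finitely many axis-parallel boxes `K = ∏ j, [lo K j, hi K j]`. -/
structure RectMesh (d : ℕ) (Ω : Set (Fin d → ℝ)) where
  n : ℕ
  lo : Fin n → Fin d → ℝ
  hi : Fin n → Fin d → ℝ
  lo_lt_hi : ∀ K j, lo K j < hi K j
  disjoint : ∀ K L, K ≠ L →
    Disjoint (univ.pi fun j => Ioo (lo K j) (hi K j)) (univ.pi fun j => Ioo (lo L j) (hi L j))
  cover : ⋃ K, Icc (lo K) (hi K) = closure Ω

namespace RectMesh

variable {d : ℕ} {Ω : Set (Fin d → ℝ)} (𝒯 : RectMesh d Ω)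

/-- All edges of all cells have length at most `h`. -/
def SizeLE (h : ℝ) : Prop := ∀ K j, 𝒯.hi K j - 𝒯.lo K j ≤ h

/-- Volume `|K|` of a cell. -/
def cellVol (K : Fin 𝒯.n) : ℝ := ∏ j, (𝒯.hi K j - 𝒯.lo K j)

/-- Area of the two sides of the cell `K` that are orthogonal to `e_i`. -/
def sideArea (i : Fin d) (K : Fin 𝒯.n) : ℝ :=
  ∏ j ∈ Finset.univ.erase i, (𝒯.hi K j - 𝒯.lo K j)

/-- Area of the interior face `K ∩ L` with normal `e_i` from `K` to `L`
(zero if there is no such face). -/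
def faceArea (i : Fin d) (K L : Fin 𝒯.n) : ℝ :=
  if 𝒯.hi K i = 𝒯.lo L i then
    ∏ j ∈ Finset.univ.erase i,
      max 0 (min (𝒯.hi K j) (𝒯.hi L j) - max (𝒯.lo K j) (𝒯.lo L j))
  else 0

/-- Area of the part of `∂K ∩ ∂Ω` with outer normal `e_i`:
what the neighbours of `K` leave of that side. -/
def wallAreaR (i : Fin d) (K : Fin 𝒯.n) : ℝ := 𝒯.sideArea i K - ∑ L, 𝒯.faceArea i K L

/-- Area of the part of `∂K ∩ ∂Ω` with outer normal `-e_i`. -/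
def wallAreaL (i : Fin d) (K : Fin 𝒯.n) : ℝ := 𝒯.sideArea i K - ∑ L, 𝒯.faceArea i L K

/-- The piecewise constant function with the value `v K` inside the cell `K`. -/
def toFun {V : Type*} [AddCommMonoid V] (v : Fin 𝒯.n → V) (x : Fin d → ℝ) : V :=
  ∑ K, (univ.pi fun j => Ioo (𝒯.lo K j) (𝒯.hi K j)).indicator (fun _ => v K) x

/-- The projection onto piecewise constants: the mean value over each cell. -/
def proj {V : Type*} [NormedAddCommGroup V] [NormedSpace ℝ V] (f : (Fin d → ℝ) → V)
    (K : Fin 𝒯.n) : V :=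
  ⨍ x in Icc (𝒯.lo K) (𝒯.hi K), f x

/-- `∑ σ interior, ∫_σ |[[v]]| dS`. -/
def totalJump (v : Fin 𝒯.n → State d) : ℝ :=
  ∑ i, ∑ K, ∑ L, 𝒯.faceArea i K L * stateNorm (v L - v K)

/-- `U` is the solution of the semi-discrete Godunov method on `[0, T]` with initial data `U0`.
At time `t`, `V i K L` is the exact Riemann solution on the interior face from `K` to `L` in
direction `e_i`, and `VR i K`, `VL i K` are those on the parts of `∂K ∩ ∂Ω` with outer normal
`e_i`, `-e_i`, where the outer state is the mirror image of the inner one. For all piecewise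
constant `φ`, with `[[φ]] = φ L - φ K` on an interior face,
`∫_Ω φ dU/dt - ∑ σ interior, ∫_σ F(V)·n [[φ]] + ∑ σ on the boundary, ∫_σ F(V)·n φ = 0`. -/
structure IsGodunovSolution (γ T : ℝ) (U0 : (Fin d → ℝ) → State d)
    (U : ℝ → Fin 𝒯.n → State d) : Prop where
  initial : ∀ K, U 0 K = 𝒯.proj U0 K
  scheme : ∃ U' : ℝ → Fin 𝒯.n → State d, ∀ t ∈ Icc 0 T,
    (∀ K, HasDerivWithinAt (fun s => U s K) (U' t K) (Icc 0 T) t) ∧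
    ∃ (V : Fin d → Fin 𝒯.n → Fin 𝒯.n → State d) (VR VL : Fin d → Fin 𝒯.n → State d),
      (∀ i K L, 0 < 𝒯.faceArea i K L → IsInterfaceState γ i (U t K) (U t L) (V i K L)) ∧
      (∀ i K, 0 < 𝒯.wallAreaR i K →
        IsInterfaceState γ i (U t K) (reflect i (U t K)) (VR i K)) ∧
      (∀ i K, 0 < 𝒯.wallAreaL i K →
        IsInterfaceState γ i (reflect i (U t K)) (U t K) (VL i K)) ∧
      ∀ φ : Fin 𝒯.n → ℝ,
        ∑ K, (𝒯.cellVol K * φ K) • U' t K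
          - ∑ i, ∑ K, ∑ L, (𝒯.faceArea i K L * (φ L - φ K)) • flux γ i (V i K L)
          + ∑ i, ∑ K, ((𝒯.wallAreaR i K * φ K) • flux γ i (VR i K)
              - (𝒯.wallAreaL i K * φ K) • flux γ i (VL i K)) = 0

end RectMesh

end GodunovEuler

end

open GodunovEuler

open Set Filter Topology MeasureTheory
open scoped ContDiff

noncomputable section

namespace GodunovEuler

/-! ### Thermodynamics and the relative energy -/

section Thermo

variable {d : ℕ} {γ : ℝ}

/-- A state with positive density and pressure. -/
def IsGas (γ : ℝ) (U : State d) : Prop := 0 < U.1 ∧ 0 < pressure γ U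

/-- Velocity of a state. -/
def vel (U : State d) (j : Fin d) : ℝ := U.2.1 j / U.1

/-- Temperature of a state. -/
def temp (γ : ℝ) (U : State d) : ℝ := pressure γ U / U.1

/-- Specific entropy as a function of density and temperature. -/
def spEntropy (γ ρ ϑ : ℝ) : ℝ := Real.log ϑ / (γ - 1) - Real.log ρ

/-- The derivative of the total energy with respect to the density at fixed momentum and
total entropy. -/
def chem (γ ρ : ℝ) (u : Fin d → ℝ) (ϑ : ℝ) : ℝ :=
  -(∑ j, u j ^ 2) / 2 + ϑ * (γ / (γ - 1) - spEntropy γ ρ ϑ)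

/-- Thermal part of the relative energy. -/
def thermoRel (γ ρ ϑ ρ' ϑ' : ℝ) : ℝ :=
  1 / (γ - 1) * ρ * (ϑ - ϑ' - ϑ' * Real.log (ϑ / ϑ')) + ϑ' * (ρ * Real.log (ρ / ρ') - ρ + ρ')

/-- The relative energy, affine in the conserved variables and the entropy. -/
def relLin (γ : ℝ) (U : State d) (ρ' : ℝ) (u' : Fin d → ℝ) (ϑ' : ℝ) : ℝ :=
  U.2.2 - chem γ ρ' u' ϑ' * U.1 - ∑ j, u' j * U.2.1 j - ϑ' * entropy γ U + ρ' * ϑ'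

theorem IsGas.temp_pos {U : State d} (h : IsGas γ U) : 0 < temp γ U := div_pos h.2 h.1

theorem Admissible.isGas_or {U : State d} (h : Admissible γ U) : IsGas γ U ∨ U = 0 := h

theorem IsGas.admissible {U : State d} (h : IsGas γ U) : Admissible γ U := Or.inl h

@[simp] theorem pressure_zero : pressure γ (0 : State d) = 0 := by simp [pressure]

@[simp] theorem entropy_zero : entropy γ (0 : State d) = 0 := by simp [entropy]

@[simp] theorem entropyFlux_zero (i : Fin d) : entropyFlux γ i (0 : State d) = 0 := by
  simp [entropyFlux]

@[simp] theorem flux_zero (i : Fin d) : flux γ i (0 : State d) = 0 := by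
  ext <;> simp [flux]

theorem Admissible.nonneg {U : State d} (h : Admissible γ U) :
    0 ≤ U.1 ∧ 0 ≤ pressure γ U := by
  rcases h with h | rfl
  · exact ⟨h.1.le, h.2.le⟩
  · simp

theorem Admissible.isGas_of_pos {U : State d} (h : Admissible γ U) (h0 : 0 < U.1) : IsGas γ U := by
  rcases h with h | rfl
  · exact h
  · simp at h0

theorem log_pressure_div (hγ : 1 < γ) {p ρ : ℝ} (hp : 0 < p) (hρ : 0 < ρ) :
    1 / (γ - 1) * Real.log (p / ρ ^ γ) = spEntropy γ ρ (p / ρ) := by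
  have h1 : γ - 1 ≠ 0 := by linarith
  rw [spEntropy, Real.log_div hp.ne' (Real.rpow_pos_of_pos hρ _).ne', Real.log_rpow hρ,
    Real.log_div hp.ne' hρ.ne']
  field_simp
  ring

theorem entropy_eq (hγ : 1 < γ) {U : State d} (h : IsGas γ U) :
    entropy γ U = U.1 * spEntropy γ U.1 (temp γ U) := by
  rw [temp, ← log_pressure_div hγ h.2 h.1, entropy]; ring

theorem energy_eq (hγ : 1 < γ) (U : State d) (h : U.1 ≠ 0) :
    U.2.2 = 1 / 2 * U.1 * ∑ j, vel U j ^ 2 + 1 / (γ - 1) * (U.1 * temp γ U) := by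
  have h1 : γ - 1 ≠ 0 := by linarith
  have : ∑ j, vel U j ^ 2 = (∑ j, U.2.1 j ^ 2) / U.1 ^ 2 := by
    rw [Finset.sum_div]; exact Finset.sum_congr rfl fun j _ => by rw [vel, div_pow]
  rw [this, temp, pressure]
  field_simp
  ring

theorem mom_eq (U : State d) (h : U.1 ≠ 0) (j : Fin d) : U.2.1 j = U.1 * vel U j := by
  rw [vel]; field_simp

theorem spEntropy_sub {ρ ϑ ρ' ϑ' : ℝ} (hρ : 0 < ρ) (hϑ : 0 < ϑ) (hρ' : 0 < ρ') (hϑ' : 0 < ϑ') :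
    spEntropy γ ρ ϑ - spEntropy γ ρ' ϑ'
      = 1 / (γ - 1) * Real.log (ϑ / ϑ') - Real.log (ρ / ρ') := by
  rw [spEntropy, spEntropy, Real.log_div hϑ.ne' hϑ'.ne', Real.log_div hρ.ne' hρ'.ne']; ring

theorem relLin_eq (hγ : 1 < γ) {U : State d} (h : Admissible γ U) {ρ' ϑ' : ℝ} (hρ' : 0 < ρ')
    (hϑ' : 0 < ϑ') (u' : Fin d → ℝ) :
    relLin γ U ρ' u' ϑ'
      = 1 / 2 * U.1 * ∑ j, (vel U j - u' j) ^ 2 + thermoRel γ U.1 (temp γ U) ρ' ϑ' := by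
  have h1 : γ - 1 ≠ 0 := by linarith
  rcases h.isGas_or with h | rfl
  · have hs := spEntropy_sub (γ := γ) h.1 h.temp_pos hρ' hϑ'
    have hm : ∑ j, u' j * U.2.1 j = U.1 * ∑ j, u' j * vel U j := by
      rw [Finset.mul_sum]
      exact Finset.sum_congr rfl fun j _ => by rw [mom_eq U h.1.ne' j]; ring
    have hw : ∑ j, (vel U j - u' j) ^ 2
        = ∑ j, vel U j ^ 2 - 2 * ∑ j, u' j * vel U j + ∑ j, u' j ^ 2 := by
      rw [Finset.mul_sum, ← Finset.sum_sub_distrib, ← Finset.sum_add_distrib]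
      exact Finset.sum_congr rfl fun j _ => by ring
    rw [relLin, entropy_eq hγ h, hm, hw, thermoRel, chem, energy_eq hγ U h.1.ne']
    have e1 : γ / (γ - 1) = 1 + 1 / (γ - 1) := by field_simp; ring
    rw [e1]
    linear_combination (-ϑ' * U.1) * hs
  · simp [relLin, thermoRel, chem]; ring

theorem sub_sq_sqrt {x : ℝ} (hx : 0 < x) : (√x - 1) ^ 2 ≤ x - 1 - Real.log x := by
  have h := Real.log_le_sub_one_of_pos (Real.sqrt_pos.2 hx)
  have h2 : Real.log √x = Real.log x / 2 := by rw [Real.log_sqrt hx.le]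
  nlinarith [Real.sq_sqrt hx.le]

theorem sub_mul_log_ge {x y : ℝ} (hx : 0 < x) (hy : 0 < y) :
    (√x - √y) ^ 2 ≤ x - y - y * Real.log (x / y) := by
  have h := sub_sq_sqrt (div_pos hx hy)
  have h2 := mul_le_mul_of_nonneg_left h hy.le
  have h3 : y * (√(x / y) - 1) ^ 2 = (√x - √y) ^ 2 := by
    rw [Real.sqrt_div hx.le]
    have := Real.sqrt_pos.2 hy
    have e := Real.sq_sqrt hy.le
    field_simp
    rw [e]
  have h4 : y * (x / y - 1 - Real.log (x / y)) = x - y - y * Real.log (x / y) := by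
    field_simp
  linarith

theorem thermoRel_ge (hγ : 1 < γ) {ρ ϑ ρ' ϑ' : ℝ} (h : (0 < ρ ∧ 0 < ϑ) ∨ ρ = 0)
    (hρ' : 0 < ρ') (hϑ' : 0 < ϑ') :
    1 / (γ - 1) * ρ * (√ϑ - √ϑ') ^ 2 + ϑ' * (√ρ - √ρ') ^ 2 ≤ thermoRel γ ρ ϑ ρ' ϑ' := by
  have hg : 0 < 1 / (γ - 1) := by apply one_div_pos.2; linarith
  rcases h with ⟨hρ, hϑ⟩ | rfl
  · have h1 := sub_mul_log_ge hϑ hϑ'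
    have h2 := sub_mul_log_ge hρ' hρ
    have h3 : Real.log (ρ' / ρ) = - Real.log (ρ / ρ') := by
      rw [← Real.log_inv, inv_div]
    rw [h3] at h2
    have h4 : (√ρ - √ρ') ^ 2 ≤ ρ * Real.log (ρ / ρ') - ρ + ρ' := by
      have : (√ρ - √ρ') ^ 2 = (√ρ' - √ρ) ^ 2 := by ring
      rw [this]; linarith
    rw [thermoRel]
    gcongr
  · simp [thermoRel, Real.sq_sqrt hρ'.le]

theorem thermoRel_le (hγ : 1 < γ) {ρ ϑ ρ' ϑ' : ℝ} (hρ : 0 < ρ) (hϑ : 0 < ϑ)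
    (hρ' : 0 < ρ') (hϑ' : 0 < ϑ') :
    thermoRel γ ρ ϑ ρ' ϑ'
      ≤ 1 / (γ - 1) * ρ * ((ϑ - ϑ') ^ 2 / ϑ) + ϑ' * ((ρ - ρ') ^ 2 / ρ') := by
  have hg : 0 < 1 / (γ - 1) := by apply one_div_pos.2; linarith
  have key : ∀ {x y : ℝ}, 0 < x → 0 < y → x - y - y * Real.log (x / y) ≤ (x - y) ^ 2 / x := by
    intro x y hx hy
    have h := Real.log_le_sub_one_of_pos (div_pos hy hx)
    have h3 : Real.log (y / x) = - Real.log (x / y) := by rw [← Real.log_inv, inv_div]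
    rw [h3] at h
    have h2 := mul_le_mul_of_nonneg_left h hy.le
    have h4 : (x - y) ^ 2 / x = x - y + y * (y / x - 1) := by field_simp; ring
    rw [h4]; linarith
  have h1 := key hϑ hϑ'
  have h2 := key hρ' hρ
  have h3 : Real.log (ρ' / ρ) = - Real.log (ρ / ρ') := by rw [← Real.log_inv, inv_div]
  rw [h3] at h2
  have h4 : ρ * Real.log (ρ / ρ') - ρ + ρ' ≤ (ρ - ρ') ^ 2 / ρ' := by
    have : (ρ' - ρ) ^ 2 / ρ' = (ρ - ρ') ^ 2 / ρ' := by ring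
    rw [← this]; linarith
  rw [thermoRel]
  gcongr

theorem Admissible.cases_temp {U : State d} (h : Admissible γ U) :
    (0 < U.1 ∧ 0 < temp γ U) ∨ U.1 = 0 := by
  rcases h.isGas_or with h | rfl
  · exact Or.inl ⟨h.1, h.temp_pos⟩
  · exact Or.inr rfl

/-- Lower bound of the relative energy, valid up to the vacuum. -/
theorem relLin_ge (hγ : 1 < γ) {U : State d} (h : Admissible γ U) {ρ' ϑ' : ℝ} (hρ' : 0 < ρ')
    (hϑ' : 0 < ϑ') (u' : Fin d → ℝ) :
    1 / 2 * U.1 * ∑ j, (vel U j - u' j) ^ 2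
      + 1 / (γ - 1) * U.1 * (√(temp γ U) - √ϑ') ^ 2 + ϑ' * (√U.1 - √ρ') ^ 2
      ≤ relLin γ U ρ' u' ϑ' := by
  rw [relLin_eq hγ h hρ' hϑ']
  have := thermoRel_ge hγ h.cases_temp hρ' hϑ'
  linarith

theorem relLin_nonneg (hγ : 1 < γ) {U : State d} (h : Admissible γ U) {ρ' ϑ' : ℝ} (hρ' : 0 < ρ')
    (hϑ' : 0 < ϑ') (u' : Fin d → ℝ) : 0 ≤ relLin γ U ρ' u' ϑ' := by
  refine le_trans ?_ (relLin_ge hγ h hρ' hϑ' u')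
  have := h.nonneg.1
  have hg : 0 < 1 / (γ - 1) := by apply one_div_pos.2; linarith
  positivity

theorem relLin_self (hγ : 1 < γ) {U : State d} (h : IsGas γ U) :
    relLin γ U U.1 (vel U) (temp γ U) = 0 := by
  rw [relLin_eq hγ h.admissible h.1 h.temp_pos]
  simp [thermoRel, h.1.ne', h.temp_pos.ne']

/-- Bound of the entropy defect by the thermal relative energy, for entropies bounded below. -/
theorem entropy_defect_le (hγ : 1 < γ) {K : ℝ} (hK : 0 ≤ K) {ρ ϑ ρ' ϑ' : ℝ} (hρ : 0 < ρ)
    (hϑ : 0 < ϑ) (hρ' : 0 < ρ') (hϑ' : 0 < ϑ')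
    (hD : -K ≤ spEntropy γ ρ ϑ - spEntropy γ ρ' ϑ') :
    ϑ' * (ρ * (spEntropy γ ρ ϑ - spEntropy γ ρ' ϑ') ^ 2)
      ≤ 4 * (1 / (γ - 1) + 1) * Real.exp K * thermoRel γ ρ ϑ ρ' ϑ' := by
  rw [spEntropy_sub hρ hϑ hρ' hϑ'] at hD ⊢
  set a := Real.log (ϑ / ϑ') with ha
  set b := - Real.log (ρ / ρ') with hb
  set c := 1 / (γ - 1) with hc
  have hcpos : 0 < c := one_div_pos.2 (by linarith)
  have hea : Real.exp a = ϑ / ϑ' := Real.exp_log (div_pos hϑ hϑ')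
  have heb : Real.exp b = ρ' / ρ := by
    rw [hb, Real.exp_neg, Real.exp_log (div_pos hρ hρ'), inv_div]
  set z := (c * a + b) / (c + 1) with hz
  have hzD : c * a - Real.log (ρ / ρ') = (c + 1) * z := by
    rw [hz]; field_simp; rw [hb]; ring
  have hT : thermoRel γ ρ ϑ ρ' ϑ'
      = ρ * ϑ' * (c * (Real.exp a - 1 - a) + (Real.exp b - 1 - b)) := by
    rw [thermoRel, hea, heb, ← ha, hb, ← hc]
    field_simp
    ring
  have hJ : (c + 1) * (Real.exp z - 1 - z) ≤ c * (Real.exp a - 1 - a) + (Real.exp b - 1 - b) := by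
    have h1 : Real.exp z * (1 + (a - z)) ≤ Real.exp a := by
      have := Real.add_one_le_exp (a - z)
      have e : Real.exp a = Real.exp z * Real.exp (a - z) := by rw [← Real.exp_add]; ring_nf
      rw [e]; gcongr; linarith
    have h2 : Real.exp z * (1 + (b - z)) ≤ Real.exp b := by
      have := Real.add_one_le_exp (b - z)
      have e : Real.exp b = Real.exp z * Real.exp (b - z) := by rw [← Real.exp_add]; ring_nf
      rw [e]; gcongr; linarith
    have h3 : c * (a - z) + (b - z) = 0 := by rw [hz]; field_simp; ring
    have h4 := mul_le_mul_of_nonneg_left h1 hcpos.le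
    have h5 : Real.exp z * (c * (a - z) + (b - z)) = 0 := by rw [h3, mul_zero]
    nlinarith
  have hq : z ^ 2 ≤ 4 * Real.exp K * (Real.exp z - 1 - z) := by
    have h1 : (√(Real.exp z) - 1) ^ 2 ≤ Real.exp z - 1 - z := by
      have := sub_sq_sqrt (Real.exp_pos z); rwa [Real.log_exp] at this
    have h2 : √(Real.exp z) = Real.exp (z / 2) := by rw [Real.exp_half]
    rw [h2] at h1
    have h3 : (z / 2) ^ 2 ≤ Real.exp K * (Real.exp (z / 2) - 1) ^ 2 := by
      rcases le_total 0 z with h0 | h0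
      · have e1 := Real.add_one_le_exp (z / 2)
        have e2 : 1 ≤ Real.exp K := Real.one_le_exp hK
        have e3 : (z / 2) ^ 2 ≤ (Real.exp (z / 2) - 1) ^ 2 := by
          apply pow_le_pow_left₀ <;> linarith
        nlinarith [sq_nonneg (Real.exp (z / 2) - 1)]
      · have hzK : -K ≤ z := by
          rw [hzD] at hD
          by_contra hcon
          push Not at hcon
          nlinarith
        have e1 := Real.add_one_le_exp (-(z / 2))
        have e0 : Real.exp (z / 2) * Real.exp (-(z / 2)) = 1 := by rw [← Real.exp_add]; simp
        have e2 : Real.exp (z / 2) * (-(z / 2)) ≤ 1 - Real.exp (z / 2) := by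
          nlinarith [Real.exp_pos (z / 2)]
        have e3 : (Real.exp (z / 2) * (-(z / 2))) ^ 2 ≤ (1 - Real.exp (z / 2)) ^ 2 := by
          apply pow_le_pow_left₀ _ e2
          have := Real.exp_pos (z / 2)
          apply mul_nonneg this.le; linarith
        have e4 : 1 ≤ Real.exp K * Real.exp (z / 2) ^ 2 := by
          rw [← Real.exp_nat_mul, ← Real.exp_add]
          apply Real.one_le_exp; push_cast; linarith
        calc (z / 2) ^ 2 = 1 * (z / 2) ^ 2 := by ring
          _ ≤ (Real.exp K * Real.exp (z / 2) ^ 2) * (z / 2) ^ 2 := by gcongr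
          _ = Real.exp K * (Real.exp (z / 2) * (-(z / 2))) ^ 2 := by ring
          _ ≤ Real.exp K * (1 - Real.exp (z / 2)) ^ 2 := by gcongr
          _ = _ := by ring
    nlinarith [Real.exp_pos K, mul_le_mul_of_nonneg_left h1 (Real.exp_pos K).le]
  rw [hzD, hT]
  have hc1 : 0 < c + 1 := by linarith
  calc ϑ' * (ρ * ((c + 1) * z) ^ 2) = ρ * ϑ' * (c + 1) ^ 2 * z ^ 2 := by ring
    _ ≤ ρ * ϑ' * (c + 1) ^ 2 * (4 * Real.exp K * (Real.exp z - 1 - z)) := by gcongr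
    _ = 4 * (c + 1) * Real.exp K * (ρ * ϑ' * ((c + 1) * (Real.exp z - 1 - z))) := by ring
    _ ≤ _ := by gcongr

/-- Difference of the normal flux functionals of the relative energy. -/
theorem flux_functional_eq (i : Fin d) {U : State d} (hU : U.1 ≠ 0) (ρ' : ℝ)
    (u' : Fin d → ℝ) (ϑ' : ℝ) :
    (flux γ i U).2.2 - chem γ ρ' u' ϑ' * (flux γ i U).1 - ∑ j, u' j * (flux γ i U).2.1 j
      - ϑ' * entropyFlux γ i U
      = vel U i * relLin γ U ρ' u' ϑ' + (pressure γ U - ρ' * ϑ') * (vel U i - u' i)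
        - ρ' * ϑ' * u' i := by
  have h : ∑ j, u' j * (flux γ i U).2.1 j
      = vel U i * ∑ j, u' j * U.2.1 j + u' i * pressure γ U := by
    have : ∀ j, u' j * (flux γ i U).2.1 j
        = vel U i * (u' j * U.2.1 j) + (if j = i then u' i * pressure γ U else 0) := by
      intro j
      simp only [flux, vel]
      split_ifs with hj
      · subst hj; ring
      · ring
    simp only [this, Finset.sum_add_distrib, Finset.mul_sum, Finset.sum_ite_eq',
      Finset.mem_univ, if_true]
  rw [h, relLin]
  simp only [flux, entropyFlux]
  have e : U.2.1 i = U.1 * vel U i := mom_eq U hU i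
  have e2 : U.2.1 i / U.1 = vel U i := rfl
  rw [e2, e]
  ring

theorem intEnergy_deriv_entropy (hγ : 1 < γ) {ρ η : ℝ} (hρ : 0 < ρ) :
    deriv (fun s => intEnergy γ ρ s) η = temperature γ ρ η := by
  have h1 : γ - 1 ≠ 0 := by linarith
  have h : HasDerivAt (fun s => intEnergy γ ρ s) (temperature γ ρ η) η := by
    have h2 : HasDerivAt (fun s => (γ - 1) * s / ρ) ((γ - 1) * 1 / ρ) η :=
      ((hasDerivAt_id η).const_mul (γ - 1)).div_const ρ
    have := ((h2.exp).const_mul (ρ ^ γ)).div_const (γ - 1)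
    refine this.congr_deriv ?_
    simp only [temperature, intEnergy]
    field_simp
  exact h.deriv

theorem temperature_pos (hγ : 1 < γ) {ρ : ℝ} (η : ℝ) (hρ : 0 < ρ) : 0 < temperature γ ρ η := by
  have : 0 < γ - 1 := by linarith
  have h2 := Real.rpow_pos_of_pos hρ γ
  rw [temperature, intEnergy]; positivity

theorem eq_mul_spEntropy (hγ : 1 < γ) {ρ : ℝ} (η : ℝ) (hρ : 0 < ρ) :
    η = ρ * spEntropy γ ρ (temperature γ ρ η) := by
  have h1 : γ - 1 ≠ 0 := by linarith
  have h2 : temperature γ ρ η = ρ ^ γ * Real.exp ((γ - 1) * η / ρ) / ρ := by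
    rw [temperature, intEnergy]; field_simp
  have h3 := (Real.rpow_pos_of_pos hρ γ)
  rw [spEntropy, h2, Real.log_div (by positivity) hρ.ne', Real.log_mul h3.ne' (Real.exp_ne_zero _),
    Real.log_exp, Real.log_rpow hρ]
  field_simp
  ring

theorem intEnergy_deriv_density (hγ : 1 < γ) {ρ η : ℝ} (hρ : 0 < ρ) :
    deriv (fun r => intEnergy γ r η) ρ
      = temperature γ ρ η * (γ / (γ - 1) - spEntropy γ ρ (temperature γ ρ η)) := by
  have h1 : γ - 1 ≠ 0 := by linarith
  have hs : η / ρ = spEntropy γ ρ (temperature γ ρ η) := by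
    conv_lhs => rw [eq_mul_spEntropy hγ η hρ]
    field_simp
  rw [← hs]
  have h : HasDerivAt (fun r => intEnergy γ r η)
      (temperature γ ρ η * (γ / (γ - 1) - η / ρ)) ρ := by
    have h2 : HasDerivAt (fun r => (γ - 1) * η / r) (-((γ - 1) * η) / ρ ^ 2) ρ := by
      have := (hasDerivAt_inv hρ.ne').const_mul ((γ - 1) * η)
      simp only [div_eq_mul_inv]
      exact this.congr_deriv (by ring)
    have h3 := Real.hasDerivAt_rpow_const (x := ρ) (p := γ) (Or.inl hρ.ne')
    have := (h3.mul h2.exp).div_const (γ - 1)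
    refine this.congr_deriv ?_
    simp only [temperature, intEnergy]
    rw [Real.rpow_sub_one hρ.ne']
    field_simp
    ring
  exact h.deriv

theorem intEnergy_eq (hγ : 1 < γ) {ρ : ℝ} (η : ℝ) (hρ : 0 < ρ) :
    intEnergy γ ρ η = 1 / (γ - 1) * (ρ * temperature γ ρ η) := by
  have h1 : γ - 1 ≠ 0 := by linarith
  rw [temperature]; field_simp

theorem temperature_entropy (hγ : 1 < γ) {U : State d} (h : IsGas γ U) :
    temperature γ U.1 (entropy γ U) = temp γ U := by
  have h1 : γ - 1 ≠ 0 := by linarith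
  have h2 := eq_mul_spEntropy hγ (entropy γ U) h.1
  rw [entropy_eq hγ h] at h2 ⊢
  have h3 := mul_left_cancel₀ h.1.ne' h2
  simp only [spEntropy] at h3
  have h4 : Real.log (temp γ U) = Real.log (temperature γ U.1 (U.1 * spEntropy γ U.1 (temp γ U))) := by
    have := congrArg (· * (γ - 1)) (sub_left_inj.1 h3)
    simpa [div_mul_cancel₀ _ h1, spEntropy] using this
  exact (Real.log_injOn_pos (mem_Ioi.2 h.temp_pos) (mem_Ioi.2 (temperature_pos hγ _ h.1)) h4).symm

/-- The relative energy of the statement is `relLin`. -/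
theorem relEnergy_eq (hγ : 1 < γ) {U : State d} (h : IsGas γ U) {ρ' : ℝ} (hρ' : 0 < ρ')
    (u' : Fin d → ℝ) (η' : ℝ) :
    relEnergy γ U.1 U.2.1 (entropy γ U) ρ' u' η' = relLin γ U ρ' u' (temperature γ ρ' η') := by
  have h1 : γ - 1 ≠ 0 := by linarith
  rw [relLin_eq hγ h.admissible hρ' (temperature_pos hγ _ hρ'), relEnergy,
    intEnergy_deriv_entropy hγ hρ', intEnergy_deriv_density hγ hρ', intEnergy_eq hγ _ h.1,
    temperature_entropy hγ h, intEnergy_eq hγ η' hρ', thermoRel]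
  have hs := spEntropy_sub (γ := γ) h.1 h.temp_pos hρ' (temperature_pos hγ η' hρ')
  have h2 := eq_mul_spEntropy hγ η' hρ'
  set ϑ' := temperature γ ρ' η'
  rw [entropy_eq hγ h]
  have e1 : γ / (γ - 1) = 1 + 1 / (γ - 1) := by field_simp; ring
  rw [e1]
  simp only [vel]
  linear_combination (-ϑ' * U.1) * hs + ϑ' * h2

end Thermo

/-! ### Monotonicity across finitely many jumps -/

theorem eventually_notMem_finset (B : Finset ℝ) (a : ℝ) : ∀ᶠ ξ in 𝓝[≠] a, ξ ∉ B := by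
  have h : ∀ᶠ ξ in 𝓝 a, ξ ∉ B.erase a :=
    (B.erase a).finite_toSet.isClosed.isOpen_compl.mem_nhds (by simp)
  filter_upwards [h.filter_mono nhdsWithin_le_nhds, self_mem_nhdsWithin] with ξ h1 h2 h3
  exact h1 (Finset.mem_erase.2 ⟨h2, h3⟩)

theorem eventually_notMem_left (B : Finset ℝ) (a : ℝ) : ∀ᶠ ξ in 𝓝[<] a, ξ ∉ B :=
  (eventually_notMem_finset B a).filter_mono (nhdsWithin_mono _ fun _ h => ne_of_lt h)

theorem eventually_notMem_right (B : Finset ℝ) (a : ℝ) : ∀ᶠ ξ in 𝓝[>] a, ξ ∉ B :=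
  (eventually_notMem_finset B a).filter_mono (nhdsWithin_mono _ fun _ h => ne_of_gt h)

/-- A function with nonpositive derivative off a finite set and downward jumps is antitone. -/
theorem le_of_deriv_nonpos_of_jump {f : ℝ → ℝ} {B : Finset ℝ} {x y : ℝ} (hxy : x ≤ y)
    (hx : x ∉ B) (hy : y ∉ B)
    (hd : ∀ ξ ∈ Icc x y, ξ ∉ B → ∃ f', HasDerivAt f f' ξ ∧ f' ≤ 0)
    (hj : ∀ b ∈ B, x < b → b < y →
      ∃ l r, Tendsto f (𝓝[<] b) (𝓝 l) ∧ Tendsto f (𝓝[>] b) (𝓝 r) ∧ r ≤ l) : f y ≤ f x := by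
  induction hn : (B.filter fun b => x < b ∧ b < y).card using Nat.strong_induction_on
    generalizing x y with
  | _ n ih =>
    by_cases hB : ∃ b ∈ B, x < b ∧ b < y
    · obtain ⟨b, hbB, hxb, hby⟩ := hB
      obtain ⟨l, r, hl, hr, hrl⟩ := hj b hbB hxb hby
      have h1 : l ≤ f x := by
        refine le_of_tendsto hl ?_
        filter_upwards [eventually_notMem_left B b, Ioo_mem_nhdsLT hxb] with ξ hξ hξ2
        refine ih _ ?_ hξ2.1.le hx hξ (fun ζ hζ => hd ζ ⟨hζ.1, hζ.2.trans (hξ2.2.trans hby).le⟩)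
          (fun c hc h1 h2 => hj c hc h1 (h2.trans (hξ2.2.trans hby))) rfl
        rw [← hn]
        refine Finset.card_lt_card (Finset.ssubset_iff_of_subset ?_ |>.2 ⟨b, ?_, ?_⟩)
        · intro c hc
          simp only [Finset.mem_filter] at hc ⊢
          exact ⟨hc.1, hc.2.1, hc.2.2.trans (hξ2.2.trans hby)⟩
        · simp [hbB, hxb, hby]
        · simp [hξ2.2.le]
      have h2 : f y ≤ r := by
        refine ge_of_tendsto hr ?_
        filter_upwards [eventually_notMem_right B b, Ioo_mem_nhdsGT hby] with ξ hξ hξ2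
        refine ih _ ?_ hξ2.2.le hξ hy (fun ζ hζ => hd ζ ⟨(hxb.trans hξ2.1).le.trans hζ.1, hζ.2⟩)
          (fun c hc h1 h2 => hj c hc ((hxb.trans hξ2.1).trans h1) h2) rfl
        rw [← hn]
        refine Finset.card_lt_card (Finset.ssubset_iff_of_subset ?_ |>.2 ⟨b, ?_, ?_⟩)
        · intro c hc
          simp only [Finset.mem_filter] at hc ⊢
          exact ⟨hc.1, (hxb.trans hξ2.1).trans hc.2.1, hc.2.2⟩
        · simp [hbB, hxb, hby]
        · simp [hξ2.1.le]
      linarith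
    · push Not at hB
      have hnB : ∀ ξ ∈ Icc x y, ξ ∉ B := by
        intro ξ hξ hξB
        rcases hξ.1.eq_or_lt with h | h
        · exact hx (h ▸ hξB)
        · rcases hξ.2.eq_or_lt with h' | h'
          · exact hy (h' ▸ hξB)
          · exact absurd h' (not_lt.2 (hB ξ hξB h))
      have hD : ∀ ξ ∈ Icc x y, ∃ f', HasDerivAt f f' ξ ∧ f' ≤ 0 := fun ξ hξ => hd ξ hξ (hnB ξ hξ)
      refine antitoneOn_of_deriv_nonpos (convex_Icc x y) ?_ ?_ ?_ (left_mem_Icc.2 hxy)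
        (right_mem_Icc.2 hxy) hxy
      · intro ξ hξ
        obtain ⟨f', h, -⟩ := hD ξ hξ
        exact h.continuousAt.continuousWithinAt
      · intro ξ hξ
        obtain ⟨f', h, -⟩ := hD ξ (interior_subset hξ)
        exact h.differentiableAt.differentiableWithinAt
      · intro ξ hξ
        obtain ⟨f', h, h'⟩ := hD ξ (interior_subset hξ)
        rw [h.deriv]; exact h'

theorem eq_of_deriv_zero_of_jump {f : ℝ → ℝ} {B : Finset ℝ} {x y : ℝ} (hxy : x ≤ y)
    (hx : x ∉ B) (hy : y ∉ B) (hd : ∀ ξ ∈ Icc x y, ξ ∉ B → HasDerivAt f 0 ξ)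
    (hj : ∀ b ∈ B, x < b → b < y →
      ∃ l, Tendsto f (𝓝[<] b) (𝓝 l) ∧ Tendsto f (𝓝[>] b) (𝓝 l)) : f y = f x := by
  apply le_antisymm
  · exact le_of_deriv_nonpos_of_jump hxy hx hy (fun ξ h1 h2 => ⟨0, hd ξ h1 h2, le_rfl⟩)
      fun b h1 h2 h3 => let ⟨l, h4, h5⟩ := hj b h1 h2 h3; ⟨l, l, h4, h5, le_rfl⟩
  · have := le_of_deriv_nonpos_of_jump (f := fun ξ => - f ξ) hxy hx hy
      (fun ξ h1 h2 => ⟨-0, (hd ξ h1 h2).neg, by simp⟩)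
      fun b h1 h2 h3 => let ⟨l, h4, h5⟩ := hj b h1 h2 h3; ⟨-l, -l, h4.neg, h5.neg, le_rfl⟩
    linarith

/-! ### The Hugoniot relations -/

theorem hugoniot_log_neg {γ y : ℝ} (hγ : 1 < γ) (hy : 1 < y) (hy2 : 0 < (γ + 1) - (γ - 1) * y) :
    Real.log ((γ + 1) - (γ - 1) * y) - Real.log ((γ + 1) * y - (γ - 1)) + γ * Real.log y < 0 := by
  set k : ℝ → ℝ := fun y =>
    Real.log ((γ + 1) - (γ - 1) * y) - Real.log ((γ + 1) * y - (γ - 1)) + γ * Real.log y with hk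
  have hd : ∀ z ∈ Icc 1 y, HasDerivAt k
      ((-(γ - 1)) / ((γ + 1) - (γ - 1) * z) - (γ + 1) / ((γ + 1) * z - (γ - 1))
        + γ * z⁻¹) z ∧ 0 < (γ + 1) - (γ - 1) * z ∧ 0 < (γ + 1) * z - (γ - 1) := by
    intro z hz
    have h1 : 0 < (γ + 1) - (γ - 1) * z := by nlinarith [hz.2]
    have h2 : 0 < (γ + 1) * z - (γ - 1) := by nlinarith [hz.1]
    have h0 : z ≠ 0 := by linarith [hz.1]
    refine ⟨?_, h1, h2⟩
    have d1 : HasDerivAt (fun z : ℝ => (γ + 1) - (γ - 1) * z) (-(γ - 1)) z := by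
      simpa using ((hasDerivAt_id z).const_mul (γ - 1)).const_sub (γ + 1)
    have d2 : HasDerivAt (fun z : ℝ => (γ + 1) * z - (γ - 1)) (γ + 1) z := by
      simpa using ((hasDerivAt_id z).const_mul (γ + 1)).sub_const (γ - 1)
    exact ((d1.log h1.ne').sub (d2.log h2.ne')).add ((Real.hasDerivAt_log h0).const_mul γ)
  have hanti : StrictAntiOn k (Icc 1 y) := by
    apply strictAntiOn_of_deriv_neg (convex_Icc _ _)
    · intro z hz; exact (hd z hz).1.continuousAt.continuousWithinAt
    · intro z hz
      rw [interior_Icc] at hz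
      obtain ⟨h, h1, h2⟩ := hd z ⟨hz.1.le, hz.2.le⟩
      rw [h.deriv]
      have h0 : 0 < z := by linarith [hz.1]
      have e : (-(γ - 1)) / ((γ + 1) - (γ - 1) * z) - (γ + 1) / ((γ + 1) * z - (γ - 1))
          + γ * z⁻¹ = - (γ * (γ ^ 2 - 1) * (1 - z) ^ 2)
            / (((γ + 1) - (γ - 1) * z) * ((γ + 1) * z - (γ - 1)) * z) := by
        have := h1.ne'; have := h2.ne'; have := h0.ne'
        field_simp
        ring
      rw [e, neg_div, neg_lt_zero]
      have h3 : 0 < (1 - z) ^ 2 := by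
        nlinarith [mul_pos (sub_pos.2 hz.1) (sub_pos.2 hz.1)]
      have h4 : 0 < γ ^ 2 - 1 := by nlinarith
      positivity
  have h1 : k 1 = 0 := by
    have e1 : γ + 1 - (γ - 1) * 1 = 2 := by ring
    have e2 : (γ + 1) * 1 - (γ - 1) = 2 := by ring
    simp only [hk, e1, e2]; simp
  have := hanti (left_mem_Icc.2 hy.le) (right_mem_Icc.2 hy.le) hy
  rwa [h1] at this

/-- Consequences of the jump relations with positive mass flux and of the entropy inequality. -/
theorem shock_scalar {γ J vl vr pl pr : ℝ} (hγ : 1 < γ) (hJ : 0 < J) (hvl : 0 < vl)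
    (hvr : 0 < vr) (hpl : 0 < pl) (hpr : 0 < pr) (hm : pr - pl = J ^ 2 * (vl - vr))
    (hH : 1 / (γ - 1) * (pr * vr - pl * vl) + (pl + pr) / 2 * (vr - vl) = 0)
    (hS : 0 ≤ Real.log (pr / pl) + γ * Real.log (vr / vl)) :
    (vr = vl ∧ pr = pl) ∨
    (vr < vl ∧ pl < pr ∧ γ * (pl * vl) < (J * vl) ^ 2 ∧ (J * vr) ^ 2 < γ * (pr * vr) ∧
      J ^ 2 * ((γ + 1) * vr - (γ - 1) * vl) = 2 * γ * pl ∧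
      pr * ((γ + 1) * vr - (γ - 1) * vl) = pl * ((γ + 1) * vl - (γ - 1) * vr)) := by
  have hg : 0 < γ - 1 := by linarith
  have hH2 : pr * ((γ + 1) * vr - (γ - 1) * vl) = pl * ((γ + 1) * vl - (γ - 1) * vr) := by
    field_simp at hH
    linarith
  have hD : 0 < (γ + 1) * vr - (γ - 1) * vl := by
    by_contra hcon
    push Not at hcon
    have h1 : pr * ((γ + 1) * vr - (γ - 1) * vl) ≤ 0 :=
      mul_nonpos_of_nonneg_of_nonpos hpr.le hcon
    rw [hH2] at h1
    have h2 : (γ + 1) * vl - (γ - 1) * vr ≤ 0 := by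
      by_contra h3; push Not at h3; nlinarith [mul_pos hpl h3]
    nlinarith
  have hD2 : 0 < (γ + 1) * vl - (γ - 1) * vr := by
    have : 0 < pl * ((γ + 1) * vl - (γ - 1) * vr) := by rw [← hH2]; positivity
    exact (pos_iff_pos_of_mul_pos this).1 hpl
  rcases lt_trichotomy vr vl with h | h | h
  · right
    have hJ2 : J ^ 2 * ((γ + 1) * vr - (γ - 1) * vl) = 2 * γ * pl := by
      have h3 : (vl - vr) * (J ^ 2 * ((γ + 1) * vr - (γ - 1) * vl)) = (vl - vr) * (2 * γ * pl) := by
        linear_combination hH2 - ((γ + 1) * vr - (γ - 1) * vl) * hm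
      exact mul_left_cancel₀ (by linarith : vl - vr ≠ 0) h3
    have hJp : 0 < J ^ 2 := by positivity
    refine ⟨h, ?_, ?_, ?_, hJ2, hH2⟩
    · nlinarith [mul_pos hJp (sub_pos.2 h)]
    · have h5 : (γ + 1) * vr - (γ - 1) * vl < 2 * vl := by nlinarith
      have : 2 * γ * pl < J ^ 2 * (2 * vl) := by rw [← hJ2]; gcongr
      nlinarith
    · have h6 : J ^ 2 * (2 * vr) < 2 * γ * pr := by
        have h7 : J ^ 2 * (2 * vr) * ((γ + 1) * vr - (γ - 1) * vl)
            < 2 * γ * pr * ((γ + 1) * vr - (γ - 1) * vl) := by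
          have e1 : J ^ 2 * (2 * vr) * ((γ + 1) * vr - (γ - 1) * vl) = 2 * γ * pl * (2 * vr) := by
            linear_combination (2 * vr) * hJ2
          have e2 : 2 * γ * pr * ((γ + 1) * vr - (γ - 1) * vl)
              = 2 * γ * pl * ((γ + 1) * vl - (γ - 1) * vr) := by
            linear_combination (2 * γ) * hH2
          rw [e1, e2]
          gcongr
          nlinarith
        exact lt_of_mul_lt_mul_right h7 hD.le
      nlinarith
  · left
    subst h
    exact ⟨rfl, by nlinarith⟩
  · exfalso
    have hy : 1 < vr / vl := (one_lt_div hvl).2 h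
    have e1 : γ + 1 - (γ - 1) * (vr / vl) = ((γ + 1) * vl - (γ - 1) * vr) / vl := by field_simp
    have e2 : (γ + 1) * (vr / vl) - (γ - 1) = ((γ + 1) * vr - (γ - 1) * vl) / vl := by field_simp
    have hneg := hugoniot_log_neg hγ hy (by rw [e1]; positivity)
    have e3 : pr / pl = ((γ + 1) * vl - (γ - 1) * vr) / ((γ + 1) * vr - (γ - 1) * vl) := by
      rw [div_eq_div_iff hpl.ne' hD.ne']; linarith
    rw [e1, e2, Real.log_div hD2.ne' hvl.ne', Real.log_div hD.ne' hvl.ne'] at hneg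
    rw [e3, Real.log_div hD2.ne' hD.ne'] at hS
    linarith

/-! ### Self-similar solutions: smooth parts and jumps -/

section Fan

variable {d : ℕ} {γ : ℝ} {i : Fin d}

/-- Mass flux through the ray of speed `ξ`. -/
def massFlux (i : Fin d) (U : State d) (ξ : ℝ) : ℝ := U.2.1 i - ξ * U.1

theorem massFlux_eq {U : State d} (h : U.1 ≠ 0) (ξ : ℝ) :
    massFlux i U ξ = U.1 * (vel U i - ξ) := by
  rw [massFlux, mom_eq U h i]; ring

theorem momFlux_sub {U : State d} (h : U.1 ≠ 0) (ξ : ℝ) (j : Fin d) :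
    (flux γ i U).2.1 j - ξ * U.2.1 j
      = massFlux i U ξ * vel U j + if j = i then U.1 * temp γ U else 0 := by
  have : U.1 * temp γ U = pressure γ U := by rw [temp]; field_simp
  rw [this, massFlux_eq h]
  simp only [flux]
  rw [mom_eq U h j]
  simp only [vel]; ring

theorem energyFlux_sub (hγ : 1 < γ) {U : State d} (h : U.1 ≠ 0) (ξ : ℝ) :
    (flux γ i U).2.2 - ξ * U.2.2
      = massFlux i U ξ * (1 / 2 * ∑ j, vel U j ^ 2 + 1 / (γ - 1) * temp γ U)
        + vel U i * (U.1 * temp γ U) := by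
  have h2 : U.1 * temp γ U = pressure γ U := by rw [temp]; field_simp
  have h3 := energy_eq hγ U h
  rw [massFlux_eq h]
  simp only [flux]
  have e : U.2.1 i / U.1 = vel U i := rfl
  rw [e, ← h2, h3]; ring

theorem entropyFlux_sub (hγ : 1 < γ) {U : State d} (h : IsGas γ U) (ξ : ℝ) :
    entropyFlux γ i U - ξ * entropy γ U
      = massFlux i U ξ * spEntropy γ U.1 (temp γ U) := by
  rw [massFlux_eq h.1.ne', entropyFlux, entropy_eq hγ h]
  simp only [vel]; ring

theorem gas_ext (hγ : 1 < γ) {U V : State d} (hU : U.1 ≠ 0) (hV : V.1 ≠ 0) (hρ : U.1 = V.1)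
    (hv : ∀ j, vel U j = vel V j) (hθ : temp γ U = temp γ V) : U = V := by
  have hmom : U.2.1 = V.2.1 := by
    funext j; rw [mom_eq U hU, mom_eq V hV, hρ, hv]
  have hen : U.2.2 = V.2.2 := by
    rw [energy_eq hγ U hU, energy_eq hγ V hV, hρ, hθ]; simp only [hv]
  exact Prod.ext hρ (Prod.ext hmom hen)

theorem hasDerivAt_state {W : ℝ → State d} {W' : State d} {ξ : ℝ} (h : HasDerivAt W W' ξ) :
    HasDerivAt (fun ζ => (W ζ).1) W'.1 ξ ∧
    (∀ j, HasDerivAt (fun ζ => (W ζ).2.1 j) (W'.2.1 j) ξ) ∧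
    HasDerivAt (fun ζ => (W ζ).2.2) W'.2.2 ξ := by
  refine ⟨?_, fun j => ?_, ?_⟩
  · exact (ContinuousLinearMap.fst ℝ ℝ ((Fin d → ℝ) × ℝ)).hasFDerivAt.comp_hasDerivAt ξ h
  · exact ((ContinuousLinearMap.proj (R := ℝ) (φ := fun _ : Fin d => ℝ) j).comp
      ((ContinuousLinearMap.fst ℝ (Fin d → ℝ) ℝ).comp
        (ContinuousLinearMap.snd ℝ ℝ ((Fin d → ℝ) × ℝ)))).hasFDerivAt.comp_hasDerivAt ξ h
  · exact ((ContinuousLinearMap.snd ℝ (Fin d → ℝ) ℝ).comp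
        (ContinuousLinearMap.snd ℝ ℝ ((Fin d → ℝ) × ℝ))).hasFDerivAt.comp_hasDerivAt ξ h

theorem IsGas.continuousAt_pressure {U : State d} (h : U.1 ≠ 0) :
    ContinuousAt (pressure γ) U := by
  unfold pressure
  have : (2 * U.1) ≠ 0 := by simpa using h
  fun_prop (disch := assumption)

theorem IsGas.eventually {U : State d} (h : IsGas γ U) : ∀ᶠ V in 𝓝 U, IsGas γ V :=
  (continuousAt_fst.eventually (lt_mem_nhds h.1)).and
    ((IsGas.continuousAt_pressure h.1.ne').eventually (lt_mem_nhds h.2))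

theorem IsGas.continuousAt_temp {U : State d} (h : U.1 ≠ 0) : ContinuousAt (temp γ) U :=
  (IsGas.continuousAt_pressure h).div continuousAt_fst h

theorem continuousAt_vel {U : State d} (h : U.1 ≠ 0) (j : Fin d) :
    ContinuousAt (fun V : State d => vel V j) U := by
  unfold vel
  fun_prop (disch := assumption)

theorem smooth_eqs (hγ : 1 < γ) {W : ℝ → State d} {ξ : ℝ} (hW : ContDiffAt ℝ 1 W ξ)
    (hg : IsGas γ (W ξ)) (hF : HasDerivAt (fun ζ => flux γ i (W ζ)) (ξ • deriv W ξ) ξ) :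
    ∃ (ρ' ϑ' : ℝ) (u' : Fin d → ℝ), HasDerivAt (fun ζ => (W ζ).1) ρ' ξ ∧
      HasDerivAt (fun ζ => temp γ (W ζ)) ϑ' ξ ∧
      (∀ j, HasDerivAt (fun ζ => vel (W ζ) j) (u' j) ξ) ∧
      massFlux i (W ξ) ξ * ρ' = - (W ξ).1 ^ 2 * u' i ∧
      massFlux i (W ξ) ξ * ϑ' = - (γ - 1) * ((W ξ).1 * temp γ (W ξ)) * u' i ∧
      massFlux i (W ξ) ξ * u' i = - (ρ' * temp γ (W ξ) + (W ξ).1 * ϑ') ∧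
      ∀ j, j ≠ i → massFlux i (W ξ) ξ * u' j = 0 := by
  have hg1 : γ - 1 ≠ 0 := by linarith
  have hWd : HasDerivAt W (deriv W ξ) ξ := (hW.differentiableAt one_ne_zero).hasDerivAt
  obtain ⟨hρ, hm, hE⟩ := hasDerivAt_state hWd
  obtain ⟨hfρ, hfm, hfE⟩ := hasDerivAt_state hF
  set W' := deriv W ξ
  have hu : ∀ j, ∃ u', HasDerivAt (fun ζ => vel (W ζ) j) u' ξ := fun j =>
    ⟨_, (hm j).div hρ hg.1.ne'⟩
  choose u' hu' using hu
  have hp : ∃ p', HasDerivAt (fun ζ => pressure γ (W ζ)) p' ξ := by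
    have h1 := HasDerivAt.fun_sum (u := Finset.univ) fun j _ => (hm j).fun_pow 2
    have h2 := (hE.sub (h1.div (hρ.const_mul 2) (by simpa using hg.1.ne'))).const_mul (γ - 1)
    exact ⟨_, h2⟩
  obtain ⟨p', hp'⟩ := hp
  obtain ⟨ϑ', hϑ'⟩ : ∃ ϑ', HasDerivAt (fun ζ => temp γ (W ζ)) ϑ' ξ := ⟨_, hp'.div hρ hg.1.ne'⟩
  have hgas : ∀ᶠ ζ in 𝓝 ξ, IsGas γ (W ζ) := hW.continuousAt.eventually hg.eventually
  -- products
  have hmj : ∀ j, W'.2.1 j = W'.1 * vel (W ξ) j + (W ξ).1 * u' j := fun j => by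
    refine (hm j).unique ((hρ.mul (hu' j)).congr_of_eventuallyEq ?_)
    filter_upwards [hgas] with ζ hζ using mom_eq _ hζ.1.ne' j
  have hq : HasDerivAt (fun ζ => ∑ j, vel (W ζ) j ^ 2) (∑ j, 2 * vel (W ξ) j * u' j) ξ := by
    refine (HasDerivAt.fun_sum (u := Finset.univ) fun j _ => (hu' j).fun_pow 2).congr_deriv ?_
    exact Finset.sum_congr rfl fun j _ => by ring
  set Q := ∑ j, 2 * vel (W ξ) j * u' j with hQ
  have hEd : W'.2.2 = W'.1 * (1 / 2 * ∑ j, vel (W ξ) j ^ 2 + 1 / (γ - 1) * temp γ (W ξ))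
      + (W ξ).1 * (1 / 2 * Q + 1 / (γ - 1) * ϑ') := by
    refine hE.unique ((hρ.mul ((hq.const_mul (1 / 2)).add
      (hϑ'.const_mul (1 / (γ - 1))))).congr_of_eventuallyEq ?_)
    filter_upwards [hgas] with ζ hζ
    rw [energy_eq hγ _ hζ.1.ne']
    simp only [Pi.mul_apply, Pi.add_apply]; ring
  have hA : W'.1 * vel (W ξ) i + (W ξ).1 * u' i = ξ * W'.1 := by
    rw [← hmj i]; exact (hm i).unique hfρ
  have hJ := massFlux_eq (i := i) hg.1.ne' ξ
  have hMj : ∀ j, (massFlux i (W ξ) ξ) * u' j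
      + (if j = i then W'.1 * temp γ (W ξ) + (W ξ).1 * ϑ' else 0) = 0 := fun j => by
    have h0 : HasDerivAt (fun ζ => ((W ζ).1 * vel (W ζ) i) * vel (W ζ) j
        + if j = i then (W ζ).1 * temp γ (W ζ) else 0)
        ((W'.1 * vel (W ξ) i + (W ξ).1 * u' i) * vel (W ξ) j + ((W ξ).1 * vel (W ξ) i) * u' j
          + if j = i then W'.1 * temp γ (W ξ) + (W ξ).1 * ϑ' else 0) ξ := by
      refine ((hρ.mul (hu' i)).mul (hu' j)).add ?_
      split_ifs
      · exact hρ.mul hϑ'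
      · exact hasDerivAt_const _ _
    have h1 : (ξ • W').2.1 j = _ := (hfm j).unique (h0.congr_of_eventuallyEq ?_)
    · have e : (ξ • W').2.1 j = ξ * W'.2.1 j := rfl
      rw [e, hmj j, hA] at h1
      rw [hJ]
      linear_combination -h1
    · filter_upwards [hgas] with ζ hζ
      have := momFlux_sub (γ := γ) (i := i) hζ.1.ne' 0 j
      rw [massFlux_eq hζ.1.ne'] at this
      linear_combination this
  have hEe : massFlux i (W ξ) ξ * (1 / 2 * Q + 1 / (γ - 1) * ϑ')
      + (u' i * ((W ξ).1 * temp γ (W ξ))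
        + vel (W ξ) i * (W'.1 * temp γ (W ξ) + (W ξ).1 * ϑ')) = 0 := by
    have h0 := ((hρ.mul (hu' i)).mul ((hq.const_mul (1 / 2)).add
      (hϑ'.const_mul (1 / (γ - 1))))).add ((hu' i).mul (hρ.mul hϑ'))
    have h1 : (ξ • W').2.2 = _ := hfE.unique (h0.congr_of_eventuallyEq ?_)
    · have e : (ξ • W').2.2 = ξ * W'.2.2 := rfl
      simp only [Pi.mul_apply, Pi.add_apply] at h1
      rw [e, hEd, hA] at h1
      rw [hJ]
      linear_combination -h1
    · filter_upwards [hgas] with ζ hζ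
      have := energyFlux_sub (i := i) hγ hζ.1.ne' 0
      rw [massFlux_eq hζ.1.ne'] at this
      simp only [Pi.mul_apply, Pi.add_apply]
      linear_combination this
  have hMi := hMj i
  rw [if_pos rfl] at hMi
  have hQJ : massFlux i (W ξ) ξ * Q
      = - 2 * vel (W ξ) i * (W'.1 * temp γ (W ξ) + (W ξ).1 * ϑ') := by
    rw [hQ, Finset.mul_sum]
    have : ∀ j, massFlux i (W ξ) ξ * (2 * vel (W ξ) j * u' j)
        = if j = i then - 2 * vel (W ξ) i * (W'.1 * temp γ (W ξ) + (W ξ).1 * ϑ') else 0 := by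
      intro j
      have := hMj j
      split_ifs at this ⊢ with hj
      · subst hj; linear_combination (2 * vel (W ξ) j) * this
      · linear_combination (2 * vel (W ξ) j) * this
    simp [this]
  refine ⟨W'.1, ϑ', u', hρ, hϑ', hu', ?_, ?_, by linarith, fun j hj => ?_⟩
  · rw [hJ]; linear_combination (W ξ).1 * hA
  · have h3 : massFlux i (W ξ) ξ * (1 / (γ - 1) * ϑ') + u' i * ((W ξ).1 * temp γ (W ξ)) = 0 := by
      linear_combination hEe - 1 / 2 * hQJ
    field_simp at h3
    linear_combination h3
  · have := hMj j; rw [if_neg hj] at this; linarith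

theorem massFlux_hasDerivAt {W : ℝ → State d} {ξ : ℝ} (hW : ContDiffAt ℝ 1 W ξ)
    (hF : HasDerivAt (fun ζ => flux γ i (W ζ)) (ξ • deriv W ξ) ξ) :
    HasDerivAt (fun ζ => massFlux i (W ζ) ζ) (- (W ξ).1) ξ := by
  have hWd : HasDerivAt W (deriv W ξ) ξ := (hW.differentiableAt one_ne_zero).hasDerivAt
  obtain ⟨hρ, hm, -⟩ := hasDerivAt_state hWd
  obtain ⟨hfρ, -, -⟩ := hasDerivAt_state hF
  have h1 : (deriv W ξ).2.1 i = ξ * (deriv W ξ).1 := (hm i).unique hfρ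
  refine ((hm i).sub ((hasDerivAt_id ξ).mul hρ)).congr_deriv ?_
  simp only [id]
  rw [h1]; ring

/-- Jump relations between gas states. -/
theorem jump_eqs (hγ : 1 < γ) {b : ℝ} {Vl Vr : State d} (hl : IsGas γ Vl) (hr : IsGas γ Vr)
    (hRH : flux γ i Vr - flux γ i Vl = b • (Vr - Vl))
    (hS : b * (entropy γ Vr - entropy γ Vl) ≤ entropyFlux γ i Vr - entropyFlux γ i Vl) :
    massFlux i Vr b = massFlux i Vl b ∧
    (∀ j, j ≠ i → massFlux i Vl b * (vel Vr j - vel Vl j) = 0) ∧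
    massFlux i Vl b * (vel Vr i - vel Vl i) = - (Vr.1 * temp γ Vr - Vl.1 * temp γ Vl) ∧
    massFlux i Vl b * (1 / (γ - 1) * (temp γ Vr - temp γ Vl))
      + (Vr.1 * temp γ Vr + Vl.1 * temp γ Vl) / 2 * (vel Vr i - vel Vl i) = 0 ∧
    0 ≤ massFlux i Vl b * (spEntropy γ Vr.1 (temp γ Vr) - spEntropy γ Vl.1 (temp γ Vl)) := by
  have h1 : (flux γ i Vr).1 - (flux γ i Vl).1 = b * (Vr.1 - Vl.1) := congrArg Prod.fst hRH
  have h2 : ∀ j, (flux γ i Vr).2.1 j - (flux γ i Vl).2.1 j = b * (Vr.2.1 j - Vl.2.1 j) := fun j =>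
    congrFun (congrArg (fun x => x.2.1) hRH) j
  have h3 : (flux γ i Vr).2.2 - (flux γ i Vl).2.2 = b * (Vr.2.2 - Vl.2.2) :=
    congrArg (fun x => x.2.2) hRH
  have hJ : massFlux i Vr b = massFlux i Vl b := by
    simp only [massFlux]; simp only [flux] at h1; linarith
  have hm : ∀ j, massFlux i Vl b * (vel Vr j - vel Vl j)
      + (if j = i then Vr.1 * temp γ Vr - Vl.1 * temp γ Vl else 0) = 0 := fun j => by
    have a1 := momFlux_sub (γ := γ) (i := i) hl.1.ne' b j
    have a2 := momFlux_sub (γ := γ) (i := i) hr.1.ne' b j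
    rw [hJ] at a2
    have := h2 j
    split_ifs at a1 a2 ⊢ <;> linear_combination this + a1 - a2
  have hmi := hm i
  rw [if_pos rfl] at hmi
  have hE : massFlux i Vl b * (1 / 2 * ∑ j, vel Vr j ^ 2 - 1 / 2 * ∑ j, vel Vl j ^ 2
      + 1 / (γ - 1) * (temp γ Vr - temp γ Vl))
      + (vel Vr i * (Vr.1 * temp γ Vr) - vel Vl i * (Vl.1 * temp γ Vl)) = 0 := by
    have a1 := energyFlux_sub (i := i) hγ hl.1.ne' b
    have a2 := energyFlux_sub (i := i) hγ hr.1.ne' b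
    rw [hJ] at a2
    linear_combination h3 + a1 - a2
  have hQ : massFlux i Vl b * (∑ j, vel Vr j ^ 2 - ∑ j, vel Vl j ^ 2)
      = - (vel Vr i + vel Vl i) * (Vr.1 * temp γ Vr - Vl.1 * temp γ Vl) := by
    rw [← Finset.sum_sub_distrib, Finset.mul_sum]
    have : ∀ j, massFlux i Vl b * (vel Vr j ^ 2 - vel Vl j ^ 2)
        = if j = i then - (vel Vr i + vel Vl i) * (Vr.1 * temp γ Vr - Vl.1 * temp γ Vl) else 0 := by
      intro j
      have := hm j
      split_ifs at this ⊢ with hj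
      · subst hj; linear_combination (vel Vr j + vel Vl j) * this
      · linear_combination (vel Vr j + vel Vl j) * this
    simp [this]
  refine ⟨hJ, fun j hj => ?_, by linarith, ?_, ?_⟩
  · have := hm j; rw [if_neg hj] at this; linarith
  · linear_combination hE - 1 / 2 * hQ
  · have a1 := entropyFlux_sub (i := i) hγ hl b
    have a2 := entropyFlux_sub (i := i) hγ hr b
    rw [hJ] at a2
    nlinarith

/-- A jump between a gas state and the vacuum is impossible. -/
theorem isGas_iff_of_jump {b : ℝ} {Vl Vr : State d} (hl : Admissible γ Vl)
    (hr : Admissible γ Vr) (hRH : flux γ i Vr - flux γ i Vl = b • (Vr - Vl)) :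
    IsGas γ Vl ↔ IsGas γ Vr := by
  have key : ∀ U : State d, IsGas γ U → flux γ i U = b • U → False := by
    intro U hU h
    have h1 : U.2.1 i = b * U.1 := congrArg Prod.fst h
    have h2 : (flux γ i U).2.1 i = b * U.2.1 i := congrFun (congrArg (fun x => x.2.1) h) i
    have h3 := momFlux_sub (γ := γ) (i := i) hU.1.ne' b i
    have h4 : massFlux i U b = 0 := by rw [massFlux]; linarith
    rw [h4, if_pos rfl] at h3
    have := mul_pos hU.1 hU.temp_pos
    linarith
  constructor
  · intro h
    rcases hr.isGas_or with h' | rfl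
    · exact h'
    · refine (key Vl h ?_).elim
      simp only [flux_zero, zero_sub, smul_neg, neg_inj] at hRH
      exact hRH
  · intro h
    rcases hl.isGas_or with h' | rfl
    · exact h'
    · refine (key Vr h ?_).elim
      simpa using hRH

/-- Jumps with positive mass flux: trivial or compressive. -/
theorem shock_eqs (hγ : 1 < γ) {b : ℝ} {Vl Vr : State d} (hl : IsGas γ Vl) (hr : IsGas γ Vr)
    (hRH : flux γ i Vr - flux γ i Vl = b • (Vr - Vl))
    (hS : b * (entropy γ Vr - entropy γ Vl) ≤ entropyFlux γ i Vr - entropyFlux γ i Vl)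
    (hJ : 0 < massFlux i Vl b) :
    Vr = Vl ∨
    (Vl.1 < Vr.1 ∧ Vl.1 * temp γ Vl < Vr.1 * temp γ Vr ∧ vel Vr i < vel Vl i ∧
      γ * temp γ Vl < (vel Vl i - b) ^ 2 ∧ (vel Vr i - b) ^ 2 < γ * temp γ Vr ∧
      b < vel Vl i ∧ b < vel Vr i ∧
      massFlux i Vl b ^ 2 * ((γ + 1) * Vr.1⁻¹ - (γ - 1) * Vl.1⁻¹) = 2 * γ * (Vl.1 * temp γ Vl) ∧
      (Vr.1 * temp γ Vr) * ((γ + 1) * Vr.1⁻¹ - (γ - 1) * Vl.1⁻¹)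
        = (Vl.1 * temp γ Vl) * ((γ + 1) * Vl.1⁻¹ - (γ - 1) * Vr.1⁻¹) ∧
      vel Vl i - vel Vr i = massFlux i Vl b * (Vl.1⁻¹ - Vr.1⁻¹)) := by
  obtain ⟨hJe, ht, hm, hE, hs⟩ := jump_eqs hγ hl hr hRH hS
  set J := massFlux i Vl b with hJdef
  have hl1 := hl.1
  have hr1 := hr.1
  have hlt := hl.temp_pos
  have hrt := hr.temp_pos
  have hg : 0 < γ - 1 := by linarith
  have hul : vel Vl i - b = J * Vl.1⁻¹ := by
    rw [hJdef, massFlux_eq hl1.ne']; field_simp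
  have hur : vel Vr i - b = J * Vr.1⁻¹ := by
    rw [← hJe, massFlux_eq hr1.ne']; field_simp
  have hu : vel Vl i - vel Vr i = J * (Vl.1⁻¹ - Vr.1⁻¹) := by linear_combination hul - hur
  have hsc := shock_scalar (γ := γ) (J := J) (vl := Vl.1⁻¹) (vr := Vr.1⁻¹)
    (pl := Vl.1 * temp γ Vl) (pr := Vr.1 * temp γ Vr) hγ hJ (inv_pos.2 hl1) (inv_pos.2 hr1)
    (mul_pos hl1 hlt) (mul_pos hr1 hrt)
    (by linear_combination hm + J * hu)
    (by
      have e1 : Vr.1 * temp γ Vr * Vr.1⁻¹ = temp γ Vr := by field_simp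
      have e2 : Vl.1 * temp γ Vl * Vl.1⁻¹ = temp γ Vl := by field_simp
      rw [e1, e2]
      have h0 : J * (1 / (γ - 1) * (temp γ Vr - temp γ Vl)
          + (Vl.1 * temp γ Vl + Vr.1 * temp γ Vr) / 2 * (Vr.1⁻¹ - Vl.1⁻¹)) = 0 := by
        linear_combination hE + (Vr.1 * temp γ Vr + Vl.1 * temp γ Vl) / 2 * hu
      exact (mul_eq_zero.1 h0).resolve_left hJ.ne')
    (by
      have h0 : 0 ≤ spEntropy γ Vr.1 (temp γ Vr) - spEntropy γ Vl.1 (temp γ Vl) :=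
        nonneg_of_mul_nonneg_right hs hJ
      rw [Real.log_div (mul_pos hr1 hrt).ne' (mul_pos hl1 hlt).ne',
        Real.log_div (inv_pos.2 hr1).ne' (inv_pos.2 hl1).ne', Real.log_mul hr1.ne' hrt.ne',
        Real.log_mul hl1.ne' hlt.ne', Real.log_inv, Real.log_inv]
      simp only [spEntropy] at h0
      have := mul_nonneg hg.le h0
      field_simp at this
      linarith)
  rcases hsc with ⟨h1, h2⟩ | ⟨h1, h2, h3, h4, h5, h6⟩
  · left
    have hρ : Vr.1 = Vl.1 := inv_injective h1
    have hθ : temp γ Vr = temp γ Vl := by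
      rw [hρ] at h2; exact mul_left_cancel₀ hl1.ne' h2
    have hv : ∀ j, vel Vr j = vel Vl j := by
      intro j
      by_cases hj : j = i
      · subst hj; rw [h1, sub_self, mul_zero] at hu; linarith
      · have := (mul_eq_zero.1 (ht j hj)).resolve_left hJ.ne'
        linarith
    exact gas_ext hγ hr1.ne' hl1.ne' hρ hv hθ
  · right
    have hlr : Vl.1 < Vr.1 := (inv_lt_inv₀ hr1 hl1).1 h1
    have e1 : Vl.1 * temp γ Vl * Vl.1⁻¹ = temp γ Vl := by field_simp
    have e2 : Vr.1 * temp γ Vr * Vr.1⁻¹ = temp γ Vr := by field_simp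
    refine ⟨hlr, h2, ?_, ?_, ?_, ?_, ?_, h5, h6, hu⟩
    · have := mul_pos hJ (sub_pos.2 h1); linarith
    · rw [hul]; rwa [e1] at h3
    · rw [hur]; rwa [e2] at h4
    · have := mul_pos hJ (inv_pos.2 hl1); linarith
    · have := mul_pos hJ (inv_pos.2 hr1); linarith

end Fan

section Fan

variable {d : ℕ} {γ : ℝ} {i : Fin d}

/-- Self-similar entropy solution with break points in `B`. -/
structure IsFan (γ : ℝ) (i : Fin d) (W : ℝ → State d) (B : Finset ℝ) : Prop where
  smooth : ∀ ξ, ξ ∉ B → Admissible γ (W ξ) ∧ ContDiffAt ℝ 1 W ξ ∧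
      HasDerivAt (fun ζ => flux γ i (W ζ)) (ξ • deriv W ξ) ξ
  jump : ∀ b ∈ B, ∃ Vl Vr : State d, Admissible γ Vl ∧ Admissible γ Vr ∧
      HasTrace γ i W (𝓝[<] b) Vl ∧ HasTrace γ i W (𝓝[>] b) Vr ∧
      flux γ i Vr - flux γ i Vl = b • (Vr - Vl) ∧
      b * (entropy γ Vr - entropy γ Vl) ≤ entropyFlux γ i Vr - entropyFlux γ i Vl

/-- Off the break points, vacuum points are interior to the vacuum. -/
def VacuumOpen (γ : ℝ) (W : ℝ → State d) (B : Finset ℝ) : Prop :=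
  ∀ ξ, ξ ∉ B → IsGas γ (W ξ) ∨ ∀ᶠ ζ in 𝓝 ξ, W ζ = 0

theorem tendsto_massFlux {W : ℝ → State d} {b : ℝ} {l : Filter ℝ} {V : State d}
    (hl : l ≤ 𝓝 b) (h : Tendsto W l (𝓝 V)) :
    Tendsto (fun ζ => massFlux i (W ζ) ζ) l (𝓝 (massFlux i V b)) := by
  have h1 : Continuous fun q : State d × ℝ => massFlux i q.1 q.2 := by
    unfold massFlux; fun_prop
  exact (h1.tendsto (V, b)).comp (h.prodMk_nhds (tendsto_id.mono_left hl))

theorem massFlux_jump {b : ℝ} {Vl Vr : State d}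
    (hRH : flux γ i Vr - flux γ i Vl = b • (Vr - Vl)) :
    massFlux i Vr b = massFlux i Vl b := by
  have h1 : (flux γ i Vr).1 - (flux γ i Vl).1 = b * (Vr.1 - Vl.1) := congrArg Prod.fst hRH
  simp only [massFlux]; simp only [flux] at h1; linarith

namespace IsFan

variable {W : ℝ → State d} {B : Finset ℝ}

theorem massFlux_anti (h : IsFan γ i W B) {x y : ℝ} (hxy : x ≤ y) (hx : x ∉ B) (hy : y ∉ B) :
    massFlux i (W y) y ≤ massFlux i (W x) x := by
  refine le_of_deriv_nonpos_of_jump (f := fun ζ => massFlux i (W ζ) ζ) hxy hx hy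
    (fun ξ _ hξ => ?_) fun b hb _ _ => ?_
  · obtain ⟨ha, hs, hF⟩ := h.smooth ξ hξ
    exact ⟨_, massFlux_hasDerivAt hs hF, by linarith [ha.nonneg.1]⟩
  · obtain ⟨Vl, Vr, -, -, hl, hr, hRH, -⟩ := h.jump b hb
    exact ⟨_, _, tendsto_massFlux nhdsWithin_le_nhds hl.1,
      tendsto_massFlux nhdsWithin_le_nhds hr.1, (massFlux_jump hRH).le⟩

theorem eq_zero_of_massFlux_const (h : IsFan γ i W B) {ξ c : ℝ} (hξ : ξ ∉ B)
    (hc : ∀ᶠ ζ in 𝓝 ξ, massFlux i (W ζ) ζ = c) : W ξ = 0 := by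
  obtain ⟨ha, hs, hF⟩ := h.smooth ξ hξ
  have h1 := massFlux_hasDerivAt hs hF
  have h2 : HasDerivAt (fun ζ => massFlux i (W ζ) ζ) 0 ξ :=
    (hasDerivAt_const ξ c).congr_of_eventuallyEq hc
  have h3 := h1.unique h2
  rcases ha.isGas_or with hg | h0
  · linarith [hg.1]
  · exact h0

theorem eventually_notMem_nhds {ξ : ℝ} (hξ : ξ ∉ B) : ∀ᶠ ζ in 𝓝 ξ, ζ ∉ B :=
  B.finite_toSet.isClosed.isOpen_compl.mem_nhds (by simpa using hξ)

theorem vacuum_between (h : IsFan γ i W B) {x y ξ : ℝ} (hx : x ∉ B) (hy : y ∉ B) (hξ : ξ ∉ B)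
    (hxξ : x < ξ) (hξy : ξ < y) (hWx : W x = 0) (hWy : W y = 0) : W ξ = 0 := by
  refine h.eq_zero_of_massFlux_const (c := 0) hξ ?_
  filter_upwards [eventually_notMem_nhds hξ, Ioo_mem_nhds hxξ hξy] with ζ hζ hζ2
  have h1 := h.massFlux_anti hζ2.1.le hx hζ
  have h2 := h.massFlux_anti hζ2.2.le hζ hy
  simp only [hWx, hWy, massFlux] at h1 h2 ⊢
  simp at h1 h2
  linarith

theorem hasDerivAt_spEntropy (hγ : 1 < γ) (h : IsFan γ i W B) {ξ : ℝ} (hξ : ξ ∉ B)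
    (hg : IsGas γ (W ξ)) (hJ : massFlux i (W ξ) ξ ≠ 0) :
    HasDerivAt (fun ζ => spEntropy γ (W ζ).1 (temp γ (W ζ))) 0 ξ := by
  obtain ⟨-, hs, hF⟩ := h.smooth ξ hξ
  obtain ⟨ρ', ϑ', u', h1, h2, h3, e1, e2, -⟩ := smooth_eqs hγ hs hg hF
  have h4 := ((h2.log hg.temp_pos.ne').div_const (γ - 1)).sub (h1.log hg.1.ne')
  refine h4.congr_deriv ?_
  have hg1 : γ - 1 ≠ 0 := by linarith
  have h5 : massFlux i (W ξ) ξ * (ϑ' / temp γ (W ξ) / (γ - 1) - ρ' / (W ξ).1) = 0 := by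
    have a1 := hg.1.ne'
    have a2 := hg.temp_pos.ne'
    field_simp
    linear_combination (W ξ).1 * e2 - temp γ (W ξ) * (γ - 1) * e1
  exact (mul_eq_zero.1 h5).resolve_left hJ

theorem massFlux_ne_zero (h : IsFan γ i W B) {a b ξ ξ0 : ℝ} (hξ : ξ ∈ Ioo a b)
    (h0 : ξ0 = a ∨ ξ0 = b) (hB : ∀ ζ ∈ Ioo a b, ζ ∉ B ∧ IsGas γ (W ζ))
    (hc : ContinuousAt (fun ζ => massFlux i (W ζ) ζ) ξ0) (hz : massFlux i (W ξ0) ξ0 = 0) :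
    massFlux i (W ξ) ξ ≠ 0 := by
  intro hcon
  have hd : ∀ ζ ∈ Ioo a b, HasDerivAt (fun ζ => massFlux i (W ζ) ζ) (-(W ζ).1) ζ := fun ζ hζ =>
    massFlux_hasDerivAt (h.smooth ζ (hB ζ hζ).1).2.1 (h.smooth ζ (hB ζ hζ).1).2.2
  rcases h0 with rfl | rfl
  · obtain ⟨c, hc1, hc2⟩ := exists_hasDerivAt_eq_zero (f := fun ζ => massFlux i (W ζ) ζ)
      (f' := fun ζ => -(W ζ).1) hξ.1
      (fun ζ hζ => by
        rcases hζ.1.eq_or_lt with rfl | h1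
        · exact hc.continuousWithinAt
        · exact (hd ζ ⟨h1, hζ.2.trans_lt hξ.2⟩).continuousAt.continuousWithinAt)
      (hz.trans hcon.symm) (fun ζ hζ => hd ζ ⟨hζ.1, hζ.2.trans hξ.2⟩)
    have := (hB c ⟨hc1.1, hc1.2.trans hξ.2⟩).2.1
    linarith
  · obtain ⟨c, hc1, hc2⟩ := exists_hasDerivAt_eq_zero (f := fun ζ => massFlux i (W ζ) ζ)
      (f' := fun ζ => -(W ζ).1) hξ.2
      (fun ζ hζ => by
        rcases hζ.2.eq_or_lt with rfl | h1
        · exact hc.continuousWithinAt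
        · exact (hd ζ ⟨hξ.1.trans_le hζ.1, h1⟩).continuousAt.continuousWithinAt)
      (hcon.trans hz.symm) (fun ζ hζ => hd ζ ⟨hξ.1.trans hζ.1, hζ.2⟩)
    have := (hB c ⟨hξ.1.trans hc1.1, hc1.2⟩).2.1
    linarith

/-- Entropy traces at an endpoint where the solution reaches the vacuum continuously. -/
theorem entropy_tendsto_zero (hγ : 1 < γ) (h : IsFan γ i W B) {a b ξ0 : ℝ} (hab : a < b)
    (h0 : ξ0 = a ∨ ξ0 = b) (hB : ∀ ζ ∈ Ioo a b, ζ ∉ B ∧ IsGas γ (W ζ)) (hξ0 : ξ0 ∉ B)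
    (hW0 : W ξ0 = 0) {l : Filter ℝ} (hl : l ≤ 𝓝 ξ0) (hIoo : Ioo a b ∈ l) :
    Tendsto (fun ζ => entropy γ (W ζ)) l (𝓝 0) ∧
      Tendsto (fun ζ => entropyFlux γ i (W ζ)) l (𝓝 0) := by
  have hWc : ContinuousAt W ξ0 := (h.smooth ξ0 hξ0).2.1.continuousAt
  have hc : ContinuousAt (fun ζ => massFlux i (W ζ) ζ) ξ0 := tendsto_massFlux le_rfl hWc
  have hz : massFlux i (W ξ0) ξ0 = 0 := by simp [massFlux, hW0]
  obtain ⟨m, hm⟩ : (Ioo a b).Nonempty := nonempty_Ioo.2 hab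
  have hconst : ∀ ζ ∈ Ioo a b, spEntropy γ (W ζ).1 (temp γ (W ζ))
      = spEntropy γ (W m).1 (temp γ (W m)) := by
    have hd : ∀ ζ ∈ Ioo a b,
        HasDerivAt (fun ζ => spEntropy γ (W ζ).1 (temp γ (W ζ))) 0 ζ := fun ζ hζ =>
      h.hasDerivAt_spEntropy hγ (hB ζ hζ).1 (hB ζ hζ).2 (h.massFlux_ne_zero hζ h0 hB hc hz)
    intro ζ hζ
    exact isOpen_Ioo.is_const_of_deriv_eq_zero isPreconnected_Ioo
      (fun z hz => (hd z hz).differentiableAt.differentiableWithinAt)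
      (fun z hz => (hd z hz).deriv) hζ hm
  set σ := spEntropy γ (W m).1 (temp γ (W m))
  have hρ : Tendsto (fun ζ => (W ζ).1) l (𝓝 0) := by
    have := (continuous_fst.tendsto (W ξ0)).comp (hWc.tendsto.mono_left hl)
    rw [hW0] at this; exact this
  have hm : Tendsto (fun ζ => (W ζ).2.1 i) l (𝓝 0) := by
    have hcont : Continuous fun U : State d => U.2.1 i := by fun_prop
    have := (hcont.tendsto (W ξ0)).comp (hWc.tendsto.mono_left hl)
    rw [hW0] at this; exact this
  constructor
  · have h2 := hρ.mul_const σ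
    rw [zero_mul] at h2
    refine h2.congr' ?_
    filter_upwards [hIoo] with ζ hζ
    rw [entropy_eq hγ (hB ζ hζ).2, hconst ζ hζ]
  · have h2 := hm.mul_const σ
    rw [zero_mul] at h2
    refine h2.congr' ?_
    filter_upwards [hIoo] with ζ hζ
    rw [entropyFlux, entropy_eq hγ (hB ζ hζ).2, hconst ζ hζ]
    have := (hB ζ hζ).2.1.ne'
    field_simp

theorem hasTrace_vacuum_left (hγ : 1 < γ) (h : IsFan γ i W B) {ξ0 : ℝ} (hξ0 : ξ0 ∉ B)
    (hW0 : W ξ0 = 0) : HasTrace γ i W (𝓝[<] ξ0) 0 := by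
  obtain ⟨-, hs, hF⟩ := h.smooth ξ0 hξ0
  have hle : 𝓝[<] ξ0 ≤ 𝓝 ξ0 := nhdsWithin_le_nhds
  have hW := hs.continuousAt.tendsto
  have hFt := hF.continuousAt.tendsto
  rw [hW0] at hW hFt
  obtain ⟨a, ha, haB⟩ := (mem_nhdsLT_iff_exists_Ioo_subset).1 (eventually_notMem_left B ξ0)
  refine ⟨hW.mono_left hle, hFt.mono_left hle, ?_⟩
  rw [entropy_zero, entropyFlux_zero]
  by_cases hv : ∃ x ∈ Ioo a ξ0, W x = 0
  · obtain ⟨x, hx, hWx⟩ := hv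
    have hev : ∀ᶠ ζ in 𝓝[<] ξ0, W ζ = 0 := by
      filter_upwards [Ioo_mem_nhdsLT hx.2] with ζ hζ
      exact h.vacuum_between (haB hx) hξ0 (haB ⟨hx.1.trans hζ.1, hζ.2⟩) hζ.1 hζ.2 hWx hW0
    constructor
    · refine tendsto_const_nhds.congr' ?_
      filter_upwards [hev] with ζ hζ; rw [hζ, entropy_zero]
    · refine tendsto_const_nhds.congr' ?_
      filter_upwards [hev] with ζ hζ; rw [hζ, entropyFlux_zero]
  · push Not at hv
    exact h.entropy_tendsto_zero hγ ha (Or.inr rfl)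
      (fun ζ hζ => ⟨haB hζ, ((h.smooth ζ (haB hζ)).1.isGas_or).resolve_right (hv ζ hζ)⟩)
      hξ0 hW0 hle (Ioo_mem_nhdsLT ha)

theorem hasTrace_vacuum_right (hγ : 1 < γ) (h : IsFan γ i W B) {ξ0 : ℝ} (hξ0 : ξ0 ∉ B)
    (hW0 : W ξ0 = 0) : HasTrace γ i W (𝓝[>] ξ0) 0 := by
  obtain ⟨-, hs, hF⟩ := h.smooth ξ0 hξ0
  have hle : 𝓝[>] ξ0 ≤ 𝓝 ξ0 := nhdsWithin_le_nhds
  have hW := hs.continuousAt.tendsto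
  have hFt := hF.continuousAt.tendsto
  rw [hW0] at hW hFt
  obtain ⟨a, ha, haB⟩ := (mem_nhdsGT_iff_exists_Ioo_subset).1 (eventually_notMem_right B ξ0)
  refine ⟨hW.mono_left hle, hFt.mono_left hle, ?_⟩
  rw [entropy_zero, entropyFlux_zero]
  by_cases hv : ∃ x ∈ Ioo ξ0 a, W x = 0
  · obtain ⟨x, hx, hWx⟩ := hv
    have hev : ∀ᶠ ζ in 𝓝[>] ξ0, W ζ = 0 := by
      filter_upwards [Ioo_mem_nhdsGT hx.1] with ζ hζ
      exact h.vacuum_between hξ0 (haB hx) (haB ⟨hζ.1, hζ.2.trans hx.2⟩) hζ.1 hζ.2 hW0 hWx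
    constructor
    · refine tendsto_const_nhds.congr' ?_
      filter_upwards [hev] with ζ hζ; rw [hζ, entropy_zero]
    · refine tendsto_const_nhds.congr' ?_
      filter_upwards [hev] with ζ hζ; rw [hζ, entropyFlux_zero]
  · push Not at hv
    exact h.entropy_tendsto_zero hγ ha (Or.inl rfl)
      (fun ζ hζ => ⟨haB hζ, ((h.smooth ζ (haB hζ)).1.isGas_or).resolve_right (hv ζ hζ)⟩)
      hξ0 hW0 hle (Ioo_mem_nhdsGT ha)

/-- The edges of the vacuum can be counted as break points. -/
theorem exists_vacuumOpen (hγ : 1 < γ) (h : IsFan γ i W B) :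
    ∃ B', IsFan γ i W B' ∧ VacuumOpen γ W B' := by
  set X : Set ℝ := {ξ | ξ ∉ B ∧ W ξ = 0} with hX
  set E : Set ℝ := {ξ | ξ ∈ X ∧ (IsLeast X ξ ∨ IsGreatest X ξ)} with hE
  have hfin : E.Finite := by
    have : E ⊆ {sInf X, sSup X} := by
      rintro ξ ⟨-, h | h⟩
      · left; exact h.csInf_eq.symm
      · right; exact h.csSup_eq.symm
    exact (Set.toFinite _).subset this
  refine ⟨B ∪ hfin.toFinset, ⟨fun ξ hξ => h.smooth ξ fun h' => hξ (Finset.mem_union_left _ h'),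
    fun b hb => ?_⟩, fun ξ hξ => ?_⟩
  · by_cases hbB : b ∈ B
    · exact h.jump b hbB
    · have hbX : b ∈ X := by
        have := (Finset.mem_union.1 hb).resolve_left hbB
        exact ((Set.Finite.mem_toFinset _).1 this).1
      exact ⟨0, 0, Or.inr rfl, Or.inr rfl, h.hasTrace_vacuum_left hγ hbX.1 hbX.2,
        h.hasTrace_vacuum_right hγ hbX.1 hbX.2, by simp, by simp⟩
  · have hξB : ξ ∉ B := fun h' => hξ (Finset.mem_union_left _ h')
    have hξE : ξ ∉ E := fun h' => hξ (Finset.mem_union_right _ (by simpa using h'))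
    rcases (h.smooth ξ hξB).1.isGas_or with hg | h0
    · exact Or.inl hg
    · right
      have hξX : ξ ∈ X := ⟨hξB, h0⟩
      have h1 : ¬ IsLeast X ξ := fun h' => hξE ⟨hξX, Or.inl h'⟩
      have h2 : ¬ IsGreatest X ξ := fun h' => hξE ⟨hξX, Or.inr h'⟩
      have h3 : ∃ x ∈ X, x < ξ := by
        by_contra hc; push Not at hc; exact h1 ⟨hξX, hc⟩
      have h4 : ∃ x ∈ X, ξ < x := by
        by_contra hc; push Not at hc; exact h2 ⟨hξX, hc⟩
      obtain ⟨x, hx, hxξ⟩ := h3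
      obtain ⟨y, hy, hξy⟩ := h4
      filter_upwards [eventually_notMem_nhds hξB, Ioo_mem_nhds hxξ hξy] with ζ hζ hζ2
      exact h.vacuum_between hx.1 hy.1 hζ hζ2.1 hζ2.2 hx.2 hy.2

end IsFan

/-! ### The waves on the left of the contact -/

/-- Sound speed. -/
def sound (γ : ℝ) (U : State d) : ℝ := √(γ * temp γ U)

theorem IsGas.sound_pos (hγ : 1 < γ) {U : State d} (h : IsGas γ U) : 0 < sound γ U :=
  Real.sqrt_pos.2 (mul_pos (by linarith) h.temp_pos)

theorem IsGas.sound_sq (hγ : 1 < γ) {U : State d} (h : IsGas γ U) :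
    sound γ U ^ 2 = γ * temp γ U :=
  Real.sq_sqrt (mul_pos (by linarith) h.temp_pos).le

theorem IsGas.continuousAt_sound {U : State d} (h : U.1 ≠ 0) : ContinuousAt (sound γ) U :=
  ((IsGas.continuousAt_temp h).const_mul γ).sqrt

/-- Riemann invariant of the left waves. -/
def riemannInv (γ : ℝ) (i : Fin d) (U : State d) : ℝ := vel U i + 2 / (γ - 1) * sound γ U

/-- Excess of the relative velocity over the sound speed. -/
def machGap (γ : ℝ) (i : Fin d) (U : State d) (ξ : ℝ) : ℝ := vel U i - ξ - sound γ U

theorem tendsto_machGap {W : ℝ → State d} {b : ℝ} {l : Filter ℝ} {V : State d}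
    (hl : l ≤ 𝓝 b) (h : Tendsto W l (𝓝 V)) (hV : V.1 ≠ 0) :
    Tendsto (fun ζ => machGap γ i (W ζ) ζ) l (𝓝 (machGap γ i V b)) :=
  ((((continuousAt_vel hV i).tendsto.comp h).sub (tendsto_id.mono_left hl)).sub
    ((IsGas.continuousAt_sound hV).tendsto.comp h))

theorem continuousAt_riemannInv {V : State d} (hV : V.1 ≠ 0) :
    ContinuousAt (riemannInv γ i) V :=
  (continuousAt_vel hV i).add ((IsGas.continuousAt_sound hV).const_mul _)

theorem continuousAt_spEntropy {V : State d} (hV : IsGas γ V) :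
    ContinuousAt (fun U : State d => spEntropy γ U.1 (temp γ U)) V :=
  (((IsGas.continuousAt_temp hV.1.ne').log hV.temp_pos.ne').div_const _).sub
    (continuousAt_fst.log hV.1.ne')

/-- Jump conditions of a compressive wave with positive mass flux. -/
def IsShock (γ : ℝ) (i : Fin d) (b : ℝ) (Vl Vr : State d) : Prop :=
  Vl.1 < Vr.1 ∧ Vl.1 * temp γ Vl < Vr.1 * temp γ Vr ∧ vel Vr i < vel Vl i ∧
    γ * temp γ Vl < (vel Vl i - b) ^ 2 ∧ (vel Vr i - b) ^ 2 < γ * temp γ Vr ∧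
    b < vel Vl i ∧ b < vel Vr i ∧
    massFlux i Vl b ^ 2 * ((γ + 1) * Vr.1⁻¹ - (γ - 1) * Vl.1⁻¹) = 2 * γ * (Vl.1 * temp γ Vl) ∧
    (Vr.1 * temp γ Vr) * ((γ + 1) * Vr.1⁻¹ - (γ - 1) * Vl.1⁻¹)
      = (Vl.1 * temp γ Vl) * ((γ + 1) * Vl.1⁻¹ - (γ - 1) * Vr.1⁻¹) ∧
    vel Vl i - vel Vr i = massFlux i Vl b * (Vl.1⁻¹ - Vr.1⁻¹)

theorem IsShock.machGap_pos {b : ℝ} {Vl Vr : State d} (h : IsShock γ i b Vl Vr) :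
    0 < machGap γ i Vl b := by
  have h1 : sound γ Vl < vel Vl i - b :=
    Real.sqrt_lt' (by linarith [h.2.2.2.2.2.1]) |>.2 h.2.2.2.1
  rw [machGap]; linarith

theorem IsShock.machGap_neg {b : ℝ} {Vl Vr : State d} (h : IsShock γ i b Vl Vr) :
    machGap γ i Vr b < 0 := by
  have h1 : vel Vr i - b < sound γ Vr :=
    Real.lt_sqrt (by linarith [h.2.2.2.2.2.2.1]) |>.2 h.2.2.2.2.1
  rw [machGap]; linarith

namespace IsFan

variable {W : ℝ → State d} {B : Finset ℝ} {ξs : ℝ}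

/-- Derivatives at smooth points with positive mass flux. -/
theorem left_smooth (hγ : 1 < γ) (h : IsFan γ i W B) {ξ : ℝ} (hξ : ξ ∉ B)
    (hJ : 0 < massFlux i (W ξ) ξ) :
    IsGas γ (W ξ) ∧ ∃ (ρ' ϑ' : ℝ) (u' : Fin d → ℝ), HasDerivAt (fun ζ => (W ζ).1) ρ' ξ ∧
      HasDerivAt (fun ζ => temp γ (W ζ)) ϑ' ξ ∧ (∀ j, HasDerivAt (fun ζ => vel (W ζ) j) (u' j) ξ) ∧
      HasDerivAt (fun ζ => sound γ (W ζ)) (-((γ - 1) / 2 * u' i)) ξ ∧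
      0 ≤ u' i ∧ (γ + 1) / 2 * u' i - 1 ≤ 0 ∧ ρ' * temp γ (W ξ) + (W ξ).1 * ϑ' ≤ 0 ∧
      (∀ j, j ≠ i → u' j = 0) ∧ (machGap γ i (W ξ) ξ ≠ 0 → ρ' = 0 ∧ ϑ' = 0 ∧ ∀ j, u' j = 0) := by
  obtain ⟨ha, hs, hF⟩ := h.smooth ξ hξ
  have hg : IsGas γ (W ξ) := by
    rcases ha.isGas_or with hg | h0
    · exact hg
    · simp [massFlux, h0] at hJ
  have key : ∀ ζ, ContDiffAt ℝ 1 W ζ →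
      HasDerivAt (fun ζ => flux γ i (W ζ)) (ζ • deriv W ζ) ζ → IsGas γ (W ζ) →
      0 < massFlux i (W ζ) ζ →
      ∃ (ρ' ϑ' : ℝ) (u' : Fin d → ℝ), HasDerivAt (fun ζ => (W ζ).1) ρ' ζ ∧
      HasDerivAt (fun ζ => temp γ (W ζ)) ϑ' ζ ∧ (∀ j, HasDerivAt (fun ζ => vel (W ζ) j) (u' j) ζ) ∧
      HasDerivAt (fun ζ => sound γ (W ζ)) (-((γ - 1) / 2 * u' i)) ζ ∧
      massFlux i (W ζ) ζ * u' i = - (ρ' * temp γ (W ζ) + (W ζ).1 * ϑ') ∧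
      (∀ j, j ≠ i → u' j = 0) ∧ (u' i = 0 → ρ' = 0 ∧ ϑ' = 0) ∧
      (u' i ≠ 0 → machGap γ i (W ζ) ζ = 0) := by
    intro ζ hs hF hg hJ
    obtain ⟨ρ', ϑ', u', h1, h2, h3, e1, e2, e3, e4⟩ := smooth_eqs hγ hs hg hF
    have hc := hg.sound_pos hγ
    have hc2 := hg.sound_sq hγ
    have hJe := massFlux_eq (i := i) hg.1.ne' ζ
    have h0 : u' i = 0 → ρ' = 0 ∧ ϑ' = 0 := fun hu => by
      rw [hu, mul_zero] at e1 e2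
      exact ⟨(mul_eq_zero.1 e1).resolve_left hJ.ne', (mul_eq_zero.1 e2).resolve_left hJ.ne'⟩
    have hrel : 0 < vel (W ζ) i - ζ := by
      rw [hJe] at hJ; exact (pos_iff_pos_of_mul_pos hJ).1 hg.1
    have hmg : u' i ≠ 0 → machGap γ i (W ζ) ζ = 0 := fun hu => by
      have e5 : (massFlux i (W ζ) ζ ^ 2 - (W ζ).1 ^ 2 * (γ * temp γ (W ζ))) * u' i = 0 := by
        linear_combination (massFlux i (W ζ) ζ) * e3 - temp γ (W ζ) * e1 - (W ζ).1 * e2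
      have e6 := (mul_eq_zero.1 e5).resolve_right hu
      rw [← hc2, hJe] at e6
      have e7 : (W ζ).1 ^ 2 * ((vel (W ζ) i - ζ - sound γ (W ζ))
          * (vel (W ζ) i - ζ + sound γ (W ζ))) = 0 := by linear_combination e6
      have e8 := (mul_eq_zero.1 e7).resolve_left (pow_ne_zero 2 hg.1.ne')
      exact (mul_eq_zero.1 e8).resolve_right (by linarith)
    refine ⟨ρ', ϑ', u', h1, h2, h3, ?_, e3,
      fun j hj => (mul_eq_zero.1 (e4 j hj)).resolve_left hJ.ne', h0, hmg⟩
    have h5 := (h2.const_mul γ).sqrt (mul_pos (by linarith) hg.temp_pos).ne'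
    refine h5.congr_deriv ?_
    change γ * ϑ' / (2 * sound γ (W ζ)) = _
    by_cases hu : u' i = 0
    · rw [hu, (h0 hu).2]; simp
    · have e9 := hmg hu
      rw [machGap] at e9
      have e10 : vel (W ζ) i - ζ = sound γ (W ζ) := by linarith
      rw [hJe, e10] at e2
      have e11 : sound γ (W ζ) * ϑ' = - (γ - 1) * temp γ (W ζ) * u' i := by
        have := hg.1.ne'
        have e12 : (W ζ).1 * (sound γ (W ζ) * ϑ')
            = (W ζ).1 * (- (γ - 1) * temp γ (W ζ) * u' i) := by linear_combination e2
        exact mul_left_cancel₀ this e12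
      field_simp
      have e13 : sound γ (W ζ) * (γ * ϑ') = sound γ (W ζ) * (-(sound γ (W ζ) * (γ - 1) * u' i)) := by
        linear_combination γ * e11 + (γ - 1) * u' i * hc2
      exact mul_left_cancel₀ hc.ne' e13
  obtain ⟨ρ', ϑ', u', h1, h2, h3, h4, e3, h5, h6, h7⟩ := key ξ hs hF hg hJ
  have hval : u' i = 0 ∨ (γ + 1) / 2 * u' i = 1 := by
    by_cases hu : u' i = 0
    · exact Or.inl hu
    · right
      have hvC : ContDiffAt ℝ 1 (fun ζ => vel (W ζ) i) ξ := by
        unfold vel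
        exact ((contDiffAt_pi.1 hs.snd.fst i)).div hs.fst hg.1.ne'
      have hdc : ContinuousAt (deriv fun ζ => vel (W ζ) i) ξ := by
        have := (hvC.fderiv_right (m := 0) le_rfl).continuousAt
        exact ((ContinuousLinearMap.apply ℝ ℝ (1 : ℝ)).continuous.continuousAt.comp this :)
      have hne : ∀ᶠ ζ in 𝓝 ξ, deriv (fun ζ => vel (W ζ) i) ζ ≠ 0 :=
        hdc.eventually_ne (by rwa [(h3 i).deriv])
      have hJc : ContinuousAt (fun ζ => massFlux i (W ζ) ζ) ξ :=
        tendsto_massFlux le_rfl hs.continuousAt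
      have hz : ∀ᶠ ζ in 𝓝 ξ, machGap γ i (W ζ) ζ = 0 := by
        filter_upwards [hne, eventually_notMem_nhds hξ, hs.continuousAt.eventually hg.eventually,
          hJc.eventually (lt_mem_nhds hJ)] with ζ a1 a2 a3 a4
        obtain ⟨_, _, v', _, _, b3, _, _, _, _, b7⟩ :=
          key ζ (h.smooth ζ a2).2.1 (h.smooth ζ a2).2.2 a3 a4
        rw [(b3 i).deriv] at a1
        exact b7 a1
      have hd0 : HasDerivAt (fun ζ => machGap γ i (W ζ) ζ) 0 ξ :=
        (hasDerivAt_const ξ (0 : ℝ)).congr_of_eventuallyEq hz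
      have hd1 := ((h3 i).sub (hasDerivAt_id ξ)).sub h4
      have := hd0.unique hd1
      linarith
  refine ⟨hg, ρ', ϑ', u', h1, h2, h3, h4, ?_, ?_, ?_, h5, fun hm => ?_⟩
  · rcases hval with h | h
    · exact h.ge
    · by_contra hc; push Not at hc; nlinarith
  · rcases hval with h | h
    · rw [h]; norm_num
    · linarith
  · have hu0 : 0 ≤ u' i := by
      rcases hval with h | h
      · exact h.ge
      · by_contra hc; push Not at hc; nlinarith
    have := mul_nonneg hJ.le hu0
    linarith
  · have hu0 : u' i = 0 := by by_contra hu; exact hm (h7 hu)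
    refine ⟨(h6 hu0).1, (h6 hu0).2, fun j => ?_⟩
    by_cases hj : j = i
    · rw [hj]; exact hu0
    · exact h5 j hj

/-- Jumps with positive mass flux. -/
theorem left_jump (hγ : 1 < γ) (h : IsFan γ i W B)
    (hpos : ∀ ξ, ξ ∉ B → ξ < ξs → 0 < massFlux i (W ξ) ξ) {b : ℝ} (hb : b ∈ B) (hbs : b < ξs) :
    ∃ Vl Vr, IsGas γ Vl ∧ IsGas γ Vr ∧ Tendsto W (𝓝[<] b) (𝓝 Vl) ∧ Tendsto W (𝓝[>] b) (𝓝 Vr) ∧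
      (Vr = Vl ∨ IsShock γ i b Vl Vr) := by
  obtain ⟨Vl, Vr, hal, har, hl, hr, hRH, hS⟩ := h.jump b hb
  have hJ : 0 < massFlux i Vl b := by
    have h1 := (eventually_notMem_right B b).and (Ioo_mem_nhdsGT hbs)
    obtain ⟨y, hyB, hy⟩ := h1.exists
    refine (hpos y hyB hy.2).trans_le ?_
    refine ge_of_tendsto (tendsto_massFlux nhdsWithin_le_nhds hl.1) ?_
    filter_upwards [eventually_notMem_left B b, self_mem_nhdsWithin] with x hx hxb
    exact h.massFlux_anti ((mem_Iio.1 hxb).trans hy.1).le hx hyB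
  have hgl : IsGas γ Vl := by
    rcases hal.isGas_or with hg | h0
    · exact hg
    · simp [massFlux, h0] at hJ
  have hgr := (isGas_iff_of_jump hal har hRH).1 hgl
  exact ⟨Vl, Vr, hgl, hgr, hl.1, hr.1, shock_eqs hγ hgl hgr hRH hS hJ⟩

theorem machGap_anti (hγ : 1 < γ) (h : IsFan γ i W B)
    (hpos : ∀ ξ, ξ ∉ B → ξ < ξs → 0 < massFlux i (W ξ) ξ) {x y : ℝ} (hxy : x ≤ y) (hx : x ∉ B)
    (hy : y ∉ B) (hys : y < ξs) : machGap γ i (W y) y ≤ machGap γ i (W x) x := by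
  refine le_of_deriv_nonpos_of_jump (f := fun ζ => machGap γ i (W ζ) ζ) hxy hx hy
    (fun ξ hξ hξB => ?_) fun b hb _ hby => ?_
  · obtain ⟨hg, ρ', ϑ', u', h1, h2, h3, h4, h5, h6, -⟩ :=
      h.left_smooth hγ hξB (hpos ξ hξB (hξ.2.trans_lt hys))
    exact ⟨_, ((h3 i).sub (hasDerivAt_id ξ)).sub h4, by linarith⟩
  · obtain ⟨Vl, Vr, hgl, hgr, hl, hr, hor⟩ := h.left_jump hγ hpos hb (hby.trans hys)
    refine ⟨_, _, tendsto_machGap nhdsWithin_le_nhds hl hgl.1.ne',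
      tendsto_machGap nhdsWithin_le_nhds hr hgr.1.ne', ?_⟩
    rcases hor with rfl | hsh
    · exact le_rfl
    · exact (hsh.machGap_neg.trans hsh.machGap_pos).le

/-- Without sonic points and shocks the solution is constant. -/
theorem left_const (hγ : 1 < γ) (h : IsFan γ i W B)
    (hpos : ∀ ξ, ξ ∉ B → ξ < ξs → 0 < massFlux i (W ξ) ξ) {x y : ℝ} (hxy : x ≤ y) (hx : x ∉ B)
    (hy : y ∉ B) (hys : y < ξs) (hN : ∀ ξ ∈ Icc x y, ξ ∉ B → machGap γ i (W ξ) ξ ≠ 0)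
    (hj : ∀ b ∈ B, x < b → b < y → ∀ Vl Vr, Tendsto W (𝓝[<] b) (𝓝 Vl) →
      Tendsto W (𝓝[>] b) (𝓝 Vr) → ¬ IsShock γ i b Vl Vr) : W y = W x := by
  have hgas : ∀ ξ, ξ ∉ B → ξ ≤ y → IsGas γ (W ξ) := fun ξ hξ hξy =>
    (h.left_smooth hγ hξ (hpos ξ hξ (hξy.trans_lt hys))).1
  have hjump : ∀ b ∈ B, x < b → b < y → ∃ V, IsGas γ V ∧ Tendsto W (𝓝[<] b) (𝓝 V) ∧
      Tendsto W (𝓝[>] b) (𝓝 V) := by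
    intro b hb hxb hby
    obtain ⟨Vl, Vr, hgl, hgr, hl, hr, hor⟩ := h.left_jump hγ hpos hb (hby.trans hys)
    rcases hor with rfl | hsh
    · exact ⟨_, hgl, hl, hr⟩
    · exact (hj b hb hxb hby Vl Vr hl hr hsh).elim
  refine gas_ext hγ (hgas y hy le_rfl).1.ne' (hgas x hx hxy).1.ne' ?_ (fun j => ?_) ?_
  · refine eq_of_deriv_zero_of_jump (f := fun ζ => (W ζ).1) hxy hx hy (fun ξ hξ hξB => ?_)
      fun b hb h1 h2 => ?_
    · obtain ⟨-, ρ', ϑ', u', h1, h2, h3, -, -, -, -, -, h8⟩ :=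
        h.left_smooth hγ hξB (hpos ξ hξB (hξ.2.trans_lt hys))
      rw [← (h8 (hN ξ hξ hξB)).1]; exact h1
    · obtain ⟨V, hV, hl, hr⟩ := hjump b hb h1 h2
      exact ⟨_, (continuous_fst.tendsto V).comp hl, (continuous_fst.tendsto V).comp hr⟩
  · refine eq_of_deriv_zero_of_jump (f := fun ζ => vel (W ζ) j) hxy hx hy (fun ξ hξ hξB => ?_)
      fun b hb h1 h2 => ?_
    · obtain ⟨-, ρ', ϑ', u', h1, h2, h3, -, -, -, -, -, h8⟩ :=
        h.left_smooth hγ hξB (hpos ξ hξB (hξ.2.trans_lt hys))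
      rw [← (h8 (hN ξ hξ hξB)).2.2 j]; exact h3 j
    · obtain ⟨V, hV, hl, hr⟩ := hjump b hb h1 h2
      exact ⟨_, (continuousAt_vel hV.1.ne' j).tendsto.comp hl,
        (continuousAt_vel hV.1.ne' j).tendsto.comp hr⟩
  · refine eq_of_deriv_zero_of_jump (f := fun ζ => temp γ (W ζ)) hxy hx hy (fun ξ hξ hξB => ?_)
      fun b hb h1 h2 => ?_
    · obtain ⟨-, ρ', ϑ', u', h1, h2, h3, -, -, -, -, -, h8⟩ :=
        h.left_smooth hγ hξB (hpos ξ hξB (hξ.2.trans_lt hys))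
      rw [← (h8 (hN ξ hξ hξB)).2.1]; exact h2
    · obtain ⟨V, hV, hl, hr⟩ := hjump b hb h1 h2
      exact ⟨_, (IsGas.continuousAt_temp hV.1.ne').tendsto.comp hl,
        (IsGas.continuousAt_temp hV.1.ne').tendsto.comp hr⟩

end IsFan

end Fan

section Fan

variable {d : ℕ} {γ : ℝ} {i : Fin d}

/-- The left waves contain no shock. -/
def IsLeftRarefaction (γ : ℝ) (i : Fin d) (W : ℝ → State d) (B : Finset ℝ) (ξs : ℝ)
    (UL : State d) : Prop :=
  ∀ ξ, ξ ∉ B → ξ < ξs → IsGas γ (W ξ) ∧ riemannInv γ i (W ξ) = riemannInv γ i UL ∧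
    spEntropy γ (W ξ).1 (temp γ (W ξ)) = spEntropy γ UL.1 (temp γ UL) ∧
    vel UL i ≤ vel (W ξ) i ∧ (W ξ).1 * temp γ (W ξ) ≤ UL.1 * temp γ UL ∧
    (0 < machGap γ i (W ξ) ξ → W ξ = UL)

/-- The left waves consist of one shock of speed `b`. -/
def IsLeftShock (γ : ℝ) (i : Fin d) (W : ℝ → State d) (B : Finset ℝ) (ξs : ℝ)
    (UL : State d) (b : ℝ) (V : State d) : Prop :=
  b < ξs ∧ IsGas γ V ∧ IsShock γ i b UL V ∧ (∀ ξ, ξ ∉ B → ξ < b → W ξ = UL) ∧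
    ∀ ξ, ξ ∉ B → b < ξ → ξ < ξs → W ξ = V

namespace IsFan

variable {W : ℝ → State d} {B : Finset ℝ} {ξs : ℝ}

theorem exists_left_const (UL : State d) (hL : ∀ᶠ ξ in atBot, W ξ = UL) (B : Finset ℝ) (y : ℝ) :
    ∃ x < y, x ∉ B ∧ ∀ ξ ≤ x, W ξ = UL := by
  obtain ⟨a, ha⟩ := eventually_atBot.1 hL
  obtain ⟨m, hm⟩ := B.finite_toSet.bddBelow
  refine ⟨min (min a y) m - 1, ?_, fun h => ?_, fun ξ hξ => ha ξ ?_⟩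
  · have := (min_le_left (min a y) m).trans (min_le_right a y); linarith
  · have := hm h; have := min_le_right (min a y) m; linarith
  · have := (min_le_left (min a y) m).trans (min_le_left a y); linarith

theorem isGas_left (hγ : 1 < γ) (h : IsFan γ i W B)
    (hpos : ∀ ξ, ξ ∉ B → ξ < ξs → 0 < massFlux i (W ξ) ξ) {UL : State d}
    (hL : ∀ᶠ ξ in atBot, W ξ = UL) : IsGas γ UL := by
  obtain ⟨x, hx, hxB, hW⟩ := exists_left_const UL hL B ξs
  have := (h.left_smooth hγ hxB (hpos x hxB hx)).1
  rwa [hW x le_rfl] at this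

theorem left_structure (hγ : 1 < γ) (h : IsFan γ i W B)
    (hpos : ∀ ξ, ξ ∉ B → ξ < ξs → 0 < massFlux i (W ξ) ξ) {UL : State d}
    (hL : ∀ᶠ ξ in atBot, W ξ = UL) :
    IsLeftRarefaction γ i W B ξs UL ∨ ∃ b V, IsLeftShock γ i W B ξs UL b V := by
  by_cases hsh : ∃ b ∈ B, b < ξs ∧ ∃ Vl Vr, IsGas γ Vl ∧ IsGas γ Vr ∧
      Tendsto W (𝓝[<] b) (𝓝 Vl) ∧ Tendsto W (𝓝[>] b) (𝓝 Vr) ∧ IsShock γ i b Vl Vr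
  · right
    obtain ⟨b, hb, hbs, Vl, Vr, hgl, hgr, hl, hr, hS⟩ := hsh
    have hNl : ∀ ξ, ξ ∉ B → ξ < b → 0 < machGap γ i (W ξ) ξ := fun ξ hξ hξb => by
      refine hS.machGap_pos.trans_le (le_of_tendsto
        (tendsto_machGap nhdsWithin_le_nhds hl hgl.1.ne') ?_)
      filter_upwards [eventually_notMem_left B b, Ioo_mem_nhdsLT hξb] with ζ hζ hζ2
      exact h.machGap_anti hγ hpos hζ2.1.le hξ hζ (hζ2.2.trans hbs)
    have hNr : ∀ ξ, ξ ∉ B → b < ξ → ξ < ξs → machGap γ i (W ξ) ξ < 0 := fun ξ hξ hbξ hξs => by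
      refine lt_of_le_of_lt (ge_of_tendsto
        (tendsto_machGap nhdsWithin_le_nhds hr hgr.1.ne') ?_) hS.machGap_neg
      filter_upwards [eventually_notMem_right B b, Ioo_mem_nhdsGT hbξ] with ζ hζ hζ2
      exact h.machGap_anti hγ hpos hζ2.2.le hζ hξ hξs
    have hWl : ∀ ξ, ξ ∉ B → ξ < b → W ξ = UL := fun ξ hξ hξb => by
      obtain ⟨x, hx, hxB, hW⟩ := exists_left_const UL hL B ξ
      rw [← hW x le_rfl]
      refine h.left_const hγ hpos hx.le hxB hξ (hξb.trans hbs)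
        (fun ζ hζ hζB => (hNl ζ hζB (hζ.2.trans_lt hξb)).ne') fun b' hb' _ hb'ξ Vl' Vr' hl' hr' hS' => ?_
      have hlt := hS'.machGap_neg
      obtain ⟨Ul, Ur, gl, gr, tl, tr, -⟩ := h.left_jump hγ hpos hb' ((hb'ξ.trans hξb).trans hbs)
      have e : Vr' = Ur := tendsto_nhds_unique hr' tr
      subst e
      refine absurd hlt (not_lt.2 (ge_of_tendsto
        (tendsto_machGap nhdsWithin_le_nhds hr' gr.1.ne') ?_))
      filter_upwards [eventually_notMem_right B b', Ioo_mem_nhdsGT hb'ξ] with ζ hζ hζ2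
      exact (hNl ζ hζ (hζ2.2.trans hξb)).le
    have hVl : Vl = UL := by
      refine tendsto_nhds_unique hl (tendsto_const_nhds.congr' ?_)
      filter_upwards [eventually_notMem_left B b, self_mem_nhdsWithin] with ζ h1 h2
      exact (hWl ζ h1 h2).symm
    subst hVl
    have hcr : ∀ x y, x ∉ B → y ∉ B → b < x → x ≤ y → y < ξs → W y = W x := by
      intro x y hx hy hbx hxy hys
      refine h.left_const hγ hpos hxy hx hy hys
        (fun ζ hζ hζB => (hNr ζ hζB (hbx.trans_le hζ.1) (hζ.2.trans_lt hys)).ne)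
        fun b' hb' hxb' hb'y Vl' Vr' hl' hr' hS' => ?_
      have hlt := hS'.machGap_pos
      obtain ⟨Ul, Ur, gl, gr, tl, tr, -⟩ := h.left_jump hγ hpos hb' (hb'y.trans hys)
      have e : Vl' = Ul := tendsto_nhds_unique hl' tl
      subst e
      refine absurd hlt (not_lt.2 (le_of_tendsto
        (tendsto_machGap nhdsWithin_le_nhds hl' gl.1.ne') ?_))
      filter_upwards [eventually_notMem_left B b', Ioo_mem_nhdsLT hxb'] with ζ hζ hζ2
      exact (hNr ζ hζ (hbx.trans hζ2.1) (hζ2.2.trans (hb'y.trans hys))).le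
    refine ⟨b, Vr, hbs, hgr, hS, hWl, fun ξ hξ hbξ hξs => ?_⟩
    refine tendsto_nhds_unique (tendsto_const_nhds.congr' ?_) hr
    filter_upwards [eventually_notMem_right B b, Ioo_mem_nhdsGT hbξ] with ζ h1 h2
    exact hcr ζ ξ h1 hξ h2.1 h2.2.le hξs
  · left
    have hj : ∀ b ∈ B, b < ξs → ∃ V, IsGas γ V ∧ Tendsto W (𝓝[<] b) (𝓝 V) ∧
        Tendsto W (𝓝[>] b) (𝓝 V) := by
      intro b hb hbs
      obtain ⟨Vl, Vr, hgl, hgr, hl, hr, hor⟩ := h.left_jump hγ hpos hb hbs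
      rcases hor with rfl | hS
      · exact ⟨_, hgl, hl, hr⟩
      · exact (hsh ⟨b, hb, hbs, Vl, Vr, hgl, hgr, hl, hr, hS⟩).elim
    intro ξ hξ hξs
    have hg := (h.left_smooth hγ hξ (hpos ξ hξ hξs)).1
    obtain ⟨x, hx, hxB, hW⟩ := exists_left_const UL hL B ξ
    have hWx := hW x le_rfl
    rw [← hWx]
    refine ⟨hg, ?_, ?_, ?_, ?_, fun hN => ?_⟩
    · refine eq_of_deriv_zero_of_jump (f := fun ζ => riemannInv γ i (W ζ)) hx.le hxB hξ
        (fun ζ hζ hζB => ?_) fun b hb _ h2 => ?_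
      · obtain ⟨-, ρ', ϑ', u', -, -, h3, h4, -⟩ :=
          h.left_smooth hγ hζB (hpos ζ hζB (hζ.2.trans_lt hξs))
        refine ((h3 i).add (h4.const_mul (2 / (γ - 1)))).congr_deriv ?_
        have : γ - 1 ≠ 0 := by linarith
        field_simp; ring
      · obtain ⟨V, hV, hl, hr⟩ := hj b hb (h2.trans hξs)
        exact ⟨_, (continuousAt_riemannInv hV.1.ne').tendsto.comp hl,
          (continuousAt_riemannInv hV.1.ne').tendsto.comp hr⟩
    · refine eq_of_deriv_zero_of_jump (f := fun ζ => spEntropy γ (W ζ).1 (temp γ (W ζ))) hx.le hxB hξ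
        (fun ζ hζ hζB => ?_) fun b hb _ h2 => ?_
      · have hJ := hpos ζ hζB (hζ.2.trans_lt hξs)
        exact h.hasDerivAt_spEntropy hγ hζB (h.left_smooth hγ hζB hJ).1 hJ.ne'
      · obtain ⟨V, hV, hl, hr⟩ := hj b hb (h2.trans hξs)
        exact ⟨_, (continuousAt_spEntropy hV).tendsto.comp hl,
          (continuousAt_spEntropy hV).tendsto.comp hr⟩
    · have := le_of_deriv_nonpos_of_jump (f := fun ζ => - vel (W ζ) i) hx.le hxB hξ
        (fun ζ hζ hζB => ?_) fun b hb _ h2 => ?_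
      · linarith
      · obtain ⟨-, ρ', ϑ', u', -, -, h3, -, h5, -⟩ :=
          h.left_smooth hγ hζB (hpos ζ hζB (hζ.2.trans_lt hξs))
        exact ⟨_, (h3 i).neg, by linarith⟩
      · obtain ⟨V, hV, hl, hr⟩ := hj b hb (h2.trans hξs)
        exact ⟨_, _, ((continuousAt_vel hV.1.ne' i).tendsto.comp hl).neg,
          ((continuousAt_vel hV.1.ne' i).tendsto.comp hr).neg, le_rfl⟩
    · refine le_of_deriv_nonpos_of_jump (f := fun ζ => (W ζ).1 * temp γ (W ζ)) hx.le hxB hξ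
        (fun ζ hζ hζB => ?_) fun b hb _ h2 => ?_
      · obtain ⟨-, ρ', ϑ', u', h1, h2, -, -, -, -, h7, -⟩ :=
          h.left_smooth hγ hζB (hpos ζ hζB (hζ.2.trans_lt hξs))
        exact ⟨_, h1.mul h2, h7⟩
      · obtain ⟨V, hV, hl, hr⟩ := hj b hb (h2.trans hξs)
        have hc : ContinuousAt (fun U : State d => U.1 * temp γ U) V :=
          continuousAt_fst.mul (IsGas.continuousAt_temp hV.1.ne')
        exact ⟨_, _, hc.tendsto.comp hl, hc.tendsto.comp hr, le_rfl⟩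
    · refine h.left_const hγ hpos hx.le hxB hξ hξs
        (fun ζ hζ hζB => (hN.trans_le (h.machGap_anti hγ hpos hζ.2 hζB hξ hξs)).ne')
        fun b hb _ hbξ Vl Vr hl hr hS => ?_
      obtain ⟨V, hV, hl', hr'⟩ := hj b hb (hbξ.trans hξs)
      have e1 := tendsto_nhds_unique hl hl'
      have e2 := tendsto_nhds_unique hr hr'
      rw [e1, e2] at hS
      exact lt_irrefl _ hS.1

/-! #### Reflection -/

end IsFan

@[simp] theorem reflect_fst (U : State d) : (reflect i U).1 = U.1 := rfl

theorem reflect_mom_same (U : State d) : (reflect i U).2.1 i = - U.2.1 i := by simp [reflect]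

theorem reflect_mom_ne (U : State d) {j : Fin d} (hj : j ≠ i) :
    (reflect i U).2.1 j = U.2.1 j := by simp [reflect, hj]

@[simp] theorem reflect_energy (U : State d) : (reflect i U).2.2 = U.2.2 := rfl

theorem reflect_mom_sq (U : State d) : ∑ j, (reflect i U).2.1 j ^ 2 = ∑ j, U.2.1 j ^ 2 :=
  Finset.sum_congr rfl fun j _ => by
    by_cases hj : j = i
    · rw [hj, reflect_mom_same]; ring
    · rw [reflect_mom_ne U hj]

@[simp] theorem pressure_reflect (U : State d) : pressure γ (reflect i U) = pressure γ U := by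
  rw [pressure, pressure, reflect_mom_sq]; rfl

@[simp] theorem temp_reflect (U : State d) : temp γ (reflect i U) = temp γ U := by
  rw [temp, temp, pressure_reflect]; rfl

@[simp] theorem entropy_reflect (U : State d) : entropy γ (reflect i U) = entropy γ U := by
  rw [entropy, entropy, pressure_reflect]; rfl

theorem entropyFlux_reflect (U : State d) :
    entropyFlux γ i (reflect i U) = - entropyFlux γ i U := by
  rw [entropyFlux, entropyFlux, entropy_reflect, reflect_mom_same, reflect_fst]; ring

theorem vel_reflect (U : State d) : vel (reflect i U) i = - vel U i := by
  rw [vel, vel, reflect_mom_same, reflect_fst]; ring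

theorem isGas_reflect {U : State d} : IsGas γ (reflect i U) ↔ IsGas γ U := by
  rw [IsGas, IsGas, pressure_reflect, reflect_fst]

theorem reflect_reflect (U : State d) : reflect i (reflect i U) = U := by
  refine Prod.ext rfl (Prod.ext ?_ rfl)
  funext j
  by_cases hj : j = i
  · rw [hj, reflect_mom_same, reflect_mom_same, neg_neg]
  · rw [reflect_mom_ne _ hj, reflect_mom_ne _ hj]

@[simp] theorem reflect_zero : reflect i (0 : State d) = 0 := by
  refine Prod.ext rfl (Prod.ext ?_ rfl)
  funext j
  by_cases hj : j = i
  · rw [hj, reflect_mom_same]; simp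
  · rw [reflect_mom_ne _ hj]

theorem admissible_reflect {U : State d} (h : Admissible γ U) : Admissible γ (reflect i U) := by
  rcases h.isGas_or with h | rfl
  · exact Or.inl (isGas_reflect.2 h)
  · exact Or.inr reflect_zero

/-- Reflection as a continuous linear map. -/
def reflectL (d : ℕ) (i : Fin d) : State d →L[ℝ] State d :=
  LinearMap.toContinuousLinearMap
    { toFun := reflect i
      map_add' := fun U V => by
        refine Prod.ext rfl (Prod.ext ?_ rfl)
        funext j
        change (reflect i (U + V)).2.1 j = (reflect i U).2.1 j + (reflect i V).2.1 j
        by_cases hj : j = i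
        · subst hj
          simp only [reflect_mom_same]
          simp only [Prod.snd_add, Prod.fst_add, Pi.add_apply]; ring
        · simp only [reflect_mom_ne _ hj]
          simp only [Prod.snd_add, Prod.fst_add, Pi.add_apply]
      map_smul' := fun c U => by
        refine Prod.ext rfl (Prod.ext ?_ rfl)
        funext j
        change (reflect i (c • U)).2.1 j = c * (reflect i U).2.1 j
        by_cases hj : j = i
        · subst hj
          simp only [reflect_mom_same]
          simp
        · simp only [reflect_mom_ne _ hj]
          simp }

theorem reflectL_apply (U : State d) : reflectL d i U = reflect i U := rfl

theorem flux_reflect (U : State d) : flux γ i (reflect i U) = - reflect i (flux γ i U) := by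
  refine Prod.ext ?_ (Prod.ext ?_ ?_)
  · change (reflect i U).2.1 i = - U.2.1 i
    exact reflect_mom_same U
  · funext j
    change (flux γ i (reflect i U)).2.1 j = - (reflect i (flux γ i U)).2.1 j
    by_cases hj : j = i
    · subst hj
      rw [reflect_mom_same]
      simp only [flux, reflect_mom_same, pressure_reflect, reflect_fst, if_true]
      ring
    · rw [reflect_mom_ne _ hj]
      simp only [flux, reflect_mom_same, reflect_mom_ne _ hj, pressure_reflect, reflect_fst,
        if_neg hj]
      ring
  · change (reflect i U).2.1 i / U.1 * (U.2.2 + pressure γ (reflect i U))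
      = - (U.2.1 i / U.1 * (U.2.2 + pressure γ U))
    rw [reflect_mom_same, pressure_reflect]; ring

theorem massFlux_reflect (U : State d) (ξ : ℝ) :
    massFlux i (reflect i U) (-ξ) = - massFlux i U ξ := by
  rw [massFlux, massFlux, reflect_mom_same, reflect_fst]; ring

theorem tendsto_neg_left (b : ℝ) : Tendsto (fun x : ℝ => -x) (𝓝[<] b) (𝓝[>] (-b)) :=
  tendsto_nhdsWithin_of_tendsto_nhds_of_eventually_within _
    ((continuous_neg.tendsto b).mono_left nhdsWithin_le_nhds)
    (by filter_upwards [self_mem_nhdsWithin] with x hx; simpa using hx)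

theorem tendsto_neg_right (b : ℝ) : Tendsto (fun x : ℝ => -x) (𝓝[>] b) (𝓝[<] (-b)) :=
  tendsto_nhdsWithin_of_tendsto_nhds_of_eventually_within _
    ((continuous_neg.tendsto b).mono_left nhdsWithin_le_nhds)
    (by filter_upwards [self_mem_nhdsWithin] with x hx; simpa using hx)

theorem HasTrace.reflect {W : ℝ → State d} {l l' : Filter ℝ} {V : State d}
    (h : HasTrace γ i W l V) (hl : Tendsto (fun x : ℝ => -x) l' l) :
    HasTrace γ i (fun ξ => reflect i (W (-ξ))) l' (GodunovEuler.reflect i V) := by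
  obtain ⟨h1, h2, h3, h4⟩ := h
  refine ⟨((reflectL d i).continuous.tendsto V).comp (h1.comp hl), ?_, ?_, ?_⟩
  · have := (((reflectL d i).continuous.tendsto _).comp (h2.comp hl)).neg
    simp only [flux_reflect]
    exact this
  · simp only [entropy_reflect]; exact h3.comp hl
  · simp only [entropyFlux_reflect]; exact (h4.comp hl).neg

/-- The mirror image of a self-similar solution. -/
theorem IsFan.reflect {W : ℝ → State d} {B : Finset ℝ} (h : IsFan γ i W B) :
    IsFan γ i (fun ξ => reflect i (W (-ξ))) (B.image fun b => -b) := by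
  have hmem : ∀ ξ, ξ ∈ B.image (fun b => -b) ↔ -ξ ∈ B := fun ξ => by
    simp only [Finset.mem_image]
    constructor
    · rintro ⟨b, hb, rfl⟩; simpa using hb
    · intro hb; exact ⟨_, hb, neg_neg ξ⟩
  refine ⟨fun ξ hξ => ?_, fun b hb => ?_⟩
  · rw [hmem] at hξ
    obtain ⟨ha, hs, hF⟩ := h.smooth (-ξ) hξ
    have hsn : ContDiffAt ℝ 1 (fun ξ => W (-ξ)) ξ :=
      ContDiffAt.comp ξ hs contDiff_neg.contDiffAt
    refine ⟨admissible_reflect ha, (reflectL d i).contDiff.contDiffAt.comp ξ hsn, ?_⟩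
    have hWd : HasDerivAt W (deriv W (-ξ)) (-ξ) := (hs.differentiableAt one_ne_zero).hasDerivAt
    have hn : HasDerivAt (fun x : ℝ => -x) (-1) ξ := (hasDerivAt_id ξ).neg
    have h1 : HasDerivAt (fun ξ => GodunovEuler.reflect i (W (-ξ)))
        (GodunovEuler.reflect i ((-1 : ℝ) • deriv W (-ξ))) ξ :=
      (reflectL d i).hasFDerivAt.comp_hasDerivAt ξ (hWd.scomp ξ hn)
    rw [h1.deriv]
    have h2 := ((reflectL d i).hasFDerivAt.comp_hasDerivAt ξ (hF.scomp ξ hn)).neg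
    have h3 : (fun ζ => flux γ i (GodunovEuler.reflect i (W (-ζ))))
        = - (⇑(reflectL d i) ∘ ((fun ζ => flux γ i (W ζ)) ∘ fun x => -x)) := by
      funext ζ
      simp only [flux_reflect, Pi.neg_apply, Function.comp, reflectL_apply]
    rw [h3]
    refine h2.congr_deriv ?_
    change - (reflectL d i) ((-1 : ℝ) • (-ξ) • deriv W (-ξ))
      = ξ • (reflectL d i) ((-1 : ℝ) • deriv W (-ξ))
    simp only [map_smul, smul_smul]
    rw [← neg_smul]; congr 1; ring
  · rw [hmem] at hb
    obtain ⟨Vl, Vr, hal, har, hl, hr, hRH, hS⟩ := h.jump _ hb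
    refine ⟨GodunovEuler.reflect i Vr, GodunovEuler.reflect i Vl, admissible_reflect har,
      admissible_reflect hal, hr.reflect (tendsto_neg_left b), hl.reflect (tendsto_neg_right b),
      ?_, ?_⟩
    · rw [flux_reflect, flux_reflect]
      have := congrArg (reflectL d i) hRH
      simp only [map_sub, map_smul, reflectL_apply] at this
      rw [neg_smul] at this
      rw [sub_neg_eq_add, neg_add_eq_sub, this, ← smul_neg, neg_sub]
    · rw [entropy_reflect, entropy_reflect, entropyFlux_reflect, entropyFlux_reflect]
      linarith

end Fan

section Fan

variable {d : ℕ} {γ : ℝ} {i : Fin d}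

/-- Relation between the left state and the state on the left of the contact. -/
def LeftRel (γ : ℝ) (i : Fin d) (UL V : State d) : Prop :=
  (riemannInv γ i V = riemannInv γ i UL ∧
    spEntropy γ V.1 (temp γ V) = spEntropy γ UL.1 (temp γ UL) ∧
    vel UL i ≤ vel V i ∧ V.1 * temp γ V ≤ UL.1 * temp γ UL) ∨ ∃ b, IsShock γ i b UL V

theorem LeftRel.vel_unique (hγ : 1 < γ) {UL V V' : State d} (hUL : IsGas γ UL) (hV : IsGas γ V)
    (hV' : IsGas γ V') (h : LeftRel γ i UL V) (h' : LeftRel γ i UL V')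
    (hp : V.1 * temp γ V = V'.1 * temp γ V') : vel V i = vel V' i := by
  have hg : 0 < γ - 1 := by linarith
  rcases h with ⟨h1, h2, h3, h4⟩ | ⟨b, h⟩ <;> rcases h' with ⟨h1', h2', h3', h4'⟩ | ⟨b', h'⟩
  · have hs : spEntropy γ V.1 (temp γ V) = spEntropy γ V'.1 (temp γ V') := h2.trans h2'.symm
    have hl := congrArg Real.log hp
    rw [Real.log_mul hV.1.ne' hV.temp_pos.ne', Real.log_mul hV'.1.ne' hV'.temp_pos.ne'] at hl
    simp only [spEntropy] at hs
    field_simp at hs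
    have h5 : γ * (Real.log V.1 - Real.log V'.1) = 0 := by linear_combination hl - hs
    have h6 : Real.log V.1 = Real.log V'.1 := by
      have := (mul_eq_zero.1 h5).resolve_left (by linarith); linarith
    have hρ : V.1 = V'.1 := Real.log_injOn_pos hV.1 hV'.1 h6
    have hθ : temp γ V = temp γ V' := by
      rw [hρ] at hp; exact mul_left_cancel₀ hV'.1.ne' hp
    have hR := h1.trans h1'.symm
    simp only [riemannInv, sound, hθ] at hR
    linarith
  · linarith [h'.2.1]
  · linarith [h.2.1]
  · obtain ⟨-, -, a3, -, -, a6, -, a8, a9, a10⟩ := h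
    obtain ⟨-, -, b3, -, -, b6, -, b8, b9, b10⟩ := h'
    have hpl := mul_pos hUL.1 hUL.temp_pos
    have hpr := mul_pos hV'.1 hV'.temp_pos
    rw [hp] at a9
    have hv : V.1⁻¹ = V'.1⁻¹ := by
      have e : (V'.1 * temp γ V' * (γ + 1) + UL.1 * temp γ UL * (γ - 1)) * (V.1⁻¹ - V'.1⁻¹) = 0 := by
        linear_combination a9 - b9
      have hne : V'.1 * temp γ V' * (γ + 1) + UL.1 * temp γ UL * (γ - 1) ≠ 0 := by positivity
      have := (mul_eq_zero.1 e).resolve_left hne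
      linarith
    have hJ1 : 0 < massFlux i UL b := by
      rw [massFlux_eq hUL.1.ne']; exact mul_pos hUL.1 (by linarith)
    have hJ2 : 0 < massFlux i UL b' := by
      rw [massFlux_eq hUL.1.ne']; exact mul_pos hUL.1 (by linarith)
    rw [hv] at a8
    have hJ : massFlux i UL b = massFlux i UL b' := by
      have hD : (γ + 1) * V'.1⁻¹ - (γ - 1) * UL.1⁻¹ ≠ 0 := by
        intro h0
        rw [h0, mul_zero] at a8
        have : 0 < 2 * γ * (UL.1 * temp γ UL) := by positivity
        linarith
      have := mul_right_cancel₀ hD (a8.trans b8.symm)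
      exact (pow_left_inj₀ hJ1.le hJ2.le two_ne_zero).1 this
    rw [hv, hJ] at a10
    linarith

theorem continuousAt_flux {U : State d} (h : U.1 ≠ 0) : ContinuousAt (flux γ i) U := by
  have hp := IsGas.continuousAt_pressure (γ := γ) h
  unfold flux
  refine ContinuousAt.prodMk (by fun_prop) (ContinuousAt.prodMk ?_ ?_)
  · refine continuousAt_pi.2 fun j => ?_
    split_ifs
    · exact ContinuousAt.add (by fun_prop (disch := assumption)) hp
    · fun_prop (disch := assumption)
  · exact ContinuousAt.mul (by fun_prop (disch := assumption)) (ContinuousAt.add (by fun_prop) hp)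

theorem continuousAt_entropy {U : State d} (h : IsGas γ U) : ContinuousAt (entropy γ) U := by
  have hp := IsGas.continuousAt_pressure (γ := γ) h.1.ne'
  unfold entropy
  have h1 : ContinuousAt (fun U : State d => U.1 ^ γ) U :=
    continuousAt_fst.rpow_const (Or.inl h.1.ne')
  have h2 := hp.div h1 (Real.rpow_pos_of_pos h.1 γ).ne'
  exact (continuousAt_const.mul continuousAt_fst).mul
    (h2.log (div_pos h.2 (Real.rpow_pos_of_pos h.1 γ)).ne')

theorem continuousAt_entropyFlux {U : State d} (h : IsGas γ U) :
    ContinuousAt (entropyFlux γ i) U :=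
  (continuousAt_entropy h).mul (continuousAt_vel h.1.ne' i)

theorem hasTrace_of_gas {W : ℝ → State d} {l : Filter ℝ} {V : State d} (h : IsGas γ V)
    (hW : Tendsto W l (𝓝 V)) : HasTrace γ i W l V :=
  ⟨hW, (continuousAt_flux h.1.ne').tendsto.comp hW, (continuousAt_entropy h).tendsto.comp hW,
    (continuousAt_entropyFlux h).tendsto.comp hW⟩

namespace IsFan

variable {W : ℝ → State d} {B : Finset ℝ} {ξs : ℝ} {UL UR : State d}

/-- One-sided traces exist everywhere. -/
theorem traces (hγ : 1 < γ) (h : IsFan γ i W B) (ξ : ℝ) : ∃ Vl Vr : State d, Admissible γ Vl ∧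
    Admissible γ Vr ∧ HasTrace γ i W (𝓝[<] ξ) Vl ∧ HasTrace γ i W (𝓝[>] ξ) Vr ∧
      flux γ i Vr - flux γ i Vl = ξ • (Vr - Vl) ∧
      ξ * (entropy γ Vr - entropy γ Vl) ≤ entropyFlux γ i Vr - entropyFlux γ i Vl := by
  by_cases hξ : ξ ∈ B
  · exact h.jump ξ hξ
  · obtain ⟨ha, hs, hF⟩ := h.smooth ξ hξ
    have hW := hs.continuousAt.tendsto
    rcases ha.isGas_or with hg | h0
    · exact ⟨W ξ, W ξ, ha, ha, hasTrace_of_gas hg (hW.mono_left nhdsWithin_le_nhds),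
        hasTrace_of_gas hg (hW.mono_left nhdsWithin_le_nhds), by simp, by simp⟩
    · exact ⟨0, 0, Or.inr rfl, Or.inr rfl, h.hasTrace_vacuum_left hγ hξ h0,
        h.hasTrace_vacuum_right hγ hξ h0, by simp, by simp⟩

/-- The rays of positive mass flux form a left half line. -/
theorem exists_contact (h : IsFan γ i W B) (hgl : 0 < UL.1) (hgr : 0 < UR.1)
    (hL : ∀ᶠ ξ in atBot, W ξ = UL) (hR : ∀ᶠ ξ in atTop, W ξ = UR) :
    ∃ ξs, (∀ ξ, ξ ∉ B → ξ < ξs → 0 < massFlux i (W ξ) ξ) ∧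
      ∀ ξ, ξ ∉ B → ξs < ξ → massFlux i (W ξ) ξ ≤ 0 := by
  set P : Set ℝ := {ξ | ξ ∉ B ∧ 0 < massFlux i (W ξ) ξ} with hP
  have hne : P.Nonempty := by
    obtain ⟨x, hx, hxB, hW⟩ := exists_left_const UL hL B (vel UL i)
    refine ⟨x, hxB, ?_⟩
    rw [hW x le_rfl, massFlux_eq hgl.ne']
    exact mul_pos hgl (by linarith)
  have hbd : BddAbove P := by
    obtain ⟨a, ha⟩ := eventually_atTop.1 hR
    obtain ⟨m, hm⟩ := B.finite_toSet.bddAbove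
    set y := max (max a (vel UR i)) m + 1 with hy
    have h1 : a ≤ y := by
      have := (le_max_left a (vel UR i)).trans (le_max_left _ m); linarith
    have h2 : vel UR i < y := by
      have := (le_max_right a (vel UR i)).trans (le_max_left _ m); linarith
    have hyB : y ∉ B := fun h' => by
      have := hm h'; have := le_max_right (max a (vel UR i)) m; linarith
    refine ⟨y, fun ξ hξ => ?_⟩
    by_contra hc
    push Not at hc
    have h3 := h.massFlux_anti hc.le hyB hξ.1
    rw [ha y h1, massFlux_eq hgr.ne'] at h3
    have := hξ.2
    nlinarith
  refine ⟨sSup P, fun ξ hξ hlt => ?_, fun ξ hξ hlt => ?_⟩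
  · obtain ⟨y, hy, hξy⟩ := exists_lt_of_lt_csSup hne hlt
    exact hy.2.trans_le (h.massFlux_anti hξy.le hξ hy.1)
  · by_contra hc
    push Not at hc
    exact absurd (le_csSup hbd ⟨hξ, hc⟩) (not_le.2 hlt)

theorem massFlux_contact (hpos : ∀ ξ, ξ ∉ B → ξ < ξs → 0 < massFlux i (W ξ) ξ)
    (hneg : ∀ ξ, ξ ∉ B → ξs < ξ → massFlux i (W ξ) ξ ≤ 0) {Vl Vr : State d}
    (hl : Tendsto W (𝓝[<] ξs) (𝓝 Vl)) (hr : Tendsto W (𝓝[>] ξs) (𝓝 Vr))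
    (hRH : flux γ i Vr - flux γ i Vl = ξs • (Vr - Vl)) :
    massFlux i Vl ξs = 0 ∧ massFlux i Vr ξs = 0 := by
  have h1 : 0 ≤ massFlux i Vl ξs := by
    refine ge_of_tendsto (tendsto_massFlux nhdsWithin_le_nhds hl) ?_
    filter_upwards [eventually_notMem_left B ξs, self_mem_nhdsWithin] with ζ a1 a2
    exact (hpos ζ a1 a2).le
  have h2 : massFlux i Vr ξs ≤ 0 := by
    refine le_of_tendsto (tendsto_massFlux nhdsWithin_le_nhds hr) ?_
    filter_upwards [eventually_notMem_right B ξs, self_mem_nhdsWithin] with ζ a1 a2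
    exact hneg ζ a1 a2
  have h3 := massFlux_jump hRH
  constructor <;> linarith

theorem leftRel_contact (hγ : 1 < γ) (h : IsFan γ i W B)
    (hpos : ∀ ξ, ξ ∉ B → ξ < ξs → 0 < massFlux i (W ξ) ξ) (hL : ∀ᶠ ξ in atBot, W ξ = UL)
    {V : State d} (hV : IsGas γ V) (hl : Tendsto W (𝓝[<] ξs) (𝓝 V)) : LeftRel γ i UL V := by
  have hB := eventually_notMem_left B ξs
  have hlt : ∀ᶠ ζ in 𝓝[<] ξs, ζ < ξs := self_mem_nhdsWithin
  rcases h.left_structure hγ hpos hL with hrar | ⟨b, V', hsh⟩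
  · left
    have hev := hB.and hlt
    refine ⟨?_, ?_, ?_, ?_⟩
    · refine tendsto_nhds_unique ((continuousAt_riemannInv hV.1.ne').tendsto.comp hl)
        (tendsto_const_nhds.congr' ?_)
      filter_upwards [hev] with ζ hζ using (hrar ζ hζ.1 hζ.2).2.1.symm
    · refine tendsto_nhds_unique ((continuousAt_spEntropy hV).tendsto.comp hl)
        (tendsto_const_nhds.congr' ?_)
      filter_upwards [hev] with ζ hζ using (hrar ζ hζ.1 hζ.2).2.2.1.symm
    · refine ge_of_tendsto ((continuousAt_vel hV.1.ne' i).tendsto.comp hl) ?_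
      filter_upwards [hev] with ζ hζ using (hrar ζ hζ.1 hζ.2).2.2.2.1
    · have hc : ContinuousAt (fun U : State d => U.1 * temp γ U) V :=
        continuousAt_fst.mul (IsGas.continuousAt_temp hV.1.ne')
      refine le_of_tendsto (hc.tendsto.comp hl) ?_
      filter_upwards [hev] with ζ hζ using (hrar ζ hζ.1 hζ.2).2.2.2.2.1
  · right
    refine ⟨b, ?_⟩
    have : V = V' := by
      refine tendsto_nhds_unique hl (tendsto_const_nhds.congr' ?_)
      filter_upwards [hB, Ioo_mem_nhdsLT hsh.1] with ζ h1 h2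
      exact (hsh.2.2.2.2 ζ h1 h2.1 h2.2).symm
    rw [this]; exact hsh.2.2.1

/-- Where the left waves end in the vacuum. -/
theorem riemannInv_eq_of_vacuum (hγ : 1 < γ) (h : IsFan γ i W B)
    (hpos : ∀ ξ, ξ ∉ B → ξ < ξs → 0 < massFlux i (W ξ) ξ) (hL : ∀ᶠ ξ in atBot, W ξ = UL)
    (hl : Tendsto W (𝓝[<] ξs) (𝓝 0)) :
    IsLeftRarefaction γ i W B ξs UL ∧ ξs = riemannInv γ i UL := by
  have hB := eventually_notMem_left B ξs
  have hlt : ∀ᶠ ζ in 𝓝[<] ξs, ζ < ξs := self_mem_nhdsWithin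
  have hgL := h.isGas_left hγ hpos hL
  have hρ : Tendsto (fun ζ => (W ζ).1) (𝓝[<] ξs) (𝓝 0) := (continuous_fst.tendsto _).comp hl
  rcases h.left_structure hγ hpos hL with hrar | ⟨b, V', hsh⟩
  · refine ⟨hrar, ?_⟩
    have hg : 0 < γ - 1 := by linarith
    have hev := hB.and hlt
    -- the temperature tends to zero
    set σ := spEntropy γ UL.1 (temp γ UL)
    have hθ : Tendsto (fun ζ => temp γ (W ζ)) (𝓝[<] ξs) (𝓝 0) := by
      have h1 : Tendsto (fun ζ => Real.exp ((γ - 1) * σ) * (W ζ).1 ^ (γ - 1)) (𝓝[<] ξs)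
          (𝓝 (Real.exp ((γ - 1) * σ) * 0 ^ (γ - 1))) :=
        (hρ.rpow_const (Or.inr hg.le)).const_mul _
      rw [Real.zero_rpow hg.ne', mul_zero] at h1
      refine h1.congr' ?_
      filter_upwards [hev] with ζ hζ
      obtain ⟨hgas, -, hs, -⟩ := hrar ζ hζ.1 hζ.2
      rw [show σ = _ from hs.symm, Real.rpow_def_of_pos hgas.1, ← Real.exp_add]
      have : (γ - 1) * spEntropy γ (W ζ).1 (temp γ (W ζ)) + Real.log (W ζ).1 * (γ - 1)
          = Real.log (temp γ (W ζ)) := by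
        rw [spEntropy]; field_simp; ring
      rw [this, Real.exp_log hgas.temp_pos]
    have hc : Tendsto (fun ζ => sound γ (W ζ)) (𝓝[<] ξs) (𝓝 0) := by
      have := (hθ.const_mul γ).sqrt
      simpa [sound] using this
    have hu : Tendsto (fun ζ => vel (W ζ) i) (𝓝[<] ξs) (𝓝 (riemannInv γ i UL)) := by
      have h1 := (tendsto_const_nhds (x := riemannInv γ i UL)).sub (hc.const_mul (2 / (γ - 1)))
      rw [mul_zero, sub_zero] at h1
      refine h1.congr' ?_
      filter_upwards [hev] with ζ hζ
      have := (hrar ζ hζ.1 hζ.2).2.1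
      simp only [riemannInv] at this ⊢
      linarith
    have hge : ξs ≤ riemannInv γ i UL := by
      refine le_of_tendsto_of_tendsto (tendsto_id.mono_left nhdsWithin_le_nhds) hu ?_
      filter_upwards [hev] with ζ hζ
      have hJ := hpos ζ hζ.1 hζ.2
      have hgas := (hrar ζ hζ.1 hζ.2).1
      rw [massFlux_eq hgas.1.ne'] at hJ
      have := (pos_iff_pos_of_mul_pos hJ).1 hgas.1
      simp only [id]; linarith
    refine le_antisymm hge ?_
    by_contra hcon
    push Not at hcon
    have hN : Tendsto (fun ζ => machGap γ i (W ζ) ζ) (𝓝[<] ξs)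
        (𝓝 (riemannInv γ i UL - ξs - 0)) :=
      (hu.sub (tendsto_id.mono_left nhdsWithin_le_nhds)).sub hc
    have hNpos : ∀ᶠ ζ in 𝓝[<] ξs, 0 < machGap γ i (W ζ) ζ :=
      hN.eventually (lt_mem_nhds (by linarith))
    have hconst : Tendsto (fun ζ => (W ζ).1) (𝓝[<] ξs) (𝓝 UL.1) := by
      refine tendsto_const_nhds.congr' ?_
      filter_upwards [hev, hNpos] with ζ hζ hN
      rw [(hrar ζ hζ.1 hζ.2).2.2.2.2.2 hN]
    have := tendsto_nhds_unique hρ hconst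
    linarith [hgL.1]
  · exfalso
    have : Tendsto (fun ζ => (W ζ).1) (𝓝[<] ξs) (𝓝 V'.1) := by
      refine tendsto_const_nhds.congr' ?_
      filter_upwards [hB, Ioo_mem_nhdsLT hsh.1] with ζ h1 h2
      rw [hsh.2.2.2.2 ζ h1 h2.1 h2.2]
    have := tendsto_nhds_unique hρ this
    linarith [hsh.2.1.1]

theorem reflect_boundary (hR : ∀ᶠ ξ in atTop, W ξ = UR) :
    ∀ᶠ ξ in atBot, GodunovEuler.reflect i (W (-ξ)) = GodunovEuler.reflect i UR := by
  filter_upwards [tendsto_neg_atBot_atTop.eventually hR] with ξ hξ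
  rw [hξ]

theorem notMem_image_neg {ξ : ℝ} : ξ ∉ B.image (fun b => -b) ↔ -ξ ∉ B := by
  simp only [Finset.mem_image, not_exists, not_and]
  constructor
  · intro h hc; exact h _ hc (neg_neg ξ)
  · rintro h b hb rfl; exact h (by simpa using hb)

/-- The mass flux is strictly negative to the right of a gas contact. -/
theorem massFlux_neg_of_gas (h : IsFan γ i W B)
    (hneg : ∀ ξ, ξ ∉ B → ξs < ξ → massFlux i (W ξ) ξ ≤ 0) {V : State d} (hV : 0 < V.1)
    (hr : Tendsto W (𝓝[>] ξs) (𝓝 V)) {ξ : ℝ} (hξ : ξ ∉ B) (hlt : ξs < ξ) :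
    massFlux i (W ξ) ξ < 0 := by
  refine lt_of_le_of_ne (hneg ξ hξ hlt) fun h0 => ?_
  have hρ : ∀ᶠ ζ in 𝓝[>] ξs, 0 < (W ζ).1 :=
    ((continuous_fst.tendsto V).comp hr).eventually (lt_mem_nhds hV)
  obtain ⟨ζ, ⟨hζ1, hζ2⟩, hζ3⟩ :=
    ((hρ.and (eventually_notMem_right B ξs)).and (Ioo_mem_nhdsGT hlt)).exists
  have : W ζ = 0 := by
    refine h.eq_zero_of_massFlux_const (c := 0) hζ2 ?_
    filter_upwards [eventually_notMem_nhds hζ2, Ioo_mem_nhds hζ3.1 hζ3.2] with z hz hz2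
    refine le_antisymm (hneg z hz hz2.1) ?_
    rw [← h0]
    exact h.massFlux_anti hz2.2.le hz hξ
  rw [this] at hζ1
  simp at hζ1

/-- The structure of the solution around the contact. -/
theorem contact (hγ : 1 < γ) (h : IsFan γ i W B) (hgl : IsGas γ UL) (hgr : IsGas γ UR)
    (hL : ∀ᶠ ξ in atBot, W ξ = UL) (hR : ∀ᶠ ξ in atTop, W ξ = UR) :
    ∃ ξs, (∀ ξ, ξ ∉ B → ξ < ξs → 0 < massFlux i (W ξ) ξ) ∧
      ((∃ Vl Vr, IsGas γ Vl ∧ IsGas γ Vr ∧ Tendsto W (𝓝[<] ξs) (𝓝 Vl) ∧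
          vel Vl i = ξs ∧ vel Vr i = ξs ∧ Vl.1 * temp γ Vl = Vr.1 * temp γ Vr ∧
          massFlux i Vl ξs = 0 ∧
          LeftRel γ i UL Vl ∧ LeftRel γ i (GodunovEuler.reflect i UR) (GodunovEuler.reflect i Vr)) ∨
       (Tendsto W (𝓝[<] ξs) (𝓝 0) ∧ ξs = riemannInv γ i UL ∧
          (∀ ξ, ξ ∉ B → ξs < ξ → massFlux i (W ξ) ξ ≤ 0) ∧
          ∃ ξt, ξs ≤ ξt ∧ -ξt = riemannInv γ i (GodunovEuler.reflect i UR) ∧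
            ∀ ξ, ξ ∉ B → ξ < ξt → 0 ≤ massFlux i (W ξ) ξ)) := by
  obtain ⟨ξs, hpos, hneg⟩ := h.exists_contact hgl.1 hgr.1 hL hR
  obtain ⟨Vl, Vr, hal, har, hl, hr, hRH, hS⟩ := h.traces hγ ξs
  obtain ⟨hJl, hJr⟩ := massFlux_contact hpos hneg hl.1 hr.1 hRH
  refine ⟨ξs, hpos, ?_⟩
  rcases hal.isGas_or with hVl | hVl
  · left
    have hVr := (isGas_iff_of_jump hal har hRH).1 hVl
    have hul : vel Vl i = ξs := by
      rw [massFlux_eq hVl.1.ne'] at hJl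
      have := (mul_eq_zero.1 hJl).resolve_left hVl.1.ne'; linarith
    have hur : vel Vr i = ξs := by
      rw [massFlux_eq hVr.1.ne'] at hJr
      have := (mul_eq_zero.1 hJr).resolve_left hVr.1.ne'; linarith
    obtain ⟨-, -, hm, -⟩ := jump_eqs hγ hVl hVr hRH hS
    rw [hJl, zero_mul] at hm
    refine ⟨Vl, Vr, hVl, hVr, hl.1, hul, hur, by linarith, hJl,
      h.leftRel_contact hγ hpos hL hVl hl.1, ?_⟩
    refine h.reflect.leftRel_contact (ξs := -ξs) hγ (fun ξ hξ hlt => ?_) (reflect_boundary hR)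
      (isGas_reflect.2 hVr) ?_
    · rw [notMem_image_neg] at hξ
      have h1 := h.massFlux_neg_of_gas hneg hVr.1 hr.1 hξ (by linarith)
      have h2 := massFlux_reflect (i := i) (W (-ξ)) (-ξ)
      rw [neg_neg] at h2
      rw [h2]; linarith
    · have h1 := tendsto_neg_left (-ξs)
      rw [neg_neg] at h1
      exact ((reflectL d i).continuous.tendsto Vr).comp (hr.1.comp h1)
  · right
    have hl0 : Tendsto W (𝓝[<] ξs) (𝓝 0) := hVl ▸ hl.1
    refine ⟨hl0, (h.riemannInv_eq_of_vacuum hγ hpos hL hl0).2, hneg, ?_⟩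
    have hR' := reflect_boundary (i := i) hR
    obtain ⟨ξr, hpos', hneg'⟩ := h.reflect.exists_contact (UL := GodunovEuler.reflect i UR)
      (UR := GodunovEuler.reflect i UL) hgr.1 hgl.1 hR' (by
        filter_upwards [tendsto_neg_atTop_atBot.eventually hL] with ξ hξ
        rw [hξ])
    obtain ⟨Vl', Vr', hal', har', hl', hr', hRH', hS'⟩ := h.reflect.traces hγ ξr
    have hneg2 : ∀ ξ, ξ ∉ B → -ξr < ξ → massFlux i (W ξ) ξ < 0 := fun ξ hξ hlt => by
      have h1 := hpos' (-ξ) (by rw [notMem_image_neg, neg_neg]; exact hξ) (by linarith)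
      rw [neg_neg, massFlux_reflect] at h1
      linarith
    have hpos2 : ∀ ξ, ξ ∉ B → ξ < -ξr → 0 ≤ massFlux i (W ξ) ξ := fun ξ hξ hlt => by
      have h1 := hneg' (-ξ) (by rw [notMem_image_neg, neg_neg]; exact hξ) (by linarith)
      rw [neg_neg, massFlux_reflect] at h1
      linarith
    have hle : ξs ≤ -ξr := by
      by_contra hc
      push Not at hc
      obtain ⟨ζ, hζB, hζ⟩ := ((eventually_notMem_right B (-ξr)).and (Ioo_mem_nhdsGT hc)).exists
      linarith [hpos ζ hζB hζ.2, hneg2 ζ hζB hζ.1]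
    have hVl' : Vl' = 0 := by
      rcases hal'.isGas_or with hg | h0
      · exfalso
        have hgr' := (isGas_iff_of_jump hal' har' hRH').1 hg
        have htr : Tendsto W (𝓝[<] (-ξr)) (𝓝 (GodunovEuler.reflect i Vr')) := by
          have h1 := tendsto_neg_left (-ξr)
          rw [neg_neg] at h1
          have h2 := ((reflectL d i).continuous.tendsto Vr').comp (hr'.1.comp h1)
          refine h2.congr fun ζ => ?_
          simp only [Function.comp, reflectL_apply, neg_neg, reflect_reflect]
        have hρ : ∀ᶠ ζ in 𝓝[<] (-ξr), 0 < (W ζ).1 :=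
          ((continuous_fst.tendsto _).comp htr).eventually (lt_mem_nhds hgr'.1)
        rcases hle.eq_or_lt with he | hlt
        · rw [← he] at htr
          have := tendsto_nhds_unique htr hl0
          have h3 := hgr'.1
          rw [← reflect_fst (i := i), this] at h3
          simp at h3
        · obtain ⟨ζ, ⟨hζ1, hζ2⟩, hζ3⟩ :=
            ((hρ.and (eventually_notMem_left B (-ξr))).and (Ioo_mem_nhdsLT hlt)).exists
          have : W ζ = 0 := by
            refine h.eq_zero_of_massFlux_const (c := 0) hζ2 ?_
            filter_upwards [eventually_notMem_nhds hζ2, Ioo_mem_nhds hζ3.1 hζ3.2] with z hz hz2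
            exact le_antisymm (hneg z hz hz2.1) (hpos2 z hz hz2.2)
          rw [this] at hζ1
          simp at hζ1
      · exact h0
    refine ⟨-ξr, hle, ?_, hpos2⟩
    rw [neg_neg]
    exact (h.reflect.riemannInv_eq_of_vacuum hγ hpos' hR' (hVl' ▸ hl'.1)).2

/-- At a wall the mass flux vanishes. -/
theorem wall_massFlux (hγ : 1 < γ) (h : IsFan γ i W B) (hgl : IsGas γ UL)
    (hL : ∀ᶠ ξ in atBot, W ξ = UL) (hR : ∀ᶠ ξ in atTop, W ξ = GodunovEuler.reflect i UL)
    {V : State d} (hV : Tendsto W (𝓝[<] 0) (𝓝 V)) : V.2.1 i = 0 := by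
  have hV0 : massFlux i V 0 = V.2.1 i := by simp [massFlux]
  rw [← hV0]
  obtain ⟨ξs, hpos, hc⟩ := h.contact hγ hgl (isGas_reflect.2 hgl) hL hR
  rw [reflect_reflect] at hc
  rcases hc with ⟨Vl, Vr, hgVl, hgVr, hl, hul, hur, hp, hJ, hr1, hr2⟩ | ⟨hl, hs, hneg, ξt, hst, ht, hpos'⟩
  · have := hr1.vel_unique hγ hgl hgVl (isGas_reflect.2 hgVr) hr2 (by simpa using hp)
    rw [vel_reflect, hul, hur] at this
    have h0 : ξs = 0 := by linarith
    rw [h0] at hl hJ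
    rw [tendsto_nhds_unique hV hl]; exact hJ
  · rw [← hs] at ht
    have hs0 : ξs ≤ 0 := by linarith
    rcases hs0.eq_or_lt with h0 | h0
    · rw [h0] at hl
      rw [tendsto_nhds_unique hV hl]; simp [massFlux]
    · have hlim := tendsto_massFlux (i := i) nhdsWithin_le_nhds hV
      apply le_antisymm
      · refine le_of_tendsto hlim ?_
        filter_upwards [eventually_notMem_left B 0, Ioo_mem_nhdsLT h0] with ζ h1 h2
        exact hneg ζ h1 h2.1
      · refine ge_of_tendsto hlim ?_
        filter_upwards [eventually_notMem_left B 0, Ioo_mem_nhdsLT h0] with ζ h1 h2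
        exact hpos' ζ h1 (by linarith [h2.2])

end IsFan

end Fan

/-! ### Compact sets of gas states -/

section Range

variable {d : ℕ} {γ k K : ℝ}

/-- Gas states with density and pressure bounded below and density and energy bounded above. -/
def rangeSet (d : ℕ) (γ k K : ℝ) : Set (State d) :=
  {U | k ≤ U.1 ∧ U.1 ≤ K ∧ k ≤ pressure γ U ∧ U.2.2 ≤ K}

theorem isGas_of_mem (hk : 0 < k) {U : State d} (h : U ∈ rangeSet d γ k K) : IsGas γ U :=
  ⟨hk.trans_le h.1, hk.trans_le h.2.2.1⟩

theorem rangeSet_mono {k' K' : ℝ} (hk : k' ≤ k) (hK : K ≤ K') :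
    rangeSet d γ k K ⊆ rangeSet d γ k' K' := fun _ h =>
  ⟨hk.trans h.1, h.2.1.trans hK, hk.trans h.2.2.1, h.2.2.2.trans hK⟩

theorem energy_pos (hγ : 1 < γ) {U : State d} (h : IsGas γ U) : 0 < U.2.2 := by
  have h1 := energy_eq hγ U h.1.ne'
  have h2 := h.1
  have h3 := h.temp_pos
  have h4 : 0 < 1 / (γ - 1) := one_div_pos.2 (by linarith)
  rw [h1]; positivity

theorem mom_sq_le (hγ : 1 < γ) {U : State d} (h : IsGas γ U) (j : Fin d) :
    U.2.1 j ^ 2 ≤ 2 * U.1 * U.2.2 := by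
  have h2 := h.2
  have h1 := h.1
  rw [pressure] at h2
  have h3 : 0 < U.2.2 - (∑ j, U.2.1 j ^ 2) / (2 * U.1) :=
    (pos_iff_pos_of_mul_pos h2).1 (by linarith)
  have h4 : U.2.1 j ^ 2 ≤ ∑ j, U.2.1 j ^ 2 :=
    Finset.single_le_sum (f := fun j => U.2.1 j ^ 2) (fun _ _ => sq_nonneg _) (Finset.mem_univ j)
  rw [sub_pos, div_lt_iff₀ (by positivity)] at h3
  linarith

theorem abs_mom_le (hγ : 1 < γ) (hk : 0 < k) {U : State d} (h : U ∈ rangeSet d γ k K)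
    (j : Fin d) : |U.2.1 j| ≤ 2 * K := by
  have hg := isGas_of_mem hk h
  have h1 := mom_sq_le hγ hg j
  have h2 := energy_pos hγ hg
  have h3 := hg.1
  apply abs_le_of_sq_le_sq _ (by linarith [h.2.2.2])
  nlinarith [h.2.1, h.2.2.2]

theorem isCompact_rangeSet (hγ : 1 < γ) (hk : 0 < k) : IsCompact (rangeSet d γ k K) := by
  rw [Metric.isCompact_iff_isClosed_bounded]
  constructor
  · have h1 : IsClosed {U : State d | k ≤ U.1} := isClosed_le continuous_const continuous_fst
    have h2 : ContinuousOn (pressure γ) {U : State d | k ≤ U.1} := fun U hU =>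
      (IsGas.continuousAt_pressure (hk.trans_le hU).ne').continuousWithinAt
    have h3 := h2.preimage_isClosed_of_isClosed h1 (isClosed_Ici (a := k))
    have h4 : IsClosed {U : State d | U.1 ≤ K} := isClosed_le continuous_fst continuous_const
    have h5 : IsClosed {U : State d | U.2.2 ≤ K} :=
      isClosed_le (continuous_snd.comp continuous_snd) continuous_const
    have : rangeSet d γ k K = ({U : State d | k ≤ U.1} ∩ pressure γ ⁻¹' Ici k)
        ∩ {U : State d | U.1 ≤ K} ∩ {U : State d | U.2.2 ≤ K} := by
      ext U; simp only [rangeSet, mem_ofPred_eq, mem_inter_iff, mem_preimage, mem_Ici]; tauto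
    rw [this]
    exact (h3.inter h4).inter h5
  · rw [isBounded_iff_forall_norm_le]
    refine ⟨2 * K, fun U hU => ?_⟩
    have hg := isGas_of_mem hk hU
    have hK : 0 < K := hg.1.trans_le hU.2.1
    have he := energy_pos hγ hg
    refine norm_prod_le_iff.2 ⟨?_, norm_prod_le_iff.2 ⟨?_, ?_⟩⟩
    · rw [Real.norm_eq_abs, abs_of_pos hg.1]; linarith [hU.2.1]
    · exact (pi_norm_le_iff_of_nonneg (by linarith)).2 fun j => abs_mom_le hγ hk hU j
    · rw [Real.norm_eq_abs, abs_of_pos he]; linarith [hU.2.2.2]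

/-- On compact sets, `C¹` functions are Lipschitz. -/
theorem exists_lipschitz_of_isCompact {E : Type*} [NormedAddCommGroup E] [NormedSpace ℝ E]
    {s : Set E} (hs : IsCompact s) {f : E → ℝ} (hf : ∀ x ∈ s, ContDiffAt ℝ 1 f x) :
    ∃ C : ℝ, 0 ≤ C ∧ ∀ x ∈ s, ∀ y ∈ s, |f x - f y| ≤ C * ‖x - y‖ := by
  have h1 : LocallyLipschitzOn s f := fun x hx => by
    obtain ⟨K, t, ht, hK⟩ := (hf x hx).exists_lipschitzOnWith
    exact ⟨K, t, mem_nhdsWithin_of_mem_nhds ht, hK⟩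
  obtain ⟨K, hK⟩ := h1.exists_lipschitzOnWith_of_compact hs
  exact ⟨K, K.2, fun x hx y hy => by
    simpa [Real.dist_eq, dist_eq_norm] using hK.dist_le_mul x hx y hy⟩

theorem contDiffAt_pressure {U : State d} (h : U.1 ≠ 0) : ContDiffAt ℝ 1 (pressure γ) U := by
  unfold pressure
  have h2 : 2 * U.1 ≠ 0 := by simpa using h
  fun_prop (disch := assumption)

theorem contDiffAt_temp {U : State d} (h : U.1 ≠ 0) : ContDiffAt ℝ 1 (temp γ) U :=
  (contDiffAt_pressure h).div contDiffAt_fst h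

theorem contDiffAt_vel {U : State d} (h : U.1 ≠ 0) (j : Fin d) :
    ContDiffAt ℝ 1 (fun V : State d => vel V j) U := by
  unfold vel
  fun_prop (disch := assumption)

theorem contDiffAt_spEntropy {U : State d} (h : IsGas γ U) :
    ContDiffAt ℝ 1 (fun V : State d => spEntropy γ V.1 (temp γ V)) U :=
  (((contDiffAt_temp h.1.ne').log h.temp_pos.ne').div_const _).sub
    (contDiffAt_fst.log h.1.ne')

theorem contDiffAt_chem {U : State d} (h : IsGas γ U) :
    ContDiffAt ℝ 1 (fun V : State d => chem γ V.1 (vel V) (temp γ V)) U := by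
  unfold chem
  refine ContDiffAt.add ?_ ((contDiffAt_temp h.1.ne').mul
    (contDiffAt_const.sub (contDiffAt_spEntropy h)))
  exact ((ContDiffAt.sum fun j _ => (contDiffAt_vel h.1.ne' j).pow 2).neg).div_const _

theorem contDiffAt_entropy {U : State d} (hγ : 1 < γ) (h : IsGas γ U) :
    ContDiffAt ℝ 1 (entropy γ) U := by
  have h1 : ContDiffAt ℝ 1 (fun V : State d => V.1 * spEntropy γ V.1 (temp γ V)) U :=
    contDiffAt_fst.mul (contDiffAt_spEntropy h)
  refine h1.congr_of_eventuallyEq ?_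
  filter_upwards [h.eventually] with V hV using entropy_eq hγ hV

theorem exists_lipschitz_rangeSet (hγ : 1 < γ) (hk : 0 < k) {f : State d → ℝ}
    (hf : ∀ U, IsGas γ U → ContDiffAt ℝ 1 f U) :
    ∃ C : ℝ, 0 ≤ C ∧ ∀ U ∈ rangeSet d γ k K, ∀ V ∈ rangeSet d γ k K,
      |f U - f V| ≤ C * ‖U - V‖ :=
  exists_lipschitz_of_isCompact (isCompact_rangeSet hγ hk) fun U hU => hf U (isGas_of_mem hk hU)

theorem exists_bound_rangeSet (hγ : 1 < γ) (hk : 0 < k) {f : State d → ℝ}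
    (hf : ∀ U, IsGas γ U → ContinuousAt f U) :
    ∃ C : ℝ, 0 ≤ C ∧ ∀ U ∈ rangeSet d γ k K, |f U| ≤ C := by
  obtain ⟨C, hC⟩ := (isCompact_rangeSet (K := K) hγ hk).exists_bound_of_continuousOn (f := f)
    fun U hU => (hf U (isGas_of_mem hk hU)).continuousWithinAt
  exact ⟨max C 0, le_max_right _ _, fun U hU => (hC U hU).trans (le_max_left _ _)⟩

theorem norm_le_stateNorm (U : State d) : ‖U‖ ≤ stateNorm U := by
  have h0 : 0 ≤ stateNorm U := Real.sqrt_nonneg _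
  have hs : 0 ≤ ∑ j, U.2.1 j ^ 2 := Finset.sum_nonneg fun _ _ => sq_nonneg _
  refine norm_prod_le_iff.2 ⟨?_, norm_prod_le_iff.2 ⟨?_, ?_⟩⟩
  · apply Real.abs_le_sqrt; nlinarith [sq_nonneg U.2.2]
  · refine (pi_norm_le_iff_of_nonneg h0).2 fun j => ?_
    apply Real.abs_le_sqrt
    have : U.2.1 j ^ 2 ≤ ∑ j, U.2.1 j ^ 2 :=
      Finset.single_le_sum (f := fun j => U.2.1 j ^ 2) (fun _ _ => sq_nonneg _) (Finset.mem_univ j)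
    nlinarith [sq_nonneg U.2.2, sq_nonneg U.1]
  · apply Real.abs_le_sqrt; nlinarith [sq_nonneg U.1]

theorem temp_bounds (hγ : 1 < γ) (hk : 0 < k) {U : State d} (h : U ∈ rangeSet d γ k K) :
    k / K ≤ temp γ U ∧ temp γ U ≤ (γ - 1) * K / k ∧ pressure γ U ≤ (γ - 1) * K := by
  have hg := isGas_of_mem hk h
  have hK : 0 < K := hg.1.trans_le h.2.1
  have hg1 : 0 < γ - 1 := by linarith
  have hp : pressure γ U ≤ (γ - 1) * K := by
    rw [pressure]
    have h1 : 0 ≤ (∑ j, U.2.1 j ^ 2) / (2 * U.1) :=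
      div_nonneg (Finset.sum_nonneg fun _ _ => sq_nonneg _) (by linarith [hg.1])
    gcongr
    linarith [h.2.2.2]
  refine ⟨?_, ?_, hp⟩
  · rw [temp]
    exact div_le_div₀ hg.2.le h.2.2.1 hg.1 h.2.1
  · rw [temp]
    exact div_le_div₀ (by positivity) hp hk h.1

theorem abs_vel_le (hγ : 1 < γ) (hk : 0 < k) {U : State d} (h : U ∈ rangeSet d γ k K)
    (j : Fin d) : |vel U j| ≤ 2 * K / k := by
  have hg := isGas_of_mem hk h
  rw [vel, abs_div, abs_of_pos hg.1]
  exact div_le_div₀ (by linarith [hg.1, h.2.1]) (abs_mom_le hγ hk h j) hk h.1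

/-- Quadratic upper bound of the relative energy. -/
theorem exists_relLin_le (hγ : 1 < γ) (hk : 0 < k) : ∃ C : ℝ, 0 ≤ C ∧
    ∀ U ∈ rangeSet d γ k K, ∀ V ∈ rangeSet d γ k K,
      relLin γ U V.1 (vel V) (temp γ V) ≤ C * ‖U - V‖ ^ 2 := by
  have hv : ∀ j : Fin d, ∃ C : ℝ, 0 ≤ C ∧ ∀ U ∈ rangeSet d γ k K, ∀ V ∈ rangeSet d γ k K,
      |vel U j - vel V j| ≤ C * ‖U - V‖ := fun j =>
    exists_lipschitz_rangeSet hγ hk fun U hU => contDiffAt_vel hU.1.ne' j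
  choose Cv hCv0 hCv using hv
  obtain ⟨Ct, hCt0, hCt⟩ : ∃ C : ℝ, 0 ≤ C ∧ ∀ U ∈ rangeSet d γ k K, ∀ V ∈ rangeSet d γ k K,
      |temp γ U - temp γ V| ≤ C * ‖U - V‖ :=
    exists_lipschitz_rangeSet hγ hk fun U hU => contDiffAt_temp hU.1.ne'
  have hg1 : 0 < γ - 1 := by linarith
  refine ⟨1 / 2 * |K| * ∑ j, Cv j ^ 2 + (1 / (γ - 1) * |K| * (Ct ^ 2 * (|K| / k))
    + ((γ - 1) * |K| / k) * (1 / k)), ?_, fun U hU V hV => ?_⟩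
  · have : 0 ≤ ∑ j, Cv j ^ 2 := Finset.sum_nonneg fun _ _ => sq_nonneg _
    positivity
  have hgU := isGas_of_mem hk hU
  have hgV := isGas_of_mem hk hV
  have hK : 0 < K := hgU.1.trans_le hU.2.1
  rw [abs_of_pos hK]
  rw [relLin_eq hγ hgU.admissible hgV.1 hgV.temp_pos, add_mul]
  set δ := ‖U - V‖
  have hδ : 0 ≤ δ := norm_nonneg _
  have h1 : ∑ j, (vel U j - vel V j) ^ 2 ≤ (∑ j, Cv j ^ 2) * δ ^ 2 := by
    rw [Finset.sum_mul]
    refine Finset.sum_le_sum fun j _ => ?_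
    rw [← mul_pow, ← sq_abs]
    exact pow_le_pow_left₀ (abs_nonneg _) (hCv j U hU V hV) 2
  have hs : 0 ≤ ∑ j, Cv j ^ 2 := Finset.sum_nonneg fun _ _ => sq_nonneg _
  refine add_le_add ?_ ((thermoRel_le hγ hgU.1 hgU.temp_pos hgV.1 hgV.temp_pos).trans ?_)
  · calc _ ≤ 1 / 2 * K * ((∑ j, Cv j ^ 2) * δ ^ 2) := by
          have := hU.2.1
          have := hgU.1
          gcongr
      _ = _ := by ring
  · rw [add_mul]
    have h2 : (temp γ U - temp γ V) ^ 2 ≤ Ct ^ 2 * δ ^ 2 := by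
      rw [← mul_pow, ← sq_abs]
      exact pow_le_pow_left₀ (abs_nonneg _) (hCt U hU V hV) 2
    have h3 : (U.1 - V.1) ^ 2 ≤ δ ^ 2 := by
      rw [← sq_abs]
      exact pow_le_pow_left₀ (abs_nonneg _) (norm_fst_le (U - V)) 2
    refine add_le_add ?_ ?_
    · calc _ ≤ 1 / (γ - 1) * K * (Ct ^ 2 * δ ^ 2 / (k / K)) := by
            have hq : (temp γ U - temp γ V) ^ 2 / temp γ U ≤ Ct ^ 2 * δ ^ 2 / (k / K) :=
              div_le_div₀ (by positivity) h2 (by positivity) (temp_bounds hγ hk hU).1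
            have hn : 0 ≤ (temp γ U - temp γ V) ^ 2 / temp γ U :=
              div_nonneg (sq_nonneg _) hgU.temp_pos.le
            have hc : 1 / (γ - 1) * U.1 ≤ 1 / (γ - 1) * K :=
              mul_le_mul_of_nonneg_left hU.2.1 (by positivity)
            exact mul_le_mul hc hq hn (by positivity)
        _ = _ := by field_simp
    · calc _ ≤ ((γ - 1) * K / k) * (δ ^ 2 / k) := by
            have hq : (U.1 - V.1) ^ 2 / V.1 ≤ δ ^ 2 / k :=
              div_le_div₀ (by positivity) h3 hk hV.1
            exact mul_le_mul (temp_bounds hγ hk hV).2.1 hq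
              (div_nonneg (sq_nonneg _) hgV.1.le) (by positivity)
        _ = _ := by ring

theorem abs_le_young {z a δ E : ℝ} (hδ : 0 < δ) (ha : 0 ≤ a)
    (hE : z ^ 2 ≤ E) : a * |z| ≤ a * (δ + E / δ) := by
  have h1 : |z| ≤ δ + z ^ 2 / δ := by
    rcases le_total |z| δ with h | h
    · have : 0 ≤ z ^ 2 / δ := by positivity
      linarith
    · have : |z| ≤ z ^ 2 / δ := by
        rw [le_div_iff₀ hδ, ← sq_abs]; nlinarith [abs_nonneg z]
      linarith
  have : z ^ 2 / δ ≤ E / δ := by gcongr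
  exact mul_le_mul_of_nonneg_left (by linarith) ha

set_option maxHeartbeats 1000000 in
/-- Linear control of a state by its relative energy with respect to a gas state, up to the
vacuum. -/
theorem exists_abs_sub_le (hγ : 1 < γ) (hk : 0 < k) (δ₀ : ℝ) : ∃ C : ℝ, 0 ≤ C ∧
    ∀ W : State d, Admissible γ W → ∀ V ∈ rangeSet d γ k K, ∀ δ, 0 < δ → δ ≤ δ₀ →
      |W.1 - V.1| ≤ C * (δ + relLin γ W V.1 (vel V) (temp γ V) / δ) ∧
      (∀ j, |W.2.1 j - V.2.1 j| ≤ C * (δ + relLin γ W V.1 (vel V) (temp γ V) / δ)) ∧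
      |W.2.2 - V.2.2| ≤ C * (δ + relLin γ W V.1 (vel V) (temp γ V) / δ) := by
  have hg1 : 0 < γ - 1 := by linarith
  -- Everything is a combination, with bounded coefficients, of `Z`, its square root and so on.
  set c1 := (|K| / k) with hc1
  set D := |δ₀| with hD
  set R := √|K| with hR
  set u0 := 2 * |K| / k with hu0
  set T := √((γ - 1) * |K| / k) with hT
  set θ0 := (γ - 1) * |K| / k with hθ0
  set a := c1 * D + 2 * R * (1 + c1) with ha
  have hc1n : 0 ≤ c1 := by positivity
  have hDn : 0 ≤ D := abs_nonneg _
  have hRn : 0 ≤ R := Real.sqrt_nonneg _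
  have hu0n : 0 ≤ u0 := by positivity
  have hTn : 0 ≤ T := Real.sqrt_nonneg _
  have hθ0n : 0 ≤ θ0 := by positivity
  have han : 0 ≤ a := by positivity
  set m := (2 + c1) * D + R * (1 + 2) with hm
  have hmn : 0 ≤ m := by positivity
  set q := (γ - 1 + c1) * D + R * (1 + (γ - 1)) with hq
  have hqn : 0 ≤ q := by rw [hq]; positivity
  set pC := (γ - 1) * D + 2 * T * q + a * θ0 with hp
  have hpn : 0 ≤ pC := by positivity
  set ke := D + d * (m * u0) + d * (a * u0 ^ 2) with hke
  have hken : 0 ≤ ke := by positivity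
  refine ⟨a + (m + a * u0) + (ke + 1 / (γ - 1) * pC), by positivity, fun W hW V hV δ hδ hδ₀ => ?_⟩
  have hgV := isGas_of_mem hk hV
  have hK : 0 < K := hgV.1.trans_le hV.2.1
  set E := relLin γ W V.1 (vel V) (temp γ V) with hEdef
  have hE0 : 0 ≤ E := relLin_nonneg hγ hW hgV.1 hgV.temp_pos _
  have hge := relLin_ge hγ hW hgV.1 hgV.temp_pos (vel V)
  rw [← hEdef] at hge
  obtain ⟨hW1, hW2⟩ := hW.nonneg
  have hδD : δ ≤ D := hδ₀.trans (le_abs_self _)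
  have hKa : |K| = K := abs_of_pos hK
  set X := δ + E / δ with hX
  have hX0 : 0 ≤ X := by positivity
  have hEX : E ≤ D * X := by
    have h1 : E = δ * (E / δ) := by field_simp
    have h2 : 0 ≤ E / δ := by positivity
    have h3 : E / δ ≤ X := by rw [hX]; linarith
    calc E = δ * (E / δ) := h1
      _ ≤ D * X := by gcongr
  have hS0 : 0 ≤ ∑ j, (vel W j - vel V j) ^ 2 := Finset.sum_nonneg fun _ _ => sq_nonneg _
  have hcg : 0 < 1 / (γ - 1) := by positivity
  set z := √W.1 - √V.1 with hz
  set t := √(temp γ W) - √(temp γ V) with ht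
  have t0 : 0 ≤ temp γ W := div_nonneg hW2 hW1
  -- the three quadratic quantities
  have hz2 : z ^ 2 ≤ c1 * E := by
    have h1 : temp γ V * z ^ 2 ≤ E := by
      have : 0 ≤ 1 / 2 * W.1 * ∑ j, (vel W j - vel V j) ^ 2 := by positivity
      have : 0 ≤ 1 / (γ - 1) * W.1 * t ^ 2 := by positivity
      linarith
    have h2 := (temp_bounds hγ hk hV).1
    have h3 : k / K * z ^ 2 ≤ E := (mul_le_mul_of_nonneg_right h2 (sq_nonneg z)).trans h1
    rw [hc1, hKa]
    calc z ^ 2 = K / k * (k / K * z ^ 2) := by field_simp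
      _ ≤ _ := by gcongr
  have hw2 : ∀ j, W.1 * (vel W j - vel V j) ^ 2 ≤ 2 * E := fun j => by
    have h1 : (vel W j - vel V j) ^ 2 ≤ ∑ j, (vel W j - vel V j) ^ 2 :=
      Finset.single_le_sum (f := fun j => (vel W j - vel V j) ^ 2) (fun _ _ => sq_nonneg _)
        (Finset.mem_univ j)
    have h2 : W.1 * (vel W j - vel V j) ^ 2 ≤ W.1 * ∑ j, (vel W j - vel V j) ^ 2 := by gcongr
    have : 0 ≤ temp γ V * z ^ 2 := mul_nonneg hgV.temp_pos.le (sq_nonneg _)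
    have : 0 ≤ 1 / (γ - 1) * W.1 * t ^ 2 := by positivity
    linarith
  have ht2 : W.1 * t ^ 2 ≤ (γ - 1) * E := by
    have : 0 ≤ temp γ V * z ^ 2 := mul_nonneg hgV.temp_pos.le (sq_nonneg _)
    have : 0 ≤ 1 / 2 * W.1 * ∑ j, (vel W j - vel V j) ^ 2 := by positivity
    have h1 : 1 / (γ - 1) * (W.1 * t ^ 2) ≤ E := by linarith
    calc W.1 * t ^ 2 = (γ - 1) * (1 / (γ - 1) * (W.1 * t ^ 2)) := by field_simp
      _ ≤ _ := by gcongr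
  have sW : √W.1 ^ 2 = W.1 := Real.sq_sqrt hW1
  have sV : √V.1 ^ 2 = V.1 := Real.sq_sqrt hgV.1.le
  have sVR : √V.1 ≤ R := by rw [hR, hKa]; exact Real.sqrt_le_sqrt hV.2.1
  have sV0 : 0 ≤ √V.1 := Real.sqrt_nonneg _
  have hyoung : ∀ y A : ℝ, 0 ≤ A → y ^ 2 ≤ A * E → |y| ≤ (1 + A) * X := by
    intro y A hA hy
    have h1 := abs_le_young (a := 1) hδ zero_le_one hy
    rw [one_mul, one_mul] at h1
    refine h1.trans ?_
    have h2 : A * E / δ = A * (E / δ) := by ring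
    have h3 : 0 ≤ E / δ := by positivity
    rw [h2, hX]
    have h4 : 0 ≤ A * δ := mul_nonneg hA hδ.le
    linarith
  have hzX := hyoung z c1 hc1n hz2
  have hρ : |W.1 - V.1| ≤ a * X := by
    have h1 : W.1 - V.1 = z ^ 2 + 2 * √V.1 * z := by
      rw [hz]; linear_combination sV - sW
    rw [h1]
    calc |z ^ 2 + 2 * √V.1 * z| ≤ |z ^ 2| + |2 * √V.1 * z| := abs_add_le _ _
      _ = z ^ 2 + 2 * √V.1 * |z| := by
          rw [abs_mul, abs_of_nonneg (sq_nonneg z), abs_of_nonneg (by positivity : 0 ≤ 2 * √V.1)]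
      _ ≤ c1 * (D * X) + 2 * R * ((1 + c1) * X) := by
          have : z ^ 2 ≤ c1 * (D * X) := hz2.trans (by gcongr)
          gcongr
      _ = a * X := by rw [ha]; ring
  -- products with the density
  have hprod : ∀ y A : ℝ, 0 ≤ A → W.1 * y ^ 2 ≤ A * E →
      W.1 * |y| ≤ ((A + c1) * D + R * (1 + A)) * X := by
    intro y A hA hy
    have h1 : (√W.1 * y) ^ 2 ≤ A * E := by rw [mul_pow, sW]; exact hy
    have h2 := hyoung _ A hA h1
    have h3 : W.1 * |y| = z * |√W.1 * y| + √V.1 * |√W.1 * y| := by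
      rw [abs_mul, abs_of_nonneg (Real.sqrt_nonneg W.1), hz]
      linear_combination (-|y|) * sW
    have h4 : z * |√W.1 * y| ≤ (A + c1) * (D * X) := by
      have e1 : z * |√W.1 * y| ≤ z ^ 2 + (√W.1 * y) ^ 2 := by
        rw [← sq_abs (√W.1 * y)]
        linarith [two_mul_le_add_sq z |√W.1 * y|, sq_nonneg z, sq_nonneg |√W.1 * y|]
      calc _ ≤ c1 * E + A * E := e1.trans (add_le_add hz2 h1)
        _ = (A + c1) * E := by ring
        _ ≤ _ := by gcongr
    rw [h3]
    calc _ ≤ (A + c1) * (D * X) + R * ((1 + A) * X) := by gcongr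
      _ = _ := by ring
  have hmom : ∀ j, W.1 * |vel W j - vel V j| ≤ m * X := fun j => by
    exact hprod _ 2 (by norm_num) (hw2 j)
  have hWm : ∀ j, W.2.1 j = W.1 * vel W j := fun j => by
    rcases hW.isGas_or with hg | rfl
    · exact mom_eq W hg.1.ne' j
    · simp
  have hWE : W.2.2 = 1 / 2 * W.1 * ∑ j, vel W j ^ 2 + 1 / (γ - 1) * (W.1 * temp γ W) := by
    rcases hW.isGas_or with hg | rfl
    · exact energy_eq hγ W hg.1.ne'
    · simp
  have hu : ∀ j, |vel V j| ≤ u0 := fun j => by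
    rw [hu0, hKa]; exact abs_vel_le hγ hk hV j
  refine ⟨hρ.trans ?_, fun j => ?_, ?_⟩
  · gcongr
    have : 0 ≤ (m + a * u0) + (ke + 1 / (γ - 1) * pC) := by positivity
    linarith
  · have h1 : W.2.1 j - V.2.1 j = W.1 * (vel W j - vel V j) + (W.1 - V.1) * vel V j := by
      rw [hWm j, mom_eq V hgV.1.ne' j]; ring
    rw [h1]
    calc _ ≤ |W.1 * (vel W j - vel V j)| + |(W.1 - V.1) * vel V j| := abs_add_le _ _
      _ = W.1 * |vel W j - vel V j| + |W.1 - V.1| * |vel V j| := by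
          rw [abs_mul, abs_mul, abs_of_nonneg hW1]
      _ ≤ m * X + a * X * u0 := by
          have := hmom j
          have := hu j
          gcongr
      _ = (m + a * u0) * X := by ring
      _ ≤ _ := by
          refine mul_le_mul_of_nonneg_right ?_ hX0
          have : 0 ≤ a + (ke + 1 / (γ - 1) * pC) := by positivity
          linarith
  · have hk1 : |1 / 2 * W.1 * ∑ j, vel W j ^ 2 - 1 / 2 * V.1 * ∑ j, vel V j ^ 2| ≤ ke * X := by
      have e1 : 1 / 2 * W.1 * ∑ j, vel W j ^ 2 - 1 / 2 * V.1 * ∑ j, vel V j ^ 2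
          = 1 / 2 * W.1 * ∑ j, (vel W j - vel V j) ^ 2
            + ∑ j, W.1 * (vel W j - vel V j) * vel V j
            + ∑ j, (W.1 - V.1) * (vel V j ^ 2 / 2) := by
        simp only [Finset.mul_sum, ← Finset.sum_add_distrib, ← Finset.sum_sub_distrib]
        exact Finset.sum_congr rfl fun j _ => by ring
      have e2 : |1 / 2 * W.1 * ∑ j, (vel W j - vel V j) ^ 2| ≤ D * X := by
        rw [abs_of_nonneg (by positivity)]
        have : 0 ≤ temp γ V * z ^ 2 := mul_nonneg hgV.temp_pos.le (sq_nonneg _)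
        have : 0 ≤ 1 / (γ - 1) * W.1 * t ^ 2 := by positivity
        linarith
      have e3 : |∑ j, W.1 * (vel W j - vel V j) * vel V j| ≤ d * (m * u0) * X := by
        refine (Finset.abs_sum_le_sum_abs _ _).trans ?_
        calc _ ≤ ∑ _j : Fin d, (m * X) * u0 := by
              refine Finset.sum_le_sum fun j _ => ?_
              rw [abs_mul, abs_mul, abs_of_nonneg hW1]
              have := hmom j
              have := hu j
              gcongr
          _ = _ := by simp; ring
      have e4 : |∑ j, (W.1 - V.1) * (vel V j ^ 2 / 2)| ≤ d * (a * u0 ^ 2) * X := by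
        refine (Finset.abs_sum_le_sum_abs _ _).trans ?_
        calc _ ≤ ∑ _j : Fin d, (a * X) * u0 ^ 2 := by
              refine Finset.sum_le_sum fun j _ => ?_
              rw [abs_mul, abs_of_nonneg (by positivity : 0 ≤ vel V j ^ 2 / 2)]
              have h5 : vel V j ^ 2 / 2 ≤ u0 ^ 2 := by
                have : vel V j ^ 2 ≤ u0 ^ 2 := by
                  rw [← sq_abs]; exact pow_le_pow_left₀ (abs_nonneg _) (hu j) 2
                linarith [sq_nonneg u0, sq_nonneg (vel V j)]
              gcongr
          _ = _ := by simp; ring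
      rw [e1]
      refine (abs_add_le _ _).trans ((add_le_add (abs_add_le _ _) le_rfl).trans ?_)
      rw [hke]; linarith
    have hp1 : |W.1 * temp γ W - V.1 * temp γ V| ≤ pC * X := by
      have st : √(temp γ W) ^ 2 = temp γ W := Real.sq_sqrt t0
      have sv : √(temp γ V) ^ 2 = temp γ V := Real.sq_sqrt hgV.temp_pos.le
      have svT : √(temp γ V) ≤ T := by
        rw [hT, hθ0, hKa]; exact Real.sqrt_le_sqrt (temp_bounds hγ hk hV).2.1
      have e1 : W.1 * temp γ W - V.1 * temp γ V
          = W.1 * t ^ 2 + 2 * √(temp γ V) * (W.1 * t) + (W.1 - V.1) * temp γ V := by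
        rw [ht]; linear_combination (-W.1) * st + W.1 * sv
      have e2 : W.1 * |t| ≤ q * X := by
        exact hprod t (γ - 1) hg1.le ht2
      have e3 : temp γ V ≤ θ0 := by rw [hθ0, hKa]; exact (temp_bounds hγ hk hV).2.1
      rw [e1]
      calc _ ≤ |W.1 * t ^ 2| + |2 * √(temp γ V) * (W.1 * t)| + |(W.1 - V.1) * temp γ V| :=
            (abs_add_le _ _).trans (add_le_add (abs_add_le _ _) le_rfl)
        _ = W.1 * t ^ 2 + 2 * √(temp γ V) * (W.1 * |t|) + |W.1 - V.1| * temp γ V := by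
            rw [abs_mul, abs_mul, abs_mul, abs_mul, abs_mul, abs_of_nonneg hW1,
              abs_of_nonneg (sq_nonneg t), abs_of_nonneg (Real.sqrt_nonneg _),
              abs_of_pos hgV.temp_pos, abs_of_pos (by norm_num : (0 : ℝ) < 2)]
        _ ≤ (γ - 1) * (D * X) + 2 * T * (q * X) + (a * X) * θ0 := by
            have e4 : W.1 * t ^ 2 ≤ (γ - 1) * (D * X) := ht2.trans (by gcongr)
            have := hgV.temp_pos.le
            gcongr
        _ = pC * X := by rw [hp]; ring
    have e5 : W.2.2 - V.2.2 = (1 / 2 * W.1 * ∑ j, vel W j ^ 2 - 1 / 2 * V.1 * ∑ j, vel V j ^ 2)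
        + 1 / (γ - 1) * (W.1 * temp γ W - V.1 * temp γ V) := by
      rw [hWE, energy_eq hγ V hgV.1.ne']; ring
    rw [e5]
    calc _ ≤ ke * X + 1 / (γ - 1) * (pC * X) := by
          refine (abs_add_le _ _).trans (add_le_add hk1 ?_)
          rw [abs_mul, abs_of_pos hcg]
          gcongr
      _ = (ke + 1 / (γ - 1) * pC) * X := by ring
      _ ≤ _ := by
          refine mul_le_mul_of_nonneg_right ?_ hX0
          have : 0 ≤ a + (m + a * u0) := by positivity
          linarith

end Range

/-! ### Monotone functionals of Riemann fans -/

section Fan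

variable {d : ℕ} {γ : ℝ} {i : Fin d}

/-- The linear part of the relative energy. -/
def lam (γ ρ' : ℝ) (u' : Fin d → ℝ) (ϑ' : ℝ) : State d →L[ℝ] ℝ :=
  (ContinuousLinearMap.snd ℝ (Fin d → ℝ) ℝ).comp (ContinuousLinearMap.snd ℝ ℝ ((Fin d → ℝ) × ℝ))
    - chem γ ρ' u' ϑ' • ContinuousLinearMap.fst ℝ ℝ ((Fin d → ℝ) × ℝ)
    - ∑ j, u' j • (ContinuousLinearMap.proj (R := ℝ) (φ := fun _ : Fin d => ℝ) j).comp
        ((ContinuousLinearMap.fst ℝ (Fin d → ℝ) ℝ).comp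
          (ContinuousLinearMap.snd ℝ ℝ ((Fin d → ℝ) × ℝ)))

theorem lam_apply (ρ' : ℝ) (u' : Fin d → ℝ) (ϑ' : ℝ) (U : State d) :
    lam γ ρ' u' ϑ' U = U.2.2 - chem γ ρ' u' ϑ' * U.1 - ∑ j, u' j * U.2.1 j := by
  simp [lam]

theorem relLin_eq_lam (U : State d) (ρ' : ℝ) (u' : Fin d → ℝ) (ϑ' : ℝ) :
    relLin γ U ρ' u' ϑ' = lam γ ρ' u' ϑ' U - ϑ' * entropy γ U + ρ' * ϑ' := by
  rw [lam_apply, relLin]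

theorem lam_flux {U : State d} (h : U.1 ≠ 0) (ρ' : ℝ)
    (u' : Fin d → ℝ) (ϑ' : ℝ) :
    lam γ ρ' u' ϑ' (flux γ i U) - ϑ' * entropyFlux γ i U
      = vel U i * relLin γ U ρ' u' ϑ' + (pressure γ U - ρ' * ϑ') * (vel U i - u' i)
        - ρ' * ϑ' * u' i := by
  rw [lam_apply]; exact flux_functional_eq i h ρ' u' ϑ'

/-- A combination of the self-similar balance laws. -/
def fanFun (γ : ℝ) (i : Fin d) (W : ℝ → State d) (ℓ : State d →L[ℝ] ℝ) (a c : ℝ) (ξ : ℝ) : ℝ :=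
  ℓ (flux γ i (W ξ)) - ξ * ℓ (W ξ) - a * (entropyFlux γ i (W ξ) - ξ * entropy γ (W ξ)) + c * ξ

namespace IsFan

variable {W : ℝ → State d} {B : Finset ℝ} {ξs : ℝ} {UL UR : State d}

theorem hasDerivAt_entropyFlux_sub (hγ : 1 < γ) (h : IsFan γ i W B) (hv : VacuumOpen γ W B)
    {ξ : ℝ} (hξ : ξ ∉ B) :
    HasDerivAt (fun ζ => entropyFlux γ i (W ζ) - ζ * entropy γ (W ζ)) (-entropy γ (W ξ)) ξ := by
  obtain ⟨-, hs, hF⟩ := h.smooth ξ hξ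
  rcases hv ξ hξ with hg | h0
  · obtain ⟨ρ', ϑ', u', h1, h2, h3, e1, e2, -⟩ := smooth_eqs hγ hs hg hF
    have h4 := ((h2.log hg.temp_pos.ne').div_const (γ - 1)).sub (h1.log hg.1.ne')
    have hg1 : γ - 1 ≠ 0 := by linarith
    have h5 : massFlux i (W ξ) ξ * (ϑ' / temp γ (W ξ) / (γ - 1) - ρ' / (W ξ).1) = 0 := by
      have a1 := hg.1.ne'
      have a2 := hg.temp_pos.ne'
      field_simp
      linear_combination (W ξ).1 * e2 - temp γ (W ξ) * (γ - 1) * e1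
    have h6 := (massFlux_hasDerivAt hs hF).mul h4
    have h7 : HasDerivAt (fun ζ => massFlux i (W ζ) ζ * spEntropy γ (W ζ).1 (temp γ (W ζ)))
        (-entropy γ (W ξ)) ξ := by
      refine h6.congr_deriv ?_
      rw [h5, entropy_eq hγ hg]; simp [spEntropy]
    refine h7.congr_of_eventuallyEq ?_
    filter_upwards [hs.continuousAt.eventually hg.eventually] with ζ hζ
      using entropyFlux_sub hγ hζ ζ
  · rw [h0.self_of_nhds, entropy_zero, neg_zero]
    refine (hasDerivAt_const ξ (0 : ℝ)).congr_of_eventuallyEq ?_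
    filter_upwards [h0] with ζ hζ
    simp [hζ]

theorem fanFun_anti (hγ : 1 < γ) (h : IsFan γ i W B) (hv : VacuumOpen γ W B)
    (ℓ : State d →L[ℝ] ℝ) {a c : ℝ} (ha : 0 ≤ a) {x y : ℝ} (hxy : x ≤ y) (hx : x ∉ B)
    (hy : y ∉ B) (hc : ∀ ξ ∈ Icc x y, ξ ∉ B → c ≤ ℓ (W ξ) - a * entropy γ (W ξ)) :
    fanFun γ i W ℓ a c y ≤ fanFun γ i W ℓ a c x := by
  refine le_of_deriv_nonpos_of_jump hxy hx hy (fun ξ hξI hξ => ?_) fun b hb _ _ => ?_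
  · obtain ⟨-, hs, hF⟩ := h.smooth ξ hξ
    have hW := (hs.differentiableAt (by norm_num)).hasDerivAt
    have h1 := (ℓ.hasFDerivAt.comp_hasDerivAt ξ hF)
    have h2 := (hasDerivAt_id ξ).mul (ℓ.hasFDerivAt.comp_hasDerivAt ξ hW)
    have h3 := ((h1.sub h2).sub ((h.hasDerivAt_entropyFlux_sub hγ hv hξ).const_mul a)).add
      ((hasDerivAt_id ξ).const_mul c)
    refine ⟨_, h3, ?_⟩
    have := hc ξ hξI hξ
    simp
    linarith
  · obtain ⟨Vl, Vr, -, -, hl, hr, hRH, hS⟩ := h.jump b hb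
    have key : ∀ {l : Filter ℝ} {V : State d}, l ≤ 𝓝 b → HasTrace γ i W l V →
        Tendsto (fanFun γ i W ℓ a c) l (𝓝 (ℓ (flux γ i V) - b * ℓ V
          - a * (entropyFlux γ i V - b * entropy γ V) + c * b)) := by
      intro l V hlb hV
      have hid : Tendsto (fun ζ : ℝ => ζ) l (𝓝 b) := tendsto_id.mono_left hlb
      exact (((((ℓ.continuous.tendsto _).comp hV.2.1).sub
        (hid.mul ((ℓ.continuous.tendsto _).comp hV.1))).sub
        ((hV.2.2.2.sub (hid.mul hV.2.2.1)).const_mul a))).add (hid.const_mul c)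
    refine ⟨_, _, key nhdsWithin_le_nhds hl, key nhdsWithin_le_nhds hr, ?_⟩
    have e1 := congrArg ℓ hRH
    rw [map_sub, map_smul, map_sub, smul_eq_mul] at e1
    have e2 : a * (b * (entropy γ Vr - entropy γ Vl))
        ≤ a * (entropyFlux γ i Vr - entropyFlux γ i Vl) := mul_le_mul_of_nonneg_left hS ha
    nlinarith

theorem exists_notMem_Ioo (B : Finset ℝ) {x y : ℝ} (hxy : x < y) : ∃ z ∈ Ioo x y, z ∉ B :=
  ((Ioo_infinite hxy).sdiff B.finite_toSet).nonempty.imp fun _ hz => ⟨hz.1, by simpa using hz.2⟩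

/-- Comparison of the interface with the left state. -/
theorem fan_left (hγ : 1 < γ) (h : IsFan γ i W B) (hv : VacuumOpen γ W B)
    (ℓ : State d →L[ℝ] ℝ) {a c A : ℝ} (ha : 0 ≤ a) (hA : 0 ≤ A)
    (hL : ∀ ξ, ξ ∉ B → ξ < -A → W ξ = UL)
    (hc : ∀ ξ, ξ ∉ B → ξ < 0 → c ≤ ℓ (W ξ) - a * entropy γ (W ξ))
    {V : State d} (hV : Tendsto W (𝓝[<] 0) (𝓝 V)) :
    ∃ x, 0 ≤ x ∧ x ≤ A + 1 ∧ ℓ (flux γ i V) - a * entropyFlux γ i V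
      ≤ ℓ (flux γ i UL) - a * entropyFlux γ i UL + x * (ℓ UL - a * entropy γ UL - c) := by
  obtain ⟨x, hx, hxB⟩ := exists_notMem_Ioo B (show -(A + 1) < -A by linarith)
  refine ⟨-x, by linarith [hx.2], by linarith [hx.1], ?_⟩
  obtain ⟨Vl, Vr, -, -, hl, -⟩ := h.traces hγ 0
  obtain rfl := tendsto_nhds_unique hl.1 hV
  have hid : Tendsto (fun ζ : ℝ => ζ) (𝓝[<] (0 : ℝ)) (𝓝 0) := nhdsWithin_le_nhds
  have hlim : Tendsto (fanFun γ i W ℓ a c) (𝓝[<] 0) (𝓝 (ℓ (flux γ i Vl) - 0 * ℓ Vl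
          - a * (entropyFlux γ i Vl - 0 * entropy γ Vl) + c * 0)) :=
    (((((ℓ.continuous.tendsto _).comp hl.2.1).sub
        (hid.mul ((ℓ.continuous.tendsto _).comp hl.1))).sub
        ((hl.2.2.2.sub (hid.mul hl.2.2.1)).const_mul a))).add (hid.const_mul c)
  have hle : ℓ (flux γ i Vl) - 0 * ℓ Vl - a * (entropyFlux γ i Vl - 0 * entropy γ Vl) + c * 0
      ≤ fanFun γ i W ℓ a c x := by
    refine le_of_tendsto hlim ?_
    have hx0 : x < 0 := by linarith [hx.2]
    filter_upwards [eventually_notMem_left B 0, Ioo_mem_nhdsLT hx0] with ζ h1 h2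
    exact h.fanFun_anti hγ hv ℓ ha h2.1.le hxB h1 fun ξ hξ hξB =>
      hc ξ hξB (hξ.2.trans_lt h2.2)
  rw [fanFun, hL x hxB hx.2] at hle
  linarith

/-- Comparison of the interface with the right state. -/
theorem fan_right (hγ : 1 < γ) (h : IsFan γ i W B) (hv : VacuumOpen γ W B)
    (ℓ : State d →L[ℝ] ℝ) {a c A : ℝ} (ha : 0 ≤ a) (hA : 0 ≤ A)
    (hR : ∀ ξ, ξ ∉ B → A < ξ → W ξ = UR)
    (hc : ∀ ξ, ξ ∉ B → 0 < ξ → c ≤ ℓ (W ξ) - a * entropy γ (W ξ))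
    {V : State d} (hV : Tendsto W (𝓝[<] 0) (𝓝 V)) :
    ∃ x, 0 ≤ x ∧ x ≤ A + 1 ∧ ℓ (flux γ i UR) - a * entropyFlux γ i UR
      ≤ ℓ (flux γ i V) - a * entropyFlux γ i V + x * (ℓ UR - a * entropy γ UR - c) := by
  obtain ⟨x, hx, hxB⟩ := exists_notMem_Ioo B (show A < A + 1 by linarith)
  refine ⟨x, by linarith [hx.1], by linarith [hx.2], ?_⟩
  obtain ⟨Vl, Vr, -, -, hl, hr, hRH, hS⟩ := h.traces hγ 0
  obtain rfl := tendsto_nhds_unique hl.1 hV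
  rw [zero_smul, sub_eq_zero] at hRH
  have hid : Tendsto (fun ζ : ℝ => ζ) (𝓝[>] (0 : ℝ)) (𝓝 0) := nhdsWithin_le_nhds
  have hlim : Tendsto (fanFun γ i W ℓ a c) (𝓝[>] 0) (𝓝 (ℓ (flux γ i Vr) - 0 * ℓ Vr
          - a * (entropyFlux γ i Vr - 0 * entropy γ Vr) + c * 0)) :=
    (((((ℓ.continuous.tendsto _).comp hr.2.1).sub
        (hid.mul ((ℓ.continuous.tendsto _).comp hr.1))).sub
        ((hr.2.2.2.sub (hid.mul hr.2.2.1)).const_mul a))).add (hid.const_mul c)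
  have hle : fanFun γ i W ℓ a c x
      ≤ ℓ (flux γ i Vr) - 0 * ℓ Vr - a * (entropyFlux γ i Vr - 0 * entropy γ Vr) + c * 0 := by
    refine ge_of_tendsto hlim ?_
    have hx0 : 0 < x := by linarith [hx.1]
    filter_upwards [eventually_notMem_right B 0, Ioo_mem_nhdsGT hx0] with ζ h1 h2
    exact h.fanFun_anti hγ hv ℓ ha h2.2.le h1 hxB fun ξ hξ hξB =>
      hc ξ hξB (h2.1.trans_le hξ.1)
  rw [fanFun, hR x hxB hx.1, hRH] at hle
  have e2 : a * entropyFlux γ i Vl ≤ a * entropyFlux γ i Vr :=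
    mul_le_mul_of_nonneg_left (by linarith) ha
  linarith

/-! ### Wave speeds -/

theorem left_speed (hγ : 1 < γ) (h : IsFan γ i W B) (hgl : IsGas γ UL) (hgr : IsGas γ UR)
    (hL : ∀ᶠ ξ in atBot, W ξ = UL) (hR : ∀ᶠ ξ in atTop, W ξ = UR) {k P u₀ T : ℝ} (hk : 0 < k)
    (hρ : k ≤ UL.1) (hpl : UL.1 * temp γ UL ≤ P) (hpr : UR.1 * temp γ UR ≤ P)
    (hul : |vel UL i| ≤ u₀) (hur : |vel UR i| ≤ u₀) (hT : temp γ UL ≤ T) {ξ : ℝ} (hξ : ξ ∉ B)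
    (hlt : ξ < -(u₀ + (γ * T + 1) + ((3 * γ + 1) * P / (2 * k) + (γ + 1) * u₀ + 1))) :
    W ξ = UL := by
  have hP : 0 ≤ P := (mul_pos hgl.1 hgl.temp_pos).le.trans hpl
  have hu0 : 0 ≤ u₀ := (abs_nonneg _).trans hul
  have hT0 : 0 ≤ T := hgl.temp_pos.le.trans hT
  have hγ0 : 0 < γ := by linarith
  have hc1 : 0 ≤ (3 * γ + 1) * P / (2 * k) := by positivity
  have hc2 : 0 ≤ (γ + 1) * u₀ := by positivity
  obtain ⟨hul1, hul2⟩ := abs_le.1 hul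
  obtain ⟨hur1, hur2⟩ := abs_le.1 hur
  obtain ⟨ξs, hpos, hc⟩ := h.contact hγ hgl hgr hL hR
  rcases h.left_structure hγ hpos hL with hrar | ⟨b, V, hbs, hgV, hsh, hb1, hb2⟩
  · have hs1 : sound γ UL ≤ γ * T + 1 := by
      have h1 := hgl.sound_sq hγ
      have h2 := hgl.sound_pos hγ
      have h3 : γ * temp γ UL ≤ γ * T := by gcongr
      nlinarith [sq_nonneg (sound γ UL - 1)]
    have hall : ∀ ζ, ζ ∉ B → ζ < ξs → ζ < vel UL i - sound γ UL → W ζ = UL := by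
      intro ζ hζ hζs hζc
      obtain ⟨-, hR1, -, hu, -, himp⟩ := hrar ζ hζ hζs
      apply himp
      simp only [riemannInv] at hR1
      have h2 : 2 / (γ - 1) * (sound γ (W ζ) - sound γ UL) ≤ 0 := by linarith
      have h3 : sound γ (W ζ) - sound γ UL ≤ 0 := by
        by_contra hcon
        have : 0 < 2 / (γ - 1) * (sound γ (W ζ) - sound γ UL) :=
          mul_pos (div_pos two_pos (by linarith)) (not_le.1 hcon)
        linarith
      rw [machGap]; linarith
    have hξs : vel UL i - sound γ UL ≤ ξs := by
      by_contra hcon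
      rw [not_le] at hcon
      have hWl : Tendsto W (𝓝[<] ξs) (𝓝 UL) := by
        refine tendsto_const_nhds.congr' ?_
        filter_upwards [eventually_notMem_left B ξs, self_mem_nhdsWithin] with ζ h1 h2
        exact (hall ζ h1 h2 (lt_trans h2 hcon)).symm
      have hJ : massFlux i UL ξs = 0 := by
        rcases hc with ⟨Vl, Vr, -, -, hl, -, -, -, hJ, -⟩ | ⟨hl, -⟩
        · rwa [tendsto_nhds_unique hWl hl]
        · rw [tendsto_nhds_unique hWl hl]; simp [massFlux]
      rw [massFlux_eq hgl.1.ne'] at hJ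
      have h1 := (mul_eq_zero.1 hJ).resolve_left hgl.1.ne'
      linarith [hgl.sound_pos hγ]
    exact hall ξ hξ (by linarith) (by linarith)
  · apply hb1 ξ hξ
    obtain ⟨Vl, Vr, hgVl, hgVr, hl, hVl, hVr, hp, -, -, hrel⟩ |
        ⟨hl, -⟩ := hc
    swap
    · exfalso
      have hWl : Tendsto W (𝓝[<] ξs) (𝓝 V) := by
        refine tendsto_const_nhds.congr' ?_
        filter_upwards [eventually_notMem_left B ξs, Ioo_mem_nhdsLT hbs] with ζ h1 h2
        exact (hb2 ζ h1 h2.1 h2.2).symm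
      have h0 := hgV.1
      rw [tendsto_nhds_unique hWl hl] at h0
      simp at h0
    have hWl : Tendsto W (𝓝[<] ξs) (𝓝 V) := by
      refine tendsto_const_nhds.congr' ?_
      filter_upwards [eventually_notMem_left B ξs, Ioo_mem_nhdsLT hbs] with ζ h1 h2
      exact (hb2 ζ h1 h2.1 h2.2).symm
    obtain rfl := tendsto_nhds_unique hWl hl
    obtain ⟨-, s2, s3, -, -, s6, -, s8, s9, s10⟩ := hsh
    rw [massFlux_eq hgl.1.ne'] at s8 s10
    set y := vel UL i - b with hy
    have hy0 : 0 < y := by linarith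
    set J := UL.1 * y with hJ
    have hJ0 : 0 < J := mul_pos hgl.1 hy0
    set pl := UL.1 * temp γ UL
    set pv := V.1 * temp γ V
    have hpl0 : 0 < pl := mul_pos hgl.1 hgl.temp_pos
    set D := (γ + 1) * V.1⁻¹ - (γ - 1) * UL.1⁻¹ with hD
    have hD0 : D ≠ 0 := by
      intro h0
      rw [h0, mul_zero] at s8
      have : 0 < 2 * γ * pl := by positivity
      linarith
    have e1 : pv - pl = J ^ 2 * (UL.1⁻¹ - V.1⁻¹) := by
      apply mul_right_cancel₀ hD0
      rw [hD] at s8 s9 ⊢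
      linear_combination s9 - (UL.1⁻¹ - V.1⁻¹) * s8
    have e2 : J * (vel UL i - vel V i) = pv - pl := by
      rw [s10, e1]; ring
    have e3 : 2 * (J * y) = 2 * γ * pl + (γ + 1) * (J * (vel UL i - vel V i)) := by
      have : J * UL.1⁻¹ = y := by rw [hJ]; field_simp [hgl.1.ne']
      rw [← s8, s10, hD]
      linear_combination (-2 * J) * this
    have e4 : J * (vel UL i - vel V i) ≤ P + J * (2 * u₀) := by
      have hJu : 0 ≤ J * (2 * u₀) := by positivity
      rcases hrel with ⟨-, -, -, h4⟩ | ⟨b', hs'⟩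
      · rw [temp_reflect, temp_reflect, reflect_fst, reflect_fst, ← hp] at h4
        rw [e2]; linarith
      · have h5 := hs'.2.2.1
        rw [vel_reflect, vel_reflect] at h5
        have h6 : vel UL i - vel V i ≤ 2 * u₀ := by linarith
        have h7 := mul_le_mul_of_nonneg_left h6 hJ0.le
        linarith
    have e5 : 2 * (J * y) ≤ (3 * γ + 1) * P + (γ + 1) * (2 * u₀) * J := by
      have h1 := mul_le_mul_of_nonneg_left e4 (by linarith : 0 ≤ γ + 1)
      have h2 : 2 * γ * pl ≤ 2 * γ * P := by gcongr
      rw [e3]; linarith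
    have e6 : y * y ≤ (3 * γ + 1) * P / (2 * k) + (γ + 1) * u₀ * y := by
      have h1 : 2 * k * (y * y - (γ + 1) * u₀ * y) ≤ (3 * γ + 1) * P := by
        rcases le_total (y * y - (γ + 1) * u₀ * y) 0 with h2 | h2
        · have : 2 * k * (y * y - (γ + 1) * u₀ * y) ≤ 0 :=
            mul_nonpos_of_nonneg_of_nonpos (by linarith) h2
          have : 0 ≤ (3 * γ + 1) * P := by positivity
          linarith
        · have h3 : 2 * k * (y * y - (γ + 1) * u₀ * y) ≤ 2 * UL.1 * (y * y - (γ + 1) * u₀ * y) := by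
            gcongr
          rw [hJ] at e5
          linarith
      have h2 : y * y - (γ + 1) * u₀ * y ≤ (3 * γ + 1) * P / (2 * k) := by
        rw [le_div_iff₀ (by positivity)]; linarith
      linarith
    have e7 : y ≤ (3 * γ + 1) * P / (2 * k) + (γ + 1) * u₀ + 1 := by
      by_contra hcon
      rw [not_le] at hcon
      have h1 : 1 ≤ y := by linarith
      have h2 := mul_lt_mul_of_pos_right hcon hy0
      have h3 : (3 * γ + 1) * P / (2 * k) ≤ (3 * γ + 1) * P / (2 * k) * y :=
        le_mul_of_one_le_right hc1 h1
      linarith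
    have : 0 ≤ γ * T := by positivity
    linarith

/-- Riemann solutions between states of a compact set have bounded wave speeds. -/
theorem exists_speed (hγ : 1 < γ) {k K : ℝ} (hk : 0 < k) : ∃ A : ℝ, 0 ≤ A ∧
    ∀ UL ∈ rangeSet d γ k K, ∀ UR ∈ rangeSet d γ k K, ∀ (i : Fin d) (W : ℝ → State d)
      (B : Finset ℝ), IsFan γ i W B → (∀ᶠ ξ in atBot, W ξ = UL) → (∀ᶠ ξ in atTop, W ξ = UR) →
      (∀ ξ, ξ ∉ B → ξ < -A → W ξ = UL) ∧ ∀ ξ, ξ ∉ B → A < ξ → W ξ = UR := by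
  have hγ0 : 0 < γ := by linarith
  have hg1 : 0 < γ - 1 := by linarith
  by_cases hK : 0 < K
  swap
  · exact ⟨0, le_rfl, fun UL hUL => absurd (hk.trans_le (hUL.1.trans hUL.2.1)) hK⟩
  have hpress : ∀ U ∈ rangeSet d γ k K, U.1 * temp γ U ≤ (γ - 1) * K := fun U hU => by
    have h1 := (temp_bounds hγ hk hU).2.2
    rwa [temp, mul_div_cancel₀ _ (isGas_of_mem hk hU).1.ne']
  refine ⟨2 * K / k + (γ * ((γ - 1) * K / k) + 1)
    + ((3 * γ + 1) * ((γ - 1) * K) / (2 * k) + (γ + 1) * (2 * K / k) + 1), by positivity,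
    fun UL hUL UR hUR i W B h hL hR => ⟨fun ξ hξ hlt => ?_, fun ξ hξ hlt => ?_⟩⟩
  · exact h.left_speed hγ (isGas_of_mem hk hUL) (isGas_of_mem hk hUR) hL hR hk hUL.1
      (hpress _ hUL) (hpress _ hUR) (abs_vel_le hγ hk hUL i) (abs_vel_le hγ hk hUR i)
      (temp_bounds hγ hk hUL).2.1 hξ hlt
  · have h1 := h.reflect.left_speed hγ (UL := GodunovEuler.reflect i UR)
      (UR := GodunovEuler.reflect i UL) (isGas_reflect.2 (isGas_of_mem hk hUR))
      (isGas_reflect.2 (isGas_of_mem hk hUL)) (reflect_boundary hR)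
      (by
        have := tendsto_neg_atTop_atBot.eventually hL
        filter_upwards [this] with ζ hζ
        rw [hζ]) hk (P := (γ - 1) * K) (u₀ := 2 * K / k) (T := (γ - 1) * K / k)
      (by rw [reflect_fst]; exact hUR.1) (by rw [reflect_fst, temp_reflect]; exact hpress _ hUR)
      (by rw [reflect_fst, temp_reflect]; exact hpress _ hUL)
      (by rw [vel_reflect, abs_neg]; exact abs_vel_le hγ hk hUR i)
      (by rw [vel_reflect, abs_neg]; exact abs_vel_le hγ hk hUL i)
      (by rw [temp_reflect]; exact (temp_bounds hγ hk hUR).2.1) (ξ := -ξ)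
      (notMem_image_neg.2 (by rwa [neg_neg])) (neg_lt_neg hlt)
    rw [neg_neg] at h1
    have h2 := congrArg (GodunovEuler.reflect i) h1
    rwa [reflect_reflect, reflect_reflect] at h2

/-! ### Minimum of the specific entropy -/

theorem spEntropy_ge_left (hγ : 1 < γ) (h : IsFan γ i W B) (hL : ∀ᶠ ξ in atBot, W ξ = UL)
    {ξ : ℝ} (hξ : ξ ∉ B) (hJ : 0 < massFlux i (W ξ) ξ) :
    spEntropy γ UL.1 (temp γ UL) ≤ spEntropy γ (W ξ).1 (temp γ (W ξ)) := by
  obtain ⟨x, hx, hxB, hW⟩ := exists_left_const UL hL B ξ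
  have hgas : ∀ U : State d, ∀ ζ, Admissible γ U → 0 < massFlux i U ζ → IsGas γ U := by
    intro U ζ hU hp
    rcases hU.isGas_or with hg | rfl
    · exact hg
    · simp [massFlux] at hp
  have hpos : ∀ ζ ≤ ξ, ζ ∉ B → 0 < massFlux i (W ζ) ζ := fun ζ hζ hζB =>
    hJ.trans_le (h.massFlux_anti hζ hζB hξ)
  have := le_of_deriv_nonpos_of_jump (f := fun ζ => -spEntropy γ (W ζ).1 (temp γ (W ζ)))
    hx.le hxB hξ (fun ζ hζ hζB => ?_) fun b hb hxb hbξ => ?_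
  · rw [hW x le_rfl] at this; linarith
  · exact ⟨_, (h.hasDerivAt_spEntropy hγ hζB (hgas _ ζ (h.smooth ζ hζB).1 (hpos ζ hζ.2 hζB))
      (hpos ζ hζ.2 hζB).ne').neg, by simp⟩
  · obtain ⟨Vl, Vr, hal, har, hl, hr, hRH, hS⟩ := h.jump b hb
    have hJl : 0 < massFlux i Vl b := by
      refine hJ.trans_le (ge_of_tendsto (tendsto_massFlux nhdsWithin_le_nhds hl.1) ?_)
      filter_upwards [eventually_notMem_left B b, self_mem_nhdsWithin] with ζ h1 h2
      exact h.massFlux_anti (le_trans (le_of_lt h2) hbξ.le) h1 hξ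
    have hgl := hgas _ b hal hJl
    have hgr := (isGas_iff_of_jump hal har hRH).1 hgl
    refine ⟨_, _, ((continuousAt_spEntropy hgl).tendsto.comp hl.1).neg,
      ((continuousAt_spEntropy hgr).tendsto.comp hr.1).neg, ?_⟩
    have h1 := (jump_eqs hγ hgl hgr hRH hS).2.2.2.2
    have h2 := nonneg_of_mul_nonneg_right h1 hJl
    linarith

theorem spEntropy_ge (hγ : 1 < γ) (h : IsFan γ i W B) (hL : ∀ᶠ ξ in atBot, W ξ = UL)
    (hR : ∀ᶠ ξ in atTop, W ξ = UR) {ξ : ℝ} (hξ : ξ ∉ B) (hg : IsGas γ (W ξ)) :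
    min (spEntropy γ UL.1 (temp γ UL)) (spEntropy γ UR.1 (temp γ UR))
      ≤ spEntropy γ (W ξ).1 (temp γ (W ξ)) := by
  rcases lt_trichotomy (massFlux i (W ξ) ξ) 0 with hJ | hJ | hJ
  · refine (min_le_right _ _).trans ?_
    have := h.reflect.spEntropy_ge_left hγ (reflect_boundary hR) (ξ := -ξ)
      (notMem_image_neg.2 (by rwa [neg_neg]))
      (by rw [neg_neg, massFlux_reflect]; linarith)
    rwa [neg_neg, reflect_fst, temp_reflect, reflect_fst, temp_reflect] at this
  · refine (min_le_left _ _).trans ?_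
    obtain ⟨-, hs, -⟩ := h.smooth ξ hξ
    obtain ⟨a, ha, haI⟩ := exists_Ioc_subset_of_mem_nhds
      ((hs.continuousAt.eventually hg.eventually).and (eventually_notMem_nhds hξ))
      ⟨ξ - 1, by linarith⟩
    refine ge_of_tendsto (((continuousAt_spEntropy hg).tendsto.comp hs.continuousAt.tendsto).mono_left
      (nhdsWithin_le_nhds (s := Iio ξ))) ?_
    filter_upwards [Ioo_mem_nhdsLT ha] with ζ hζ
    refine h.spEntropy_ge_left hγ hL (haI ⟨hζ.1, hζ.2.le⟩).2 ?_
    have h0 := h.massFlux_anti hζ.2.le (haI ⟨hζ.1, hζ.2.le⟩).2 hξ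
    rw [hJ] at h0
    refine h0.lt_of_ne fun hz => ?_
    have hmI : (ζ + ξ) / 2 ∈ Ioc a ξ := ⟨by linarith [hζ.1, hζ.2], by linarith [hζ.2]⟩
    have hm := h.eq_zero_of_massFlux_const (c := 0) (haI hmI).2 (by
      filter_upwards [Ioo_mem_nhds (show ζ < (ζ + ξ) / 2 by linarith [hζ.2])
        (show (ζ + ξ) / 2 < ξ by linarith [hζ.2])] with z hz'
      have hzB := (haI ⟨hζ.1.trans hz'.1, hz'.2.le⟩).2
      have h1 := h.massFlux_anti hz'.1.le (haI ⟨hζ.1, hζ.2.le⟩).2 hzB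
      have h2 := h.massFlux_anti hz'.2.le hzB hξ
      linarith)
    have := (haI hmI).1.1
    rw [hm] at this
    simp at this
  · exact (min_le_left _ _).trans (h.spEntropy_ge_left hγ hL hξ hJ)

end IsFan

end Fan

/-! ### Estimates of the interface flux -/

section Interface

variable {d : ℕ} {γ : ℝ} {i : Fin d}

theorem IsInterfaceState.exists_fan (hγ : 1 < γ) {UL UR V : State d}
    (h : IsInterfaceState γ i UL UR V) : ∃ (W : ℝ → State d) (B : Finset ℝ),
      IsFan γ i W B ∧ VacuumOpen γ W B ∧ (∀ᶠ ξ in atBot, W ξ = UL) ∧ (∀ᶠ ξ in atTop, W ξ = UR) ∧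
      Tendsto W (𝓝[<] 0) (𝓝 V) := by
  obtain ⟨W, ⟨hL, hR, B, hs, hj⟩, hV⟩ := h
  obtain ⟨B', h1, h2⟩ := IsFan.exists_vacuumOpen hγ (⟨hs, hj⟩ : IsFan γ i W B)
  exact ⟨W, B', h1, h2, hL, hR, hV⟩

theorem exists_left_bound {W : ℝ → State d} {UL : State d} (hL : ∀ᶠ ξ in atBot, W ξ = UL) :
    ∃ A : ℝ, 0 ≤ A ∧ ∀ ξ, ξ < -A → W ξ = UL := by
  obtain ⟨a, ha⟩ := eventually_atBot.1 hL
  exact ⟨max (-a) 0, le_max_right _ _, fun ξ hξ => ha ξ (by linarith [le_max_left (-a) 0])⟩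

theorem exists_right_bound {W : ℝ → State d} {UR : State d} (hR : ∀ᶠ ξ in atTop, W ξ = UR) :
    ∃ A : ℝ, 0 ≤ A ∧ ∀ ξ, A < ξ → W ξ = UR := by
  obtain ⟨a, ha⟩ := eventually_atTop.1 hR
  exact ⟨max a 0, le_max_right _ _, fun ξ hξ => ha ξ (by linarith [le_max_left a 0])⟩

theorem IsInterfaceState.entropy_left (hγ : 1 < γ) {UL UR V : State d} (hgl : IsGas γ UL)
    (h : IsInterfaceState γ i UL UR V) :
    lam γ UL.1 (vel UL) (temp γ UL) (flux γ i V - flux γ i UL)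
      ≤ temp γ UL * (entropyFlux γ i V - entropyFlux γ i UL) := by
  obtain ⟨W, B, hf, hv, hL, -, hV⟩ := h.exists_fan hγ
  obtain ⟨A, hA, hLA⟩ := exists_left_bound hL
  obtain ⟨x, -, -, hx⟩ := hf.fan_left hγ hv (lam γ UL.1 (vel UL) (temp γ UL))
    (c := -(UL.1 * temp γ UL)) hgl.temp_pos.le hA (fun ξ _ hξ => hLA ξ hξ)
    (fun ξ hξ _ => by
      have := relLin_nonneg hγ (hf.smooth ξ hξ).1 hgl.1 hgl.temp_pos (vel UL)
      rw [relLin_eq_lam] at this; linarith) hV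
  have h0 := relLin_self hγ hgl
  rw [relLin_eq_lam] at h0
  rw [sub_neg_eq_add, h0, mul_zero] at hx
  rw [map_sub]; linarith

theorem IsInterfaceState.entropy_right (hγ : 1 < γ) {UL UR V : State d} (hgr : IsGas γ UR)
    (h : IsInterfaceState γ i UL UR V) :
    temp γ UR * (entropyFlux γ i V - entropyFlux γ i UR)
      ≤ lam γ UR.1 (vel UR) (temp γ UR) (flux γ i V - flux γ i UR) := by
  obtain ⟨W, B, hf, hv, -, hR, hV⟩ := h.exists_fan hγ
  obtain ⟨A, hA, hRA⟩ := exists_right_bound hR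
  obtain ⟨x, -, -, hx⟩ := hf.fan_right hγ hv (lam γ UR.1 (vel UR) (temp γ UR))
    (c := -(UR.1 * temp γ UR)) hgr.temp_pos.le hA (fun ξ _ hξ => hRA ξ hξ)
    (fun ξ hξ _ => by
      have := relLin_nonneg hγ (hf.smooth ξ hξ).1 hgr.1 hgr.temp_pos (vel UR)
      rw [relLin_eq_lam] at this; linarith) hV
  have h0 := relLin_self hγ hgr
  rw [relLin_eq_lam] at h0
  rw [sub_neg_eq_add, h0, mul_zero] at hx
  rw [map_sub]; linarith

/-- The density coordinate. -/
def densityL (d : ℕ) : State d →L[ℝ] ℝ := ContinuousLinearMap.fst ℝ ℝ ((Fin d → ℝ) × ℝ)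

@[simp] theorem densityL_apply (U : State d) : densityL d U = U.1 := rfl

theorem IsFan.lam_sub_nonneg (hγ : 1 < γ) {W : ℝ → State d} {B : Finset ℝ} {UL UR U : State d}
    (hf : IsFan γ i W B) (hL : ∀ᶠ ξ in atBot, W ξ = UL) (hR : ∀ᶠ ξ in atTop, W ξ = UR)
    (hg : IsGas γ U) (h1 : spEntropy γ U.1 (temp γ U) ≤ spEntropy γ UL.1 (temp γ UL))
    (h2 : spEntropy γ U.1 (temp γ U) ≤ spEntropy γ UR.1 (temp γ UR)) {ξ : ℝ} (hξ : ξ ∉ B) :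
    -(U.1 * temp γ U) ≤ (lam γ U.1 (vel U) (temp γ U)
      - (temp γ U * spEntropy γ U.1 (temp γ U)) • densityL d) (W ξ) - 0 * entropy γ (W ξ) := by
  have ha := (hf.smooth ξ hξ).1
  have h3 := relLin_nonneg hγ ha hg.1 hg.temp_pos (vel U)
  rw [relLin_eq_lam] at h3
  have h4 : spEntropy γ U.1 (temp γ U) * (W ξ).1 ≤ entropy γ (W ξ) := by
    rcases ha.isGas_or with hW | hW
    · rw [entropy_eq hγ hW, mul_comm]
      exact mul_le_mul_of_nonneg_left ((le_min h1 h2).trans (hf.spEntropy_ge hγ hL hR hξ hW)) hW.1.le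
    · simp [hW]
  have h5 := mul_le_mul_of_nonneg_left h4 hg.temp_pos.le
  simp
  linarith

theorem lam_sub_self (hγ : 1 < γ) {U : State d} (hg : IsGas γ U) :
    (lam γ U.1 (vel U) (temp γ U)
      - (temp γ U * spEntropy γ U.1 (temp γ U)) • densityL d) U = -(U.1 * temp γ U) := by
  have h0 := relLin_self hγ hg
  rw [relLin_eq_lam, entropy_eq hγ hg] at h0
  simp
  linarith

/-- Minimum principle of the specific entropy at an interface. -/
theorem IsInterfaceState.spEntropy_left (hγ : 1 < γ) {UL UR V : State d} (hgl : IsGas γ UL)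
    (h : IsInterfaceState γ i UL UR V)
    (hs : spEntropy γ UL.1 (temp γ UL) ≤ spEntropy γ UR.1 (temp γ UR)) :
    (lam γ UL.1 (vel UL) (temp γ UL) - (temp γ UL * spEntropy γ UL.1 (temp γ UL)) • densityL d)
      (flux γ i V - flux γ i UL) ≤ 0 := by
  obtain ⟨W, B, hf, hv, hL, hR, hV⟩ := h.exists_fan hγ
  obtain ⟨A, hA, hLA⟩ := exists_left_bound hL
  obtain ⟨x, -, -, hx⟩ := hf.fan_left hγ hv (lam γ UL.1 (vel UL) (temp γ UL)
      - (temp γ UL * spEntropy γ UL.1 (temp γ UL)) • densityL d) (a := 0)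
    (c := -(UL.1 * temp γ UL)) le_rfl hA (fun ξ _ hξ => hLA ξ hξ)
    (fun ξ hξ _ => hf.lam_sub_nonneg hγ hL hR hgl le_rfl hs hξ) hV
  rw [lam_sub_self hγ hgl] at hx
  rw [map_sub]; linarith

theorem IsInterfaceState.spEntropy_right (hγ : 1 < γ) {UL UR V : State d} (hgr : IsGas γ UR)
    (h : IsInterfaceState γ i UL UR V)
    (hs : spEntropy γ UR.1 (temp γ UR) ≤ spEntropy γ UL.1 (temp γ UL)) :
    0 ≤ (lam γ UR.1 (vel UR) (temp γ UR) - (temp γ UR * spEntropy γ UR.1 (temp γ UR)) • densityL d)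
      (flux γ i V - flux γ i UR) := by
  obtain ⟨W, B, hf, hv, hL, hR, hV⟩ := h.exists_fan hγ
  obtain ⟨A, hA, hRA⟩ := exists_right_bound hR
  obtain ⟨x, -, -, hx⟩ := hf.fan_right hγ hv (lam γ UR.1 (vel UR) (temp γ UR)
      - (temp γ UR * spEntropy γ UR.1 (temp γ UR)) • densityL d) (a := 0)
    (c := -(UR.1 * temp γ UR)) le_rfl hA (fun ξ _ hξ => hRA ξ hξ)
    (fun ξ hξ _ => hf.lam_sub_nonneg hγ hL hR hgr hs le_rfl hξ) hV
  rw [lam_sub_self hγ hgr] at hx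
  rw [map_sub]; linarith

/-- Bound of one component of the interface flux. -/
theorem IsFan.abs_flux_sub_le (hγ : 1 < γ) {W : ℝ → State d} {B : Finset ℝ} {UL UR V : State d}
    (hf : IsFan γ i W B) (hv : VacuumOpen γ W B) (hgl : IsGas γ UL) {A : ℝ} (hA : 0 ≤ A)
    (hL : ∀ ξ, ξ ∉ B → ξ < -A → W ξ = UL) (hR : ∀ ξ, ξ ∉ B → A < ξ → W ξ = UR)
    (hgr : IsGas γ UR)
    (hV : Tendsto W (𝓝[<] 0) (𝓝 V)) (e : State d →L[ℝ] ℝ) {C δ D : ℝ} (hC : 0 ≤ C) (hδ : 0 < δ)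
    (he : ∀ U : State d, Admissible γ U →
      |e U - e UL| ≤ C * (δ + relLin γ U UL.1 (vel UL) (temp γ UL) / δ))
    (hD : (A + 1) * relLin γ UR UL.1 (vel UL) (temp γ UL)
      + (lam γ UL.1 (vel UL) (temp γ UL) (flux γ i UL) - temp γ UL * entropyFlux γ i UL)
      - (lam γ UL.1 (vel UL) (temp γ UL) (flux γ i UR) - temp γ UL * entropyFlux γ i UR)
        ≤ D * δ ^ 2) :
    |e (flux γ i V) - e (flux γ i UL)| ≤ C * (D + A + 1) * δ := by
  set ℓ := lam γ UL.1 (vel UL) (temp γ UL) with hℓ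
  have hself := relLin_self hγ hgl
  rw [relLin_eq_lam, ← hℓ] at hself
  obtain ⟨x, hx0, hx1, hx⟩ := hf.fan_right hγ hv ℓ
    (c := -(UL.1 * temp γ UL)) hgl.temp_pos.le hA hR
    (fun ξ hξ _ => by
      have := relLin_nonneg hγ (hf.smooth ξ hξ).1 hgl.1 hgl.temp_pos (vel UL)
      rw [relLin_eq_lam] at this; linarith) hV
  have hrel0 := relLin_nonneg hγ hgr.admissible hgl.1 hgl.temp_pos (vel UL)
  have hdiss : (ℓ (flux γ i UL) - temp γ UL * entropyFlux γ i UL)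
      - (ℓ (flux γ i V) - temp γ UL * entropyFlux γ i V) ≤ D * δ ^ 2 := by
    have h1 := mul_le_mul_of_nonneg_right hx1 hrel0
    rw [relLin_eq_lam, ← hℓ] at h1 hD
    rw [sub_neg_eq_add] at hx
    linarith
  have key : ∀ s : ℝ, |s| = 1 → s * (e (flux γ i V) - e (flux γ i UL)) ≤ C * (D + A + 1) * δ := by
    intro s hs
    obtain ⟨y, hy0, hy1, hy⟩ := hf.fan_left hγ hv ((C / δ) • ℓ + s • e)
      (a := C / δ * temp γ UL) (c := -(C / δ * (UL.1 * temp γ UL)) + s * e UL - C * δ)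
      (mul_nonneg (by positivity) hgl.temp_pos.le) hA hL
      (fun ξ hξ _ => by
        have h1 := he (W ξ) (hf.smooth ξ hξ).1
        have h2 : s * (e UL - e (W ξ)) ≤ |e (W ξ) - e UL| := by
          calc _ ≤ |s * (e UL - e (W ξ))| := le_abs_self _
            _ = _ := by rw [abs_mul, hs, one_mul, abs_sub_comm]
        have h3 : C * (relLin γ (W ξ) UL.1 (vel UL) (temp γ UL) / δ)
            = C / δ * (ℓ (W ξ) - temp γ UL * entropy γ (W ξ) + UL.1 * temp γ UL) := by
          rw [relLin_eq_lam]; ring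
        simp
        linarith) hV
    have h4 : ((C / δ) • ℓ + s • e) UL - C / δ * temp γ UL * entropy γ UL
        - (-(C / δ * (UL.1 * temp γ UL)) + s * e UL - C * δ) = C * δ := by
      simp
      linear_combination (C / δ) * hself
    rw [h4] at hy
    simp at hy
    have h5 : y * (C * δ) ≤ (A + 1) * (C * δ) := by gcongr
    have h6 : C / δ * ((ℓ (flux γ i UL) - temp γ UL * entropyFlux γ i UL)
      - (ℓ (flux γ i V) - temp γ UL * entropyFlux γ i V)) ≤ C / δ * (D * δ ^ 2) := by gcongr
    have h7 : C / δ * (D * δ ^ 2) = C * D * δ := by field_simp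
    linarith
  rw [abs_le]
  have h1 := key 1 (by simp)
  have h2 := key (-1) (by simp)
  constructor <;> linarith

theorem contDiffAt_flux {U : State d} (h : U.1 ≠ 0) : ContDiffAt ℝ 1 (flux γ i) U := by
  unfold flux
  have hp := contDiffAt_pressure (γ := γ) h
  refine ContDiffAt.prodMk (by fun_prop) (ContDiffAt.prodMk (contDiffAt_pi.2 fun j => ?_) ?_)
  · refine ContDiffAt.add (by fun_prop (disch := assumption)) ?_
    split_ifs
    · exact hp
    · exact contDiffAt_const
  · refine ContDiffAt.mul (by fun_prop (disch := assumption)) (ContDiffAt.add (by fun_prop) hp)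

theorem contDiffAt_entropyFlux (hγ : 1 < γ) {U : State d} (h : IsGas γ U) :
    ContDiffAt ℝ 1 (entropyFlux γ i) U :=
  (contDiffAt_entropy hγ h).mul (contDiffAt_vel h.1.ne' i)

theorem reflect_mem_rangeSet {k K : ℝ} {U : State d} (h : U ∈ rangeSet d γ k K) :
    reflect i U ∈ rangeSet d γ k K := by
  obtain ⟨h1, h2, h3, h4⟩ := h
  exact ⟨by rwa [reflect_fst], by rwa [reflect_fst], by rwa [pressure_reflect], h4⟩

theorem exists_norm_le (hγ : 1 < γ) {k K : ℝ} (hk : 0 < k) :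
    ∃ R : ℝ, 0 ≤ R ∧ ∀ U ∈ rangeSet d γ k K, ‖U‖ ≤ R := by
  obtain ⟨R, hR⟩ := (isCompact_rangeSet (d := d) (K := K) hγ hk).isBounded.exists_norm_le
  exact ⟨max R 0, le_max_right _ _, fun U hU => (hR U hU).trans (le_max_left _ _)⟩

theorem exists_lipschitz_rangeSet_all {ι : Type*} [Fintype ι] (hγ : 1 < γ) {k K : ℝ} (hk : 0 < k)
    {f : ι → State d → ℝ} (hf : ∀ i U, IsGas γ U → ContDiffAt ℝ 1 (f i) U) :
    ∃ C : ℝ, 0 ≤ C ∧ ∀ i, ∀ U ∈ rangeSet d γ k K, ∀ V ∈ rangeSet d γ k K,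
      |f i U - f i V| ≤ C * ‖U - V‖ := by
  choose C hC0 hC using fun i => exists_lipschitz_rangeSet (K := K) hγ hk (hf i)
  refine ⟨∑ i, C i, Finset.sum_nonneg fun i _ => hC0 i, fun i U hU V hV => (hC i U hU V hV).trans ?_⟩
  gcongr
  exact Finset.single_le_sum (f := C) (fun i _ => hC0 i) (Finset.mem_univ i)

theorem abs_lam_le (hγ : 1 < γ) {k K : ℝ} (hk : 0 < k) : ∃ C : ℝ, 0 ≤ C ∧
    ∀ U ∈ rangeSet d γ k K, ∀ X : State d, |lam γ U.1 (vel U) (temp γ U) X| ≤ C * ‖X‖ := by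
  obtain ⟨Cc, hCc0, hCc⟩ := exists_bound_rangeSet (d := d) (K := K) hγ hk
    (f := fun V : State d => chem γ V.1 (vel V) (temp γ V)) fun U hU =>
      (contDiffAt_chem hU).continuousAt
  refine ⟨1 + Cc + ∑ _j : Fin d, |2 * K / k|, by positivity, fun U hU X => ?_⟩
  have h1 : |X.1| ≤ ‖X‖ := norm_fst_le X
  have h2 : |X.2.2| ≤ ‖X‖ := (norm_snd_le X.2).trans (norm_snd_le X)
  have h3 : ∀ j, |X.2.1 j| ≤ ‖X‖ := fun j =>
    (norm_le_pi_norm X.2.1 j).trans ((norm_fst_le X.2).trans (norm_snd_le X))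
  rw [lam_apply]
  refine (abs_sub _ _).trans ?_
  rw [add_mul, Finset.sum_mul]
  refine add_le_add ((abs_sub _ _).trans ?_) ((Finset.abs_sum_le_sum_abs _ _).trans
    (Finset.sum_le_sum fun j _ => ?_))
  · rw [add_mul, one_mul, abs_mul]
    have := hCc U hU
    gcongr
  · rw [abs_mul]
    have := (abs_vel_le hγ hk hU j).trans (le_abs_self _)
    have := h3 j
    gcongr

theorem norm_state_le {X : State d} {a : ℝ} (ha : 0 ≤ a) (h1 : |X.1| ≤ a)
    (h2 : ∀ j, |X.2.1 j| ≤ a) (h3 : |X.2.2| ≤ a) : ‖X‖ ≤ a :=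
  norm_prod_le_iff.2 ⟨h1, norm_prod_le_iff.2 ⟨(pi_norm_le_iff_of_nonneg ha).2 h2, h3⟩⟩

theorem exists_flux_sub_le_of_pos (hγ : 1 < γ) {k K : ℝ} (hk : 0 < k) (δ₀ : ℝ) : ∃ C : ℝ, 0 ≤ C ∧
    ∀ UL ∈ rangeSet d γ k K, ∀ UR ∈ rangeSet d γ k K, ∀ (i : Fin d) (V : State d),
      IsInterfaceState γ i UL UR V → ∀ δ, 0 < δ → δ ≤ δ₀ → ‖UR - UL‖ ≤ δ →
        ‖flux γ i V - flux γ i UL‖ ≤ C * δ := by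
  obtain ⟨A, hA, hspeed⟩ := IsFan.exists_speed (d := d) (K := K) hγ hk
  obtain ⟨C1, hC1, hrel⟩ := exists_relLin_le (d := d) (K := K) hγ hk
  obtain ⟨C2, hC2, hdev⟩ := exists_abs_sub_le (d := d) (K := K) hγ hk δ₀
  obtain ⟨Lp, hLp, hp⟩ := exists_lipschitz_rangeSet (d := d) (K := K) hγ hk (f := pressure γ)
    fun U hU => contDiffAt_pressure hU.1.ne'
  obtain ⟨Lv, hLv, hv'⟩ := exists_lipschitz_rangeSet_all (d := d) (K := K) hγ hk
    (f := fun (i : Fin d) U => vel U i) fun i U hU => contDiffAt_vel hU.1.ne' i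
  set D := (A + 1) * C1 + |2 * K / k| * C1 + Lp * Lv with hD
  have hD0 : 0 ≤ D := by positivity
  refine ⟨C2 * (D + A + 1), by positivity, fun UL hUL UR hUR i V h δ hδ hδ₀ hle => ?_⟩
  have hgl := isGas_of_mem hk hUL
  have hgr := isGas_of_mem hk hUR
  obtain ⟨W, B, hf, hv, hL, hR, hV⟩ := h.exists_fan hγ
  obtain ⟨hLA, hRA⟩ := hspeed UL hUL UR hUR i W B hf hL hR
  have hrelR : relLin γ UR UL.1 (vel UL) (temp γ UL) ≤ C1 * δ ^ 2 :=
    (hrel UR hUR UL hUL).trans (by gcongr)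
  have hrel0 := relLin_nonneg hγ hgr.admissible hgl.1 hgl.temp_pos (vel UL)
  have hdiss : (A + 1) * relLin γ UR UL.1 (vel UL) (temp γ UL)
      + (lam γ UL.1 (vel UL) (temp γ UL) (flux γ i UL) - temp γ UL * entropyFlux γ i UL)
      - (lam γ UL.1 (vel UL) (temp γ UL) (flux γ i UR) - temp γ UL * entropyFlux γ i UR)
        ≤ D * δ ^ 2 := by
    rw [lam_flux hgl.1.ne', lam_flux hgr.1.ne', relLin_self hγ hgl]
    have e1 : -(vel UR i * relLin γ UR UL.1 (vel UL) (temp γ UL)) ≤ |2 * K / k| * (C1 * δ ^ 2) := by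
      refine (neg_le_abs _).trans ?_
      rw [abs_mul, abs_of_nonneg hrel0]
      have := (abs_vel_le hγ hk hUR i).trans (le_abs_self _)
      gcongr
    have hpl : UL.1 * temp γ UL = pressure γ UL := by rw [temp, mul_div_cancel₀ _ hgl.1.ne']
    have e2 : -((pressure γ UR - UL.1 * temp γ UL) * (vel UR i - vel UL i)) ≤ Lp * Lv * δ ^ 2 := by
      refine (neg_le_abs _).trans ?_
      rw [abs_mul, hpl]
      have h1 := (hp UR hUR UL hUL).trans (mul_le_mul_of_nonneg_left hle hLp)
      have h2 := (hv' i UR hUR UL hUL).trans (mul_le_mul_of_nonneg_left hle hLv)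
      calc _ ≤ (Lp * δ) * (Lv * δ) := by gcongr
        _ = _ := by ring
    have e3 : (A + 1) * relLin γ UR UL.1 (vel UL) (temp γ UL) ≤ (A + 1) * (C1 * δ ^ 2) := by gcongr
    have e4 : (pressure γ UL - UL.1 * temp γ UL) * (vel UL i - vel UL i) = 0 := by simp
    rw [hD, mul_zero, e4]
    linarith
  have key : ∀ e : State d →L[ℝ] ℝ, (∀ U : State d, Admissible γ U →
      |e U - e UL| ≤ C2 * (δ + relLin γ U UL.1 (vel UL) (temp γ UL) / δ)) →
      |e (flux γ i V) - e (flux γ i UL)| ≤ C2 * (D + A + 1) * δ := fun e he =>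
    hf.abs_flux_sub_le hγ hv hgl hA hLA hRA hgr hV e hC2 hδ he hdiss
  refine norm_state_le (by positivity) ?_ (fun j => ?_) ?_
  · exact key (densityL d) fun U hU => (hdev U hU UL hUL δ hδ hδ₀).1
  · exact key ((ContinuousLinearMap.proj (R := ℝ) (φ := fun _ : Fin d => ℝ) j).comp
        ((ContinuousLinearMap.fst ℝ (Fin d → ℝ) ℝ).comp
          (ContinuousLinearMap.snd ℝ ℝ ((Fin d → ℝ) × ℝ))))
      fun U hU => (hdev U hU UL hUL δ hδ hδ₀).2.1 j
  · exact key ((ContinuousLinearMap.snd ℝ (Fin d → ℝ) ℝ).comp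
      (ContinuousLinearMap.snd ℝ ℝ ((Fin d → ℝ) × ℝ)))
      fun U hU => (hdev U hU UL hUL δ hδ hδ₀).2.2

/-- The interface flux and entropy flux differ from those of the two states at most by a multiple
of the jump. -/
theorem exists_interface_bound (hγ : 1 < γ) {k K : ℝ} (hk : 0 < k) : ∃ C : ℝ, 0 ≤ C ∧
    ∀ UL ∈ rangeSet d γ k K, ∀ UR ∈ rangeSet d γ k K, ∀ (i : Fin d) (V : State d),
      IsInterfaceState γ i UL UR V →
        ‖flux γ i V - flux γ i UL‖ ≤ C * ‖UR - UL‖ ∧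
        ‖flux γ i V - flux γ i UR‖ ≤ C * ‖UR - UL‖ ∧
        |entropyFlux γ i V - entropyFlux γ i UL| ≤ C * ‖UR - UL‖ ∧
        |entropyFlux γ i V - entropyFlux γ i UR| ≤ C * ‖UR - UL‖ := by
  by_cases hK : 0 < K
  swap
  · exact ⟨0, le_rfl, fun UL hUL => absurd (hk.trans_le (hUL.1.trans hUL.2.1)) hK⟩
  obtain ⟨R, hR0, hR⟩ := exists_norm_le (d := d) (K := K) hγ hk
  obtain ⟨C, hC, hfl⟩ := exists_flux_sub_le_of_pos (d := d) (K := K) hγ hk (2 * R + 1)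
  obtain ⟨L1, hL1, h1⟩ := exists_lipschitz_rangeSet_all (d := d) (K := K) hγ hk
    (f := fun (i : Fin d) U => (flux γ i U).1) fun i U hU => (contDiffAt_flux hU.1.ne').fst
  obtain ⟨L2, hL2, h2⟩ := exists_lipschitz_rangeSet_all (d := d) (K := K) hγ hk
    (f := fun (p : Fin d × Fin d) U => (flux γ p.1 U).2.1 p.2)
    fun p U hU => contDiffAt_pi.1 (contDiffAt_flux hU.1.ne').snd.fst p.2
  obtain ⟨L3, hL3, h3⟩ := exists_lipschitz_rangeSet_all (d := d) (K := K) hγ hk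
    (f := fun (i : Fin d) U => (flux γ i U).2.2) fun i U hU => (contDiffAt_flux hU.1.ne').snd.snd
  obtain ⟨L4, hL4, h4⟩ := exists_lipschitz_rangeSet_all (d := d) (K := K) hγ hk
    (f := fun (i : Fin d) U => entropyFlux γ i U) fun i U hU => contDiffAt_entropyFlux hγ hU
  obtain ⟨Λ, hΛ, hlam⟩ := abs_lam_le (d := d) (K := K) hγ hk
  set L := L1 + L2 + L3 with hL
  set C' := C + L with hC'
  set Cq := K / k * (Λ * C') + L4 with hCq
  have hL0 : 0 ≤ L := by positivity
  have hC'0 : 0 ≤ C' := by positivity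
  have hCq0 : 0 ≤ Cq := by positivity
  refine ⟨C' + Cq, by positivity, fun UL hUL UR hUR i V h => ?_⟩
  have hgl := isGas_of_mem hk hUL
  have hgr := isGas_of_mem hk hUR
  set δ := ‖UR - UL‖ with hδ
  have hδ0 : 0 ≤ δ := norm_nonneg _
  have hδR : δ ≤ 2 * R := by
    have := norm_sub_le UR UL
    have := hR UR hUR
    have := hR UL hUL
    linarith
  have hFL : ‖flux γ i V - flux γ i UL‖ ≤ C * δ := by
    refine le_of_forall_pos_le_add fun ε hε => ?_
    have h5 := hfl UL hUL UR hUR i V h (δ + min 1 (ε / (C + 1))) (by positivity)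
      (by linarith [min_le_left 1 (ε / (C + 1))])
      (by have : 0 < min 1 (ε / (C + 1)) := by positivity
          linarith)
    have h6 : C * min 1 (ε / (C + 1)) ≤ ε := by
      calc _ ≤ C * (ε / (C + 1)) := by gcongr; exact min_le_right _ _
        _ = C / (C + 1) * ε := by ring
        _ ≤ 1 * ε := by
            gcongr
            rw [div_le_one (by positivity)]; linarith
        _ = ε := one_mul ε
    linarith
  have hLR : ‖flux γ i UL - flux γ i UR‖ ≤ L * δ := by
    have hs : ‖UL - UR‖ = δ := norm_sub_rev _ _
    have a1 := h1 i UL hUL UR hUR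
    have a2 := fun j => h2 (i, j) UL hUL UR hUR
    have a3 := h3 i UL hUL UR hUR
    rw [hs] at a1 a3
    simp only [hs] at a2
    have b1 : 0 ≤ L1 * δ := by positivity
    have b2 : 0 ≤ L2 * δ := by positivity
    have b3 : 0 ≤ L3 * δ := by positivity
    have hLe : L * δ = L1 * δ + L2 * δ + L3 * δ := by rw [hL]; ring
    refine norm_state_le (by positivity) (a1.trans ?_) (fun j => (a2 j).trans ?_) (a3.trans ?_) <;>
      linarith
  have hFL' : ‖flux γ i V - flux γ i UL‖ ≤ C' * δ := hFL.trans (by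
    gcongr; linarith)
  have hFR' : ‖flux γ i V - flux γ i UR‖ ≤ C' * δ := by
    calc _ = ‖(flux γ i V - flux γ i UL) + (flux γ i UL - flux γ i UR)‖ := by rw [sub_add_sub_cancel]
      _ ≤ C * δ + L * δ := (norm_add_le _ _).trans (add_le_add hFL hLR)
      _ = _ := by ring
  have hLR4 : |entropyFlux γ i UL - entropyFlux γ i UR| ≤ L4 * δ := by
    have := h4 i UL hUL UR hUR
    rwa [norm_sub_rev] at this
  have hdivθ : ∀ U ∈ rangeSet d γ k K, ∀ z y : ℝ, 0 ≤ y → temp γ U * z ≤ y → z ≤ K / k * y := by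
    intro U hU z y hy hz
    have hθ := (temp_bounds hγ hk hU).1
    rcases le_total z 0 with h0 | h0
    · exact h0.trans (by positivity)
    · have h5 : k / K * z ≤ y := (mul_le_mul_of_nonneg_right hθ h0).trans hz
      calc z = K / k * (k / K * z) := by field_simp
        _ ≤ _ := by gcongr
  have hlo : entropyFlux γ i UL - entropyFlux γ i V ≤ K / k * (Λ * C' * δ) := by
    refine hdivθ UL hUL _ _ (by positivity) ?_
    have h5 := h.entropy_left hγ hgl
    have h6 := (abs_le.1 (hlam UL hUL (flux γ i V - flux γ i UL))).1
    have h7 : Λ * ‖flux γ i V - flux γ i UL‖ ≤ Λ * (C' * δ) := by gcongr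
    linarith
  have hup : entropyFlux γ i V - entropyFlux γ i UR ≤ K / k * (Λ * C' * δ) := by
    refine hdivθ UR hUR _ _ (by positivity) ?_
    have h5 := h.entropy_right hγ hgr
    have h6 := (abs_le.1 (hlam UR hUR (flux γ i V - flux γ i UR))).2
    have h7 : Λ * ‖flux γ i V - flux γ i UR‖ ≤ Λ * (C' * δ) := by gcongr
    linarith
  obtain ⟨c1, c2⟩ := abs_le.1 hLR4
  have hCqe : Cq * δ = K / k * (Λ * C' * δ) + L4 * δ := by rw [hCq]; ring
  have hpos : 0 ≤ K / k * (Λ * C' * δ) := by positivity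
  have hpos4 : 0 ≤ L4 * δ := by positivity
  have hC'δ : 0 ≤ C' * δ := by positivity
  have hCqδ : 0 ≤ Cq * δ := by positivity
  have hsum : (C' + Cq) * δ = C' * δ + Cq * δ := by ring
  refine ⟨by linarith, by linarith, ?_, ?_⟩
  · rw [abs_le]; constructor <;> linarith
  · rw [abs_le]; constructor <;> linarith

/-- The flux through an impermeable wall is the pressure. -/
theorem wall_flux (hγ : 1 < γ) {U V : State d} (hg : IsGas γ U)
    (h : IsInterfaceState γ i U (reflect i U) V ∨ IsInterfaceState γ i (reflect i U) U V) :
    (flux γ i V).1 = 0 ∧ (∀ j, j ≠ i → (flux γ i V).2.1 j = 0) ∧ (flux γ i V).2.2 = 0 ∧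
      entropyFlux γ i V = 0 := by
  have h0 : V.2.1 i = 0 := by
    rcases h with h | h
    · obtain ⟨W, B, hf, -, hL, hR, hV⟩ := h.exists_fan hγ
      exact hf.wall_massFlux hγ hg hL hR hV
    · obtain ⟨W, B, hf, -, hL, hR, hV⟩ := h.exists_fan hγ
      exact hf.wall_massFlux hγ (isGas_reflect.2 hg) hL (by rwa [reflect_reflect]) hV
  refine ⟨by simp [flux, h0], fun j hj => by simp [flux, h0, hj], by simp [flux, h0],
    by simp [entropyFlux, h0]⟩

end Interface

/-! ### Weak derivatives of Lipschitz functions -/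

section WeakDeriv

theorem integrable_smul_of_support_subset {X V : Type*} [NormedAddCommGroup X] [MeasureSpace X]
    [BorelSpace X] [NormedAddCommGroup V] [NormedSpace ℝ V] {Q K : Set X} {φ : X → ℝ} {f : X → V}
    (hf : LocallyIntegrableOn f Q) (hK : IsCompact K) (hKQ : K ⊆ Q) (hφ : Continuous φ)
    (hs : Function.support φ ⊆ K) : Integrable fun z => φ z • f z := by
  have h1 : IntegrableOn f K := hf.integrableOn_compact_subset hKQ hK
  have h2 : IntegrableOn (fun z => φ z • f z) K := h1.continuousOn_smul hφ.continuousOn hK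
  refine (integrableOn_iff_integrable_of_support_subset fun z hz => hs ?_).1 h2
  intro h0
  exact hz (by simp [h0])

theorem support_fderiv_apply_subset {X : Type*} [NormedAddCommGroup X] [NormedSpace ℝ X] (φ : X → ℝ) (v : X) :
    Function.support (fun z => fderiv ℝ φ z v) ⊆ tsupport φ := by
  intro z hz
  refine support_fderiv_subset ℝ (f := φ) ?_
  intro h0
  exact hz (by simp [h0])

variable {X V V' : Type*} [NormedAddCommGroup X] [NormedSpace ℝ X] [MeasureSpace X]
  [BorelSpace X] [NormedAddCommGroup V] [NormedSpace ℝ V] [NormedAddCommGroup V'] [NormedSpace ℝ V']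

theorem HasWeakDeriv.clm_comp [CompleteSpace V] [CompleteSpace V'] {Q : Set X} {v : X}
    {f g : X → V} (h : HasWeakDeriv Q v f g) (e : V →L[ℝ] V') :
    HasWeakDeriv Q v (fun z => e (f z)) (fun z => e (g z)) := by
  obtain ⟨hf, hg, hw⟩ := h
  refine ⟨fun x hx => ?_, fun x hx => ?_, fun φ h1 h2 h3 => ?_⟩
  · obtain ⟨u, hu, hi⟩ := hf x hx
    exact ⟨u, hu, e.integrable_comp hi⟩
  · obtain ⟨u, hu, hi⟩ := hg x hx
    exact ⟨u, hu, e.integrable_comp hi⟩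
  · have i1 : Integrable fun z => fderiv ℝ φ z v • f z :=
      integrable_smul_of_support_subset hf h2 h3
        ((h1.continuous_fderiv (by simp)).clm_apply continuous_const)
        (support_fderiv_apply_subset φ v)
    have i2 : Integrable fun z => φ z • g z :=
      integrable_smul_of_support_subset hg h2 h3 h1.continuous (subset_tsupport φ)
    have := congrArg e (hw φ h1 h2 h3)
    rw [map_neg, ← e.integral_comp_comm i1.integrableOn, ← e.integral_comp_comm i2.integrableOn]
      at this
    simpa using this

variable [FiniteDimensional ℝ X] [(volume : Measure X).IsAddHaarMeasure]

/-- A bounded weak derivative of a continuous function bounds its increments. -/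
theorem HasWeakDeriv.norm_sub_le [CompleteSpace V] {Q : Set X} (hQ : IsOpen Q) {v : X} {f g : X → V}
    (hf : ContinuousOn f Q) (h : HasWeakDeriv Q v f g) {M : ℝ} (hM : 0 ≤ M)
    (hg : ∀ᵐ z ∂(volume.restrict Q), ‖g z‖ ≤ M) {x : X} {s : ℝ}
    (hseg : ∀ τ ∈ Icc (0 : ℝ) 1, x + τ • s • v ∈ Q) :
    ‖f (x + s • v) - f x‖ ≤ M * |s| := by
  set p : ℝ → X := fun τ => x + τ • s • v with hp
  have hpc : Continuous p := by fun_prop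
  set S := p '' Icc 0 1 with hS
  have hSc : IsCompact S := isCompact_Icc.image hpc
  obtain ⟨δ, hδ, hδQ⟩ := hSc.exists_cthickening_subset_open hQ (by
    rintro _ ⟨τ, hτ, rfl⟩; exact hseg τ hτ)
  set C := Metric.cthickening δ S with hC
  have hCc : IsCompact C := hSc.cthickening
  set F := C.indicator f with hF
  have hFi : Integrable F :=
    ((hf.mono hδQ).integrableOn_compact hCc).integrable_indicator hCc.isClosed.measurableSet
  have hFcont : ∀ z ∈ S, ContinuousAt F z ∧ F z = f z := fun z hz => by
    have hn : C ∈ 𝓝 z := by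
      refine mem_of_superset (Metric.ball_mem_nhds z hδ) fun y hy => ?_
      exact Metric.thickening_subset_cthickening δ S
        (Metric.mem_thickening_iff.2 ⟨z, hz, hy⟩)
    have hzQ : Q ∈ 𝓝 z := mem_of_superset hn hδQ
    refine ⟨(hf.continuousAt hzQ).congr ?_, indicator_of_mem (mem_of_mem_nhds hn) f⟩
    filter_upwards [hn] with y hy
    exact (indicator_of_mem hy f).symm
  refine le_of_forall_pos_le_add fun e he => ?_
  have h1S : x + s • v ∈ S := ⟨1, by simp, by simp [hp]⟩
  have h0S : x ∈ S := ⟨0, by simp, by simp [hp]⟩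
  obtain ⟨r1, hr1, hF1⟩ := Metric.continuousAt_iff.1 (hFcont _ h1S).1 (e / 2) (by positivity)
  obtain ⟨r0, hr0, hF0⟩ := Metric.continuousAt_iff.1 (hFcont _ h0S).1 (e / 2) (by positivity)
  set ε := min (min r1 r0) δ with hε
  have hε0 : 0 < ε := by positivity
  let φ : ContDiffBump (0 : X) := ⟨ε / 2, ε, by positivity, by linarith⟩
  set ψ := φ.normed (volume : Measure X) with hψ
  have hψc : ContDiff ℝ ∞ ψ := φ.contDiff_normed
  have hψs : HasCompactSupport ψ := φ.hasCompactSupport_normed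
  set G := MeasureTheory.convolution ψ F (ContinuousLinearMap.lsmul ℝ ℝ) volume with hG
  have hG1 : dist (G (x + s • v)) (F (x + s • v)) ≤ e / 2 :=
    φ.dist_normed_convolution_le hFi.aestronglyMeasurable fun y hy =>
      (hF1 (lt_of_lt_of_le (Metric.mem_ball.1 hy)
        ((min_le_left _ _).trans (min_le_left _ _)))).le
  have hG0 : dist (G x) (F x) ≤ e / 2 :=
    φ.dist_normed_convolution_le hFi.aestronglyMeasurable fun y hy =>
      (hF0 (lt_of_lt_of_le (Metric.mem_ball.1 hy)
        ((min_le_left _ _).trans (min_le_right _ _)))).le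
  have hderiv : ∀ z, ∃ D : X →L[ℝ] V, HasFDerivAt G D z ∧
      D v = ∫ t, fderiv ℝ ψ (z - t) v • F t := fun z => by
    have h1 := hψs.hasFDerivAt_convolution_right (𝕜 := ℝ) (μ := (volume : Measure X))
      (ContinuousLinearMap.lsmul ℝ ℝ (E := V)).flip hFi.locallyIntegrable (hψc.of_le (by simp)) z
    rw [convolution_flip] at h1
    refine ⟨_, h1, ?_⟩
    rw [convolution_precompR_apply _ hFi.locallyIntegrable (hψs.fderiv ℝ)
      (hψc.continuous_fderiv (by simp))]
    rfl
  have hbound : ∀ z ∈ S, ∀ D : X →L[ℝ] V, D v = ∫ t, fderiv ℝ ψ (z - t) v • F t → ‖D v‖ ≤ M := by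
    intro z hz D hD
    set χ : X → ℝ := fun t => ψ (z - t) with hχ
    have hχc : ContDiff ℝ ∞ χ := hψc.comp (contDiff_const.sub contDiff_id)
    have hsub : tsupport χ ⊆ Metric.closedBall z ε := by
      refine closure_minimal (fun t ht => ?_) Metric.isClosed_closedBall
      have h1 : z - t ∈ Function.support ψ := ht
      rw [hψ, φ.support_normed_eq, Metric.mem_ball, dist_zero_right] at h1
      rw [Metric.mem_closedBall, dist_comm, dist_eq_norm]
      exact h1.le
    have hballC : Metric.closedBall z ε ⊆ C :=
      (Metric.closedBall_subset_closedBall (min_le_right _ _)).trans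
        (Metric.closedBall_subset_cthickening hz δ)
    have hχs : HasCompactSupport χ :=
      (isCompact_closedBall z ε).of_isClosed_subset (isClosed_tsupport χ) hsub
    have hχd : ∀ t, fderiv ℝ χ t v = - fderiv ℝ ψ (z - t) v := fun t => by
      have h1 : HasFDerivAt ψ (fderiv ℝ ψ (z - t)) (z - t) :=
        (hψc.differentiable (by simp) _).hasFDerivAt
      have h2 : HasFDerivAt (fun t : X => z - t) (-(ContinuousLinearMap.id ℝ X)) t := by
        simpa using (hasFDerivAt_id t).const_sub z
      have h3 : HasFDerivAt χ _ t := h1.comp t h2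
      rw [h3.fderiv]; simp
    have h1 : ∫ t, fderiv ℝ ψ (z - t) v • F t = ∫ t in Q, χ t • g t := by
      have h2 := h.2.2 χ hχc hχs (hsub.trans (hballC.trans hδQ))
      have h3 : ∫ t in Q, fderiv ℝ χ t v • f t = ∫ t, fderiv ℝ χ t v • f t := by
        refine setIntegral_eq_integral_of_forall_compl_eq_zero fun t ht => ?_
        have : fderiv ℝ χ t v = 0 := by
          by_contra hne
          exact ht ((hsub.trans (hballC.trans hδQ)) (support_fderiv_apply_subset χ v hne))
        rw [this, zero_smul]
      have h4 : ∫ t, fderiv ℝ χ t v • f t = - ∫ t, fderiv ℝ ψ (z - t) v • F t := by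
        rw [← integral_neg]
        refine integral_congr_ae (Eventually.of_forall fun t => ?_)
        simp only
        by_cases hne : fderiv ℝ χ t v = 0
        · have : fderiv ℝ ψ (z - t) v = 0 := by rw [← neg_eq_zero, ← hχd, hne]
          rw [hne, this]; simp
        · have htC := hballC (hsub (support_fderiv_apply_subset χ v hne))
          rw [hF, indicator_of_mem htC, hχd, neg_smul]
      rw [h3, h4, neg_inj] at h2
      exact h2
    have hχint : ∫ t, χ t = 1 := by
      rw [hχ, integral_sub_left_eq_self (fun t => ψ t) volume z]
      exact φ.integral_normed
    have hχi : Integrable χ := hχc.continuous.integrable_of_hasCompactSupport hχs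
    have hχ0 : ∀ t, 0 ≤ χ t := fun t => φ.nonneg_normed _
    rw [hD, h1]
    calc ‖∫ t in Q, χ t • g t‖ ≤ ∫ t in Q, χ t * M := by
          refine norm_integral_le_of_norm_le (hχi.integrableOn.mul_const M) ?_
          filter_upwards [hg] with t ht
          rw [norm_smul, Real.norm_eq_abs, abs_of_nonneg (hχ0 t)]
          exact mul_le_mul_of_nonneg_left ht (hχ0 t)
      _ = (∫ t in Q, χ t) * M := integral_mul_const _ _
      _ ≤ 1 * M := by
          refine mul_le_mul_of_nonneg_right ?_ hM
          rw [← hχint]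
          exact setIntegral_le_integral hχi (Eventually.of_forall hχ0)
      _ = M := one_mul M
  have hGle : ‖G (x + s • v) - G x‖ ≤ M * |s| := by
    choose D hD hDv using hderiv
    have h1 := norm_image_sub_le_of_norm_deriv_le_segment_01' (f := fun τ => G (p τ))
      (f' := fun τ => D (p τ) (s • v)) (C := M * |s|)
      (fun τ _ => by
        have h2 : HasDerivAt p ((1 : ℝ) • s • v) τ :=
          ((hasDerivAt_id τ).smul_const (s • v)).const_add x
        rw [one_smul] at h2
        exact ((hD (p τ)).comp_hasDerivAt τ h2).hasDerivWithinAt)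
      (fun τ hτ => by
        rw [map_smul, norm_smul, Real.norm_eq_abs, mul_comm]
        exact mul_le_mul_of_nonneg_right
          (hbound (p τ) ⟨τ, ⟨hτ.1, hτ.2.le⟩, rfl⟩ _ (hDv _)) (abs_nonneg s))
    simpa [hp] using h1
  rw [(hFcont _ h1S).2] at hG1
  rw [(hFcont _ h0S).2] at hG0
  rw [dist_comm, dist_eq_norm] at hG1
  rw [dist_eq_norm] at hG0
  calc ‖f (x + s • v) - f x‖
      = ‖(f (x + s • v) - G (x + s • v)) + (G (x + s • v) - G x) + (G x - f x)‖ := by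
        congr 1; abel
    _ ≤ ‖f (x + s • v) - G (x + s • v)‖ + ‖G (x + s • v) - G x‖ + ‖G x - f x‖ := norm_add₃_le
    _ ≤ M * |s| + e := by linarith

/-- Almost everywhere, the weak derivative of a Lipschitz function is its derivative. -/
theorem HasWeakDeriv.ae_fderiv_eq_real {Q O : Set X} (hO : IsOpen O) (hOQ : O ⊆ Q) {v : X}
    {f g : X → ℝ} (h : HasWeakDeriv Q v f g) {C : NNReal} (hf : LipschitzOnWith C f O) :
    ∀ᵐ z, z ∈ O → fderiv ℝ f z v = g z := by
  obtain ⟨F, hF, hFf⟩ := hf.extend_real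
  have hFd : LocallyIntegrable fun z => lineDeriv ℝ F z v := by
    have hm : AEStronglyMeasurable (fun z => lineDeriv ℝ F z v) (volume : Measure X) :=
      aestronglyMeasurable_lineDeriv hF.continuous volume
    refine (locallyIntegrable_const ((C : ℝ) * ‖v‖)).mono hm (Eventually.of_forall fun z => ?_)
    exact (norm_lineDeriv_le_of_lipschitz ℝ hF).trans (le_abs_self _)
  have hgO : LocallyIntegrableOn g O := h.2.1.mono_set hOQ
  have key : ∀ᵐ z, z ∈ O → lineDeriv ℝ F z v - g z = 0 := by
    refine hO.ae_eq_zero_of_integral_contDiff_smul_eq_zero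
      ((hFd.locallyIntegrableOn O).sub hgO) fun φ h1 h2 h3 => ?_
    have i1 : Integrable fun z => φ z • lineDeriv ℝ F z v :=
      integrable_smul_of_support_subset (hFd.locallyIntegrableOn univ) h2 (subset_univ _)
        h1.continuous (subset_tsupport φ)
    have i2 : Integrable fun z => φ z • g z :=
      integrable_smul_of_support_subset hgO h2 h3 h1.continuous (subset_tsupport φ)
    simp only [smul_sub]
    rw [integral_sub i1 i2, sub_eq_zero]
    obtain ⟨D, hD⟩ := (h1.of_le (by simp : (1 : WithTop ℕ∞) ≤ ∞)).lipschitzWith_of_hasCompactSupport h2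
      one_ne_zero
    have e1 := hF.integral_lineDeriv_mul_eq (μ := volume) hD h2 v
    have e2 := h.2.2 φ h1 h2 (h3.trans hOQ)
    have e3 : ∫ z in Q, fderiv ℝ φ z v • f z = ∫ z, fderiv ℝ φ z v • f z := by
      refine setIntegral_eq_integral_of_forall_compl_eq_zero fun t ht => ?_
      have : fderiv ℝ φ t v = 0 := by
        by_contra hne
        exact ht (hOQ (h3 (support_fderiv_apply_subset φ v hne)))
      rw [this, zero_smul]
    have e4 : ∫ z in Q, φ z • g z = ∫ z, φ z • g z := by
      refine setIntegral_eq_integral_of_forall_compl_eq_zero fun t ht => ?_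
      have : φ t = 0 := by
        by_contra hne
        exact ht (hOQ (h3 (subset_tsupport φ hne)))
      rw [this, zero_smul]
    have e5 : ∫ z, lineDeriv ℝ φ z (-v) * F z = - ∫ z, fderiv ℝ φ z v • f z := by
      rw [← integral_neg]
      refine integral_congr_ae (Eventually.of_forall fun z => ?_)
      simp only
      rw [(h1.differentiable (by simp) z).lineDeriv_eq_fderiv, map_neg]
      by_cases hne : fderiv ℝ φ z v = 0
      · rw [hne]; simp
      · rw [hFf (h3 (support_fderiv_apply_subset φ v hne))]; simp
    rw [e5, ← e3, e2, e4, neg_neg] at e1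
    rw [← e1]
    exact integral_congr_ae (Eventually.of_forall fun z => by simp [mul_comm])
  filter_upwards [key, hF.ae_differentiableAt (μ := volume)] with z hz hd hzO
  have hEq : f =ᶠ[𝓝 z] F := Filter.eventually_of_mem (hO.mem_nhds hzO) fun y hy => hFf hy
  rw [hEq.fderiv_eq, ← hd.lineDeriv_eq_fderiv]
  exact sub_eq_zero.1 (hz hzO)

theorem ae_differentiableAt_of_lipschitzOn [FiniteDimensional ℝ V] {O : Set X} (hO : IsOpen O)
    {f : X → V} {C : NNReal} (hf : LipschitzOnWith C f O) :
    ∀ᵐ z, z ∈ O → DifferentiableAt ℝ f z := by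
  filter_upwards [hf.ae_differentiableWithinAt_of_mem (μ := volume)] with z hz hzO
  exact (hz hzO).differentiableAt (hO.mem_nhds hzO)

end WeakDeriv

section Box

variable {d : ℕ}

/-- The momentum coordinates. -/
def momL (d : ℕ) (j : Fin d) : State d →L[ℝ] ℝ :=
  (ContinuousLinearMap.proj (R := ℝ) (φ := fun _ : Fin d => ℝ) j).comp
    ((ContinuousLinearMap.fst ℝ (Fin d → ℝ) ℝ).comp
      (ContinuousLinearMap.snd ℝ ℝ ((Fin d → ℝ) × ℝ)))

/-- The energy coordinate. -/
def energyL (d : ℕ) : State d →L[ℝ] ℝ :=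
  (ContinuousLinearMap.snd ℝ (Fin d → ℝ) ℝ).comp (ContinuousLinearMap.snd ℝ ℝ ((Fin d → ℝ) × ℝ))

@[simp] theorem momL_apply (j : Fin d) (U : State d) : momL d j U = U.2.1 j := rfl

@[simp] theorem energyL_apply (U : State d) : energyL d U = U.2.2 := rfl

instance : (volume : Measure (ℝ × (Fin d → ℝ))).IsAddHaarMeasure :=
  inferInstanceAs ((volume : Measure ℝ).prod (volume : Measure (Fin d → ℝ))).IsAddHaarMeasure

theorem HasWeakDeriv.ae_fderiv_eq {Q O : Set (ℝ × (Fin d → ℝ))} (hO : IsOpen O) (hOQ : O ⊆ Q)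
    {v : ℝ × (Fin d → ℝ)} {f g : ℝ × (Fin d → ℝ) → State d} (h : HasWeakDeriv Q v f g)
    {C : NNReal} (hf : LipschitzOnWith C f O) :
    ∀ᵐ z, z ∈ O → fderiv ℝ f z v = g z := by
  have key : ∀ e : State d →L[ℝ] ℝ, ∀ᵐ z, z ∈ O → DifferentiableAt ℝ f z →
      e (fderiv ℝ f z v) = e (g z) := fun e => by
    filter_upwards [(h.clm_comp e).ae_fderiv_eq_real hO hOQ (e.lipschitz.comp_lipschitzOnWith hf)]
      with z hz hzO hd
    rw [← hz hzO]
    have : fderiv ℝ (fun z => e (f z)) z = e.comp (fderiv ℝ f z) :=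
      (e.hasFDerivAt.comp z hd.hasFDerivAt).fderiv
    rw [this]; rfl
  filter_upwards [ae_differentiableAt_of_lipschitzOn hO hf, key (densityL d), key (energyL d),
    ae_all_iff.2 fun j => key (momL d j)] with z hd h1 h2 h3 hzO
  have hd := hd hzO
  refine Prod.ext (h1 hzO hd) (Prod.ext (funext fun j => ?_) (h2 hzO hd))
  exact h3 j hzO hd

variable {V : Type*} [NormedAddCommGroup V] [NormedSpace ℝ V]

/-- The open box with the given corners. -/
def openBox (lo hi : Fin d → ℝ) : Set (Fin d → ℝ) := univ.pi fun j => Ioo (lo j) (hi j)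

theorem isOpen_openBox (lo hi : Fin d → ℝ) : IsOpen (openBox lo hi) :=
  isOpen_set_pi finite_univ fun _ _ => isOpen_Ioo

theorem mem_openBox {lo hi x : Fin d → ℝ} : x ∈ openBox lo hi ↔ ∀ j, lo j < x j ∧ x j < hi j := by
  simp [openBox]

theorem openBox_subset_Icc (lo hi : Fin d → ℝ) : openBox lo hi ⊆ Icc lo hi := fun _ hx =>
  ⟨fun j => (mem_openBox.1 hx j).1.le, fun j => (mem_openBox.1 hx j).2.le⟩

theorem convex_openBox (lo hi : Fin d → ℝ) : Convex ℝ (openBox lo hi) :=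
  convex_pi fun _ _ => convex_Ioo _ _

theorem HasWeakDeriv.norm_sub_le_openBox [CompleteSpace V] {T : ℝ} {Ω : Set (Fin d → ℝ)}
    (hΩ : IsOpen Ω) {f : ℝ × (Fin d → ℝ) → V} {M : ℝ} (hM : 0 ≤ M) (h : W1InfNormLE T Ω f M)
    {lo hi : Fin d → ℝ} (hbox : openBox lo hi ⊆ Ω) {z w : ℝ × (Fin d → ℝ)}
    (hz : z ∈ Ioo 0 T ×ˢ openBox lo hi) (hw : w ∈ Ioo 0 T ×ˢ openBox lo hi) :
    ‖f z - f w‖ ≤ M * (|z.1 - w.1| + ∑ j, |z.2 j - w.2 j|) := by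
  obtain ⟨hc, -, ⟨gt, hgt, hgtM⟩, hx⟩ := h
  have hQ : IsOpen (cylinder T Ω) := isOpen_Ioo.prod hΩ
  have hcQ : ContinuousOn f (cylinder T Ω) :=
    hc.mono (prod_mono Ioo_subset_Icc_self subset_closure)
  have hO : Ioo 0 T ×ˢ openBox lo hi ⊆ cylinder T Ω := prod_mono le_rfl hbox
  have hconv : Convex ℝ (Ioo 0 T ×ˢ openBox lo hi) := (convex_Ioo _ _).prod (convex_openBox _ _)
  have hseg : ∀ {a b : ℝ × (Fin d → ℝ)}, a ∈ Ioo 0 T ×ˢ openBox lo hi →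
      b ∈ Ioo 0 T ×ˢ openBox lo hi → ∀ τ ∈ Icc (0 : ℝ) 1, a + τ • (b - a) ∈ cylinder T Ω :=
    fun ha hb τ hτ => hO (hconv.add_smul_sub_mem ha hb hτ)
  obtain ⟨t, x⟩ := z
  obtain ⟨s, y⟩ := w
  have hmem : ∀ F : Finset (Fin d), (t, F.piecewise x y) ∈ Ioo 0 T ×ˢ openBox lo hi := fun F => by
    refine ⟨hz.1, mem_openBox.2 fun j => ?_⟩
    by_cases hj : j ∈ F
    · simpa [hj] using mem_openBox.1 hz.2 j
    · simpa [hj] using mem_openBox.1 hw.2 j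
  have hspace : ∀ F : Finset (Fin d),
      ‖f (t, F.piecewise x y) - f (t, y)‖ ≤ M * ∑ j ∈ F, |x j - y j| := by
    intro F
    induction F using Finset.induction_on with
    | empty => simp
    | insert j F hj ih =>
      obtain ⟨g, hg, hgM⟩ := hx j
      have e1 : (t, (insert j F).piecewise x y)
          = (t, F.piecewise x y) + (x j - y j) • dirX j := by
        rw [Finset.piecewise_insert, dirX]
        ext k
        · simp
        · by_cases hk : k = j
          · subst hk; simp [hj]
          · simp [hk]
      have e2 := hg.norm_sub_le hQ hcQ hM hgM (x := (t, F.piecewise x y)) (s := x j - y j)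
        (by
          intro τ hτ
          have := hseg (hmem F) (hmem (insert j F)) τ hτ
          rwa [e1, add_sub_cancel_left] at this)
      rw [← e1] at e2
      rw [Finset.sum_insert hj, mul_add]
      calc _ ≤ ‖f (t, (insert j F).piecewise x y) - f (t, F.piecewise x y)‖
            + ‖f (t, F.piecewise x y) - f (t, y)‖ := norm_sub_le_norm_sub_add_norm_sub _ _ _
        _ ≤ _ := add_le_add e2 ih
  have h1 := hspace Finset.univ
  rw [Finset.piecewise_univ] at h1
  have e3 : (t, y) = (s, y) + (t - s) • dirT d := by
    rw [dirT]; ext <;> simp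
  have h2 := hgt.norm_sub_le hQ hcQ hM hgtM (x := (s, y)) (s := t - s) (by
    intro τ hτ
    have := hseg hw (show (t, y) ∈ Ioo 0 T ×ˢ openBox lo hi from ⟨hz.1, hw.2⟩) τ hτ
    rwa [e3, add_sub_cancel_left] at this)
  rw [← e3] at h2
  rw [mul_add]
  calc _ ≤ ‖f (t, x) - f (t, y)‖ + ‖f (t, y) - f (s, y)‖ := norm_sub_le_norm_sub_add_norm_sub _ _ _
    _ ≤ _ := by linarith

/-- Functions in `W^{1,∞}` are Lipschitz on closed boxes. -/
theorem W1InfNormLE.norm_sub_le [CompleteSpace V] {T : ℝ} (hT : 0 < T) {Ω : Set (Fin d → ℝ)}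
    (hΩ : IsOpen Ω) {f : ℝ × (Fin d → ℝ) → V} {M : ℝ} (hM : 0 ≤ M) (h : W1InfNormLE T Ω f M)
    {lo hi : Fin d → ℝ} (hlt : ∀ j, lo j < hi j) (hbox : openBox lo hi ⊆ Ω)
    (hbox' : Icc lo hi ⊆ closure Ω) {z w : ℝ × (Fin d → ℝ)}
    (hz : z ∈ Icc 0 T ×ˢ Icc lo hi) (hw : w ∈ Icc 0 T ×ˢ Icc lo hi) :
    ‖f z - f w‖ ≤ M * (1 + d) * ‖z - w‖ := by
  have hmem : ∀ z ∈ Icc 0 T ×ˢ Icc lo hi, ∀ ε ∈ Ioo (0 : ℝ) 1,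
      z + ε • ((T / 2, fun j => (lo j + hi j) / 2) - z) ∈ Ioo 0 T ×ˢ openBox lo hi := by
    rintro ⟨t, x⟩ ⟨ht, hx⟩ ε hε
    have ht' : 0 ≤ t ∧ t ≤ T := ht
    have aux : ∀ a b c : ℝ, a ≤ c → c ≤ b → a < b → a < c + ε * ((a + b) / 2 - c) ∧
        c + ε * ((a + b) / 2 - c) < b := by
      intro a b c h1 h2 h3
      have h4 := hε.1
      have h5 : 0 < 1 - ε := by linarith [hε.2]
      constructor
      · nlinarith [mul_nonneg h5.le (sub_nonneg.2 h1), mul_pos h4 (sub_pos.2 h3)]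
      · nlinarith [mul_nonneg h5.le (sub_nonneg.2 h2), mul_pos h4 (sub_pos.2 h3)]
    refine ⟨?_, mem_openBox.2 fun j => ?_⟩
    · have := aux 0 T t ht'.1 ht'.2 hT
      simpa using this
    · have := aux (lo j) (hi j) (x j) (hx.1 j) (hx.2 j) (hlt j)
      simpa using this
  have hlim : ∀ z ∈ Icc 0 T ×ˢ Icc lo hi,
      Tendsto (fun ε : ℝ => f (z + ε • ((T / 2, fun j => (lo j + hi j) / 2) - z))) (𝓝[>] 0)
        (𝓝 (f z)) := by
    intro z hz
    have h1 : ContinuousWithinAt f (Icc 0 T ×ˢ closure Ω) z := h.1 z ⟨hz.1, hbox' hz.2⟩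
    refine h1.tendsto.comp (tendsto_nhdsWithin_iff.2 ⟨?_, ?_⟩)
    · have : Continuous fun ε : ℝ => z + ε • (((T / 2, fun j => (lo j + hi j) / 2) : ℝ × (Fin d → ℝ)) - z) := by
        fun_prop
      have h2 := this.tendsto 0
      rw [zero_smul, add_zero] at h2
      exact h2.mono_left nhdsWithin_le_nhds
    · filter_upwards [Ioo_mem_nhdsGT zero_lt_one] with ε hε
      have := hmem z hz ε hε
      exact ⟨Ioo_subset_Icc_self this.1, subset_closure (hbox this.2)⟩
  refine le_of_tendsto (((hlim z hz).sub (hlim w hw)).norm) ?_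
  filter_upwards [Ioo_mem_nhdsGT zero_lt_one] with ε hε
  refine (HasWeakDeriv.norm_sub_le_openBox hΩ hM h hbox (hmem z hz ε hε) (hmem w hw ε hε)).trans ?_
  rw [mul_assoc]
  refine mul_le_mul_of_nonneg_left ?_ hM
  have hsc : ∀ a b c : ℝ, |a + ε * (c - a) - (b + ε * (c - b))| ≤ |a - b| := by
    intro a b c
    have : a + ε * (c - a) - (b + ε * (c - b)) = (1 - ε) * (a - b) := by ring
    rw [this, abs_mul, abs_of_nonneg (by linarith [hε.2])]
    exact mul_le_of_le_one_left (abs_nonneg _) (by linarith [hε.1])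
  have h1 : |z.1 - w.1| ≤ ‖z - w‖ := norm_fst_le (z - w)
  have h2 : ∀ j, |z.2 j - w.2 j| ≤ ‖z - w‖ := fun j =>
    (norm_le_pi_norm (z - w).2 j).trans (norm_snd_le (z - w))
  rw [add_mul, one_mul]
  refine add_le_add ?_ ?_
  · refine le_trans ?_ h1
    simpa using hsc z.1 w.1 (T / 2)
  · calc _ ≤ ∑ _j : Fin d, ‖z - w‖ := by
          refine Finset.sum_le_sum fun j _ => le_trans ?_ (h2 j)
          simpa using hsc (z.2 j) (w.2 j) ((lo j + hi j) / 2)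
      _ = _ := by simp

end Box

/-! ### Divergence theorem for Lipschitz functions on boxes -/

section BoxIntegral

variable {n : ℕ}

/-- The corner of a box without the `i`-th coordinate. -/
abbrev drop (i : Fin (n + 1)) (x : Fin (n + 1) → ℝ) : Fin n → ℝ := fun j => x (i.succAbove j)

/-- Splitting off the `i`-th coordinate. -/
abbrev ins (i : Fin (n + 1)) (s : ℝ) (y : Fin n → ℝ) : Fin (n + 1) → ℝ :=
  i.insertNth (α := fun _ => ℝ) s y

/-- Splitting off the `i`-th coordinate as a measurable equivalence. -/
def insEquiv (i : Fin (n + 1)) : (Fin n → ℝ) × ℝ ≃ᵐ (Fin (n + 1) → ℝ) :=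
  MeasurableEquiv.prodComm.trans (MeasurableEquiv.piFinSuccAbove (fun _ => ℝ) i).symm

theorem insEquiv_apply (i : Fin (n + 1)) (p : (Fin n → ℝ) × ℝ) :
    insEquiv i p = ins i p.2 p.1 := rfl

theorem measurePreserving_insEquiv (i : Fin (n + 1)) :
    MeasurePreserving (insEquiv i) ((volume : Measure (Fin n → ℝ)).prod (volume : Measure ℝ))
      volume :=
  ((volume_preserving_piFinSuccAbove (fun _ => ℝ) i).symm _).comp Measure.measurePreserving_swap

theorem mem_Icc_ins {i : Fin (n + 1)} {s : ℝ} {y : Fin n → ℝ} {lo hi : Fin (n + 1) → ℝ} :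
    ins i s y ∈ Icc lo hi ↔ s ∈ Icc (lo i) (hi i) ∧ y ∈ Icc (drop i lo) (drop i hi) :=
  Fin.insertNth_mem_Icc

theorem mem_openBox_ins {i : Fin (n + 1)} {s : ℝ} {y : Fin n → ℝ} {lo hi : Fin (n + 1) → ℝ} :
    ins i s y ∈ openBox lo hi ↔ s ∈ Ioo (lo i) (hi i) ∧ y ∈ openBox (drop i lo) (drop i hi) := by
  simp only [mem_openBox, Fin.forall_iff_succAbove i, Fin.insertNth_apply_same,
    Fin.insertNth_apply_succAbove, mem_Ioo]

theorem continuous_ins (i : Fin (n + 1)) : Continuous fun p : ℝ × (Fin n → ℝ) => ins i p.1 p.2 :=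
  continuous_pi <| (Fin.forall_iff_succAbove i).2
    ⟨by simpa using continuous_fst,
      fun j => by simpa using (by fun_prop : Continuous fun p : ℝ × (Fin n → ℝ) => p.2 j)⟩

theorem openBox_ae_eq_Icc {m : ℕ} (lo hi : Fin m → ℝ) :
    openBox lo hi =ᵐ[volume] Icc lo hi := Measure.univ_pi_Ioo_ae_eq_Icc

theorem setIntegral_Icc_ins (i : Fin (n + 1)) (lo hi : Fin (n + 1) → ℝ)
    (g : (Fin (n + 1) → ℝ) → ℝ) (hg : IntegrableOn g (Icc lo hi)) :
    ∫ x in Icc lo hi, g x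
      = ∫ y in Icc (drop i lo) (drop i hi), ∫ s in Icc (lo i) (hi i), g (ins i s y) := by
  have hmp := measurePreserving_insEquiv i
  have hpre : insEquiv i ⁻¹' Icc lo hi = Icc (drop i lo) (drop i hi) ×ˢ Icc (lo i) (hi i) := by
    ext p
    rw [mem_preimage, insEquiv_apply, mem_Icc_ins, mem_prod, and_comm]
  have h1 := hmp.setIntegral_preimage_emb (insEquiv i).measurableEmbedding g (Icc lo hi)
  have h2 : IntegrableOn (g ∘ insEquiv i) (Icc (drop i lo) (drop i hi) ×ˢ Icc (lo i) (hi i))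
      ((volume : Measure (Fin n → ℝ)).prod (volume : Measure ℝ)) := by
    rw [← hpre]
    exact (hmp.integrableOn_comp_preimage (insEquiv i).measurableEmbedding).2 hg
  rw [← h1, hpre]
  exact setIntegral_prod _ h2

theorem norm_single_one (i : Fin n) : ‖(Pi.single i (1 : ℝ) : Fin n → ℝ)‖ = 1 := by
  rw [Pi.norm_single, norm_one]

theorem abs_fderiv_single_le {m : ℕ} {f : (Fin m → ℝ) → ℝ} {lo hi : Fin m → ℝ} {C : NNReal}
    (hf : LipschitzOnWith C f (Icc lo hi)) {x : Fin m → ℝ} (hx : x ∈ openBox lo hi) (i : Fin m) :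
    ‖fderiv ℝ f x (Pi.single i 1)‖ ≤ C := by
  have h1 := norm_fderiv_le_of_lipschitzOn ℝ ((isOpen_openBox lo hi).mem_nhds hx)
    (hf.mono (openBox_subset_Icc lo hi))
  calc _ ≤ ‖fderiv ℝ f x‖ * ‖(Pi.single i (1 : ℝ) : Fin m → ℝ)‖ := ContinuousLinearMap.le_opNorm _ _
    _ ≤ C := by rw [norm_single_one, mul_one]; exact h1

theorem integrableOn_fderiv_single {m : ℕ} {f : (Fin m → ℝ) → ℝ} {lo hi : Fin m → ℝ} {C : NNReal}
    (hf : LipschitzOnWith C f (Icc lo hi)) (i : Fin m) :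
    IntegrableOn (fun x => fderiv ℝ f x (Pi.single i 1)) (Icc lo hi) := by
  have h1 : IntegrableOn (fun x => fderiv ℝ f x (Pi.single i 1)) (openBox lo hi) := by
    refine Measure.integrableOn_of_bounded (M := C) ?_
      (measurable_fderiv_apply_const ℝ f _).aestronglyMeasurable ?_
    · exact ((measure_mono (openBox_subset_Icc lo hi)).trans_lt isCompact_Icc.measure_lt_top).ne
    · filter_upwards [ae_restrict_mem (isOpen_openBox lo hi).measurableSet] with x hx
      exact abs_fderiv_single_le hf hx i
  exact h1.congr_set_ae (openBox_ae_eq_Icc lo hi).symm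

/-- Divergence theorem on a box, in one coordinate direction. -/
theorem integral_fderiv_single (i : Fin (n + 1)) {lo hi : Fin (n + 1) → ℝ}
    (hlt : ∀ j, lo j < hi j) {f : (Fin (n + 1) → ℝ) → ℝ} {C : NNReal}
    (hf : LipschitzOnWith C f (Icc lo hi)) :
    ∫ x in Icc lo hi, fderiv ℝ f x (Pi.single i 1)
      = ∫ y in Icc (drop i lo) (drop i hi), (f (ins i (hi i) y) - f (ins i (lo i) y)) := by
  rw [setIntegral_Icc_ins i lo hi _ (integrableOn_fderiv_single hf i)]
  have hd : ∀ᵐ x, x ∈ openBox lo hi → DifferentiableAt ℝ f x :=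
    ae_differentiableAt_of_lipschitzOn (isOpen_openBox lo hi)
      (hf.mono (openBox_subset_Icc lo hi))
  have hd2 := (measurePreserving_insEquiv i).quasiMeasurePreserving.ae hd
  have hd3 := Measure.ae_ae_of_ae_prod hd2
  have hmem : ∀ᵐ y ∂(volume.restrict (Icc (drop i lo) (drop i hi))),
      y ∈ openBox (drop i lo) (drop i hi) := by
    rw [← Measure.restrict_congr_set (openBox_ae_eq_Icc (drop i lo) (drop i hi))]
    exact ae_restrict_mem (isOpen_openBox _ _).measurableSet
  refine integral_congr_ae ?_
  filter_upwards [ae_restrict_of_ae hd3, hmem] with y hy hyb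
  have hlip : LipschitzOnWith C (fun s => f (ins i s y)) (Icc (lo i) (hi i)) := by
    refine LipschitzOnWith.of_dist_le_mul fun s hs s' hs' => ?_
    refine (hf.dist_le_mul _ (mem_Icc_ins.2 ⟨hs, openBox_subset_Icc _ _ hyb⟩) _
      (mem_Icc_ins.2 ⟨hs', openBox_subset_Icc _ _ hyb⟩)).trans ?_
    gcongr
    rw [dist_pi_le_iff dist_nonneg, Fin.forall_iff_succAbove i]
    simp
  have hac : AbsolutelyContinuousOnInterval (fun s => f (ins i s y)) (lo i) (hi i) := by
    apply LipschitzOnWith.absolutelyContinuousOnInterval (K := C)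
    rwa [uIcc_of_le (hlt i).le]
  rw [← hac.integral_deriv_eq_sub, intervalIntegral.integral_of_le (hlt i).le,
    integral_Icc_eq_integral_Ioo, integral_Ioc_eq_integral_Ioo]
  refine setIntegral_congr_ae measurableSet_Ioo ?_
  filter_upwards [hy] with s hs hsI
  have h1 : DifferentiableAt ℝ f (ins i s y) := hs (mem_openBox_ins.2 ⟨hsI, hyb⟩)
  have h2 : HasDerivAt (fun s => ins i s y) (Pi.single i 1) s := by
    rw [hasDerivAt_pi, Fin.forall_iff_succAbove i]
    refine ⟨?_, fun j => ?_⟩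
    · simpa using hasDerivAt_id' s
    · simpa [Pi.single_apply, Fin.succAbove_ne] using hasDerivAt_const s (y j)
  exact ((h1.hasFDerivAt.comp_hasDerivAt s h2).deriv).symm

end BoxIntegral

/-! ### Faces and walls of a rectangular mesh -/

namespace RectMesh

variable {n : ℕ} {Ω : Set (Fin (n + 1) → ℝ)} (𝒯 : RectMesh (n + 1) Ω)

/-- The open cell. -/
abbrev cell {d : ℕ} {Ω : Set (Fin d → ℝ)} (𝒯 : RectMesh d Ω) (K : Fin 𝒯.n) : Set (Fin d → ℝ) :=
  openBox (𝒯.lo K) (𝒯.hi K)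

/-- Projection of a cell along `e_i`. -/
def side (i : Fin (n + 1)) (K : Fin 𝒯.n) : Set (Fin n → ℝ) :=
  openBox (drop i (𝒯.lo K)) (drop i (𝒯.hi K))

/-- Position of the upper (`true`) or lower (`false`) side. -/
def pos (b : Bool) (i : Fin (n + 1)) (K : Fin 𝒯.n) : ℝ := bif b then 𝒯.hi K i else 𝒯.lo K i

/-- The common part of the `b`-side of `K` and the opposite side of `L`. -/
def face (b : Bool) (i : Fin (n + 1)) (K L : Fin 𝒯.n) : Set (Fin n → ℝ) :=
  {y | 𝒯.pos b i K = 𝒯.pos (!b) i L ∧ y ∈ 𝒯.side i K ∧ y ∈ 𝒯.side i L}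

/-- What the neighbours leave of the `b`-side of `K`. -/
def wall (b : Bool) (i : Fin (n + 1)) (K : Fin 𝒯.n) : Set (Fin n → ℝ) :=
  𝒯.side i K \ ⋃ L, 𝒯.face b i K L

theorem cell_disjoint {d : ℕ} {Ω : Set (Fin d → ℝ)} (𝒯 : RectMesh d Ω) {K L : Fin 𝒯.n}
    {x : Fin d → ℝ} (hK : x ∈ 𝒯.cell K) (hL : x ∈ 𝒯.cell L) : K = L := by
  by_contra h
  exact (Set.disjoint_left.1 (𝒯.disjoint K L h)) hK hL

theorem cell_subset {d : ℕ} {Ω : Set (Fin d → ℝ)} (𝒯 : RectMesh d Ω)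
    (hΩ : interior (closure Ω) = Ω) (K : Fin 𝒯.n) : 𝒯.cell K ⊆ Ω := by
  refine Subset.trans (interior_maximal ((openBox_subset_Icc _ _).trans ?_) (isOpen_openBox _ _))
    hΩ.subset
  rw [← 𝒯.cover]
  exact subset_iUnion (fun K => Icc (𝒯.lo K) (𝒯.hi K)) K

theorem Icc_subset_closure {d : ℕ} {Ω : Set (Fin d → ℝ)} (𝒯 : RectMesh d Ω) (K : Fin 𝒯.n) :
    Icc (𝒯.lo K) (𝒯.hi K) ⊆ closure Ω := by
  rw [← 𝒯.cover]
  exact subset_iUnion (fun K => Icc (𝒯.lo K) (𝒯.hi K)) K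

theorem isOpen_face (b : Bool) (i : Fin (n + 1)) (K L : Fin 𝒯.n) : IsOpen (𝒯.face b i K L) := by
  by_cases h : 𝒯.pos b i K = 𝒯.pos (!b) i L
  · have : 𝒯.face b i K L = 𝒯.side i K ∩ 𝒯.side i L := by ext y; simp [face, h]
    rw [this]
    exact (isOpen_openBox _ _).inter (isOpen_openBox _ _)
  · have : 𝒯.face b i K L = ∅ := by ext y; simp [face, h]
    rw [this]; exact isOpen_empty

theorem measurableSet_wall (b : Bool) (i : Fin (n + 1)) (K : Fin 𝒯.n) :
    MeasurableSet (𝒯.wall b i K) :=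
  (isOpen_openBox _ _).measurableSet.diff
    (MeasurableSet.iUnion fun L => (𝒯.isOpen_face b i K L).measurableSet)

/-- Two cells whose projections meet and that touch the same hyperplane from the same side
coincide. -/
theorem eq_of_pos_eq {b : Bool} {i : Fin (n + 1)} {K L : Fin 𝒯.n} {y : Fin n → ℝ}
    (hK : y ∈ 𝒯.side i K) (hL : y ∈ 𝒯.side i L) (h : 𝒯.pos b i K = 𝒯.pos b i L) : K = L := by
  have h1 := 𝒯.lo_lt_hi K i
  have h2 := 𝒯.lo_lt_hi L i
  cases b
  · replace h : 𝒯.lo K i = 𝒯.lo L i := h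
    refine 𝒯.cell_disjoint (x := ins i ((𝒯.lo K i + min (𝒯.hi K i) (𝒯.hi L i)) / 2) y)
      (mem_openBox_ins.2 ⟨?_, hK⟩) (mem_openBox_ins.2 ⟨?_, hL⟩)
    all_goals
      have h3 := min_le_left (𝒯.hi K i) (𝒯.hi L i)
      have h4 := min_le_right (𝒯.hi K i) (𝒯.hi L i)
      have h5 : 𝒯.lo K i < min (𝒯.hi K i) (𝒯.hi L i) := lt_min h1 (h ▸ h2)
      constructor <;> linarith
  · replace h : 𝒯.hi K i = 𝒯.hi L i := h
    refine 𝒯.cell_disjoint (x := ins i ((𝒯.hi K i + max (𝒯.lo K i) (𝒯.lo L i)) / 2) y)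
      (mem_openBox_ins.2 ⟨?_, hK⟩) (mem_openBox_ins.2 ⟨?_, hL⟩)
    all_goals
      have h3 := le_max_left (𝒯.lo K i) (𝒯.lo L i)
      have h4 := le_max_right (𝒯.lo K i) (𝒯.lo L i)
      have h5 : max (𝒯.lo K i) (𝒯.lo L i) < 𝒯.hi K i := max_lt h1 (h ▸ h2)
      constructor <;> linarith

theorem face_disjoint (b : Bool) (i : Fin (n + 1)) (K : Fin 𝒯.n) :
    Pairwise (Function.onFun Disjoint (𝒯.face b i K)) := by
  intro L L' hne
  refine Set.disjoint_left.2 fun y hy hy' => hne ?_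
  exact 𝒯.eq_of_pos_eq hy.2.2 hy'.2.2 (hy.1.symm.trans hy'.1)

theorem iUnion_face_subset (b : Bool) (i : Fin (n + 1)) (K : Fin 𝒯.n) :
    ⋃ L, 𝒯.face b i K L ⊆ 𝒯.side i K := iUnion_subset fun _ _ hy => hy.2.1

theorem face_comm (i : Fin (n + 1)) (K L : Fin 𝒯.n) : 𝒯.face false i K L = 𝒯.face true i L K := by
  ext y
  simp only [face, mem_ofPred_eq, Bool.not_false, Bool.not_true]
  constructor
  · rintro ⟨h1, h2, h3⟩; exact ⟨h1.symm, h3, h2⟩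
  · rintro ⟨h1, h2, h3⟩; exact ⟨h1.symm, h3, h2⟩

theorem measureReal_openBox {m : ℕ} (lo hi : Fin m → ℝ) :
    volume.real (openBox lo hi) = ∏ j, max 0 (hi j - lo j) := by
  rw [Measure.real, openBox, Real.volume_pi_Ioo, ENNReal.toReal_prod]
  exact Finset.prod_congr rfl fun j _ => by rw [ENNReal.toReal_ofReal', max_comm]

theorem prod_erase_eq (i : Fin (n + 1)) (a : Fin (n + 1) → ℝ) :
    ∏ j ∈ Finset.univ.erase i, a j = ∏ j, a (i.succAbove j) := by
  rw [Fin.univ_succAbove n i, Finset.erase_cons, Finset.prod_map]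
  rfl

theorem measureReal_side (i : Fin (n + 1)) (K : Fin 𝒯.n) :
    volume.real (𝒯.side i K) = 𝒯.sideArea i K := by
  rw [side, measureReal_openBox, sideArea, prod_erase_eq i (fun j => 𝒯.hi K j - 𝒯.lo K j)]
  exact Finset.prod_congr rfl fun j _ => max_eq_right (sub_nonneg.2 (𝒯.lo_lt_hi K _).le)

theorem measureReal_face (i : Fin (n + 1)) (K L : Fin 𝒯.n) :
    volume.real (𝒯.face true i K L) = 𝒯.faceArea i K L := by
  rw [faceArea]
  split_ifs with h
  · have : 𝒯.face true i K L
        = openBox (fun j => max (𝒯.lo K (i.succAbove j)) (𝒯.lo L (i.succAbove j)))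
          (fun j => min (𝒯.hi K (i.succAbove j)) (𝒯.hi L (i.succAbove j))) := by
      ext y
      have h' : 𝒯.pos true i K = 𝒯.pos (!true) i L := h
      simp only [face, mem_ofPred_eq, h', true_and, side, mem_openBox, max_lt_iff, lt_min_iff]
      constructor
      · rintro ⟨h1, h2⟩ j; exact ⟨⟨(h1 j).1, (h2 j).1⟩, (h1 j).2, (h2 j).2⟩
      · intro h1; exact ⟨fun j => ⟨(h1 j).1.1, (h1 j).2.1⟩, fun j => ⟨(h1 j).1.2, (h1 j).2.2⟩⟩
    rw [this, measureReal_openBox, prod_erase_eq i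
      (fun j => max 0 (min (𝒯.hi K j) (𝒯.hi L j) - max (𝒯.lo K j) (𝒯.lo L j)))]
  · have : 𝒯.face true i K L = ∅ := by
      ext y; simp only [face, mem_ofPred_eq, mem_empty_iff_false, iff_false]
      rintro ⟨h1, -⟩; exact h h1
    rw [this]; simp

theorem side_volume_ne_top (i : Fin (n + 1)) (K : Fin 𝒯.n) : volume (𝒯.side i K) ≠ ⊤ :=
  ((measure_mono (openBox_subset_Icc _ _)).trans_lt isCompact_Icc.measure_lt_top).ne

theorem setIntegral_side (b : Bool) (i : Fin (n + 1)) (K : Fin 𝒯.n) {g : (Fin n → ℝ) → ℝ}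
    (hg : IntegrableOn g (𝒯.side i K)) :
    ∫ y in 𝒯.side i K, g y
      = (∑ L, ∫ y in 𝒯.face b i K L, g y) + ∫ y in 𝒯.wall b i K, g y := by
  have hm : MeasurableSet (⋃ L, 𝒯.face b i K L) :=
    MeasurableSet.iUnion fun L => (𝒯.isOpen_face b i K L).measurableSet
  have hs := 𝒯.iUnion_face_subset b i K
  rw [← integral_iUnion_fintype (fun L => (𝒯.isOpen_face b i K L).measurableSet)
    (𝒯.face_disjoint b i K) fun L => hg.mono_set ((subset_iUnion _ L).trans hs), wall,
    setIntegral_sdiff hm hg hs]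
  ring

theorem measureReal_wall_true (i : Fin (n + 1)) (K : Fin 𝒯.n) :
    volume.real (𝒯.wall true i K) = 𝒯.wallAreaR i K := by
  have h := 𝒯.setIntegral_side true i K (g := fun _ => (1 : ℝ))
    (integrableOn_const (𝒯.side_volume_ne_top i K))
  simp only [setIntegral_const, smul_eq_mul, mul_one, measureReal_side, measureReal_face] at h
  rw [wallAreaR]; linarith

theorem measureReal_wall_false (i : Fin (n + 1)) (K : Fin 𝒯.n) :
    volume.real (𝒯.wall false i K) = 𝒯.wallAreaL i K := by
  have h := 𝒯.setIntegral_side false i K (g := fun _ => (1 : ℝ))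
    (integrableOn_const (𝒯.side_volume_ne_top i K))
  simp only [setIntegral_const, smul_eq_mul, mul_one, measureReal_side, face_comm,
    measureReal_face] at h
  rw [wallAreaL]; linarith

theorem faceArea_nonneg (i : Fin (n + 1)) (K L : Fin 𝒯.n) : 0 ≤ 𝒯.faceArea i K L := by
  rw [← measureReal_face]; exact measureReal_nonneg

theorem wallAreaR_nonneg (i : Fin (n + 1)) (K : Fin 𝒯.n) : 0 ≤ 𝒯.wallAreaR i K := by
  rw [← measureReal_wall_true]; exact measureReal_nonneg

theorem wallAreaL_nonneg (i : Fin (n + 1)) (K : Fin 𝒯.n) : 0 ≤ 𝒯.wallAreaL i K := by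
  rw [← measureReal_wall_false]; exact measureReal_nonneg

/-- Points of the side that do not lie on the boundary of any other side. -/
theorem ae_generic (i : Fin (n + 1)) : ∀ᵐ y : Fin n → ℝ, ∀ (L : Fin 𝒯.n) (j : Fin n),
    y j ≠ drop i (𝒯.lo L) j ∧ y j ≠ drop i (𝒯.hi L) j := by
  refine ae_all_iff.2 fun L => ae_all_iff.2 fun j => ?_
  filter_upwards [Measure.ae_eval_ne (μ := fun _ : Fin n => (volume : Measure ℝ)) j
    (drop i (𝒯.lo L) j), Measure.ae_eval_ne (μ := fun _ : Fin n => (volume : Measure ℝ)) j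
    (drop i (𝒯.hi L) j)] with y h1 h2 using ⟨h1, h2⟩

theorem pos_mem_Icc (b : Bool) (i : Fin (n + 1)) (K : Fin 𝒯.n) :
    𝒯.pos b i K ∈ Icc (𝒯.lo K i) (𝒯.hi K i) := by
  cases b
  · exact ⟨le_rfl, (𝒯.lo_lt_hi K i).le⟩
  · exact ⟨(𝒯.lo_lt_hi K i).le, le_rfl⟩

/-- A generic wall point belongs to one closed cell only. -/
theorem eq_of_wall_mem_Icc {b : Bool} {i : Fin (n + 1)} {K L : Fin 𝒯.n} {y : Fin n → ℝ}
    (hy : ∀ (L : Fin 𝒯.n) (j : Fin n), y j ≠ drop i (𝒯.lo L) j ∧ y j ≠ drop i (𝒯.hi L) j)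
    (hK : y ∈ 𝒯.wall b i K) (hL : ins i (𝒯.pos b i K) y ∈ Icc (𝒯.lo L) (𝒯.hi L)) : L = K := by
  obtain ⟨hs, hyL⟩ := mem_Icc_ins.1 hL
  have hsL : y ∈ 𝒯.side i L := mem_openBox.2 fun j =>
    ⟨(hyL.1 j).lt_of_ne (hy L j).1.symm, (hyL.2 j).lt_of_ne (hy L j).2⟩
  have hne : 𝒯.pos b i K ≠ 𝒯.pos (!b) i L := fun h =>
    hK.2 (mem_iUnion.2 ⟨L, h, hK.1, hsL⟩)
  have h1 := 𝒯.lo_lt_hi K i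
  cases b
  · have h2 : 𝒯.lo K i < 𝒯.hi L i := lt_of_le_of_ne hs.2 hne
    have h3 : 𝒯.lo L i ≤ 𝒯.lo K i := hs.1
    have h4 := min_le_left (𝒯.hi K i) (𝒯.hi L i)
    have h5 := min_le_right (𝒯.hi K i) (𝒯.hi L i)
    have h6 : 𝒯.lo K i < min (𝒯.hi K i) (𝒯.hi L i) := lt_min h1 h2
    refine 𝒯.cell_disjoint (x := ins i ((𝒯.lo K i + min (𝒯.hi K i) (𝒯.hi L i)) / 2) y)
      (mem_openBox_ins.2 ⟨⟨?_, ?_⟩, hsL⟩) (mem_openBox_ins.2 ⟨⟨?_, ?_⟩, hK.1⟩) <;> linarith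
  · have h2 : 𝒯.lo L i < 𝒯.hi K i := lt_of_le_of_ne hs.1 (fun h => hne h.symm)
    have h3 : 𝒯.hi K i ≤ 𝒯.hi L i := hs.2
    have h4 := le_max_left (𝒯.lo K i) (𝒯.lo L i)
    have h5 := le_max_right (𝒯.lo K i) (𝒯.lo L i)
    have h6 : max (𝒯.lo K i) (𝒯.lo L i) < 𝒯.hi K i := max_lt h1 h2
    refine 𝒯.cell_disjoint (x := ins i ((𝒯.hi K i + max (𝒯.lo K i) (𝒯.lo L i)) / 2) y)
      (mem_openBox_ins.2 ⟨⟨?_, ?_⟩, hsL⟩) (mem_openBox_ins.2 ⟨⟨?_, ?_⟩, hK.1⟩) <;> linarith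

/-- `x` lies on the inner side `b` of the hyperplane at `s`. -/
def Inner (b : Bool) (x s : ℝ) : Prop := bif b then x < s else s < x

/-- Near a generic wall point, the domain is a half space. -/
theorem eventually_mem_iff (hΩ : interior (closure Ω) = Ω) {b : Bool} {i : Fin (n + 1)}
    {K : Fin 𝒯.n} {y : Fin n → ℝ}
    (hy : ∀ (L : Fin 𝒯.n) (j : Fin n), y j ≠ drop i (𝒯.lo L) j ∧ y j ≠ drop i (𝒯.hi L) j)
    (hK : y ∈ 𝒯.wall b i K) :
    ∀ᶠ z in 𝓝 (ins i (𝒯.pos b i K) y), z ∈ Ω ↔ Inner b (z i) (𝒯.pos b i K) := by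
  set x := ins i (𝒯.pos b i K) y with hx
  have hxi : x i = 𝒯.pos b i K := by simp [hx]
  have hlt := 𝒯.lo_lt_hi K i
  have hN : ∀ᶠ z in 𝓝 x, ∀ L, L ≠ K → z ∉ Icc (𝒯.lo L) (𝒯.hi L) := by
    rw [eventually_all]
    intro L
    by_cases hL : L = K
    · exact Eventually.of_forall fun z h => absurd hL h
    · have : x ∉ Icc (𝒯.lo L) (𝒯.hi L) := fun h => hL (𝒯.eq_of_wall_mem_Icc hy hK h)
      filter_upwards [isClosed_Icc.isOpen_compl.mem_nhds this] with z hz _ using hz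
  have hS : ∀ᶠ z in 𝓝 x, ∀ j, z (i.succAbove j) ∈ Ioo (drop i (𝒯.lo K) j) (drop i (𝒯.hi K) j) := by
    rw [eventually_all]
    intro j
    have h1 : x (i.succAbove j) ∈ Ioo (drop i (𝒯.lo K) j) (drop i (𝒯.hi K) j) := by
      have := mem_openBox.1 hK.1 j
      simpa [hx] using this
    exact (continuous_apply (i.succAbove j)).continuousAt.preimage_mem_nhds
      (isOpen_Ioo.mem_nhds h1)
  have hopp : ∀ᶠ z in 𝓝 x, Inner (!b) (z i) (𝒯.pos (!b) i K) := by
    have hc : ContinuousAt (fun z : Fin (n + 1) → ℝ => z i) x := (continuous_apply i).continuousAt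
    cases b
    · exact hc.eventually_lt continuousAt_const (by rw [hxi]; exact hlt)
    · exact continuousAt_const.eventually_lt hc (by rw [hxi]; exact hlt)
  have hcell : ∀ z : Fin (n + 1) → ℝ,
      (∀ j, z (i.succAbove j) ∈ Ioo (drop i (𝒯.lo K) j) (drop i (𝒯.hi K) j)) →
      Inner (!b) (z i) (𝒯.pos (!b) i K) → Inner b (z i) (𝒯.pos b i K) → z ∈ 𝒯.cell K := by
    intro z h1 h2 h3
    refine mem_openBox.2 ((Fin.forall_iff_succAbove i).2 ⟨?_, fun j => h1 j⟩)
    cases b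
    · exact ⟨h3, h2⟩
    · exact ⟨h2, h3⟩
  filter_upwards [hN.eventually_nhds, hS, hopp] with z hz1 hz2 hz3
  constructor
  · intro hzΩ
    have hzI : ∀ᶠ w in 𝓝 z, w ∈ Icc (𝒯.lo K) (𝒯.hi K) := by
      rw [← hΩ] at hzΩ
      filter_upwards [hz1, mem_interior_iff_mem_nhds.1 hzΩ] with w h1 h2
      rw [← 𝒯.cover] at h2
      obtain ⟨L, hL⟩ := mem_iUnion.1 h2
      by_cases hLK : L = K
      · rwa [hLK] at hL
      · exact absurd hL (h1 L hLK)
    have hpath : Tendsto (fun ε : ℝ => z + ε • (Pi.single i 1 : Fin (n + 1) → ℝ)) (𝓝 0) (𝓝 z) := by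
      have : Continuous fun ε : ℝ => z + ε • (Pi.single i 1 : Fin (n + 1) → ℝ) := by fun_prop
      simpa using this.tendsto 0
    have hev := hpath.eventually hzI
    cases b
    · obtain ⟨ε, h1, h2⟩ := ((hev.filter_mono nhdsWithin_le_nhds).and
        (self_mem_nhdsWithin (s := Iio (0 : ℝ)))).exists
      have := h1.1 i
      simp at this
      have h2 : ε < 0 := h2
      show 𝒯.lo K i < z i
      linarith
    · obtain ⟨ε, h1, h2⟩ := ((hev.filter_mono nhdsWithin_le_nhds).and
        (self_mem_nhdsWithin (s := Ioi (0 : ℝ)))).exists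
      have := h1.2 i
      simp at this
      have h2 : 0 < ε := h2
      show z i < 𝒯.hi K i
      linarith
  · intro h
    exact 𝒯.cell_subset hΩ K (hcell z hz2 hz3 h)

theorem wall_mem_Icc {b : Bool} {i : Fin (n + 1)} {K : Fin 𝒯.n} {y : Fin n → ℝ}
    (hK : y ∈ 𝒯.side i K) : ins i (𝒯.pos b i K) y ∈ Icc (𝒯.lo K) (𝒯.hi K) :=
  mem_Icc_ins.2 ⟨𝒯.pos_mem_Icc b i K, openBox_subset_Icc _ _ hK⟩

theorem hasNormalAlong_wall (hΩ : interior (closure Ω) = Ω) {b : Bool} {i : Fin (n + 1)}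
    {K : Fin 𝒯.n} {y : Fin n → ℝ}
    (hy : ∀ (L : Fin 𝒯.n) (j : Fin n), y j ≠ drop i (𝒯.lo L) j ∧ y j ≠ drop i (𝒯.hi L) j)
    (hK : y ∈ 𝒯.wall b i K) : ins i (𝒯.pos b i K) y ∈ frontier Ω ∧
      HasNormalAlong Ω i (ins i (𝒯.pos b i K) y) := by
  have h := 𝒯.eventually_mem_iff hΩ hy hK
  have hxi : ins i (𝒯.pos b i K) y i = 𝒯.pos b i K := by simp
  refine ⟨⟨𝒯.Icc_subset_closure K (𝒯.wall_mem_Icc hK.1), fun hint => ?_⟩, ?_⟩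
  · have h1 := h.self_of_nhds.1 (interior_subset hint)
    rw [hxi] at h1
    cases b <;> exact lt_irrefl _ h1
  · rw [HasNormalAlong, hxi]
    cases b
    · exact Or.inr h
    · exact Or.inl h

/-- A generic wall point lies on a side, with the same outer normal, of a cell of any other
mesh. -/
theorem exists_side_of_wall (hΩ : interior (closure Ω) = Ω) (𝒯₀ : RectMesh (n + 1) Ω) {b : Bool}
    {i : Fin (n + 1)} {K : Fin 𝒯.n} {y : Fin n → ℝ}
    (hy : ∀ (L : Fin 𝒯.n) (j : Fin n), y j ≠ drop i (𝒯.lo L) j ∧ y j ≠ drop i (𝒯.hi L) j)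
    (hK : y ∈ 𝒯.wall b i K) : ∃ K₀ : Fin 𝒯₀.n, 𝒯₀.pos b i K₀ = 𝒯.pos b i K ∧
      y ∈ Icc (drop i (𝒯₀.lo K₀)) (drop i (𝒯₀.hi K₀)) := by
  have hcl := 𝒯.Icc_subset_closure K (𝒯.wall_mem_Icc (b := b) hK.1)
  rw [← 𝒯₀.cover] at hcl
  obtain ⟨K₀, hK₀⟩ := mem_iUnion.1 hcl
  obtain ⟨hs, hyK⟩ := mem_Icc_ins.1 hK₀
  refine ⟨K₀, ?_, hyK⟩
  have h := 𝒯.eventually_mem_iff hΩ hy hK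
  set x := ins i (𝒯.pos b i K) y with hx
  have hxi : x i = 𝒯.pos b i K := by simp [hx]
  by_contra hne
  -- a point of the open cell of the other mesh on the outer side
  set c : Fin (n + 1) → ℝ := fun j => (𝒯₀.lo K₀ j + 𝒯₀.hi K₀ j) / 2 with hc
  set c' : Fin (n + 1) → ℝ := Function.update c i ((𝒯.pos b i K + 𝒯₀.pos b i K₀) / 2) with hc'
  have hcmem : c' ∈ 𝒯₀.cell K₀ := by
    refine mem_openBox.2 fun j => ?_
    have h0 := 𝒯₀.lo_lt_hi K₀
    by_cases hj : j = i
    · subst hj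
      have h1 := h0 j
      rw [hc', Function.update_self]
      cases b
      · have e1 : 𝒯₀.lo K₀ j < 𝒯.lo K j := lt_of_le_of_ne hs.1 hne
        have e2 : 𝒯.lo K j ≤ 𝒯₀.hi K₀ j := hs.2
        simp only [pos, cond_false]
        constructor <;> linarith
      · have e1 : 𝒯.hi K j < 𝒯₀.hi K₀ j := lt_of_le_of_ne hs.2 (Ne.symm hne)
        have e2 : 𝒯₀.lo K₀ j ≤ 𝒯.hi K j := hs.1
        simp only [pos, cond_true]
        constructor <;> linarith
    · rw [hc', Function.update_of_ne hj, hc]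
      have := h0 j
      constructor <;> simp only <;> linarith
  have hconv : ∀ ε ∈ Ioc (0 : ℝ) 1, x + ε • (c' - x) ∈ 𝒯₀.cell K₀ := by
    intro ε hε
    refine mem_openBox.2 fun j => ?_
    have h1 := mem_openBox.1 hcmem j
    have h2 : 𝒯₀.lo K₀ j ≤ x j := hK₀.1 j
    have h3 : x j ≤ 𝒯₀.hi K₀ j := hK₀.2 j
    simp only [Pi.add_apply, Pi.smul_apply, Pi.sub_apply, smul_eq_mul]
    constructor
    · nlinarith [mul_pos hε.1 (sub_pos.2 h1.1), mul_nonneg (sub_nonneg.2 hε.2) (sub_nonneg.2 h2)]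
    · nlinarith [mul_pos hε.1 (sub_pos.2 h1.2), mul_nonneg (sub_nonneg.2 hε.2) (sub_nonneg.2 h3)]
  have hpath : Tendsto (fun ε : ℝ => x + ε • (c' - x)) (𝓝[>] 0) (𝓝 x) := by
    have : Continuous fun ε : ℝ => x + ε • (c' - x) := by fun_prop
    have h1 := this.tendsto 0
    rw [zero_smul, add_zero] at h1
    exact h1.mono_left nhdsWithin_le_nhds
  obtain ⟨ε, h1, hε⟩ := ((hpath.eventually h).and (Ioo_mem_nhdsGT zero_lt_one)).exists
  have h2 := h1.1 (𝒯₀.cell_subset hΩ K₀ (hconv ε ⟨hε.1, hε.2.le⟩))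
  have h3 : (x + ε • (c' - x)) i
      = 𝒯.pos b i K + ε * ((𝒯₀.pos b i K₀ - 𝒯.pos b i K) / 2) := by
    simp only [Pi.add_apply, Pi.smul_apply, Pi.sub_apply, smul_eq_mul, hxi, hc',
      Function.update_self]
    ring
  rw [h3] at h2
  cases b
  · have e1 : 𝒯₀.lo K₀ i < 𝒯.lo K i := lt_of_le_of_ne hs.1 hne
    have h2 : 𝒯.lo K i < 𝒯.lo K i + ε * ((𝒯₀.lo K₀ i - 𝒯.lo K i) / 2) := h2
    nlinarith [mul_pos hε.1 (sub_pos.2 e1)]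
  · have e1 : 𝒯.hi K i < 𝒯₀.hi K₀ i := lt_of_le_of_ne hs.2 (Ne.symm hne)
    have h2 : 𝒯.hi K i + ε * ((𝒯₀.hi K₀ i - 𝒯.hi K i) / 2) < 𝒯.hi K i := h2
    nlinarith [mul_pos hε.1 (sub_pos.2 e1)]

theorem sum_wall_le (hΩ : interior (closure Ω) = Ω) (𝒯₀ : RectMesh (n + 1) Ω) (b : Bool)
    (i : Fin (n + 1)) : ∑ K, volume (𝒯.wall b i K)
      ≤ ∑ K₀, volume (Icc (drop i (𝒯₀.lo K₀)) (drop i (𝒯₀.hi K₀))) := by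
  classical
  have h1 : ∀ K, volume (𝒯.wall b i K) = ∫⁻ y, (𝒯.wall b i K).indicator 1 y := fun K =>
    (lintegral_indicator_one (𝒯.measurableSet_wall b i K)).symm
  have h2 : ∀ K₀, volume (Icc (drop i (𝒯₀.lo K₀)) (drop i (𝒯₀.hi K₀)))
      = ∫⁻ y, (Icc (drop i (𝒯₀.lo K₀)) (drop i (𝒯₀.hi K₀))).indicator 1 y := fun K₀ =>
    (lintegral_indicator_one measurableSet_Icc).symm
  simp only [h1, h2]
  rw [← lintegral_finsetSum _ fun K _ => measurable_one.indicator (𝒯.measurableSet_wall b i K),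
    ← lintegral_finsetSum _ fun K₀ _ => measurable_one.indicator measurableSet_Icc]
  refine lintegral_mono_ae ?_
  filter_upwards [𝒯.ae_generic i] with y hy
  by_cases hN : Nonempty (Fin 𝒯₀.n)
  swap
  · have h0 : ∀ K, y ∉ 𝒯.wall b i K := fun K hK =>
      hN ⟨(𝒯.exists_side_of_wall hΩ 𝒯₀ hy hK).choose⟩
    simp [h0]
  choose! k hk using fun K (hK : y ∈ 𝒯.wall b i K) => 𝒯.exists_side_of_wall hΩ 𝒯₀ hy hK
  have e1 : ∑ K, (𝒯.wall b i K).indicator (1 : (Fin n → ℝ) → ENNReal) y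
      = ((Finset.univ.filter fun K => y ∈ 𝒯.wall b i K).card : ENNReal) := by
    simp [Set.indicator_apply]
  have e2 : ∑ K₀, (Icc (drop i (𝒯₀.lo K₀)) (drop i (𝒯₀.hi K₀))).indicator
      (1 : (Fin n → ℝ) → ENNReal) y
      = ((Finset.univ.filter fun K₀ => y ∈ Icc (drop i (𝒯₀.lo K₀)) (drop i (𝒯₀.hi K₀))).card
        : ENNReal) := by
    simp [Set.indicator_apply]
  rw [e1, e2]
  refine Nat.cast_le.2 (Finset.card_le_card_of_injOn k (fun K hK => ?_) fun K hK L hL hKL => ?_)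
  · simp only [Finset.coe_filter, Finset.mem_univ, true_and, mem_ofPred_eq] at hK ⊢
    exact (hk K hK).2
  · simp only [Finset.coe_filter, Finset.mem_univ, true_and, mem_ofPred_eq] at hK hL
    refine 𝒯.eq_of_pos_eq hK.1 hL.1 (b := b) ?_
    rw [← (hk K hK).1, ← (hk L hL).1, hKL]

/-- The area of the boundary seen by a mesh is bounded in terms of the domain. -/
theorem exists_wallArea_le (hΩ : interior (closure Ω) = Ω) : ∃ C : ℝ, 0 ≤ C ∧
    ∀ 𝒯 : RectMesh (n + 1) Ω, ∀ i, ∑ K, 𝒯.wallAreaR i K ≤ C ∧ ∑ K, 𝒯.wallAreaL i K ≤ C := by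
  by_cases hne : Nonempty (RectMesh (n + 1) Ω)
  swap
  · exact ⟨0, le_rfl, fun 𝒯 => absurd ⟨𝒯⟩ hne⟩
  obtain ⟨𝒯₀⟩ := hne
  have hfin : ∀ i, ∑ K₀, volume (Icc (drop i (𝒯₀.lo K₀)) (drop i (𝒯₀.hi K₀))) ≠ ⊤ := fun i =>
    ENNReal.sum_ne_top.2 fun K₀ _ => isCompact_Icc.measure_lt_top.ne
  have key : ∀ (𝒯 : RectMesh (n + 1) Ω) (b : Bool) (i : Fin (n + 1)),
      ∑ K, volume.real (𝒯.wall b i K)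
        ≤ (∑ K₀, volume (Icc (drop i (𝒯₀.lo K₀)) (drop i (𝒯₀.hi K₀)))).toReal := by
    intro 𝒯 b i
    have h1 := 𝒯.sum_wall_le hΩ 𝒯₀ b i
    have h2 := ENNReal.toReal_mono (hfin i) h1
    have h3 : ∀ K ∈ Finset.univ, volume (𝒯.wall b i K) ≠ ⊤ := fun K _ =>
      ((measure_mono sdiff_subset).trans_lt (𝒯.side_volume_ne_top i K).lt_top).ne
    rwa [ENNReal.toReal_sum h3] at h2
  refine ⟨∑ i, (∑ K₀, volume (Icc (drop i (𝒯₀.lo K₀)) (drop i (𝒯₀.hi K₀)))).toReal,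
    Finset.sum_nonneg fun i _ => ENNReal.toReal_nonneg, fun 𝒯 i => ?_⟩
  have hle : (∑ K₀, volume (Icc (drop i (𝒯₀.lo K₀)) (drop i (𝒯₀.hi K₀)))).toReal
      ≤ ∑ i, (∑ K₀, volume (Icc (drop i (𝒯₀.lo K₀)) (drop i (𝒯₀.hi K₀)))).toReal :=
    Finset.single_le_sum
      (f := fun i => (∑ K₀, volume (Icc (drop i (𝒯₀.lo K₀)) (drop i (𝒯₀.hi K₀)))).toReal)
      (fun i _ => ENNReal.toReal_nonneg) (Finset.mem_univ i)
  have h1 := (key 𝒯 true i).trans hle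
  have h2 := (key 𝒯 false i).trans hle
  simp only [measureReal_wall_true] at h1
  simp only [measureReal_wall_false] at h2
  exact ⟨h1, h2⟩

theorem abs_setIntegral_sub_le {S : Set (Fin n → ℝ)}
    (hv : volume S ≠ ⊤) {g : (Fin n → ℝ) → ℝ} (hg : IntegrableOn g S) {c B : ℝ}
    (hB : ∀ y ∈ S, |g y - c| ≤ B) :
    |(∫ y in S, g y) - volume.real S * c| ≤ volume.real S * B := by
  have h1 : (∫ y in S, g y) - volume.real S * c = ∫ y in S, (g y - c) := by
    rw [integral_sub hg (integrableOn_const hv), setIntegral_const, smul_eq_mul]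
  rw [h1, mul_comm]
  exact norm_setIntegral_le_of_norm_le_const (f := fun y => g y - c) hv.lt_top hB

/-- The divergence theorem on the cells of a mesh: integrals of the normal derivative are sums of
face and wall integrals. -/
theorem exists_face_integrals (hΩ : interior (closure Ω) = Ω) (i : Fin (n + 1))
    {f : (Fin (n + 1) → ℝ) → ℝ} {C : NNReal}
    (hf : ∀ K, LipschitzOnWith C f (Icc (𝒯.lo K) (𝒯.hi K))) :
    ∃ (φ : Fin 𝒯.n → Fin 𝒯.n → ℝ) (ωR ωL : Fin 𝒯.n → ℝ),
      (∀ K, ∫ x in Icc (𝒯.lo K) (𝒯.hi K), fderiv ℝ f x (Pi.single i 1)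
        = (∑ L, φ K L + ωR K) - (∑ L, φ L K + ωL K)) ∧
      (∀ K c B, (∀ x ∈ Icc (𝒯.lo K) (𝒯.hi K), |f x - c| ≤ B) →
        (∀ L, |φ K L - 𝒯.faceArea i K L * c| ≤ 𝒯.faceArea i K L * B ∧
          |φ L K - 𝒯.faceArea i L K * c| ≤ 𝒯.faceArea i L K * B) ∧
        |ωR K - 𝒯.wallAreaR i K * c| ≤ 𝒯.wallAreaR i K * B ∧
        |ωL K - 𝒯.wallAreaL i K * c| ≤ 𝒯.wallAreaL i K * B) ∧
      ((∀ x ∈ frontier Ω, HasNormalAlong Ω i x → f x = 0) → ∀ K, ωR K = 0 ∧ ωL K = 0) := by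
  have hint : ∀ b K, IntegrableOn (fun y => f (ins i (𝒯.pos b i K) y)) (𝒯.side i K) := by
    intro b K
    have hc : ContinuousOn (fun y => f (ins i (𝒯.pos b i K) y))
        (Icc (drop i (𝒯.lo K)) (drop i (𝒯.hi K))) := by
      refine (hf K).continuousOn.comp ?_ fun y hy => mem_Icc_ins.2 ⟨𝒯.pos_mem_Icc b i K, hy⟩
      exact ((continuous_ins i).comp (Continuous.prodMk_right (𝒯.pos b i K))).continuousOn
    exact (hc.integrableOn_compact isCompact_Icc).mono_set (openBox_subset_Icc _ _)
  have hfs : ∀ b K L, 𝒯.face b i K L ⊆ 𝒯.side i K := fun b K L y hy => hy.2.1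
  have hws : ∀ b K, 𝒯.wall b i K ⊆ 𝒯.side i K := fun b K => sdiff_subset
  have hvol : ∀ {K} {S : Set (Fin n → ℝ)}, S ⊆ 𝒯.side i K → volume S ≠ ⊤ := fun {K} {S} h =>
    ((measure_mono h).trans_lt (𝒯.side_volume_ne_top i K).lt_top).ne
  set φ : Bool → Fin 𝒯.n → Fin 𝒯.n → ℝ :=
    fun b K L => ∫ y in 𝒯.face b i K L, f (ins i (𝒯.pos b i K) y) with hφ
  set w : Bool → Fin 𝒯.n → ℝ := fun b K => ∫ y in 𝒯.wall b i K, f (ins i (𝒯.pos b i K) y) with hw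
  have hφc : ∀ K L, φ false K L = φ true L K := by
    intro K L
    simp only [hφ]
    rw [𝒯.face_comm]
    by_cases h : 𝒯.pos true i L = 𝒯.pos false i K
    · rw [h]
    · have : 𝒯.face true i L K = ∅ := by
        ext y; simp only [face, mem_ofPred_eq, mem_empty_iff_false, iff_false]
        rintro ⟨h1, -⟩; exact h h1
      rw [this]; simp
  have hφb : ∀ b K L c B, (∀ x ∈ Icc (𝒯.lo K) (𝒯.hi K), |f x - c| ≤ B) →
      |φ b K L - volume.real (𝒯.face b i K L) * c| ≤ volume.real (𝒯.face b i K L) * B := by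
    intro b K L c B hB
    exact abs_setIntegral_sub_le (hvol (hfs b K L))
      ((hint b K).mono_set (hfs b K L)) fun y hy => hB _ (𝒯.wall_mem_Icc (hfs b K L hy))
  have hwb : ∀ b K c B, (∀ x ∈ Icc (𝒯.lo K) (𝒯.hi K), |f x - c| ≤ B) →
      |w b K - volume.real (𝒯.wall b i K) * c| ≤ volume.real (𝒯.wall b i K) * B := by
    intro b K c B hB
    exact abs_setIntegral_sub_le (hvol (hws b K))
      ((hint b K).mono_set (hws b K)) fun y hy => hB _ (𝒯.wall_mem_Icc (hws b K hy))
  refine ⟨φ true, w true, w false, fun K => ?_, fun K c B hB => ⟨fun L => ⟨?_, ?_⟩, ?_, ?_⟩,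
    fun h0 K => ?_⟩
  · rw [integral_fderiv_single i (𝒯.lo_lt_hi K) (hf K),
      ← Measure.restrict_congr_set (openBox_ae_eq_Icc (drop i (𝒯.lo K)) (drop i (𝒯.hi K)))]
    refine (integral_sub (hint true K) (hint false K)).trans ?_
    have h1 := 𝒯.setIntegral_side true i K (hint true K)
    have h2 := 𝒯.setIntegral_side false i K (hint false K)
    have h3 : ∑ L, φ true L K = ∑ L, φ false K L := Finset.sum_congr rfl fun L _ => (hφc K L).symm
    rw [h3]
    exact congrArg₂ (· - ·) h1 h2
  · have := hφb true K L c B hB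
    rwa [measureReal_face] at this
  · have := hφb false K L c B hB
    rwa [hφc, face_comm, measureReal_face] at this
  · have := hwb true K c B hB
    rwa [measureReal_wall_true] at this
  · have := hwb false K c B hB
    rwa [measureReal_wall_false] at this
  · have hz : ∀ b, w b K = 0 := fun b => by
      refine setIntegral_eq_zero_of_ae_eq_zero ?_
      filter_upwards [𝒯.ae_generic i] with y hy hyK
      obtain ⟨h1, h2⟩ := 𝒯.hasNormalAlong_wall hΩ hy hyK
      exact h0 _ h1 h2
    exact ⟨hz true, hz false⟩

end RectMesh

/-! ### Net fluxes and discrete integration by parts -/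

namespace RectMesh

section NetFlux

variable {d : ℕ} {Ω : Set (Fin d → ℝ)} (𝒯 : RectMesh d Ω)

/-- Total flux in direction `e_i` out of the cell `K`, for values `g` on interior faces and `gR`,
`gL` on the boundary. -/
def netFlux {V : Type*} [AddCommGroup V] [Module ℝ V] (i : Fin d) (g : Fin 𝒯.n → Fin 𝒯.n → V)
    (gR gL : Fin 𝒯.n → V) (K : Fin 𝒯.n) : V :=
  (∑ L, 𝒯.faceArea i K L • g K L + 𝒯.wallAreaR i K • gR K)
    - (∑ L, 𝒯.faceArea i L K • g L K + 𝒯.wallAreaL i K • gL K)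

variable {V V' : Type*} [AddCommGroup V] [Module ℝ V] [AddCommGroup V'] [Module ℝ V']

theorem netFlux_map (e : V →ₗ[ℝ] V') (i : Fin d) (g : Fin 𝒯.n → Fin 𝒯.n → V)
    (gR gL : Fin 𝒯.n → V) (K : Fin 𝒯.n) :
    e (𝒯.netFlux i g gR gL K)
      = 𝒯.netFlux i (fun K L => e (g K L)) (fun K => e (gR K)) (fun K => e (gL K)) K := by
  simp [netFlux, map_sub, map_add, map_sum]

theorem netFlux_sub_const (i : Fin d) (g : Fin 𝒯.n → Fin 𝒯.n → V)
    (gR gL : Fin 𝒯.n → V) (K : Fin 𝒯.n) (c : V) :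
    𝒯.netFlux i (fun K L => g K L - c) (fun K => gR K - c) (fun K => gL K - c) K
      = 𝒯.netFlux i g gR gL K := by
  simp only [netFlux, smul_sub, Finset.sum_sub_distrib, ← Finset.sum_smul, wallAreaR, wallAreaL,
    sub_smul]
  abel

theorem cellVol_pos (K : Fin 𝒯.n) : 0 < 𝒯.cellVol K :=
  Finset.prod_pos fun j _ => sub_pos.2 (𝒯.lo_lt_hi K j)

theorem measureReal_Icc (K : Fin 𝒯.n) :
    volume.real (Icc (𝒯.lo K) (𝒯.hi K)) = 𝒯.cellVol K :=
  Real.volume_Icc_pi_toReal fun j => (𝒯.lo_lt_hi K j).le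

/-- The scheme, tested with the indicator function of a cell. -/
theorem cellVol_smul_eq (U' : Fin 𝒯.n → V) (F : Fin d → Fin 𝒯.n → Fin 𝒯.n → V)
    (FR FL : Fin d → Fin 𝒯.n → V)
    (h : ∀ φ : Fin 𝒯.n → ℝ,
      ∑ K, (𝒯.cellVol K * φ K) • U' K
        - ∑ i, ∑ K, ∑ L, (𝒯.faceArea i K L * (φ L - φ K)) • F i K L
        + ∑ i, ∑ K, ((𝒯.wallAreaR i K * φ K) • FR i K
            - (𝒯.wallAreaL i K * φ K) • FL i K) = 0) (K : Fin 𝒯.n) :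
    𝒯.cellVol K • U' K = -∑ i, 𝒯.netFlux i (F i) (FR i) (FL i) K := by
  have h1 := h (fun L => if L = K then 1 else 0)
  have e1 : ∑ K', (𝒯.cellVol K' * if K' = K then 1 else 0) • U' K' = 𝒯.cellVol K • U' K := by
    simp
  have e2 : ∀ i, ∑ K', ∑ L, (𝒯.faceArea i K' L *
      ((if L = K then 1 else 0) - (if K' = K then 1 else 0))) • F i K' L
      = ∑ L, 𝒯.faceArea i L K • F i L K - ∑ L, 𝒯.faceArea i K L • F i K L := by
    intro i
    simp only [mul_sub, sub_smul, Finset.sum_sub_distrib]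
    congr 1
    · simp
    · rw [Finset.sum_comm]; simp
  have e3 : ∀ i, ∑ K', ((𝒯.wallAreaR i K' * if K' = K then 1 else 0) • FR i K'
            - (𝒯.wallAreaL i K' * if K' = K then 1 else 0) • FL i K')
      = 𝒯.wallAreaR i K • FR i K - 𝒯.wallAreaL i K • FL i K := by
    intro i
    rw [Finset.sum_sub_distrib]; simp
  rw [e1, Finset.sum_congr rfl fun i _ => e2 i, Finset.sum_congr rfl fun i _ => e3 i] at h1
  rw [eq_neg_iff_add_eq_zero, ← h1]
  rw [sub_add, ← Finset.sum_sub_distrib, sub_eq_add_neg, ← Finset.sum_neg_distrib]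
  congr 1
  refine Finset.sum_congr rfl fun i _ => ?_
  simp only [netFlux]
  abel

end NetFlux

section Parts

variable {n : ℕ} {Ω : Set (Fin (n + 1) → ℝ)} (𝒯 : RectMesh (n + 1) Ω)

/-- Weighted deviation of face values from cell values. -/
def deviation (i : Fin (n + 1)) (g : Fin 𝒯.n → ℝ) (gV : Fin 𝒯.n → Fin 𝒯.n → ℝ)
    (gR gL : Fin 𝒯.n → ℝ) : ℝ :=
  ∑ K, ∑ L, 𝒯.faceArea i K L * (|gV K L - g K| + |gV K L - g L|)
    + ∑ K, (𝒯.wallAreaR i K * |gR K - g K| + 𝒯.wallAreaL i K * |gL K - g K|)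

theorem abs_sum_parts_le (hΩ : interior (closure Ω) = Ω) (i : Fin (n + 1))
    {f : (Fin (n + 1) → ℝ) → ℝ} {C : NNReal}
    (hf : ∀ K, LipschitzOnWith C f (Icc (𝒯.lo K) (𝒯.hi K))) {fbar : Fin 𝒯.n → ℝ} {b : ℝ}
    (hb : ∀ K, ∀ x ∈ Icc (𝒯.lo K) (𝒯.hi K), |f x - fbar K| ≤ b)
    (g : Fin 𝒯.n → ℝ) (gV : Fin 𝒯.n → Fin 𝒯.n → ℝ) (gR gL : Fin 𝒯.n → ℝ)
    (hbd : ((∀ K, 0 < 𝒯.wallAreaR i K → gR K = 0) ∧ ∀ K, 0 < 𝒯.wallAreaL i K → gL K = 0) ∨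
      ∀ x ∈ frontier Ω, HasNormalAlong Ω i x → f x = 0) :
    |(∑ K, g K * ∫ x in Icc (𝒯.lo K) (𝒯.hi K), fderiv ℝ f x (Pi.single i 1))
      + ∑ K, fbar K * 𝒯.netFlux i gV gR gL K| ≤ b * 𝒯.deviation i g gV gR gL := by
  obtain ⟨φ, wR, wL, h1, h2, h3⟩ := 𝒯.exists_face_integrals hΩ i hf
  have h2' := fun K => h2 K (fbar K) b (hb K)
  have hR : ∀ K, wR K * gR K = 0 := by
    intro K
    rcases hbd with hbd | hbd
    · rcases (𝒯.wallAreaR_nonneg i K).eq_or_lt with h0 | h0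
      · have := (h2' K).2.1
        rw [← h0, zero_mul, zero_mul, sub_zero] at this
        rw [abs_nonpos_iff.1 this, zero_mul]
      · rw [hbd.1 K h0, mul_zero]
    · rw [(h3 hbd K).1, zero_mul]
  have hL : ∀ K, wL K * gL K = 0 := by
    intro K
    rcases hbd with hbd | hbd
    · rcases (𝒯.wallAreaL_nonneg i K).eq_or_lt with h0 | h0
      · have := (h2' K).2.2
        rw [← h0, zero_mul, zero_mul, sub_zero] at this
        rw [abs_nonpos_iff.1 this, zero_mul]
      · rw [hbd.2 K h0, mul_zero]
    · rw [(h3 hbd K).2, zero_mul]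
  have e1 : ∑ K, g K * ∫ x in Icc (𝒯.lo K) (𝒯.hi K), fderiv ℝ f x (Pi.single i 1)
      = ∑ K, ∑ L, φ K L * (g K - g L) + ∑ K, (wR K - wL K) * g K := by
    have : ∑ K, ∑ L, φ K L * g L = ∑ K, ∑ L, φ L K * g K := Finset.sum_comm
    simp only [mul_sub (φ _ _), Finset.sum_sub_distrib, this, h1]
    rw [← Finset.sum_sub_distrib, ← Finset.sum_add_distrib]
    refine Finset.sum_congr rfl fun K _ => ?_
    rw [← Finset.sum_mul, ← Finset.sum_mul]
    ring
  have e2 : ∑ K, fbar K * 𝒯.netFlux i gV gR gL K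
      = ∑ K, ∑ L, 𝒯.faceArea i K L * (fbar K * (gV K L - g K) - fbar L * (gV K L - g L))
        + ∑ K, fbar K * (𝒯.wallAreaR i K * (gR K - g K) - 𝒯.wallAreaL i K * (gL K - g K)) := by
    have e3 : ∀ K, 𝒯.netFlux i gV gR gL K
        = ∑ L, 𝒯.faceArea i K L * (gV K L - g K) + 𝒯.wallAreaR i K * (gR K - g K)
          - (∑ L, 𝒯.faceArea i L K * (gV L K - g K) + 𝒯.wallAreaL i K * (gL K - g K)) := fun K =>
      (𝒯.netFlux_sub_const i gV gR gL K (g K)).symm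
    have e4 : ∑ K, ∑ L, 𝒯.faceArea i K L * (fbar L * (gV K L - g L))
        = ∑ K, ∑ L, 𝒯.faceArea i L K * (fbar K * (gV L K - g K)) := Finset.sum_comm
    simp only [mul_sub (𝒯.faceArea i _ _) (fbar _ * _) _, Finset.sum_sub_distrib, e4]
    rw [← Finset.sum_sub_distrib, ← Finset.sum_add_distrib]
    refine Finset.sum_congr rfl fun K _ => ?_
    rw [e3, mul_sub, mul_add, mul_add, Finset.mul_sum, Finset.mul_sum]
    have e5 : ∀ a c : ℝ, a * (fbar K * c) = fbar K * (a * c) := fun a c => by ring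
    simp only [e5]
    ring
  rw [e1, e2]
  have e6 : ∑ K, ∑ L, φ K L * (g K - g L) + ∑ K, (wR K - wL K) * g K
      + (∑ K, ∑ L, 𝒯.faceArea i K L * (fbar K * (gV K L - g K) - fbar L * (gV K L - g L))
        + ∑ K, fbar K * (𝒯.wallAreaR i K * (gR K - g K) - 𝒯.wallAreaL i K * (gL K - g K)))
      = ∑ K, ∑ L, (-(φ K L - 𝒯.faceArea i K L * fbar K) * (gV K L - g K)
          + (φ K L - 𝒯.faceArea i K L * fbar L) * (gV K L - g L))
        + ∑ K, (-(wR K - 𝒯.wallAreaR i K * fbar K) * (gR K - g K)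
          + (wL K - 𝒯.wallAreaL i K * fbar K) * (gL K - g K)) := by
    rw [add_add_add_comm, ← Finset.sum_add_distrib, ← Finset.sum_add_distrib]
    congr 1
    · refine Finset.sum_congr rfl fun K _ => ?_
      rw [← Finset.sum_add_distrib]
      exact Finset.sum_congr rfl fun L _ => by ring
    · refine Finset.sum_congr rfl fun K _ => ?_
      linear_combination (-1 : ℝ) * hL K + hR K
  rw [e6, deviation, mul_add, Finset.mul_sum, Finset.mul_sum]
  have hmul : ∀ {x A y : ℝ}, |x| ≤ A * b → |x * y| ≤ b * (A * |y|) := fun {x A y} hx => by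
    rw [abs_mul]
    calc |x| * |y| ≤ A * b * |y| := by gcongr
      _ = b * (A * |y|) := by ring
  refine (abs_add_le _ _).trans (add_le_add ?_ ?_)
  · refine (Finset.abs_sum_le_sum_abs _ _).trans (Finset.sum_le_sum fun K _ => ?_)
    rw [Finset.mul_sum]
    refine (Finset.abs_sum_le_sum_abs _ _).trans (Finset.sum_le_sum fun L _ => ?_)
    refine (abs_add_le _ _).trans ?_
    rw [mul_add, mul_add]
    refine add_le_add ?_ (hmul ((h2' L).1 K).2)
    rw [neg_mul, abs_neg]
    exact hmul ((h2' K).1 L).1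
  · refine (Finset.abs_sum_le_sum_abs _ _).trans (Finset.sum_le_sum fun K _ => ?_)
    refine (abs_add_le _ _).trans ?_
    rw [mul_add]
    refine add_le_add ?_ (hmul (h2' K).2.2)
    rw [neg_mul, abs_neg]
    exact hmul (h2' K).2.1

/-- The integral of a normal derivative vanishes for functions that vanish on the walls. -/
theorem sum_integral_fderiv_eq_zero (hΩ : interior (closure Ω) = Ω) (i : Fin (n + 1))
    {f : (Fin (n + 1) → ℝ) → ℝ} {C : NNReal}
    (hf : ∀ K, LipschitzOnWith C f (Icc (𝒯.lo K) (𝒯.hi K)))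
    (hbd : ∀ x ∈ frontier Ω, HasNormalAlong Ω i x → f x = 0) :
    ∑ K, ∫ x in Icc (𝒯.lo K) (𝒯.hi K), fderiv ℝ f x (Pi.single i 1) = 0 := by
  obtain ⟨φ, wR, wL, h1, -, h3⟩ := 𝒯.exists_face_integrals hΩ i hf
  have h : ∑ K, ∑ L, φ K L = ∑ K, ∑ L, φ L K := Finset.sum_comm
  simp only [h1, (h3 hbd _).1, (h3 hbd _).2, add_zero, Finset.sum_sub_distrib, h, sub_self]

end Parts

end RectMesh

/-! ### The relative energy production of a smooth Euler flow -/

section Production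

variable {d : ℕ} {γ : ℝ}

theorem thermoRel_eq_sub (hγ : 1 < γ) {ρ ϑ ρ' ϑ' : ℝ} (h : (0 < ρ ∧ 0 < ϑ))
    (hρ' : 0 < ρ') (hϑ' : 0 < ϑ') :
    (γ - 1) * thermoRel γ ρ ϑ ρ' ϑ' = ρ * ϑ - ρ * ϑ'
      - (γ - 1) * ϑ' * (ρ * (spEntropy γ ρ ϑ - spEntropy γ ρ' ϑ') + ρ - ρ') := by
  rw [spEntropy_sub h.1 h.2 hρ' hϑ', thermoRel]
  have : γ - 1 ≠ 0 := by linarith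
  field_simp
  ring

/-- Production of relative energy, in terms of the derivatives `ρt, ρx, ut, ux, ϑt, ϑx` of a
solution `(ρ, u, ϑ)` of the Euler system and a state `(R, R v, Θ)` with specific entropy `S`. -/
theorem production_eq {ρ ϑ R Θ S s ρt ϑt : ℝ} {u v ut ρx ϑx : Fin d → ℝ} {ux : Fin d → Fin d → ℝ}
    (hρ0 : ρ ≠ 0)
    (hρ : ρt + ∑ i, u i * ρx i + ρ * ∑ i, ux i i = 0)
    (hu : ∀ j, ρ * (ut j + ∑ i, u i * ux i j) + ρ * ϑx j + ϑ * ρx j = 0)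
    (hϑ : ϑt + ∑ i, u i * ϑx i + (γ - 1) * ϑ * ∑ i, ux i i = 0)
    {αt : ℝ} {αx : Fin d → ℝ}
    (hαt : αt = -∑ j, u j * ut j + (1 - s) * ϑt + ϑ * ρt / ρ)
    (hαx : ∀ i, αx i = -∑ j, u j * ux i j + (1 - s) * ϑx i + ϑ * ρx i / ρ) :
    (-αt * R - ∑ j, ut j * (R * v j) - ϑt * (R * S) + (ρt * ϑ + ρ * ϑt))
      + ∑ i, (-αx i * (R * v i) - ∑ j, ux i j * (v i * (R * v j) + if j = i then R * Θ else 0)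
          - ϑx i * (R * S * v i) + ((ρx i * ϑ + ρ * ϑx i) * u i + ρ * ϑ * ux i i))
      = -(R * Θ - R * ϑ - (γ - 1) * ϑ * (R * (S - s) + R - ρ)) * ∑ i, ux i i
        - R * (S - s) * ∑ i, (v i - u i) * ϑx i
        - R * ∑ i, ∑ j, (v i - u i) * (v j - u j) * ux i j := by
  have h1 : ∑ i, (-αx i * (R * v i)
      - ∑ j, ux i j * (v i * (R * v j) + if j = i then R * Θ else 0)
          - ϑx i * (R * S * v i) + ((ρx i * ϑ + ρ * ϑx i) * u i + ρ * ϑ * ux i i))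
      = R * ∑ i, ∑ j, v i * u j * ux i j - R * (1 - s + S) * ∑ i, v i * ϑx i
        - R * ϑ / ρ * ∑ i, v i * ρx i - R * ∑ i, ∑ j, v i * v j * ux i j
        - R * Θ * ∑ i, ux i i + ϑ * ∑ i, u i * ρx i + ρ * ∑ i, u i * ϑx i
        + ρ * ϑ * ∑ i, ux i i := by
    simp only [Finset.mul_sum, ← Finset.sum_add_distrib, ← Finset.sum_sub_distrib]
    refine Finset.sum_congr rfl fun i _ => ?_
    have e1 : ∑ j, ux i j * (v i * (R * v j) + if j = i then R * Θ else 0)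
        = ∑ j, R * (v i * v j * ux i j) + R * Θ * ux i i := by
      simp only [mul_add, Finset.sum_add_distrib, mul_ite, mul_zero, Finset.sum_ite_eq',
        Finset.mem_univ, if_true]
      congr 1
      · exact Finset.sum_congr rfl fun j _ => by ring
      · ring
    have e2 : ∑ j, R * (v i * u j * ux i j) = R * v i * ∑ j, u j * ux i j := by
      rw [Finset.mul_sum]; exact Finset.sum_congr rfl fun j _ => by ring
    rw [e1, e2, hαx]
    ring
  have h2 : ∑ i, ∑ j, (v i - u i) * (v j - u j) * ux i j
      = ∑ i, ∑ j, v i * v j * ux i j - ∑ i, ∑ j, v i * u j * ux i j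
        - ∑ j, (v j - u j) * ∑ i, u i * ux i j := by
    have e1 : ∑ j, (v j - u j) * ∑ i, u i * ux i j = ∑ i, ∑ j, (v j - u j) * (u i * ux i j) := by
      rw [Finset.sum_comm]; exact Finset.sum_congr rfl fun j _ => Finset.mul_sum _ _ _
    rw [e1]
    simp only [← Finset.sum_sub_distrib]
    exact Finset.sum_congr rfl fun i _ => Finset.sum_congr rfl fun j _ => by ring
  have h3 : ∑ i, (v i - u i) * ϑx i = ∑ i, v i * ϑx i - ∑ i, u i * ϑx i := by
    rw [← Finset.sum_sub_distrib]; exact Finset.sum_congr rfl fun i _ => by ring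
  have h4 : ∑ j, (v j - u j) * ut j + ∑ j, (v j - u j) * ∑ i, u i * ux i j
      + (∑ i, v i * ϑx i - ∑ i, u i * ϑx i)
      + ϑ / ρ * (∑ i, v i * ρx i - ∑ i, u i * ρx i) = 0 := by
    rw [mul_sub, Finset.mul_sum, Finset.mul_sum, ← Finset.sum_sub_distrib,
      ← Finset.sum_sub_distrib, ← Finset.sum_add_distrib, ← Finset.sum_add_distrib,
      ← Finset.sum_add_distrib]
    refine Finset.sum_eq_zero fun j _ => ?_
    have := hu j
    have h5 : ut j + ∑ i, u i * ux i j + ϑx j + ϑ / ρ * ρx j = 0 := by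
      field_simp
      linarith
    linear_combination (v j - u j) * h5
  have h6 : ∑ j, (v j - u j) * ut j = ∑ j, v j * ut j - ∑ j, u j * ut j := by
    rw [← Finset.sum_sub_distrib]; exact Finset.sum_congr rfl fun i _ => by ring
  have h7 : ∑ j, ut j * (R * v j) = R * ∑ j, v j * ut j := by
    rw [Finset.mul_sum]; exact Finset.sum_congr rfl fun i _ => by ring
  have h8 : ϑ * ρt / ρ = -(ϑ / ρ * ∑ i, u i * ρx i) - ϑ * ∑ i, ux i i := by
    field_simp; linear_combination ϑ * hρ
  have h9 : R * ϑ / ρ = R * (ϑ / ρ) := by ring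
  rw [h1, h2, h3, h7, hαt, h8, h9]
  rw [h6] at h4
  linear_combination (-R) * h4 + (-R * (1 - s + S) + ρ) * hϑ + ϑ * hρ

theorem abs_mul_le_half {a b : ℝ} : |a * b| ≤ 1 / 2 * (a ^ 2 + b ^ 2) := by
  rw [abs_le]; constructor <;> nlinarith [sq_nonneg (a - b), sq_nonneg (a + b)]

theorem production_le (hγ : 1 < γ) {G A : ℝ} (hG : 0 ≤ G) (hA : 0 ≤ A) {R D Θr : ℝ} (hR : 0 ≤ R)
    (hΘ : 0 ≤ Θr) (hD : R * D ^ 2 ≤ A * Θr) {w ϑx : Fin d → ℝ} {ux : Fin d → Fin d → ℝ}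
    (hϑx : ∀ i, |ϑx i| ≤ G) (hux : ∀ i j, |ux i j| ≤ G) :
    -((γ - 1) * Θr) * ∑ i, ux i i - R * D * ∑ i, w i * ϑx i
      - R * ∑ i, ∑ j, w i * w j * ux i j
      ≤ ((γ - 1) * (d * G) + d * G * A + G + 2 * (d * G)) * (1 / 2 * R * ∑ i, w i ^ 2 + Θr) := by
  have hW : 0 ≤ ∑ i, w i ^ 2 := Finset.sum_nonneg fun i _ => sq_nonneg _
  have hdG : (0 : ℝ) ≤ d * G := by positivity
  have hAΘ : 0 ≤ A * Θr := mul_nonneg hA hΘ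
  have h1 : |∑ i, ux i i| ≤ d * G := by
    refine (Finset.abs_sum_le_sum_abs _ _).trans ((Finset.sum_le_sum fun i _ => hux i i).trans ?_)
    simp
  have h2 : |R * D * ∑ i, w i * ϑx i| ≤ G * (1 / 2 * (d * (A * Θr) + R * ∑ i, w i ^ 2)) := by
    rw [Finset.mul_sum]
    have : ∀ i, |R * D * (w i * ϑx i)| ≤ G * (1 / 2 * (A * Θr + R * w i ^ 2)) := fun i => by
      have e : R * D * (w i * ϑx i) = R * (D * w i) * ϑx i := by ring
      rw [e, abs_mul, abs_mul, abs_of_nonneg hR, mul_comm]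
      have h3 := abs_mul_le_half (a := D) (b := w i)
      have h4 : R * |D * w i| ≤ 1 / 2 * (A * Θr + R * w i ^ 2) := by
        calc R * |D * w i| ≤ R * (1 / 2 * (D ^ 2 + w i ^ 2)) := by gcongr
          _ = 1 / 2 * (R * D ^ 2 + R * w i ^ 2) := by ring
          _ ≤ _ := by gcongr
      exact mul_le_mul (hϑx i) h4 (by positivity) hG
    refine (Finset.abs_sum_le_sum_abs _ _).trans ((Finset.sum_le_sum fun i _ => this i).trans ?_)
    rw [← Finset.mul_sum, ← Finset.mul_sum, Finset.sum_add_distrib, ← Finset.mul_sum]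
    simp only [Finset.sum_const, Finset.card_univ, Fintype.card_fin, nsmul_eq_mul,
      ← Finset.mul_sum]
    exact le_of_eq (by ring)
  have h3 : |∑ i, ∑ j, w i * w j * ux i j| ≤ d * G * ∑ i, w i ^ 2 := by
    have : ∀ i j, |w i * w j * ux i j| ≤ G * (1 / 2 * (w i ^ 2 + w j ^ 2)) := fun i j => by
      rw [abs_mul, mul_comm]
      exact mul_le_mul (hux i j) abs_mul_le_half (abs_nonneg _) hG
    calc _ ≤ ∑ i, ∑ j, G * (1 / 2 * (w i ^ 2 + w j ^ 2)) :=
          (Finset.abs_sum_le_sum_abs _ _).trans (Finset.sum_le_sum fun i _ =>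
            (Finset.abs_sum_le_sum_abs _ _).trans (Finset.sum_le_sum fun j _ => this i j))
      _ = d * G * ∑ i, w i ^ 2 := by
          simp only [← Finset.mul_sum, Finset.sum_add_distrib, Finset.sum_const, Finset.card_univ,
            Fintype.card_fin, nsmul_eq_mul]
          ring
  have h4 : -((γ - 1) * Θr) * ∑ i, ux i i ≤ (γ - 1) * (d * G) * Θr := by
    have := (abs_le.1 h1).1
    have hc : 0 ≤ (γ - 1) * Θr := mul_nonneg (by linarith) hΘ
    nlinarith [mul_le_mul_of_nonneg_left this hc]
  have h5 := (abs_le.1 h2).1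
  have h6 := mul_le_mul_of_nonneg_left (abs_le.1 h3).1 hR
  have h7 : 0 ≤ (γ - 1) * (d * G) * (1 / 2 * R * ∑ i, w i ^ 2) :=
    mul_nonneg (mul_nonneg (by linarith) hdG) (by positivity)
  have h8 : 0 ≤ G * Θr := by positivity
  have h9 : 0 ≤ d * G * Θr := by positivity
  have h10 : 0 ≤ G * (R * ∑ i, w i ^ 2) := by positivity
  have h11 : 0 ≤ d * G * (A * Θr) := by positivity
  have h12 : 0 ≤ d * G * A * (1 / 2 * R * ∑ i, w i ^ 2) := by positivity
  linarith

end Production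

/-! ### Derivatives in primitive variables -/

section Primitive

variable {d : ℕ} {γ : ℝ}

/-- Derivative of the velocity at the state `U` in the direction `X`. -/
def dvel (U X : State d) (j : Fin d) : ℝ := fderiv ℝ (fun V : State d => vel V j) U X

/-- Derivative of the temperature at the state `U` in the direction `X`. -/
def dtemp (γ : ℝ) (U X : State d) : ℝ := fderiv ℝ (temp γ) U X

theorem hasDerivAt_line {F : Type*} [NormedAddCommGroup F] [NormedSpace ℝ F] {f : State d → F}
    {U : State d} (hf : ContDiffAt ℝ 1 f U) (X : State d) :
    HasDerivAt (fun s : ℝ => f (U + s • X)) (fderiv ℝ f U X) 0 := by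
  have h1 : HasDerivAt (fun s : ℝ => U + s • X) X 0 := by
    simpa using ((hasDerivAt_id (0 : ℝ)).smul_const X).const_add U
  have h2 : HasFDerivAt f (fderiv ℝ f U) (U + (0 : ℝ) • X) := by
    simpa using (hf.differentiableAt one_ne_zero).hasFDerivAt
  exact h2.comp_hasDerivAt 0 h1

theorem tendsto_line (U X : State d) : Tendsto (fun s : ℝ => U + s • X) (𝓝 0) (𝓝 U) := by
  have : Continuous fun s : ℝ => U + s • X := by fun_prop
  simpa using this.tendsto 0

theorem hasDerivAt_line_fst (U X : State d) :
    HasDerivAt (fun s : ℝ => (U + s • X).1) X.1 0 := by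
  have h := hasDerivAt_line (f := fun V : State d => V.1) (U := U) contDiffAt_fst X
  rwa [show fderiv ℝ (fun V : State d => V.1) U = ContinuousLinearMap.fst ℝ _ _ from fderiv_fst] at h

theorem hasDerivAt_line_clm (e : State d →L[ℝ] ℝ) (U X : State d) :
    HasDerivAt (fun s : ℝ => e (U + s • X)) (e X) 0 := by
  have h := hasDerivAt_line (f := e) (U := U) e.contDiff.contDiffAt X
  rwa [e.fderiv] at h

theorem mom_deriv {U : State d} (h : U.1 ≠ 0) (X : State d) (j : Fin d) :
    X.2.1 j = X.1 * vel U j + U.1 * dvel U X j := by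
  have h1 := hasDerivAt_line_clm (momL d j) U X
  have h2 := (hasDerivAt_line_fst U X).mul (hasDerivAt_line (contDiffAt_vel h j) X)
  have hev : ∀ᶠ s : ℝ in 𝓝 0, momL d j (U + s • X) = (U + s • X).1 * vel (U + s • X) j := by
    have hc : ContinuousAt (fun V : State d => V.1) U := continuous_fst.continuousAt
    filter_upwards [(tendsto_line U X).eventually (hc.eventually_ne h)] with s hs
    exact mom_eq _ hs j
  have h3 := h1.unique (h2.congr_of_eventuallyEq hev)
  simpa [dvel] using h3

theorem energy_deriv (hγ : 1 < γ) {U : State d} (h : U.1 ≠ 0) (X : State d) :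
    X.2.2 = 1 / 2 * X.1 * ∑ j, vel U j ^ 2 + U.1 * ∑ j, vel U j * dvel U X j
      + 1 / (γ - 1) * (X.1 * temp γ U + U.1 * dtemp γ U X) := by
  have h1 := hasDerivAt_line_clm (energyL d) U X
  have hv := fun j => hasDerivAt_line (contDiffAt_vel h j) X
  have hρ := hasDerivAt_line_fst U X
  have h2 := ((hρ.const_mul (1 / 2)).mul
      (HasDerivAt.fun_sum fun j (_ : j ∈ Finset.univ) => (hv j).pow 2)).add
    ((hρ.mul (hasDerivAt_line (contDiffAt_temp (γ := γ) h) X)).const_mul (1 / (γ - 1)))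
  have hev : ∀ᶠ s : ℝ in 𝓝 0, energyL d (U + s • X)
      = 1 / 2 * (U + s • X).1 * ∑ j, vel (U + s • X) j ^ 2
        + 1 / (γ - 1) * ((U + s • X).1 * temp γ (U + s • X)) := by
    have hc : ContinuousAt (fun V : State d => V.1) U := continuous_fst.continuousAt
    filter_upwards [(tendsto_line U X).eventually (hc.eventually_ne h)] with s hs
    exact energy_eq hγ _ hs
  have h3 := h1.unique (h2.congr_of_eventuallyEq hev)
  simp only [energyL_apply, zero_smul, add_zero, Nat.cast_ofNat, Nat.add_one_sub_one,
    pow_one, Pi.pow_apply] at h3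
  have e : ∑ j, 2 * vel U j * (fderiv ℝ (fun V : State d => vel V j) U) X
      = 2 * ∑ j, vel U j * dvel U X j := by
    rw [Finset.mul_sum]; exact Finset.sum_congr rfl fun j _ => by rw [dvel]; ring
  rw [h3, e]
  simp only [dtemp]
  ring

theorem spEntropy_deriv {U : State d} (h : IsGas γ U) (X : State d) :
    fderiv ℝ (fun V : State d => spEntropy γ V.1 (temp γ V)) U X
      = dtemp γ U X / temp γ U / (γ - 1) - X.1 / U.1 := by
  have h1 := hasDerivAt_line (contDiffAt_spEntropy h) X
  have hT := hasDerivAt_line (contDiffAt_temp (γ := γ) h.1.ne') X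
  have hρ := hasDerivAt_line_fst U X
  have h2 := ((hT.log (by simpa using h.temp_pos.ne')).div_const (γ - 1)).sub
    (hρ.log (by simpa using h.1.ne'))
  have h3 := h1.unique h2
  simpa [dtemp] using h3

theorem chem_deriv (hγ : 1 < γ) {U : State d} (h : IsGas γ U) (X : State d) :
    fderiv ℝ (fun V : State d => chem γ V.1 (vel V) (temp γ V)) U X
      = -∑ j, vel U j * dvel U X j + (1 - spEntropy γ U.1 (temp γ U)) * dtemp γ U X
        + temp γ U * X.1 / U.1 := by
  have h1 := hasDerivAt_line (contDiffAt_chem h) X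
  have hT := hasDerivAt_line (contDiffAt_temp (γ := γ) h.1.ne') X
  have hS := hasDerivAt_line (contDiffAt_spEntropy h) X
  rw [spEntropy_deriv h] at hS
  have hv := fun j => hasDerivAt_line (contDiffAt_vel h.1.ne' j) X
  have h2 := ((HasDerivAt.fun_sum fun j (_ : j ∈ Finset.univ) => (hv j).pow 2).neg.div_const 2).add
    (hT.mul (hS.const_sub (γ / (γ - 1))))
  have h3 := h1.unique h2
  simp only [zero_smul, add_zero, Nat.cast_ofNat, Nat.add_one_sub_one, pow_one] at h3
  have e : ∑ j, 2 * vel U j * (fderiv ℝ (fun V : State d => vel V j) U) X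
      = 2 * ∑ j, vel U j * dvel U X j := by
    rw [Finset.mul_sum]; exact Finset.sum_congr rfl fun j _ => by rw [dvel]; ring
  rw [h3, e]
  have hT0 := h.temp_pos.ne'
  have hρ0 := h.1.ne'
  have hg : γ - 1 ≠ 0 := by linarith
  simp only [dtemp]
  field_simp
  ring

theorem flux_deriv {i : Fin d} {U : State d} (h : U.1 ≠ 0) (X : State d) :
    fderiv ℝ (flux γ i) U X = (X.2.1 i,
      fun j => X.2.1 i * vel U j + U.2.1 i * dvel U X j
        + (if j = i then X.1 * temp γ U + U.1 * dtemp γ U X else 0),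
      dvel U X i * (U.2.2 + U.1 * temp γ U)
        + vel U i * (X.2.2 + (X.1 * temp γ U + U.1 * dtemp γ U X))) := by
  have h1 := hasDerivAt_line (contDiffAt_flux (γ := γ) (i := i) h) X
  have hT := hasDerivAt_line (contDiffAt_temp (γ := γ) h) X
  have hv := fun j => hasDerivAt_line (contDiffAt_vel h j) X
  have hρ := hasDerivAt_line_fst U X
  have hm := hasDerivAt_line_clm (momL d i) U X
  have hE := hasDerivAt_line_clm (energyL d) U X
  have hp := hρ.mul hT
  have hev : ∀ᶠ s : ℝ in 𝓝 0, flux γ i (U + s • X) = (momL d i (U + s • X),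
      fun j => momL d i (U + s • X) * vel (U + s • X) j
        + (if j = i then (U + s • X).1 * temp γ (U + s • X) else 0),
      vel (U + s • X) i * (energyL d (U + s • X) + (U + s • X).1 * temp γ (U + s • X))) := by
    have hc : ContinuousAt (fun V : State d => V.1) U := continuous_fst.continuousAt
    filter_upwards [(tendsto_line U X).eventually (hc.eventually_ne h)] with s hs
    simp only [flux, temp, momL_apply, energyL_apply, vel, mul_div_cancel₀ _ hs]
    refine Prod.ext rfl (Prod.ext (funext fun j => ?_) rfl)
    simp only
    ring
  have h2 := hm.prodMk ((hasDerivAt_pi.2 fun j => (hm.mul (hv j)).add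
    (by
      by_cases hj : j = i
      · simp only [if_pos hj]; exact hp
      · simp only [if_neg hj]; exact hasDerivAt_const (0 : ℝ) (0 : ℝ) :
      HasDerivAt (fun s : ℝ => if j = i then (U + s • X).1 * temp γ (U + s • X) else 0)
        (if j = i then X.1 * temp γ (U + (0 : ℝ) • X) + (U + (0 : ℝ) • X).1 * fderiv ℝ (temp γ) U X
          else 0) 0)).prodMk ((hv i).mul (hE.add hp)))
  have h3 := h1.unique (h2.congr_of_eventuallyEq hev)
  simpa [dvel, dtemp] using h3

/-- The Euler equations in primitive variables. -/
theorem primitive_euler (hγ : 1 < γ) {U : State d} (h : IsGas γ U) {Xt : State d}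
    {Xx : Fin d → State d} (he : Xt + ∑ i, fderiv ℝ (flux γ i) U (Xx i) = 0) :
    Xt.1 + ∑ i, vel U i * (Xx i).1 + U.1 * ∑ i, dvel U (Xx i) i = 0 ∧
    (∀ j, U.1 * (dvel U Xt j + ∑ i, vel U i * dvel U (Xx i) j) + U.1 * dtemp γ U (Xx j)
      + temp γ U * (Xx j).1 = 0) ∧
    dtemp γ U Xt + ∑ i, vel U i * dtemp γ U (Xx i)
      + (γ - 1) * temp γ U * ∑ i, dvel U (Xx i) i = 0 := by
  have hρ0 := h.1.ne'
  simp only [flux_deriv hρ0] at he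
  have e1 : Xt.1 + ∑ i, (Xx i).2.1 i = 0 := by
    simpa [Prod.fst_sum] using congrArg Prod.fst he
  have e2 : ∀ j, Xt.2.1 j + ∑ i, ((Xx i).2.1 i * vel U j + U.2.1 i * dvel U (Xx i) j
      + (if j = i then (Xx i).1 * temp γ U + U.1 * dtemp γ U (Xx i) else 0)) = 0 := fun j => by
    have := congrFun (congrArg (fun Z : State d => Z.2.1) he) j
    simpa [Prod.fst_sum, Prod.snd_sum, Finset.sum_apply] using this
  have e3 : Xt.2.2 + ∑ i, (dvel U (Xx i) i * (U.2.2 + U.1 * temp γ U)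
        + vel U i * ((Xx i).2.2 + ((Xx i).1 * temp γ U + U.1 * dtemp γ U (Xx i)))) = 0 := by
    have := congrArg (fun Z : State d => Z.2.2) he
    simpa [Prod.snd_sum] using this
  have mass : Xt.1 + ∑ i, vel U i * (Xx i).1 + U.1 * ∑ i, dvel U (Xx i) i = 0 := by
    rw [← e1, Finset.mul_sum, add_assoc, ← Finset.sum_add_distrib]
    congr 1
    exact Finset.sum_congr rfl fun i _ => by rw [mom_deriv hρ0]; ring
  have hmom : ∀ j, U.1 * (dvel U Xt j + ∑ i, vel U i * dvel U (Xx i) j) + U.1 * dtemp γ U (Xx j)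
      + temp γ U * (Xx j).1 = 0 := by
    intro j
    have h1 := e2 j
    have h2 : ∑ i, ((Xx i).2.1 i * vel U j + U.2.1 i * dvel U (Xx i) j
        + (if j = i then (Xx i).1 * temp γ U + U.1 * dtemp γ U (Xx i) else 0))
        = (∑ i, (Xx i).2.1 i) * vel U j + U.1 * ∑ i, vel U i * dvel U (Xx i) j
          + ((Xx j).1 * temp γ U + U.1 * dtemp γ U (Xx j)) := by
      rw [Finset.sum_add_distrib, Finset.sum_add_distrib, Finset.sum_ite_eq, Finset.sum_mul,
        Finset.mul_sum]
      simp only [Finset.mem_univ, if_true]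
      congr 2
      exact Finset.sum_congr rfl fun i _ => by rw [mom_eq U hρ0 i]; ring
    rw [h2, mom_deriv hρ0] at h1
    linear_combination h1 - vel U j * e1
  refine ⟨mass, hmom, ?_⟩
  have hg : γ - 1 ≠ 0 := by linarith
  obtain ⟨q, hq⟩ : ∃ q, q = ∑ j, vel U j ^ 2 := ⟨_, rfl⟩
  set D := ∑ i, dvel U (Xx i) i with hD
  have e4 : ∑ i, (dvel U (Xx i) i * (U.2.2 + U.1 * temp γ U)
        + vel U i * ((Xx i).2.2 + ((Xx i).1 * temp γ U + U.1 * dtemp γ U (Xx i))))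
      = D * (U.2.2 + U.1 * temp γ U)
        + (1 / 2 * q + 1 / (γ - 1) * temp γ U + temp γ U) * ∑ i, vel U i * (Xx i).1
        + U.1 * ∑ i, vel U i * ∑ j, vel U j * dvel U (Xx i) j
        + (1 / (γ - 1) + 1) * U.1 * ∑ i, vel U i * dtemp γ U (Xx i) := by
    rw [hD, Finset.sum_mul, Finset.mul_sum, Finset.mul_sum, Finset.mul_sum,
      ← Finset.sum_add_distrib, ← Finset.sum_add_distrib, ← Finset.sum_add_distrib]
    refine Finset.sum_congr rfl fun i _ => ?_
    rw [energy_deriv hγ hρ0 (Xx i), ← hq]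
    ring
  have e5 : U.1 * ∑ j, vel U j * dvel U Xt j
      + U.1 * ∑ i, vel U i * ∑ j, vel U j * dvel U (Xx i) j
      + U.1 * ∑ i, vel U i * dtemp γ U (Xx i) + temp γ U * ∑ i, vel U i * (Xx i).1 = 0 := by
    have hc : ∑ i, vel U i * ∑ j, vel U j * dvel U (Xx i) j
        = ∑ j, vel U j * ∑ i, vel U i * dvel U (Xx i) j := by
      simp only [Finset.mul_sum]
      rw [Finset.sum_comm]
      exact Finset.sum_congr rfl fun i _ => Finset.sum_congr rfl fun j _ => by ring
    rw [hc, Finset.mul_sum, Finset.mul_sum, Finset.mul_sum, Finset.mul_sum,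
      ← Finset.sum_add_distrib, ← Finset.sum_add_distrib, ← Finset.sum_add_distrib]
    exact Finset.sum_eq_zero fun j _ => by linear_combination vel U j * hmom j
  rw [e4, energy_deriv hγ hρ0 Xt, energy_eq hγ U hρ0, ← hq] at e3
  have e6 : U.1 * (1 / (γ - 1)) * (dtemp γ U Xt + ∑ i, vel U i * dtemp γ U (Xx i)
      + (γ - 1) * temp γ U * D) = 0 := by
    have : U.1 * (1 / (γ - 1)) * ((γ - 1) * temp γ U * D) = U.1 * temp γ U * D := by
      field_simp
    rw [mul_add, this]
    linear_combination e3 - e5 - (1 / 2 * q + 1 / (γ - 1) * temp γ U) * mass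
  have : U.1 * (1 / (γ - 1)) ≠ 0 := mul_ne_zero hρ0 (one_div_ne_zero hg)
  exact (mul_eq_zero.1 e6).resolve_left this

end Primitive

/-! ### Strong solutions as Lipschitz solutions on cells -/

section Flow

variable {d : ℕ} {γ : ℝ}

@[simp] theorem conserved_fst (ρ : ℝ) (u : Fin d → ℝ) (η : ℝ) : (conserved γ ρ u η).1 = ρ := rfl

theorem vel_conserved {ρ : ℝ} (hρ : ρ ≠ 0) (u : Fin d → ℝ) (η : ℝ) :
    vel (conserved γ ρ u η) = u := by
  ext j; simp [vel, conserved, hρ]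

theorem pressure_conserved (hγ : 1 < γ) {ρ : ℝ} (hρ : 0 < ρ) (u : Fin d → ℝ) (η : ℝ) :
    pressure γ (conserved γ ρ u η) = ρ * temperature γ ρ η := by
  have h1 : ∑ j, (ρ * u j) ^ 2 = ρ ^ 2 * ∑ j, u j ^ 2 := by
    rw [Finset.mul_sum]; exact Finset.sum_congr rfl fun j _ => by ring
  have h2 : γ - 1 ≠ 0 := by linarith
  simp only [pressure, conserved, Pi.smul_apply, smul_eq_mul, h1, intEnergy_eq hγ η hρ]
  field_simp
  ring

theorem temp_conserved (hγ : 1 < γ) {ρ : ℝ} (hρ : 0 < ρ) (u : Fin d → ℝ) (η : ℝ) :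
    temp γ (conserved γ ρ u η) = temperature γ ρ η := by
  rw [temp, pressure_conserved hγ hρ, conserved_fst, mul_div_cancel_left₀ _ hρ.ne']

theorem isGas_conserved (hγ : 1 < γ) {ρ : ℝ} (hρ : 0 < ρ) (u : Fin d → ℝ) (η : ℝ) :
    IsGas γ (conserved γ ρ u η) := by
  refine ⟨hρ, ?_⟩
  rw [pressure_conserved hγ hρ]
  exact mul_pos hρ (temperature_pos hγ η hρ)

theorem entropy_conserved (hγ : 1 < γ) {ρ : ℝ} (hρ : 0 < ρ) (u : Fin d → ℝ) (η : ℝ) :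
    entropy γ (conserved γ ρ u η) = η := by
  rw [entropy_eq hγ (isGas_conserved hγ hρ u η), temp_conserved hγ hρ, conserved_fst]
  exact (eq_mul_spEntropy hγ η hρ).symm

theorem exists_lipschitz_flux (hγ : 1 < γ) {k K : ℝ} (hk : 0 < k) : ∃ C : NNReal, ∀ i : Fin d,
    LipschitzOnWith C (flux γ i) (rangeSet d γ k K) := by
  obtain ⟨C1, h1, H1⟩ := exists_lipschitz_rangeSet_all (K := K) hγ hk
    (f := fun (i : Fin d) (U : State d) => (flux γ i U).1)
    fun i U hU => (contDiffAt_flux hU.1.ne').fst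
  obtain ⟨C2, h2, H2⟩ := exists_lipschitz_rangeSet_all (K := K) hγ hk
    (f := fun (p : Fin d × Fin d) (U : State d) => (flux γ p.1 U).2.1 p.2)
    fun p U hU => contDiffAt_pi.1 (contDiffAt_flux hU.1.ne').snd.fst p.2
  obtain ⟨C3, h3, H3⟩ := exists_lipschitz_rangeSet_all (K := K) hγ hk
    (f := fun (i : Fin d) (U : State d) => (flux γ i U).2.2)
    fun i U hU => (contDiffAt_flux hU.1.ne').snd.snd
  refine ⟨⟨C1 + C2 + C3, by positivity⟩, fun i => LipschitzOnWith.of_dist_le_mul fun U hU V hV => ?_⟩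
  rw [dist_eq_norm, dist_eq_norm]
  have hn := norm_nonneg (U - V)
  refine norm_state_le (mul_nonneg (show (0 : ℝ) ≤ C1 + C2 + C3 by positivity) hn) ((H1 i U hU V hV).trans ?_)
    (fun j => (H2 (i, j) U hU V hV).trans ?_) ((H3 i U hU V hV).trans ?_) <;>
  · refine mul_le_mul_of_nonneg_right ?_ hn
    show _ ≤ C1 + C2 + C3
    linarith

/-- A solution of the Euler system on `[0, T]` that is Lipschitz continuous on the cells of a
mesh. -/
structure IsLipschitzFlow {Ω : Set (Fin d → ℝ)} (γ T k K : ℝ) (L : NNReal) (𝒯 : RectMesh d Ω)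
    (W : ℝ × (Fin d → ℝ) → State d) : Prop where
  mem : ∀ z ∈ Icc 0 T ×ˢ closure Ω, W z ∈ rangeSet d γ k K
  lipschitz : ∀ K, LipschitzOnWith L W (Icc 0 T ×ˢ Icc (𝒯.lo K) (𝒯.hi K))
  euler : ∀ᵐ z, ∀ K, z ∈ Ioo 0 T ×ˢ 𝒯.cell K → DifferentiableAt ℝ W z ∧
    fderiv ℝ W z (dirT d) + ∑ i, fderiv ℝ (flux γ i) (W z) (fderiv ℝ W z (dirX i)) = 0
  wall : ∀ t ∈ Icc 0 T, ∀ x ∈ frontier Ω, ∀ i, HasNormalAlong Ω i x → vel (W (t, x)) i = 0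

theorem IsStrongSolution.isLipschitzFlow (hγ : 1 < γ) {T : ℝ} (hT : 0 < T) {Ω : Set (Fin d → ℝ)}
    (hΩ : IsOpen Ω) (hΩr : interior (closure Ω) = Ω) {M r : ℝ} (hM : 0 ≤ M) (hr : 0 < r)
    {ρ : ℝ × (Fin d → ℝ) → ℝ}
    {u : ℝ × (Fin d → ℝ) → Fin d → ℝ} {η : ℝ × (Fin d → ℝ) → ℝ}
    (h : IsStrongSolution γ T Ω ρ u η)
    (hn : W1InfNormLE T Ω (fun z => conserved γ (ρ z) (u z) (η z)) M)
    (hlow : ∀ z ∈ Icc 0 T ×ˢ closure Ω, r ≤ ρ z ∧ r ≤ temperature γ (ρ z) (η z))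
    (𝒯 : RectMesh d Ω) :
    IsLipschitzFlow γ T (min r (r * r)) M ⟨M * (1 + d), by positivity⟩ 𝒯
      fun z => conserved γ (ρ z) (u z) (η z) := by
  set W : ℝ × (Fin d → ℝ) → State d := fun z => conserved γ (ρ z) (u z) (η z) with hW
  have hkpos : 0 < min r (r * r) := lt_min hr (mul_pos hr hr)
  have hcl : closure (cylinder T Ω) = Icc 0 T ×ˢ closure Ω := by
    rw [cylinder, closure_prod_eq, closure_Ioo hT.ne]
  have hnorm : ∀ z ∈ Icc 0 T ×ˢ closure Ω, ‖W z‖ ≤ M := by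
    have hc : ContinuousOn W (closure (cylinder T Ω)) := by rw [hcl]; exact hn.1
    have hm : MapsTo W (cylinder T Ω) (Metric.closedBall 0 M) := fun z hz => by
      simpa using hn.2.1 z hz
    have := hm.closure_of_continuousOn hc
    rw [hcl, Metric.isClosed_closedBall.closure_eq] at this
    intro z hz
    simpa using this hz
  have hmem : ∀ z ∈ Icc 0 T ×ˢ closure Ω, W z ∈ rangeSet d γ (min r (r * r)) M := by
    intro z hz
    obtain ⟨h1, h2⟩ := hlow z hz
    have h3 := hnorm z hz
    have hp : pressure γ (W z) = ρ z * temperature γ (ρ z) (η z) :=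
      pressure_conserved hγ (hr.trans_le h1) _ _
    refine ⟨(min_le_left _ _).trans h1, ?_, ?_, ?_⟩
    · exact (le_abs_self _).trans ((norm_fst_le (W z)).trans h3)
    · rw [hp]; exact (min_le_right _ _).trans (mul_le_mul h1 h2 hr.le (hr.le.trans h1))
    · exact (le_abs_self _).trans ((norm_snd_le (W z).2).trans ((norm_snd_le (W z)).trans h3))
  have hlip : ∀ K, LipschitzOnWith ⟨M * (1 + d), by positivity⟩ W
      (Icc 0 T ×ˢ Icc (𝒯.lo K) (𝒯.hi K)) := fun K =>
    LipschitzOnWith.of_dist_le_mul fun z hz w hw => by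
      rw [dist_eq_norm, dist_eq_norm]
      exact hn.norm_sub_le hT hΩ hM (𝒯.lo_lt_hi K) (𝒯.cell_subset hΩr K)
        (𝒯.Icc_subset_closure K) hz hw
  refine ⟨hmem, hlip, ?_, fun t ht x hx i hi => ?_⟩
  swap
  · have hz : (t, x) ∈ Icc 0 T ×ˢ closure Ω := ⟨ht, frontier_subset_closure hx⟩
    rw [hW]
    simp only [vel_conserved (h.density_pos _ hz).ne']
    exact h.impermeable t ht x hx i hi
  obtain ⟨Gt, G, hGt, hG, heq⟩ := h.euler
  obtain ⟨Cf, hCf⟩ := exists_lipschitz_flux (d := d) (K := M) hγ hkpos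
  have hcyl : IsOpen (cylinder T Ω) := isOpen_Ioo.prod hΩ
  rw [ae_restrict_iff' hcyl.measurableSet] at heq
  refine ae_all_iff.2 fun K => ?_
  have hO : IsOpen (Ioo 0 T ×ˢ 𝒯.cell K) := isOpen_Ioo.prod (isOpen_openBox _ _)
  have hOQ : Ioo 0 T ×ˢ 𝒯.cell K ⊆ cylinder T Ω := prod_mono le_rfl (𝒯.cell_subset hΩr K)
  have hOI : Ioo 0 T ×ˢ 𝒯.cell K ⊆ Icc 0 T ×ˢ Icc (𝒯.lo K) (𝒯.hi K) :=
    prod_mono Ioo_subset_Icc_self (openBox_subset_Icc _ _)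
  have hIc : Icc 0 T ×ˢ Icc (𝒯.lo K) (𝒯.hi K) ⊆ Icc 0 T ×ˢ closure Ω :=
    prod_mono le_rfl (𝒯.Icc_subset_closure K)
  have hWO := (hlip K).mono hOI
  have hFO : ∀ i, LipschitzOnWith (Cf * ⟨M * (1 + d), by positivity⟩)
      (fun z => flux γ i (W z)) (Ioo 0 T ×ˢ 𝒯.cell K) := fun i =>
    (hCf i).comp hWO fun z hz => hmem z (hIc (hOI hz))
  filter_upwards [ae_differentiableAt_of_lipschitzOn hO hWO, hGt.ae_fderiv_eq hO hOQ hWO,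
    ae_all_iff.2 fun i => (hG i).ae_fderiv_eq hO hOQ (hFO i), heq] with z h1 h2 h3 h4 hz
  refine ⟨h1 hz, ?_⟩
  have hgas := isGas_of_mem hkpos (hmem z (hIc (hOI hz)))
  rw [← h4 (hOQ hz), h2 hz]
  congr 1
  refine Finset.sum_congr rfl fun i _ => ?_
  rw [← h3 i hz]
  have h5 : DifferentiableAt ℝ (flux γ i) (W z) :=
    (contDiffAt_flux hgas.1.ne').differentiableAt one_ne_zero
  have h6 := fderiv_comp z h5 (h1 hz)
  have h7 : (flux γ i ∘ W) = fun z => flux γ i (W z) := rfl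
  rw [h7] at h6
  rw [h6]; rfl

end Flow

/-! ### Entropy inequalities and bounds for the Godunov method -/

section Numerical

variable {d : ℕ} {γ : ℝ}

theorem fderiv_entropy (hγ : 1 < γ) {U : State d} (h : IsGas γ U) (X : State d) :
    temp γ U * fderiv ℝ (entropy γ) U X = lam γ U.1 (vel U) (temp γ U) X := by
  set f : State d → ℝ := fun V => lam γ U.1 (vel U) (temp γ U) V - temp γ U * entropy γ V
    + U.1 * temp γ U with hf
  have hfr : ∀ V, f V = relLin γ V U.1 (vel U) (temp γ U) := fun V => (relLin_eq_lam V _ _ _).symm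
  have hmin : IsLocalMin f U := by
    filter_upwards [h.eventually] with V hV
    rw [hfr, hfr, relLin_self hγ h]
    exact relLin_nonneg hγ hV.admissible h.1 h.temp_pos _
  have h1 : HasFDerivAt f (lam γ U.1 (vel U) (temp γ U) - temp γ U • fderiv ℝ (entropy γ) U) U :=
    ((lam γ U.1 (vel U) (temp γ U)).hasFDerivAt.sub (((contDiffAt_entropy hγ h).differentiableAt
      one_ne_zero).hasFDerivAt.const_mul (temp γ U))).add_const (U.1 * temp γ U)
  have h2 := h1.fderiv
  rw [hmin.fderiv_eq_zero] at h2
  have h4 := congrArg (fun e : State d →L[ℝ] ℝ => e X) h2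
  simp only [zero_apply, sub_apply, smul_apply, smul_eq_mul] at h4
  linarith

theorem IsInterfaceState.admissible_left {i : Fin d} {UL UR V : State d}
    (h : IsInterfaceState γ i UL UR V) : Admissible γ UL := by
  obtain ⟨W, ⟨hL, -, B, hW, -⟩, -⟩ := h
  obtain ⟨b, hb⟩ := B.finite_toSet.bddBelow
  obtain ⟨ξ, h1, h2⟩ := (hL.and (eventually_lt_atBot b)).exists
  rw [← h1]
  exact (hW ξ fun hξ => (hb hξ).not_gt h2).1

theorem eventually_ge_of_deriv_pos {T t : ℝ} (ht : t ∈ Ico 0 T) {g : ℝ → ℝ} {g' : ℝ}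
    (hg : HasDerivWithinAt g g' (Icc 0 T) t) (h0 : 0 ≤ g t) (hpos : g t = 0 → 0 < g') :
    ∀ᶠ z in 𝓝[>] t, 0 ≤ g z := by
  have hle : Icc 0 T ∈ 𝓝[>] t := by
    filter_upwards [Ioo_mem_nhdsGT ht.2] with z hz using ⟨ht.1.trans hz.1.le, hz.2.le⟩
  have h1 : HasDerivWithinAt g g' (Ioi t) t := hg.mono_of_mem_nhdsWithin hle
  rcases h0.eq_or_lt with heq | hlt
  · have h2 := (hasDerivWithinAt_iff_tendsto_slope' (self_notMem_Ioi (a := t))).1 h1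
    filter_upwards [h2.eventually (lt_mem_nhds (hpos heq.symm)), self_mem_nhdsWithin] with z hz hzt
    rw [slope_def_field, ← heq, sub_zero] at hz
    exact ((div_pos_iff_of_pos_right (sub_pos.2 hzt)).1 hz).le
  · filter_upwards [h1.continuousWithinAt.eventually (lt_mem_nhds hlt)] with z hz using hz.le

/-- If, of finitely many functions, the smallest one never decreases, their minimum does not. -/
theorem le_of_deriv_nonneg_at_min {ι : Type*} [Finite ι] {T : ℝ} {s s' : ℝ → ι → ℝ}
    (hd : ∀ t ∈ Icc 0 T, ∀ K, HasDerivWithinAt (fun t => s t K) (s' t K) (Icc 0 T) t)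
    (hmin : ∀ t ∈ Icc 0 T, ∀ K, (∀ L, s t K ≤ s t L) → 0 ≤ s' t K) {m : ℝ}
    (h0 : ∀ K, m ≤ s 0 K) : ∀ t ∈ Icc 0 T, ∀ K, m ≤ s t K := by
  have hε : ∀ ε > 0, Icc 0 T ⊆ {t | ∀ K, 0 ≤ s t K - m + ε * t} := by
    intro ε hε
    have hg : ∀ t ∈ Icc 0 T, ∀ K, HasDerivWithinAt (fun t => s t K - m + ε * t) (s' t K + ε)
        (Icc 0 T) t := fun t ht K => by
      have h1 : HasDerivWithinAt (fun t => ε * t) (ε * 1) (Icc 0 T) t :=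
        (hasDerivWithinAt_id t _).const_mul ε
      rw [mul_one] at h1
      exact ((hd t ht K).sub_const m).add h1
    refine IsClosed.Icc_subset_of_forall_mem_nhdsWithin ?_ (fun K => by simpa using h0 K) ?_
    · have : {t | ∀ K, 0 ≤ s t K - m + ε * t} ∩ Icc 0 T
          = Icc 0 T ∩ ⋂ K, {t ∈ Icc 0 T | 0 ≤ s t K - m + ε * t} := by
        ext t
        simp only [mem_inter_iff, mem_iInter, mem_ofPred_eq]
        exact ⟨fun h => ⟨h.2, fun i => ⟨h.2, h.1 i⟩⟩, fun h => ⟨fun i => (h.2 i).2, h.1⟩⟩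
      rw [this]
      refine isClosed_Icc.inter (isClosed_iInter fun K => ?_)
      exact isClosed_Icc.isClosed_le continuousOn_const fun t ht => (hg t ht K).continuousWithinAt
    · rintro t ⟨ht, htT⟩
      have htI := Ico_subset_Icc_self htT
      refine eventually_all.2 fun K => eventually_ge_of_deriv_pos htT (hg t htI K) (ht K) fun heq => ?_
      have : 0 ≤ s' t K := hmin t htI K fun L => by
        have := ht L
        linarith
      linarith
  intro t ht K
  refine le_of_forall_pos_le_add fun δ hδ => ?_
  have h1 := hε (δ / (t + 1)) (by have := ht.1; positivity) ht K
  have h2 : δ / (t + 1) * t ≤ δ := by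
    have := ht.1
    rw [div_mul_eq_mul_div, div_le_iff₀ (by positivity)]
    nlinarith
  linarith

/-- Bounds from density, energy and specific entropy. -/
theorem exists_mem_rangeSet (hγ : 1 < γ) (s₀ : ℝ) {ρmin Emax : ℝ} (hρ : 0 < ρmin) (hE : 0 < Emax) :
    ∃ k K : ℝ, 0 < k ∧ 0 < K ∧ ∀ U : State d, IsGas γ U → ρmin ≤ U.1 → U.2.2 ≤ Emax →
      s₀ ≤ spEntropy γ U.1 (temp γ U) → U ∈ rangeSet d γ k K := by
  have hg : 0 < γ - 1 := by linarith
  refine ⟨min ρmin (Real.exp (γ * Real.log ρmin + (γ - 1) * s₀)),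
    max Emax (Real.exp ((Real.log ((γ - 1) * Emax) - (γ - 1) * s₀) / γ)),
    lt_min hρ (Real.exp_pos _), lt_max_of_lt_left hE, fun U h h1 h2 h3 => ?_⟩
  have hϑ := h.temp_pos
  have hp : pressure γ U = U.1 * temp γ U := by rw [temp, mul_div_cancel₀ _ h.1.ne']
  have hlog : Real.log (pressure γ U) = Real.log U.1 + Real.log (temp γ U) := by
    rw [hp, Real.log_mul h.1.ne' hϑ.ne']
  have h4 : (γ - 1) * s₀ ≤ Real.log (temp γ U) - (γ - 1) * Real.log U.1 := by
    have := mul_le_mul_of_nonneg_left h3 hg.le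
    rwa [spEntropy, mul_sub, mul_div_cancel₀ _ hg.ne'] at this
  have h5 : pressure γ U ≤ (γ - 1) * Emax := by
    rw [pressure]
    refine mul_le_mul_of_nonneg_left ?_ hg.le
    have : 0 ≤ (∑ j, U.2.1 j ^ 2) / (2 * U.1) :=
      div_nonneg (Finset.sum_nonneg fun _ _ => sq_nonneg _) (by linarith [h.1])
    linarith
  have h6 := Real.log_le_log h.2 h5
  refine ⟨(min_le_left _ _).trans h1, le_max_of_le_right ?_, min_le_of_right_le ?_,
    h2.trans (le_max_left _ _)⟩
  · rw [← Real.log_le_iff_le_exp h.1, le_div_iff₀ (by linarith)]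
    linarith
  · rw [← Real.le_log_iff_exp_le h.2]
    have := mul_le_mul_of_nonneg_left (Real.log_le_log hρ h1) (by linarith : 0 ≤ γ)
    linarith

end Numerical

namespace RectMesh

variable {n : ℕ} {γ : ℝ} {Ω : Set (Fin (n + 1) → ℝ)} {𝒯 : RectMesh (n + 1) Ω}

theorem netFlux_mono {i : Fin (n + 1)} {K : Fin 𝒯.n} {g g' : Fin 𝒯.n → Fin 𝒯.n → ℝ}
    {gR gR' gL gL' : Fin 𝒯.n → ℝ}
    (h1 : ∀ L, 0 < 𝒯.faceArea i K L → g K L ≤ g' K L)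
    (h2 : ∀ L, 0 < 𝒯.faceArea i L K → g' L K ≤ g L K)
    (h3 : 0 < 𝒯.wallAreaR i K → gR K ≤ gR' K) (h4 : 0 < 𝒯.wallAreaL i K → gL' K ≤ gL K) :
    𝒯.netFlux i g gR gL K ≤ 𝒯.netFlux i g' gR' gL' K := by
  have aux : ∀ {a x y : ℝ}, 0 ≤ a → (0 < a → x ≤ y) → a • x ≤ a • y := fun {a x y} ha h => by
    rcases ha.eq_or_lt with h0 | h0
    · rw [← h0]; simp
    · exact mul_le_mul_of_nonneg_left (h h0) ha
  exact sub_le_sub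
    (add_le_add (Finset.sum_le_sum fun L _ => aux (𝒯.faceArea_nonneg i K L) (h1 L))
      (aux (𝒯.wallAreaR_nonneg i K) h3))
    (add_le_add (Finset.sum_le_sum fun L _ => aux (𝒯.faceArea_nonneg i L K) (h2 L))
      (aux (𝒯.wallAreaL_nonneg i K) h4))

/-- The Godunov method at one instant of time, cell by cell. -/
structure IsGodunovStep (γ : ℝ) (𝒯 : RectMesh (n + 1) Ω) (U U' : Fin 𝒯.n → State (n + 1))
    (V : Fin (n + 1) → Fin 𝒯.n → Fin 𝒯.n → State (n + 1))
    (VR VL : Fin (n + 1) → Fin 𝒯.n → State (n + 1)) : Prop where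
  face : ∀ i K L, 0 < 𝒯.faceArea i K L → IsInterfaceState γ i (U K) (U L) (V i K L)
  wallR : ∀ i K, 0 < 𝒯.wallAreaR i K → IsInterfaceState γ i (U K) (reflect i (U K)) (VR i K)
  wallL : ∀ i K, 0 < 𝒯.wallAreaL i K → IsInterfaceState γ i (reflect i (U K)) (U K) (VL i K)
  balance : ∀ K, 𝒯.cellVol K • U' K = -∑ i, 𝒯.netFlux i (fun K L => flux γ i (V i K L))
    (fun K => flux γ i (VR i K)) (fun K => flux γ i (VL i K)) K

theorem sideArea_pos (i : Fin (n + 1)) (K : Fin 𝒯.n) : 0 < 𝒯.sideArea i K :=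
  Finset.prod_pos fun j _ => sub_pos.2 (𝒯.lo_lt_hi K j)

section Step

variable {U U' : Fin 𝒯.n → State (n + 1)}
  {V : Fin (n + 1) → Fin 𝒯.n → Fin 𝒯.n → State (n + 1)}
  {VR VL : Fin (n + 1) → Fin 𝒯.n → State (n + 1)}

theorem IsGodunovStep.isGas (h : IsGodunovStep γ 𝒯 U U' V VR VL) (K : Fin 𝒯.n)
    (hK : 0 < (U K).1) : IsGas γ (U K) := by
  refine Admissible.isGas_of_pos ?_ hK
  by_cases h1 : 0 < 𝒯.wallAreaR 0 K
  · exact (h.wallR 0 K h1).admissible_left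
  · have h2 : 0 < ∑ L, 𝒯.faceArea 0 K L := by
      have := 𝒯.sideArea_pos 0 K
      rw [wallAreaR] at h1
      linarith
    obtain ⟨L, -, hL⟩ := Finset.exists_lt_of_sum_lt (f := fun _ => (0 : ℝ)) (by simpa using h2)
    exact (h.face 0 K L hL).admissible_left

theorem IsGodunovStep.clm_balance (h : IsGodunovStep γ 𝒯 U U' V VR VL) (K : Fin 𝒯.n)
    (e : State (n + 1) →L[ℝ] ℝ) :
    𝒯.cellVol K * e (U' K) = -∑ i, 𝒯.netFlux i (fun K L => e (flux γ i (V i K L)))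
      (fun K => e (flux γ i (VR i K))) (fun K => e (flux γ i (VL i K))) K := by
  have h1 := congrArg e (h.balance K)
  rw [map_smul, map_neg, map_sum] at h1
  rw [← smul_eq_mul, h1]
  exact congrArg _ (Finset.sum_congr rfl fun i _ => 𝒯.netFlux_map e.toLinearMap i _ _ _ K)

theorem IsGodunovStep.clm_balance_sub (h : IsGodunovStep γ 𝒯 U U' V VR VL) (K : Fin 𝒯.n)
    (e : State (n + 1) →L[ℝ] ℝ) :
    𝒯.cellVol K * e (U' K) = -∑ i, 𝒯.netFlux i (fun K' L => e (flux γ i (V i K' L) - flux γ i (U K)))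
      (fun K' => e (flux γ i (VR i K') - flux γ i (U K)))
      (fun K' => e (flux γ i (VL i K') - flux γ i (U K))) K := by
  rw [h.clm_balance]
  simp only [map_sub]
  exact congrArg _ (Finset.sum_congr rfl fun i _ => (𝒯.netFlux_sub_const i _ _ _ K _).symm)

/-- Discrete entropy inequality. -/
theorem IsGodunovStep.entropy_ge (hγ : 1 < γ) (h : IsGodunovStep γ 𝒯 U U' V VR VL) (K : Fin 𝒯.n)
    (hg : IsGas γ (U K)) :
    -∑ i, 𝒯.netFlux i (fun K L => entropyFlux γ i (V i K L))
      (fun K => entropyFlux γ i (VR i K)) (fun K => entropyFlux γ i (VL i K)) K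
      ≤ 𝒯.cellVol K * fderiv ℝ (entropy γ) (U K) (U' K) := by
  have hϑ := hg.temp_pos
  refine le_of_mul_le_mul_left ?_ hϑ
  rw [mul_left_comm, fderiv_entropy hγ hg, h.clm_balance_sub K, mul_neg, neg_le_neg_iff,
    Finset.mul_sum]
  refine Finset.sum_le_sum fun i _ => ?_
  have e1 := 𝒯.netFlux_map (LinearMap.lsmul ℝ ℝ (temp γ (U K))) i
    (fun K' L => entropyFlux γ i (V i K' L) - entropyFlux γ i (U K))
    (fun K' => entropyFlux γ i (VR i K') - entropyFlux γ i (U K))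
    (fun K' => entropyFlux γ i (VL i K') - entropyFlux γ i (U K)) K
  rw [𝒯.netFlux_sub_const] at e1
  refine le_trans ?_ (le_of_eq e1.symm)
  exact netFlux_mono (fun L hL => (h.face i K L hL).entropy_left hγ hg)
    (fun L hL => (h.face i L K hL).entropy_right hγ hg)
    (fun hw => (h.wallR i K hw).entropy_left hγ hg)
    (fun hw => (h.wallL i K hw).entropy_right hγ hg)

/-- Minimum principle for the specific entropy: it does not decrease where it is smallest. -/
theorem IsGodunovStep.spEntropy_deriv_nonneg (hγ : 1 < γ) (h : IsGodunovStep γ 𝒯 U U' V VR VL)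
    (K : Fin 𝒯.n) (hg : IsGas γ (U K))
    (hmin : ∀ L, spEntropy γ (U K).1 (temp γ (U K)) ≤ spEntropy γ (U L).1 (temp γ (U L))) :
    0 ≤ fderiv ℝ (fun V : State (n + 1) => spEntropy γ V.1 (temp γ V)) (U K) (U' K) := by
  set s := spEntropy γ (U K).1 (temp γ (U K)) with hs
  set e : State (n + 1) →L[ℝ] ℝ := lam γ (U K).1 (vel (U K)) (temp γ (U K))
    - (temp γ (U K) * s) • densityL (n + 1) with he
  have hϑ := hg.temp_pos
  have hrefl : ∀ i, spEntropy γ (reflect i (U K)).1 (temp γ (reflect i (U K))) = s := fun i => by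
    rw [temp_reflect]; rfl
  have h1 : 0 ≤ 𝒯.cellVol K * e (U' K) := by
    rw [h.clm_balance_sub, ← Finset.sum_neg_distrib]
    refine Finset.sum_nonneg fun i _ => neg_nonneg.2 ?_
    have h0 : 𝒯.netFlux i (fun _ _ => (0 : ℝ)) (fun _ => 0) (fun _ => 0) K = 0 := by simp [netFlux]
    rw [← h0]
    exact netFlux_mono (fun L hL => (h.face i K L hL).spEntropy_left hγ hg (hmin L))
      (fun L hL => (h.face i L K hL).spEntropy_right hγ hg (hmin L))
      (fun hw => (h.wallR i K hw).spEntropy_left hγ hg (hrefl i).ge)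
      (fun hw => (h.wallL i K hw).spEntropy_right hγ hg (hrefl i).ge)
  have h2 : 0 ≤ e (U' K) := nonneg_of_mul_nonneg_right h1 (𝒯.cellVol_pos K)
  -- the entropy is the density times the specific entropy
  have h3 : fderiv ℝ (entropy γ) (U K) (U' K) = (U' K).1 * s + (U K).1
      * fderiv ℝ (fun V : State (n + 1) => spEntropy γ V.1 (temp γ V)) (U K) (U' K) := by
    have e1 := hasDerivAt_line (contDiffAt_entropy hγ hg) (U' K)
    have e2 := (hasDerivAt_line_fst (U K) (U' K)).mul
      (hasDerivAt_line (contDiffAt_spEntropy hg) (U' K))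
    have hev : ∀ᶠ r : ℝ in 𝓝 0, entropy γ (U K + r • U' K) = (U K + r • U' K).1
        * spEntropy γ (U K + r • U' K).1 (temp γ (U K + r • U' K)) := by
      filter_upwards [(tendsto_line (U K) (U' K)).eventually hg.eventually] with r hr
      exact entropy_eq hγ hr
    have e3 := e1.unique (e2.congr_of_eventuallyEq hev)
    simpa [hs] using e3
  have h4 := fderiv_entropy hγ hg (U' K)
  have h5 : e (U' K) = temp γ (U K) * ((U K).1
      * fderiv ℝ (fun V : State (n + 1) => spEntropy γ V.1 (temp γ V)) (U K) (U' K)) := by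
    have : e (U' K) = lam γ (U K).1 (vel (U K)) (temp γ (U K)) (U' K)
        - temp γ (U K) * s * (U' K).1 := by simp [he]
    rw [this, ← h4, h3]; ring
  rw [h5] at h2
  exact nonneg_of_mul_nonneg_right (nonneg_of_mul_nonneg_right h2 hϑ) hg.1

end Step

end RectMesh

namespace RectMesh

variable {n : ℕ} {γ : ℝ} {Ω : Set (Fin (n + 1) → ℝ)} {𝒯 : RectMesh (n + 1) Ω}

/-- A Godunov solution on `[0, T]` with values in a set of gas states. -/
structure IsBoundedGodunov (γ T k K : ℝ) (𝒯 : RectMesh (n + 1) Ω) (U U' : ℝ → Fin 𝒯.n → State (n + 1))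
    (V : ℝ → Fin (n + 1) → Fin 𝒯.n → Fin 𝒯.n → State (n + 1))
    (VR VL : ℝ → Fin (n + 1) → Fin 𝒯.n → State (n + 1)) : Prop where
  deriv : ∀ t ∈ Icc 0 T, ∀ K, HasDerivWithinAt (fun s => U s K) (U' t K) (Icc 0 T) t
  step : ∀ t ∈ Icc 0 T, IsGodunovStep γ 𝒯 (U t) (U' t) (V t) (VR t) (VL t)
  mem : ∀ t ∈ Icc 0 T, ∀ L, U t L ∈ rangeSet (n + 1) γ k K

theorem IsGodunovSolution.exists_step {T : ℝ} {U0 : (Fin (n + 1) → ℝ) → State (n + 1)}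
    {U : ℝ → Fin 𝒯.n → State (n + 1)} (h : 𝒯.IsGodunovSolution γ T U0 U) :
    ∃ (U' : ℝ → Fin 𝒯.n → State (n + 1))
      (V : ℝ → Fin (n + 1) → Fin 𝒯.n → Fin 𝒯.n → State (n + 1))
      (VR VL : ℝ → Fin (n + 1) → Fin 𝒯.n → State (n + 1)), ∀ t ∈ Icc 0 T,
      (∀ K, HasDerivWithinAt (fun s => U s K) (U' t K) (Icc 0 T) t) ∧
      IsGodunovStep γ 𝒯 (U t) (U' t) (V t) (VR t) (VL t) := by
  obtain ⟨U', hU'⟩ := h.scheme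
  choose! h1 V VR VL h2 h3 h4 h5 using hU'
  exact ⟨U', V, VR, VL, fun t ht => ⟨h1 t ht, h2 t ht, h3 t ht, h4 t ht,
    𝒯.cellVol_smul_eq (U' t) (fun i K L => flux γ i (V t i K L)) _ _ (h5 t ht)⟩⟩

theorem clm_proj {V : Type*} [NormedAddCommGroup V] [NormedSpace ℝ V] [CompleteSpace V]
    (e : V →L[ℝ] ℝ) {f : (Fin (n + 1) → ℝ) → V} (K : Fin 𝒯.n)
    (hf : IntegrableOn f (Icc (𝒯.lo K) (𝒯.hi K))) :
    𝒯.cellVol K * e (𝒯.proj f K) = ∫ x in Icc (𝒯.lo K) (𝒯.hi K), e (f x) := by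
  rw [proj, setAverage_eq, map_smul, measureReal_Icc, smul_eq_mul, mul_inv_cancel_left₀
    (𝒯.cellVol_pos K).ne', e.integral_comp_comm hf]

/-- The projection onto piecewise constants does not decrease the specific entropy. -/
theorem spEntropy_proj_ge (hγ : 1 < γ) {f : (Fin (n + 1) → ℝ) → State (n + 1)} {K : Fin 𝒯.n}
    (hf : ContinuousOn f (Icc (𝒯.lo K) (𝒯.hi K))) {s₀ : ℝ}
    (hs : ∀ x ∈ Icc (𝒯.lo K) (𝒯.hi K), IsGas γ (f x) ∧
      s₀ ≤ spEntropy γ (f x).1 (temp γ (f x))) (hg : IsGas γ (𝒯.proj f K)) :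
    s₀ ≤ spEntropy γ (𝒯.proj f K).1 (temp γ (𝒯.proj f K)) := by
  set P := 𝒯.proj f K with hP
  set I := Icc (𝒯.lo K) (𝒯.hi K) with hI
  have hfi : IntegrableOn f I := hf.integrableOn_compact isCompact_Icc
  have hη : ContinuousOn (fun x => entropy γ (f x)) I := fun x hx =>
    (contDiffAt_entropy hγ (hs x hx).1).continuousAt.comp_continuousWithinAt (hf x hx)
  have hηi : IntegrableOn (fun x => entropy γ (f x)) I := hη.integrableOn_compact isCompact_Icc
  have hvol : volume.real I = 𝒯.cellVol K := 𝒯.measureReal_Icc K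
  have hvp := 𝒯.cellVol_pos K
  set e := lam γ P.1 (vel P) (temp γ P) with he
  have hei : IntegrableOn (fun x => e (f x)) I := e.integrable_comp hfi
  have h1 : 0 ≤ ∫ x in I, (e (f x) - temp γ P * entropy γ (f x) + P.1 * temp γ P) := by
    refine setIntegral_nonneg measurableSet_Icc fun x hx => ?_
    rw [← relLin_eq_lam]
    exact relLin_nonneg hγ (hs x hx).1.admissible hg.1 hg.temp_pos _
  have hconst : IntegrableOn (fun _ : Fin (n + 1) → ℝ => P.1 * temp γ P) I :=
    integrableOn_const isCompact_Icc.measure_lt_top.ne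
  have hsub : IntegrableOn (fun x => e (f x) - temp γ P * entropy γ (f x)) I :=
    hei.sub (hηi.const_mul _)
  rw [integral_add hsub hconst, integral_sub hei (hηi.const_mul _),
    integral_const_mul, setIntegral_const, hvol, smul_eq_mul, ← clm_proj e K hfi, ← hP] at h1
  have h2 : e P - temp γ P * entropy γ P + P.1 * temp γ P = 0 := by
    rw [← relLin_eq_lam, relLin_self hγ hg]
  have h3 : 𝒯.cellVol K * P.1 * s₀ ≤ ∫ x in I, entropy γ (f x) := by
    have h4 : 𝒯.cellVol K * P.1 = ∫ x in I, (f x).1 := by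
      simpa using clm_proj (densityL (n + 1)) K hfi
    have hρi : IntegrableOn (fun x => (f x).1) I := by
      simpa [IntegrableOn] using (densityL (n + 1)).integrable_comp hfi
    rw [h4, ← integral_mul_const]
    refine setIntegral_mono_on (hρi.mul_const _) hηi measurableSet_Icc fun x hx => ?_
    rw [entropy_eq hγ (hs x hx).1]
    exact mul_le_mul_of_nonneg_left (hs x hx).2 (hs x hx).1.1.le
  have h5 : 𝒯.cellVol K * (temp γ P * P.1) * s₀
      ≤ 𝒯.cellVol K * (temp γ P * P.1) * spEntropy γ P.1 (temp γ P) := by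
    have h6 := mul_le_mul_of_nonneg_left h3 hg.temp_pos.le
    have h7 := entropy_eq hγ hg
    rw [h7] at h2
    linear_combination h6 + h1 + 𝒯.cellVol K * h2
  exact le_of_mul_le_mul_left h5 (mul_pos hvp (mul_pos hg.temp_pos hg.1))

/-- A Godunov solution with density bounded below and energy bounded above stays in a fixed
compact set of gas states, and its specific entropy is not less than initially. -/
theorem IsGodunovSolution.exists_bounded (hγ : 1 < γ) {T : ℝ} (hT : 0 ≤ T)
    {U0 : (Fin (n + 1) → ℝ) → State (n + 1)}
    {U : ℝ → Fin 𝒯.n → State (n + 1)} (h : 𝒯.IsGodunovSolution γ T U0 U)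
    (hU0 : ∀ K, ContinuousOn U0 (Icc (𝒯.lo K) (𝒯.hi K))) {s₀ : ℝ}
    (hs : ∀ K, ∀ x ∈ Icc (𝒯.lo K) (𝒯.hi K), IsGas γ (U0 x) ∧
      s₀ ≤ spEntropy γ (U0 x).1 (temp γ (U0 x))) {k K : ℝ}
    (hpos : ∀ t ∈ Icc 0 T, ∀ K, 0 < (U t K).1)
    (hrange : ∀ t ∈ Icc 0 T, ∀ L, IsGas γ (U t L) →
      s₀ ≤ spEntropy γ (U t L).1 (temp γ (U t L)) → U t L ∈ rangeSet (n + 1) γ k K) :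
    ∃ U' V VR VL, IsBoundedGodunov γ T k K 𝒯 U U' V VR VL ∧
      ∀ t ∈ Icc 0 T, ∀ K, s₀ ≤ spEntropy γ (U t K).1 (temp γ (U t K)) := by
  obtain ⟨U', V, VR, VL, hstep⟩ := h.exists_step
  have hgas : ∀ t ∈ Icc 0 T, ∀ K, IsGas γ (U t K) := fun t ht K =>
    (hstep t ht).2.isGas K (hpos t ht K)
  have hmin : ∀ t ∈ Icc 0 T, ∀ K, s₀ ≤ spEntropy γ (U t K).1 (temp γ (U t K)) := by
    refine le_of_deriv_nonneg_at_min
      (s' := fun t K => fderiv ℝ (fun V : State (n + 1) => spEntropy γ V.1 (temp γ V)) (U t K)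
        (U' t K)) (fun t ht K => ?_)
      (fun t ht K hm => (hstep t ht).2.spEntropy_deriv_nonneg hγ K (hgas t ht K) hm) fun K => ?_
    · exact (((contDiffAt_spEntropy (hgas t ht K)).differentiableAt
        one_ne_zero).hasFDerivAt).comp_hasDerivWithinAt t ((hstep t ht).1 K)
    · have h0 : (0 : ℝ) ∈ Icc 0 T := ⟨le_rfl, hT⟩
      have := hgas 0 h0 K
      rw [h.initial K] at this ⊢
      exact spEntropy_proj_ge hγ (hU0 K) (hs K) this
  exact ⟨U', V, VR, VL, ⟨fun t ht => (hstep t ht).1, fun t ht => (hstep t ht).2,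
    fun t ht L => hrange t ht L (hgas t ht L) (hmin t ht L)⟩, hmin⟩

theorem norm_netFlux_le {E : Type*} [NormedAddCommGroup E] [NormedSpace ℝ E] {i : Fin (n + 1)}
    {K : Fin 𝒯.n} {g : Fin 𝒯.n → Fin 𝒯.n → E} {gR gL : Fin 𝒯.n → E} {b : ℝ}
    (h1 : ∀ L, 0 < 𝒯.faceArea i K L → ‖g K L‖ ≤ b)
    (h2 : ∀ L, 0 < 𝒯.faceArea i L K → ‖g L K‖ ≤ b)
    (h3 : 0 < 𝒯.wallAreaR i K → ‖gR K‖ ≤ b) (h4 : 0 < 𝒯.wallAreaL i K → ‖gL K‖ ≤ b) :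
    ‖𝒯.netFlux i g gR gL K‖ ≤ 2 * 𝒯.sideArea i K * b := by
  have aux : ∀ {a : ℝ} {x : E}, 0 ≤ a → (0 < a → ‖x‖ ≤ b) → ‖a • x‖ ≤ a * b := fun {a x} ha h => by
    rw [norm_smul, Real.norm_of_nonneg ha]
    rcases ha.eq_or_lt with h0 | h0
    · rw [← h0]; simp
    · exact mul_le_mul_of_nonneg_left (h h0) ha
  have e1 : ‖∑ L, 𝒯.faceArea i K L • g K L + 𝒯.wallAreaR i K • gR K‖ ≤ 𝒯.sideArea i K * b := by
    refine (norm_add_le _ _).trans ((add_le_add ((norm_sum_le _ _).trans (Finset.sum_le_sum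
      fun L _ => aux (𝒯.faceArea_nonneg i K L) (h1 L))) (aux (𝒯.wallAreaR_nonneg i K) h3)).trans ?_)
    rw [← Finset.sum_mul, wallAreaR]
    exact le_of_eq (by ring)
  have e2 : ‖∑ L, 𝒯.faceArea i L K • g L K + 𝒯.wallAreaL i K • gL K‖ ≤ 𝒯.sideArea i K * b := by
    refine (norm_add_le _ _).trans ((add_le_add ((norm_sum_le _ _).trans (Finset.sum_le_sum
      fun L _ => aux (𝒯.faceArea_nonneg i L K) (h2 L))) (aux (𝒯.wallAreaL_nonneg i K) h4)).trans ?_)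
    rw [← Finset.sum_mul, wallAreaL]
    exact le_of_eq (by ring)
  calc _ ≤ _ := norm_sub_le _ _
    _ ≤ 𝒯.sideArea i K * b + 𝒯.sideArea i K * b := add_le_add e1 e2
    _ = _ := by ring

theorem IsBoundedGodunov.exists_deriv_bound (hγ : 1 < γ) {T k K : ℝ} (hk : 0 < k)
    {U U' : ℝ → Fin 𝒯.n → State (n + 1)}
    {V : ℝ → Fin (n + 1) → Fin 𝒯.n → Fin 𝒯.n → State (n + 1)}
    {VR VL : ℝ → Fin (n + 1) → Fin 𝒯.n → State (n + 1)}
    (h : IsBoundedGodunov γ T k K 𝒯 U U' V VR VL) :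
    ∃ C : NNReal, ∀ t ∈ Icc 0 T, ∀ K, ‖U' t K‖ ≤ C := by
  obtain ⟨C, hC, hint⟩ := exists_interface_bound (d := n + 1) (K := K) hγ hk
  obtain ⟨R, hR, hn⟩ := exists_norm_le (d := n + 1) (K := K) hγ hk
  have hdiff : ∀ {A B : State (n + 1)}, A ∈ rangeSet (n + 1) γ k K → B ∈ rangeSet (n + 1) γ k K →
      C * ‖A - B‖ ≤ C * (R + R) := fun {A B} hA hB => by
    gcongr
    exact (norm_sub_le _ _).trans (add_le_add (hn _ hA) (hn _ hB))
  have hb : ∀ t ∈ Icc 0 T, ∀ K, ‖U' t K‖ ≤ (𝒯.cellVol K)⁻¹ *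
      ∑ i, 2 * 𝒯.sideArea i K * (C * (R + R)) := by
    intro t ht K
    have hs := h.step t ht
    have e1 : 𝒯.cellVol K • U' t K = -∑ i, 𝒯.netFlux i
        (fun K' L => flux γ i (V t i K' L) - flux γ i (U t K))
        (fun K' => flux γ i (VR t i K') - flux γ i (U t K))
        (fun K' => flux γ i (VL t i K') - flux γ i (U t K)) K := by
      rw [hs.balance]
      exact congrArg _ (Finset.sum_congr rfl fun i _ => (𝒯.netFlux_sub_const i _ _ _ K _).symm)
    have e2 : 𝒯.cellVol K * ‖U' t K‖ ≤ ∑ i, 2 * 𝒯.sideArea i K * (C * (R + R)) := by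
      rw [← Real.norm_of_nonneg (𝒯.cellVol_pos K).le, ← norm_smul, e1, norm_neg]
      refine (norm_sum_le _ _).trans (Finset.sum_le_sum fun i _ => norm_netFlux_le
        (fun L hL => ?_) (fun L hL => ?_) (fun hw => ?_) fun hw => ?_)
      · exact (hint _ (h.mem t ht K) _ (h.mem t ht L) i _ (hs.face i K L hL)).1.trans
          (hdiff (h.mem t ht L) (h.mem t ht K))
      · exact (hint _ (h.mem t ht L) _ (h.mem t ht K) i _ (hs.face i L K hL)).2.1.trans
          (hdiff (h.mem t ht K) (h.mem t ht L))
      · exact (hint _ (h.mem t ht K) _ (reflect_mem_rangeSet (h.mem t ht K)) i _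
          (hs.wallR i K hw)).1.trans (hdiff (reflect_mem_rangeSet (h.mem t ht K)) (h.mem t ht K))
      · exact (hint _ (reflect_mem_rangeSet (h.mem t ht K)) _ (h.mem t ht K) i _
          (hs.wallL i K hw)).2.1.trans (hdiff (h.mem t ht K) (reflect_mem_rangeSet (h.mem t ht K)))
    rwa [← div_eq_inv_mul, le_div_iff₀ (𝒯.cellVol_pos K), mul_comm]
  have hnn : ∀ K, 0 ≤ (𝒯.cellVol K)⁻¹ * ∑ i, 2 * 𝒯.sideArea i K * (C * (R + R)) := fun K =>
    mul_nonneg (inv_nonneg.2 (𝒯.cellVol_pos K).le) (Finset.sum_nonneg fun i _ =>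
      mul_nonneg (by have := 𝒯.sideArea_pos i K; positivity) (by positivity))
  refine ⟨⟨∑ K, (𝒯.cellVol K)⁻¹ * ∑ i, 2 * 𝒯.sideArea i K * (C * (R + R)),
    Finset.sum_nonneg fun K _ => hnn K⟩, fun t ht K => (hb t ht K).trans ?_⟩
  exact Finset.single_le_sum (f := fun K => (𝒯.cellVol K)⁻¹ *
    ∑ i, 2 * 𝒯.sideArea i K * (C * (R + R))) (fun K _ => hnn K) (Finset.mem_univ K)

end RectMesh

/-! ### The relative energy as a pairing of weights and densities -/

section Weights

variable {d : ℕ} {γ : ℝ}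

/-- Weights of the relative energy: temperature, chemical potential, velocity. -/
def wt (γ : ℝ) : Option (Option (Fin d)) → State d → ℝ
  | none, W => temp γ W
  | some none, W => chem γ W.1 (vel W) (temp γ W)
  | some (some j), W => vel W j

/-- Densities that are paired with the weights: entropy, mass, momentum. -/
def dens (γ : ℝ) : Option (Option (Fin d)) → State d → ℝ
  | none, U => entropy γ U
  | some none, U => U.1
  | some (some j), U => U.2.1 j

/-- Fluxes of the densities. -/
def densFlux (γ : ℝ) (i : Fin d) : Option (Option (Fin d)) → State d → ℝ
  | none, U => entropyFlux γ i U
  | some none, U => (flux γ i U).1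
  | some (some j), U => (flux γ i U).2.1 j

theorem relLin_eq_sum (U W : State d) : relLin γ U W.1 (vel W) (temp γ W)
    = U.2.2 - ∑ a, wt γ a W * dens γ a U + W.1 * temp γ W := by
  simp only [Fintype.sum_option, wt, dens, relLin]
  ring

theorem contDiffAt_wt {W : State d} (h : IsGas γ W) (a : Option (Option (Fin d))) :
    ContDiffAt ℝ 1 (wt γ a) W :=
  match a with
  | none => contDiffAt_temp h.1.ne'
  | some none => contDiffAt_chem h
  | some (some j) => contDiffAt_vel h.1.ne' j

theorem contDiffAt_dens (hγ : 1 < γ) {U : State d} (h : IsGas γ U) (a : Option (Option (Fin d))) :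
    ContDiffAt ℝ 1 (dens γ a) U :=
  match a with
  | none => contDiffAt_entropy hγ h
  | some none => contDiffAt_fst
  | some (some j) => (momL d j).contDiff.contDiffAt

theorem exists_densFlux_bound (hγ : 1 < γ) {k K : ℝ} (hk : 0 < k) : ∃ C : ℝ, 0 ≤ C ∧
    ∀ UL ∈ rangeSet d γ k K, ∀ UR ∈ rangeSet d γ k K, ∀ (i : Fin d) (V : State d),
      IsInterfaceState γ i UL UR V → ∀ a,
        |densFlux γ i a V - densFlux γ i a UL| ≤ C * ‖UR - UL‖ ∧
        |densFlux γ i a V - densFlux γ i a UR| ≤ C * ‖UR - UL‖ := by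
  obtain ⟨C, hC, h⟩ := exists_interface_bound (d := d) (K := K) hγ hk
  refine ⟨C, hC, fun UL hL UR hR i V hV a => ?_⟩
  obtain ⟨h1, h2, h3, h4⟩ := h UL hL UR hR i V hV
  match a with
  | none => exact ⟨h3, h4⟩
  | some none => exact ⟨(norm_fst_le _).trans h1, (norm_fst_le _).trans h2⟩
  | some (some j) =>
    have aux : ∀ X : State d, |X.2.1 j| ≤ ‖X‖ := fun X =>
      (norm_le_pi_norm X.2.1 j).trans ((norm_fst_le X.2).trans (norm_snd_le X))
    exact ⟨(aux _).trans h1, (aux _).trans h2⟩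

theorem densFlux_wall (hγ : 1 < γ) {i : Fin d} {U V : State d} (hg : IsGas γ U)
    (h : IsInterfaceState γ i U (reflect i U) V ∨ IsInterfaceState γ i (reflect i U) U V)
    {a : Option (Option (Fin d))} (ha : a ≠ some (some i)) : densFlux γ i a V = 0 := by
  obtain ⟨h1, h2, -, h4⟩ := wall_flux hγ hg h
  match a with
  | none => exact h4
  | some none => exact h1
  | some (some j) => exact h2 j fun hj => ha (by rw [hj])

/-- Relative energy production of a smooth Euler flow `W` against a fixed state `U`. -/
theorem sum_wt_deriv_le (hγ : 1 < γ) {U W : State d} (hU : IsGas γ U) (hW : IsGas γ W)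
    {Xt : State d} {Xx : Fin d → State d}
    (he : Xt + ∑ i, fderiv ℝ (flux γ i) W (Xx i) = 0) {G S θ₀ : ℝ} (hG : 0 ≤ G) (hS : 0 ≤ S)
    (hθ₀ : 0 < θ₀) (hθ : θ₀ ≤ temp γ W)
    (hs : -S ≤ spEntropy γ U.1 (temp γ U) - spEntropy γ W.1 (temp γ W))
    (hx : ∀ i a, |fderiv ℝ (wt γ a) W (Xx i)| ≤ G) :
    -(∑ a, fderiv ℝ (wt γ a) W Xt * dens γ a U) + (Xt.1 * temp γ W + W.1 * dtemp γ W Xt)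
      + ∑ i, (-(∑ a, fderiv ℝ (wt γ a) W (Xx i) * densFlux γ i a U)
        + fderiv ℝ (fun V : State d => V.1 * temp γ V * vel V i) W (Xx i))
      ≤ ((γ - 1) * (d * G) + d * G * (4 * (1 / (γ - 1) + 1) * Real.exp S / θ₀) + G + 2 * (d * G))
        * relLin γ U W.1 (vel W) (temp γ W) := by
  obtain ⟨e1, e2, e3⟩ := primitive_euler hγ hW he
  have hθW := hW.temp_pos
  have hUϑ := hU.temp_pos
  have hpu : ∀ i, fderiv ℝ (fun V : State d => V.1 * temp γ V * vel V i) W (Xx i)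
      = ((Xx i).1 * temp γ W + W.1 * dtemp γ W (Xx i)) * vel W i
        + W.1 * temp γ W * dvel W (Xx i) i := fun i => by
    have h1 := hasDerivAt_line (f := fun V : State d => V.1 * temp γ V * vel V i) (U := W)
      ((contDiffAt_fst.mul (contDiffAt_temp hW.1.ne')).mul (contDiffAt_vel hW.1.ne' i)) (Xx i)
    have h2 := ((hasDerivAt_line_fst W (Xx i)).mul (hasDerivAt_line (contDiffAt_temp (γ := γ)
      hW.1.ne') (Xx i))).mul (hasDerivAt_line (contDiffAt_vel hW.1.ne' i) (Xx i))
    have h3 := h1.unique h2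
    simpa [dtemp, dvel] using h3
  have hprod := production_eq (γ := γ) (R := U.1) (Θ := temp γ U)
    (S := spEntropy γ U.1 (temp γ U)) (v := vel U) hW.1.ne' e1 e2 e3
    (chem_deriv hγ hW Xt) fun i => chem_deriv hγ hW (Xx i)
  have hentropy : entropy γ U = U.1 * spEntropy γ U.1 (temp γ U) := entropy_eq hγ hU
  have hmom := mom_eq U hU.1.ne'
  have hp : pressure γ U = U.1 * temp γ U := by rw [temp, mul_div_cancel₀ _ hU.1.ne']
  have hA : 0 ≤ 4 * (1 / (γ - 1) + 1) * Real.exp S / θ₀ := by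
    have : 0 < γ - 1 := by linarith
    positivity
  have hdef := entropy_defect_le hγ hS hU.1 hUϑ hW.1 hθW hs
  have hnonneg : 0 ≤ thermoRel γ U.1 (temp γ U) W.1 (temp γ W) :=
    le_trans (add_nonneg (mul_nonneg (mul_nonneg (one_div_nonneg.2 (by linarith)) hU.1.le)
      (sq_nonneg _)) (mul_nonneg hθW.le (sq_nonneg _)))
      (thermoRel_ge hγ (Or.inl ⟨hU.1, hUϑ⟩) hW.1 hθW)
  have hle := production_le (d := d) hγ hG hA hU.1.le hnonneg
    (D := spEntropy γ U.1 (temp γ U) - spEntropy γ W.1 (temp γ W))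
    (w := fun j => vel U j - vel W j) (ϑx := fun i => dtemp γ W (Xx i))
    (ux := fun i j => dvel W (Xx i) j) ?_ (fun i => hx i none) fun i j => hx i (some (some j))
  · rw [relLin_eq hγ hU.admissible hW.1 hθW]
    refine le_trans (le_of_eq ?_) hle
    have hw0 : ∀ X : State d, fderiv ℝ (wt γ none) W X = dtemp γ W X := fun _ => rfl
    have hw1 : ∀ X : State d, fderiv ℝ (wt γ (some none)) W X
      = fderiv ℝ (fun V : State d => chem γ V.1 (vel V) (temp γ V)) W X := fun _ => rfl
    have hw2 : ∀ (X : State d) j, fderiv ℝ (wt γ (some (some j))) W X = dvel W X j :=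
      fun _ _ => rfl
    refine Eq.trans ?_ (hprod.trans ?_)
    · simp only [Fintype.sum_option, hw0, hw1, hw2, dens, densFlux, hpu, hentropy, flux,
        entropyFlux, hp, hmom, mul_div_cancel_left₀ _ hU.1.ne']
      congr 1
      · ring
      · exact Finset.sum_congr rfl fun i _ => by ring
    · rw [thermoRel_eq_sub hγ ⟨hU.1, hUϑ⟩ hW.1 hθW]
  · rw [div_mul_eq_mul_div, le_div_iff₀ hθ₀]
    refine le_trans ?_ hdef
    rw [mul_comm]
    exact mul_le_mul_of_nonneg_right hθ (mul_nonneg hU.1.le (sq_nonneg _))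

end Weights

namespace RectMesh

variable {n : ℕ} {γ : ℝ} {Ω : Set (Fin (n + 1) → ℝ)} {𝒯 : RectMesh (n + 1) Ω}
  {U U' : Fin 𝒯.n → State (n + 1)}
  {V : Fin (n + 1) → Fin 𝒯.n → Fin 𝒯.n → State (n + 1)}
  {VR VL : Fin (n + 1) → Fin 𝒯.n → State (n + 1)}

theorem IsGodunovStep.dens_balance (hγ : 1 < γ) (h : IsGodunovStep γ 𝒯 U U' V VR VL)
    (K : Fin 𝒯.n) (hg : IsGas γ (U K)) (a : Option (Option (Fin (n + 1)))) {c : ℝ}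
    (hc : a = none → 0 ≤ c) :
    -(c * (𝒯.cellVol K * fderiv ℝ (dens γ a) (U K) (U' K)))
      ≤ ∑ i, c * 𝒯.netFlux i (fun K L => densFlux γ i a (V i K L))
        (fun K => densFlux γ i a (VR i K)) (fun K => densFlux γ i a (VL i K)) K := by
  rw [← Finset.mul_sum]
  match a, hc with
  | none, hc =>
    have := mul_le_mul_of_nonneg_left (h.entropy_ge hγ K hg) (hc rfl)
    rw [mul_neg] at this
    exact neg_le.1 this
  | some none, _ =>
    have h1 := h.clm_balance K (densityL (n + 1))
    have h2 : fderiv ℝ (dens γ (some none)) (U K) = densityL (n + 1) :=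
      (densityL (n + 1)).hasFDerivAt.fderiv
    rw [h2, h1, mul_neg, neg_neg]
    rfl
  | some (some j), _ =>
    have h1 := h.clm_balance K (momL (n + 1) j)
    have h2 : fderiv ℝ (dens γ (some (some j))) (U K) = momL (n + 1) j :=
      (momL (n + 1) j).hasFDerivAt.fderiv
    rw [h2, h1, mul_neg, neg_neg]
    rfl

/-- Total energy is conserved. -/
theorem IsGodunovStep.sum_energy (hγ : 1 < γ) (hΩ : interior (closure Ω) = Ω)
    (h : IsGodunovStep γ 𝒯 U U' V VR VL)
    (hg : ∀ K, IsGas γ (U K)) : ∑ K, 𝒯.cellVol K * (U' K).2.2 = 0 := by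
  have h1 : ∀ K, 𝒯.cellVol K * (U' K).2.2 = -∑ i, 𝒯.netFlux i
      (fun K L => (flux γ i (V i K L)).2.2) (fun K => (flux γ i (VR i K)).2.2)
      (fun K => (flux γ i (VL i K)).2.2) K := fun K => h.clm_balance K (energyL (n + 1))
  rw [Finset.sum_congr rfl fun K _ => h1 K, Finset.sum_neg_distrib, neg_eq_zero, Finset.sum_comm]
  refine Finset.sum_eq_zero fun i _ => ?_
  have h2 := 𝒯.abs_sum_parts_le hΩ i (f := fun _ => 1) (C := 0) (fbar := fun _ => 1) (b := 0)
    (fun K => (LipschitzWith.const 1).lipschitzOnWith) (fun K x _ => by simp) (fun K => 0)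
    (fun K L => (flux γ i (V i K L)).2.2) (fun K => (flux γ i (VR i K)).2.2)
    (fun K => (flux γ i (VL i K)).2.2)
    (Or.inl ⟨fun K hK => (wall_flux hγ (hg K) (Or.inl (h.wallR i K hK))).2.2.1,
      fun K hK => (wall_flux hγ (hg K) (Or.inr (h.wallL i K hK))).2.2.1⟩)
  simpa using h2

/-- The deviation of the numerical fluxes is controlled by the total variation. -/
theorem exists_deviation_le (hγ : 1 < γ) (hΩ : interior (closure Ω) = Ω) {k K : ℝ} (hk : 0 < k)
    {B : ℝ} :
    ∃ D : ℝ, 0 ≤ D ∧ ∀ (𝒯 : RectMesh (n + 1) Ω) (U U' : Fin 𝒯.n → State (n + 1))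
      (V : Fin (n + 1) → Fin 𝒯.n → Fin 𝒯.n → State (n + 1))
      (VR VL : Fin (n + 1) → Fin 𝒯.n → State (n + 1)), IsGodunovStep γ 𝒯 U U' V VR VL →
      (∀ L, U L ∈ rangeSet (n + 1) γ k K) → 𝒯.totalJump U ≤ B → ∀ i a,
      𝒯.deviation i (fun K => densFlux γ i a (U K)) (fun K L => densFlux γ i a (V i K L))
        (fun K => densFlux γ i a (VR i K)) (fun K => densFlux γ i a (VL i K)) ≤ D := by
  obtain ⟨C, hC, hflux⟩ := exists_densFlux_bound (d := n + 1) (K := K) hγ hk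
  obtain ⟨R, hR, hn⟩ := exists_norm_le (d := n + 1) (K := K) hγ hk
  obtain ⟨A, hA, harea⟩ := exists_wallArea_le hΩ
  refine ⟨2 * C * max B 0 + 2 * (A * (C * (R + R))), by positivity,
    fun 𝒯 U U' V VR VL h hU hB i a => ?_⟩
  have hdiff : ∀ {X Y : State (n + 1)}, X ∈ rangeSet (n + 1) γ k K → Y ∈ rangeSet (n + 1) γ k K →
      C * ‖X - Y‖ ≤ C * (R + R) := fun {X Y} hX hY => by
    gcongr
    exact (norm_sub_le _ _).trans (add_le_add (hn _ hX) (hn _ hY))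
  have aux : ∀ {x y z : ℝ}, 0 ≤ x → (0 < x → y ≤ z) → x * y ≤ x * z := fun {x y z} hx hxy => by
    rcases hx.eq_or_lt with h0 | h0
    · rw [← h0, zero_mul, zero_mul]
    · exact mul_le_mul_of_nonneg_left (hxy h0) hx
  refine add_le_add ?_ ?_
  · have h1 : ∀ K L, 𝒯.faceArea i K L * (|densFlux γ i a (V i K L) - densFlux γ i a (U K)|
        + |densFlux γ i a (V i K L) - densFlux γ i a (U L)|)
        ≤ 𝒯.faceArea i K L * (2 * C * stateNorm (U L - U K)) := fun K L =>
      aux (𝒯.faceArea_nonneg i K L) fun hf => by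
        obtain ⟨e1, e2⟩ := hflux _ (hU K) _ (hU L) i _ (h.face i K L hf) a
        have e3 := mul_le_mul_of_nonneg_left (norm_le_stateNorm (U L - U K)) hC
        linarith
    refine (Finset.sum_le_sum fun K _ => Finset.sum_le_sum fun L _ => h1 K L).trans ?_
    have h2 : ∑ K, ∑ L, 𝒯.faceArea i K L * (2 * C * stateNorm (U L - U K))
        = 2 * C * ∑ K, ∑ L, 𝒯.faceArea i K L * stateNorm (U L - U K) := by
      simp only [Finset.mul_sum]
      exact Finset.sum_congr rfl fun K _ => Finset.sum_congr rfl fun L _ => by ring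
    rw [h2]
    refine mul_le_mul_of_nonneg_left (le_trans ?_ (hB.trans (le_max_left _ _))) (by positivity)
    exact Finset.single_le_sum
      (f := fun i => ∑ K, ∑ L, 𝒯.faceArea i K L * stateNorm (U L - U K))
      (fun i _ => Finset.sum_nonneg fun K _ => Finset.sum_nonneg fun L _ =>
        mul_nonneg (𝒯.faceArea_nonneg i K L) (Real.sqrt_nonneg _)) (Finset.mem_univ i)
  · have h1 : ∀ K, 𝒯.wallAreaR i K * |densFlux γ i a (VR i K) - densFlux γ i a (U K)|
        + 𝒯.wallAreaL i K * |densFlux γ i a (VL i K) - densFlux γ i a (U K)|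
        ≤ 𝒯.wallAreaR i K * (C * (R + R)) + 𝒯.wallAreaL i K * (C * (R + R)) := fun K =>
      add_le_add
        (aux (𝒯.wallAreaR_nonneg i K) fun hw => (hflux _ (hU K) _ (reflect_mem_rangeSet (hU K)) i _
          (h.wallR i K hw) a).1.trans (hdiff (reflect_mem_rangeSet (hU K)) (hU K)))
        (aux (𝒯.wallAreaL_nonneg i K) fun hw => (hflux _ (reflect_mem_rangeSet (hU K)) _ (hU K) i _
          (h.wallL i K hw) a).2.trans (hdiff (hU K) (reflect_mem_rangeSet (hU K))))
    refine (Finset.sum_le_sum fun K _ => h1 K).trans ?_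
    rw [Finset.sum_add_distrib, ← Finset.sum_mul, ← Finset.sum_mul, two_mul]
    have hb : 0 ≤ C * (R + R) := by positivity
    exact add_le_add (mul_le_mul_of_nonneg_right (harea 𝒯 i).1 hb)
      (mul_le_mul_of_nonneg_right (harea 𝒯 i).2 hb)

end RectMesh

/-! ### The relative energy as a function of time -/

/-- Relative energy of the state `U` with respect to the state `W`. -/
def cellRel {d : ℕ} (γ : ℝ) (U W : State d) : ℝ := relLin γ U W.1 (vel W) (temp γ W)

namespace RectMesh

variable {n : ℕ} {γ T k K k' K' : ℝ} {L : NNReal} {Ω : Set (Fin (n + 1) → ℝ)}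
  {𝒯 : RectMesh (n + 1) Ω} {W : ℝ × (Fin (n + 1) → ℝ) → State (n + 1)}
  {U U' : ℝ → Fin 𝒯.n → State (n + 1)}
  {V : ℝ → Fin (n + 1) → Fin 𝒯.n → Fin 𝒯.n → State (n + 1)}
  {VR VL : ℝ → Fin (n + 1) → Fin 𝒯.n → State (n + 1)}

/-- Total relative energy of piecewise constant data `U` with respect to `W` at time `t`. -/
def totalRel (γ : ℝ) (𝒯 : RectMesh (n + 1) Ω) (U : ℝ → Fin 𝒯.n → State (n + 1))
    (W : ℝ × (Fin (n + 1) → ℝ) → State (n + 1)) (t : ℝ) : ℝ :=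
  ∑ K, ∫ x in Icc (𝒯.lo K) (𝒯.hi K), cellRel γ (U t K) (W (t, x))

theorem _root_.GodunovEuler.IsLipschitzFlow.mem_cell (hF : IsLipschitzFlow γ T k K L 𝒯 W) {t : ℝ}
    (ht : t ∈ Icc 0 T) {J : Fin 𝒯.n} {x : Fin (n + 1) → ℝ} (hx : x ∈ Icc (𝒯.lo J) (𝒯.hi J)) :
    W (t, x) ∈ rangeSet (n + 1) γ k K := hF.mem _ ⟨ht, 𝒯.Icc_subset_closure J hx⟩

theorem _root_.GodunovEuler.IsLipschitzFlow.lipschitz_slice (hF : IsLipschitzFlow γ T k K L 𝒯 W)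
    {t : ℝ} (ht : t ∈ Icc 0 T) (J : Fin 𝒯.n) {f : State (n + 1) → ℝ} {C : NNReal}
    (hf : LipschitzOnWith C f (rangeSet (n + 1) γ k K)) :
    LipschitzOnWith (C * L) (fun x => f (W (t, x))) (Icc (𝒯.lo J) (𝒯.hi J)) := by
  refine LipschitzOnWith.comp (g := f) (f := fun x => W (t, x)) hf ?_
    fun x hx => hF.mem_cell ht hx
  refine LipschitzOnWith.of_dist_le_mul fun x hx y hy => ?_
  have := (hF.lipschitz J).dist_le_mul (t, x) ⟨ht, hx⟩ (t, y) ⟨ht, hy⟩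
  rwa [show dist (t, x) (t, y) = dist x y by simp [Prod.dist_eq]] at this

theorem _root_.GodunovEuler.IsLipschitzFlow.continuousOn_slice (hk : 0 < k)
    (hF : IsLipschitzFlow γ T k K L 𝒯 W)
    {t : ℝ} (ht : t ∈ Icc 0 T) (J : Fin 𝒯.n) {f : State (n + 1) → ℝ}
    (hf : ∀ U, IsGas γ U → ContDiffAt ℝ 1 f U) :
    ContinuousOn (fun x => f (W (t, x))) (Icc (𝒯.lo J) (𝒯.hi J)) := fun x hx =>
  ContinuousAt.comp_continuousWithinAt (f := fun x => W (t, x))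
    (hf _ (isGas_of_mem hk (hF.mem_cell ht hx))).continuousAt
    (((hF.lipschitz J).continuousOn (t, x) ⟨ht, hx⟩).comp (f := fun x => (t, x))
      (by fun_prop) fun y hy => ⟨ht, hy⟩)

theorem contDiffAt_cellRel_right (U : State (n + 1)) {X : State (n + 1)}
    (h : IsGas γ X) : ContDiffAt ℝ 1 (cellRel γ U) X := by
  have e : cellRel γ U = fun X : State (n + 1) =>
      U.2.2 - ∑ a, wt γ a X * dens γ a U + X.1 * temp γ X := funext fun X => relLin_eq_sum U X
  rw [e]
  exact (contDiffAt_const.sub (ContDiffAt.sum fun a _ =>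
    (contDiffAt_wt h a).mul contDiffAt_const)).add (contDiffAt_fst.mul (contDiffAt_temp h.1.ne'))

theorem exists_cellRel_lipschitz (hγ : 1 < γ) (hk : 0 < k) (hk' : 0 < k')
    (hF : IsLipschitzFlow γ T k K L 𝒯 W) (hU : IsBoundedGodunov γ T k' K' 𝒯 U U' V VR VL) :
    ∃ C : NNReal, ∀ J, ∀ x ∈ Icc (𝒯.lo J) (𝒯.hi J),
      LipschitzOnWith C (fun t => cellRel γ (U t J) (W (t, x))) (Icc 0 T) := by
  obtain ⟨CU, hCU⟩ := hU.exists_deriv_bound hγ hk'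
  obtain ⟨C, hC, hlip⟩ := exists_lipschitz_of_isCompact
    ((isCompact_rangeSet (d := n + 1) (K := K') hγ hk').prod
      (isCompact_rangeSet (d := n + 1) (K := K) hγ hk))
    (f := fun P : State (n + 1) × State (n + 1) => cellRel γ P.1 P.2) fun P hP => by
      have h1 := isGas_of_mem hk' hP.1
      have h2 := isGas_of_mem hk hP.2
      have e : (fun P : State (n + 1) × State (n + 1) => cellRel γ P.1 P.2) = fun P =>
          P.1.2.2 - ∑ a, wt γ a P.2 * dens γ a P.1 + P.2.1 * temp γ P.2 :=
        funext fun P => relLin_eq_sum P.1 P.2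
      rw [e]
      have d2 : ContDiffAt ℝ 1 (fun P : State (n + 1) × State (n + 1) => P.2) P := contDiffAt_snd
      have d1 : ContDiffAt ℝ 1 (fun P : State (n + 1) × State (n + 1) => P.1) P := contDiffAt_fst
      exact (d1.snd.snd.sub (ContDiffAt.sum fun a _ => ((contDiffAt_wt h2 a).comp P d2).mul
        ((contDiffAt_dens hγ h1 a).comp P d1))).add
        (d2.fst.mul ((contDiffAt_temp h2.1.ne').comp P d2))
  lift C to NNReal using hC
  refine ⟨C * (CU + L), fun J x hx => ?_⟩
  have hUl : LipschitzOnWith CU (fun t => U t J) (Icc 0 T) :=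
    (convex_Icc 0 T).lipschitzOnWith_of_nnnorm_hasDerivWithin_le
      (fun t ht => hU.deriv t ht J) fun t ht => hCU t ht J
  refine LipschitzOnWith.of_dist_le_mul fun t ht s hs => ?_
  have h1 := hlip (U t J, W (t, x)) ⟨hU.mem t ht J, hF.mem_cell ht hx⟩
    (U s J, W (s, x)) ⟨hU.mem s hs J, hF.mem_cell hs hx⟩
  have h2 := hUl.dist_le_mul t ht s hs
  have h3 := (hF.lipschitz J).dist_le_mul (t, x) ⟨ht, hx⟩ (s, x) ⟨hs, hx⟩
  rw [show dist (t, x) (s, x) = dist t s by simp [Prod.dist_eq]] at h3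
  rw [← Real.dist_eq] at h1
  refine h1.trans ?_
  rw [← dist_eq_norm, NNReal.coe_mul, mul_assoc]
  refine mul_le_mul_of_nonneg_left ?_ C.2
  rw [NNReal.coe_add, add_mul, Prod.dist_eq]
  have h4 : 0 ≤ (CU : ℝ) * dist t s := by positivity
  have h5 : 0 ≤ (L : ℝ) * dist t s := by positivity
  exact max_le (by linarith) (by linarith)

theorem exists_totalRel_lipschitz (hγ : 1 < γ) (hk : 0 < k) (hk' : 0 < k')
    (hF : IsLipschitzFlow γ T k K L 𝒯 W) (hU : IsBoundedGodunov γ T k' K' 𝒯 U U' V VR VL) :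
    ∃ C : NNReal, LipschitzOnWith C (totalRel γ 𝒯 U W) (Icc 0 T) := by
  obtain ⟨C, hC⟩ := exists_cellRel_lipschitz hγ hk hk' hF hU
  have hint : ∀ t ∈ Icc 0 T, ∀ J, IntegrableOn (fun x => cellRel γ (U t J) (W (t, x)))
      (Icc (𝒯.lo J) (𝒯.hi J)) := fun t ht J =>
    (hF.continuousOn_slice hk ht J fun X hX => contDiffAt_cellRel_right _ hX).integrableOn_compact
      isCompact_Icc
  refine ⟨∑ J, C * ⟨𝒯.cellVol J, (𝒯.cellVol_pos J).le⟩,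
    LipschitzOnWith.of_dist_le_mul fun t ht s hs => ?_⟩
  rw [Real.dist_eq, totalRel, totalRel, ← Finset.sum_sub_distrib, NNReal.coe_sum, Finset.sum_mul]
  refine (Finset.abs_sum_le_sum_abs _ _).trans (Finset.sum_le_sum fun J _ => ?_)
  rw [← integral_sub (hint t ht J) (hint s hs J)]
  refine (norm_setIntegral_le_of_norm_le_const (f := fun x => cellRel γ (U t J) (W (t, x))
    - cellRel γ (U s J) (W (s, x))) isCompact_Icc.measure_lt_top (C := C * dist t s) fun x hx => (hC J x hx).dist_le_mul t ht s hs).trans (le_of_eq ?_)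
  rw [𝒯.measureReal_Icc]
  show _ = C * 𝒯.cellVol J * dist t s
  ring

/-- Time derivative of the relative energy density. -/
def relRate (γ : ℝ) (𝒯 : RectMesh (n + 1) Ω) (U U' : ℝ → Fin 𝒯.n → State (n + 1))
    (W : ℝ × (Fin (n + 1) → ℝ) → State (n + 1)) (t : ℝ) (J : Fin 𝒯.n) (x : Fin (n + 1) → ℝ) : ℝ :=
  (U' t J).2.2 - ∑ a, (fderiv ℝ (fun z => wt γ a (W z)) (t, x) (dirT _) * dens γ a (U t J)
      + wt γ a (W (t, x)) * fderiv ℝ (dens γ a) (U t J) (U' t J))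
    + fderiv ℝ (fun z => (W z).1 * temp γ (W z)) (t, x) (dirT _)

theorem ae_hasDerivAt_totalRel (hγ : 1 < γ) (hk : 0 < k) (hk' : 0 < k')
    (hF : IsLipschitzFlow γ T k K L 𝒯 W) (hU : IsBoundedGodunov γ T k' K' 𝒯 U U' V VR VL)
    {t : ℝ} (ht : t ∈ Ioo 0 T)
    (hd : ∀ᵐ x, ∀ J, x ∈ 𝒯.cell J → DifferentiableAt ℝ W (t, x)) :
    (∀ J, IntegrableOn (relRate γ 𝒯 U U' W t J) (Icc (𝒯.lo J) (𝒯.hi J))) ∧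
    HasDerivAt (totalRel γ 𝒯 U W)
      (∑ J, ∫ x in Icc (𝒯.lo J) (𝒯.hi J), relRate γ 𝒯 U U' W t J x) t := by
  obtain ⟨C, hC⟩ := exists_cellRel_lipschitz hγ hk hk' hF hU
  have htI := Ioo_subset_Icc_self ht
  have hnhds : Icc 0 T ∈ 𝓝 t := Icc_mem_nhds ht.1 ht.2
  suffices key : ∀ J, IntegrableOn (relRate γ 𝒯 U U' W t J) (Icc (𝒯.lo J) (𝒯.hi J)) ∧
      HasDerivAt (fun t => ∫ x in Icc (𝒯.lo J) (𝒯.hi J), cellRel γ (U t J) (W (t, x)))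
        (∫ x in Icc (𝒯.lo J) (𝒯.hi J), relRate γ 𝒯 U U' W t J x) t from
    ⟨fun J => (key J).1, HasDerivAt.fun_sum fun J _ => (key J).2⟩
  intro J
  refine hasDerivAt_integral_of_dominated_loc_of_lip
    (F := fun t x => cellRel γ (U t J) (W (t, x))) (bound := fun _ => C) hnhds ?_ ?_ ?_ ?_ ?_ ?_
  · filter_upwards [hnhds] with s hs
    exact (hF.continuousOn_slice hk hs J fun X hX =>
      contDiffAt_cellRel_right _ hX).aestronglyMeasurable measurableSet_Icc
  · exact (hF.continuousOn_slice hk htI J fun X hX =>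
      contDiffAt_cellRel_right _ hX).integrableOn_compact isCompact_Icc
  · have hm : ∀ g : ℝ × (Fin (n + 1) → ℝ) → ℝ, AEStronglyMeasurable
        (fun x => fderiv ℝ g (t, x) (dirT (n + 1))) (volume.restrict (Icc (𝒯.lo J) (𝒯.hi J))) :=
      fun g => ((measurable_fderiv_apply_const ℝ g _).comp
        measurable_prodMk_left).aestronglyMeasurable
    refine (aestronglyMeasurable_const.sub (Finset.aestronglyMeasurable_fun_sum _ fun a _ => ?_)).add
      (hm _)
    exact ((hm _).mul_const _).add ((hF.continuousOn_slice hk htI J fun X hX =>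
      contDiffAt_wt hX a).aestronglyMeasurable measurableSet_Icc |>.mul_const _)
  · filter_upwards [ae_restrict_mem measurableSet_Icc] with x hx
    simpa using hC J x hx
  · exact integrableOn_const isCompact_Icc.measure_lt_top.ne
  · rw [← Measure.restrict_congr_set (openBox_ae_eq_Icc (𝒯.lo J) (𝒯.hi J))]
    filter_upwards [ae_restrict_of_ae hd, ae_restrict_mem (isOpen_openBox _ _).measurableSet]
      with x hx hxJ
    have hdW := hx J hxJ
    have hgas := isGas_of_mem hk (hF.mem_cell htI (openBox_subset_Icc _ _ hxJ))
    have hgasU := isGas_of_mem hk' (hU.mem t htI J)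
    have hline : HasDerivAt (fun s : ℝ => (s, x)) (dirT (n + 1)) t :=
      (hasDerivAt_id t).prodMk (hasDerivAt_const t x)
    have hcomp : ∀ {f : State (n + 1) → ℝ}, ContDiffAt ℝ 1 f (W (t, x)) →
        HasDerivAt (fun s => f (W (s, x))) (fderiv ℝ (fun z => f (W z)) (t, x) (dirT _)) t :=
      fun {f} hf => HasFDerivAt.comp_hasDerivAt (f := fun s : ℝ => (s, x)) t
        (((hf.differentiableAt one_ne_zero).comp (t, x) hdW).hasFDerivAt) hline
    have hUd : HasDerivAt (fun s => U s J) (U' t J) t := (hU.deriv t htI J).hasDerivAt hnhds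
    have hdens : ∀ a, HasDerivAt (fun s => dens γ a (U s J))
        (fderiv ℝ (dens γ a) (U t J) (U' t J)) t := fun a =>
      HasFDerivAt.comp_hasDerivAt (f := fun s => U s J) t
        ((contDiffAt_dens hγ hgasU a).differentiableAt one_ne_zero).hasFDerivAt hUd
    have hE : HasDerivAt (fun s => (U s J).2.2) (U' t J).2.2 t := hUd.snd.snd
    have := (hE.sub (HasDerivAt.fun_sum fun a (_ : a ∈ Finset.univ) =>
      (hcomp (contDiffAt_wt hgas a)).mul (hdens a))).add
      (hcomp (contDiffAt_fst.mul (contDiffAt_temp (γ := γ) hgas.1.ne')))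
    refine this.congr_of_eventuallyEq (Eventually.of_forall fun s => ?_)
    exact relLin_eq_sum _ _

end RectMesh

/-! ### The differential inequality for the relative energy -/

namespace RectMesh

variable {n : ℕ} {Ω : Set (Fin (n + 1) → ℝ)}

theorem abs_sub_mean_le {𝒯 : RectMesh (n + 1) Ω} {h : ℝ} (hh : 0 ≤ h) (hs : 𝒯.SizeLE h) {J : Fin 𝒯.n}
    {f : (Fin (n + 1) → ℝ) → ℝ} {C : NNReal}
    (hf : LipschitzOnWith C f (Icc (𝒯.lo J) (𝒯.hi J))) {x : Fin (n + 1) → ℝ}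
    (hx : x ∈ Icc (𝒯.lo J) (𝒯.hi J)) :
    |f x - (𝒯.cellVol J)⁻¹ * ∫ y in Icc (𝒯.lo J) (𝒯.hi J), f y| ≤ C * h := by
  have hv := 𝒯.cellVol_pos J
  have h1 := abs_setIntegral_sub_le isCompact_Icc.measure_lt_top.ne
    (hf.continuousOn.integrableOn_compact isCompact_Icc) (c := f x) (B := C * h) fun y hy => by
      refine (hf.dist_le_mul y hy x hx).trans (mul_le_mul_of_nonneg_left ?_ C.2)
      rw [dist_pi_le_iff hh]
      intro j
      have h1 := hs J j
      have h2 := hy.1 j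
      have h3 := hy.2 j
      have h4 := hx.1 j
      have h5 := hx.2 j
      rw [Real.dist_eq, abs_le]
      constructor <;> linarith
  rw [𝒯.measureReal_Icc] at h1
  have h2 : f x - (𝒯.cellVol J)⁻¹ * ∫ y in Icc (𝒯.lo J) (𝒯.hi J), f y
      = -((𝒯.cellVol J)⁻¹ * ((∫ y in Icc (𝒯.lo J) (𝒯.hi J), f y) - 𝒯.cellVol J * f x)) := by
    field_simp; ring
  rw [h2, abs_neg, abs_mul, abs_of_pos (inv_pos.2 hv), inv_mul_le_iff₀ hv]
  exact h1

theorem exists_rate {γ : ℝ} (hγ : 1 < γ) (hΩ : interior (closure Ω) = Ω) {k K S₀ : ℝ} (hk : 0 < k)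
    (hK : 0 < K) (L : NNReal) (hS0 : 0 ≤ S₀)
    (hS : ∀ X ∈ rangeSet (n + 1) γ k K, |spEntropy γ X.1 (temp γ X)| ≤ S₀) :
    ∃ c : ℝ, 0 ≤ c ∧ ∀ k' K' B : ℝ, 0 < k' → ∃ C : ℝ, 0 ≤ C ∧
    ∀ (T h : ℝ) (𝒯 : RectMesh (n + 1) Ω) (W : ℝ × (Fin (n + 1) → ℝ) → State (n + 1))
      (U U' : ℝ → Fin 𝒯.n → State (n + 1))
      (V : ℝ → Fin (n + 1) → Fin 𝒯.n → Fin 𝒯.n → State (n + 1))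
      (VR VL : ℝ → Fin (n + 1) → Fin 𝒯.n → State (n + 1)),
      IsLipschitzFlow γ T k K L 𝒯 W → IsBoundedGodunov γ T k' K' 𝒯 U U' V VR VL → 0 ≤ h →
      𝒯.SizeLE h → (∀ t ∈ Icc 0 T, ∀ J, -S₀ ≤ spEntropy γ (U t J).1 (temp γ (U t J))) →
      (∀ t ∈ Icc 0 T, 𝒯.totalJump (U t) ≤ B) →
      ∀ᵐ t, t ∈ Ioo 0 T → ∃ y', HasDerivAt (totalRel γ 𝒯 U W) y' t ∧
        y' ≤ c * totalRel γ 𝒯 U W t + C * h := by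
  obtain ⟨Cw, hCw, hw⟩ := exists_lipschitz_rangeSet_all (d := n + 1) (K := K) hγ hk
    (f := wt γ) fun a X hX => contDiffAt_wt hX a
  obtain ⟨Cp, hCp, hp⟩ := exists_lipschitz_rangeSet_all (d := n + 1) (K := K) hγ hk
    (f := fun (i : Fin (n + 1)) (X : State (n + 1)) => X.1 * temp γ X * vel X i) fun i X hX =>
      (contDiffAt_fst.mul (contDiffAt_temp hX.1.ne')).mul (contDiffAt_vel hX.1.ne' i)
  lift Cw to NNReal using hCw
  lift Cp to NNReal using hCp
  have hg : 0 < γ - 1 := by linarith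
  have hG : (0 : ℝ) ≤ (Cw * L : NNReal) := NNReal.coe_nonneg _
  obtain ⟨c, hc⟩ : ∃ c : ℝ, c = (γ - 1) * ((n + 1 : ℕ) * (Cw * L : NNReal)) + (n + 1 : ℕ)
    * (Cw * L : NNReal) * (4 * (1 / (γ - 1) + 1) * Real.exp (S₀ + S₀) / (k / K))
    + (Cw * L : NNReal) + 2 * ((n + 1 : ℕ) * (Cw * L : NNReal)) := ⟨_, rfl⟩
  refine ⟨c, by rw [hc]; positivity, fun k' K' B hk' => ?_⟩
  obtain ⟨D, hD, hdev⟩ := exists_deviation_le (K := K') (B := B) hγ hΩ hk'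
  refine ⟨∑ _a : Option (Option (Fin (n + 1))), ∑ _i : Fin (n + 1), (Cw * L : NNReal) * D,
    by positivity, fun T h 𝒯 W U U' V VR VL hF hU hh hsize hent hjump => ?_⟩
  filter_upwards [Measure.ae_ae_of_ae_prod hF.euler] with t hae ht
  have htI := Ioo_subset_Icc_self ht
  have hstep := hU.step t htI
  have hgasU := fun J => isGas_of_mem hk' (hU.mem t htI J)
  obtain ⟨hint, hder⟩ := ae_hasDerivAt_totalRel hγ hk hk' hF hU ht (by
    filter_upwards [hae] with x hx J hxJ using (hx J ⟨ht, hxJ⟩).1)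
  refine ⟨_, hder, ?_⟩
  have hfL : ∀ a J, LipschitzOnWith (Cw * L) (fun x => wt γ a (W (t, x)))
      (Icc (𝒯.lo J) (𝒯.hi J)) := fun a J => hF.lipschitz_slice htI J
    (LipschitzOnWith.of_dist_le_mul fun X hX Y hY => by
      rw [Real.dist_eq, dist_eq_norm]; exact hw a X hX Y hY)
  have hqL : ∀ i J, LipschitzOnWith (Cp * L)
      (fun x => (W (t, x)).1 * temp γ (W (t, x)) * vel (W (t, x)) i)
      (Icc (𝒯.lo J) (𝒯.hi J)) := fun i J => hF.lipschitz_slice htI J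
        (f := fun X : State (n + 1) => X.1 * temp γ X * vel X i)
    (LipschitzOnWith.of_dist_le_mul fun X hX Y hY => by
      rw [Real.dist_eq, dist_eq_norm]; exact hp i X hX Y hY)
  set I : Fin 𝒯.n → Set (Fin (n + 1) → ℝ) := fun J => Icc (𝒯.lo J) (𝒯.hi J) with hI
  set f := fun a x => wt γ a (W (t, x)) with hf
  set q := fun i x => (W (t, x)).1 * temp γ (W (t, x)) * vel (W (t, x)) i with hq
  set df := fun (i : Fin (n + 1)) a x => fderiv ℝ (f a) x (Pi.single i 1) with hdf
  set dq := fun (i : Fin (n + 1)) x => fderiv ℝ (q i) x (Pi.single i 1) with hdq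
  set g := fun i a J => densFlux γ i a (U t J) with hgdef
  set net := fun i a J => 𝒯.netFlux i (fun J L => densFlux γ i a (V t i J L))
    (fun J => densFlux γ i a (VR t i J)) (fun J => densFlux γ i a (VL t i J)) J with hnet
  set fbar := fun a J => (𝒯.cellVol J)⁻¹ * ∫ y in I J, f a y with hfbar
  set Dd := fun a J => fderiv ℝ (dens γ a) (U t J) (U' t J) with hDd
  have hfi : ∀ a J, IntegrableOn (f a) (I J) := fun a J =>
    (hfL a J).continuousOn.integrableOn_compact isCompact_Icc
  have hdfi : ∀ i a J, IntegrableOn (df i a) (I J) := fun i a J => integrableOn_fderiv_single (hfL a J) i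
  have hdqi : ∀ i J, IntegrableOn (dq i) (I J) := fun i J => integrableOn_fderiv_single (hqL i J) i
  have hparts : ∀ a i, ∑ J, fbar a J * net i a J
      ≤ (Cw * L : NNReal) * D * h - ∑ J, g i a J * ∫ x in I J, df i a x := by
    intro a i
    have h1 := 𝒯.abs_sum_parts_le hΩ i (hfL a) (fbar := fbar a) (b := (Cw * L : NNReal) * h)
      (fun J x hx => abs_sub_mean_le hh hsize (hfL a J) hx) (g i a)
      (fun J L => densFlux γ i a (V t i J L))
      (fun J => densFlux γ i a (VR t i J)) (fun J => densFlux γ i a (VL t i J)) (by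
        by_cases ha : a = some (some i)
        · right
          intro x hx hn
          rw [ha]
          exact hF.wall t htI x hx i hn
        · exact Or.inl ⟨fun J hJ => densFlux_wall hγ (hgasU J) (Or.inl (hstep.wallR i J hJ)) ha,
            fun J hJ => densFlux_wall hγ (hgasU J) (Or.inr (hstep.wallL i J hJ)) ha⟩)
    have h2 := mul_le_mul_of_nonneg_left (hdev 𝒯 _ _ _ _ _ hstep (hU.mem t htI) (hjump t htI) i a)
      (mul_nonneg hG hh)
    have h3 := (abs_le.1 h1).2
    have h4 : (Cw * L : NNReal) * h * D = (Cw * L : NNReal) * D * h := by ring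
    linarith
  -- the part of the rate that contains the scheme
  set N := fun J x => (U' t J).2.2 - ∑ a, f a x * Dd a J with hN
  have hcst : ∀ J, IntegrableOn (fun _ : Fin (n + 1) → ℝ => (U' t J).2.2) (I J) := fun J =>
    integrableOn_const isCompact_Icc.measure_lt_top.ne
  have hsum : ∀ J, IntegrableOn (fun x => ∑ a, f a x * Dd a J) (I J) := fun J =>
    integrable_finsetSum _ fun a _ => (hfi a J).mul_const _
  have hNi : ∀ J, IntegrableOn (N J) (I J) := fun J =>
    (hcst J).sub (hsum J)
  have hNint : ∀ J, ∫ x in I J, N J x ≤ 𝒯.cellVol J * (U' t J).2.2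
      + ∑ a, ∑ i, fbar a J * net i a J := by
    intro J
    have h1 : ∫ x in I J, N J x = 𝒯.cellVol J * (U' t J).2.2 - ∑ a, (∫ x in I J, f a x) * Dd a J := by
      rw [hN, integral_sub (hcst J) (hsum J), integral_finsetSum _ fun a _ => (hfi a J).mul_const _, setIntegral_const, measureReal_Icc]
      simp only [integral_mul_const, smul_eq_mul]
    rw [h1, sub_eq_add_neg, ← Finset.sum_neg_distrib]
    refine add_le_add le_rfl (Finset.sum_le_sum fun a _ => ?_)
    refine le_trans (le_of_eq ?_) (hstep.dens_balance hγ J (hgasU J) a (c := fbar a J) fun ha => ?_)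
    · simp only [hfbar, hDd]
      have := (𝒯.cellVol_pos J).ne'
      field_simp
    · rw [ha]
      refine mul_nonneg (inv_nonneg.2 (𝒯.cellVol_pos J).le)
        (setIntegral_nonneg measurableSet_Icc fun x hx => ?_)
      exact (isGas_of_mem hk (hF.mem_cell htI hx)).temp_pos.le
  have hNsum : ∑ J, ∫ x in I J, N J x
      ≤ ∑ a, ∑ i, ((Cw * L : NNReal) * D * h - ∑ J, g i a J * ∫ x in I J, df i a x) := by
    refine (Finset.sum_le_sum fun J _ => hNint J).trans ?_
    rw [Finset.sum_add_distrib, hstep.sum_energy hγ hΩ hgasU, zero_add, Finset.sum_comm]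
    refine Finset.sum_le_sum fun a _ => ?_
    rw [Finset.sum_comm]
    exact Finset.sum_le_sum fun i _ => hparts a i
  -- the production
  set P := fun J x => relRate γ 𝒯 U U' W t J x - N J x with hP
  have hPi : ∀ J, IntegrableOn (P J) (I J) := fun J => (hint J).sub (hNi J)
  set Z := fun J x => P J x + ∑ i, (dq i x - ∑ a, g i a J * df i a x) with hZ
  have hZi' : ∀ i J, IntegrableOn (fun x => ∑ a, g i a J * df i a x) (I J) := fun i J =>
    integrable_finsetSum _ fun a _ => (hdfi i a J).const_mul _
  have hZi'' : ∀ J, IntegrableOn (fun x => ∑ i, (dq i x - ∑ a, g i a J * df i a x)) (I J) := fun J =>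
    integrable_finsetSum _ fun i _ => (hdqi i J).sub (hZi' i J)
  have hZint : ∀ J, ∫ x in I J, Z J x = (∫ x in I J, P J x)
      + ∑ i, ((∫ x in I J, dq i x) - ∑ a, g i a J * ∫ x in I J, df i a x) := by
    intro J
    rw [hZ, integral_add (hPi J) (hZi'' J)]
    congr 1
    refine (integral_finsetSum _ fun i _ => (hdqi i J).sub (hZi' i J)).trans ?_
    refine Finset.sum_congr rfl fun i _ => ?_
    refine (integral_sub (hdqi i J) (hZi' i J)).trans ?_
    rw [integral_finsetSum _ fun a _ => (hdfi i a J).const_mul _]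
    simp only [integral_const_mul]
  have hZle : ∀ J, ∫ x in I J, Z J x ≤ c * ∫ x in I J, cellRel γ (U t J) (W (t, x)) := by
    intro J
    have hri : IntegrableOn (fun x => cellRel γ (U t J) (W (t, x))) (I J) :=
      (hF.continuousOn_slice hk htI J fun X hX => contDiffAt_cellRel_right _ hX).integrableOn_compact
        isCompact_Icc
    rw [← integral_const_mul]
    refine setIntegral_mono_ae_restrict ((hPi J).add (hZi'' J)) (hri.const_mul c) ?_
    rw [hI, ← Measure.restrict_congr_set (openBox_ae_eq_Icc (𝒯.lo J) (𝒯.hi J))]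
    filter_upwards [ae_restrict_of_ae hae, ae_restrict_mem (isOpen_openBox _ _).measurableSet]
      with x hx hxJ
    obtain ⟨hdW, heul⟩ := hx J ⟨ht, hxJ⟩
    have hmemW := hF.mem_cell htI (openBox_subset_Icc _ _ hxJ)
    have hgas := isGas_of_mem hk hmemW
    have hslice : HasFDerivAt (fun y : Fin (n + 1) → ℝ => (t, y))
        (ContinuousLinearMap.inr ℝ ℝ (Fin (n + 1) → ℝ)) x := hasFDerivAt_prodMk_right t x
    have hcompt : ∀ {F : State (n + 1) → ℝ}, ContDiffAt ℝ 1 F (W (t, x)) →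
        HasFDerivAt (fun z => F (W z)) ((fderiv ℝ F (W (t, x))).comp (fderiv ℝ W (t, x))) (t, x) :=
      fun {F} hF => (hF.differentiableAt one_ne_zero).hasFDerivAt.comp (t, x) hdW.hasFDerivAt
    have hcompx : ∀ {F : State (n + 1) → ℝ}, ContDiffAt ℝ 1 F (W (t, x)) → ∀ i,
        fderiv ℝ (fun y => F (W (t, y))) x (Pi.single i 1)
          = fderiv ℝ F (W (t, x)) (fderiv ℝ W (t, x) (dirX i)) := fun {F} hF i => by
      have := (HasFDerivAt.comp (f := fun y : Fin (n + 1) → ℝ => (t, y)) x (hcompt hF) hslice).fderiv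
      have h2 := congrArg (fun e : (Fin (n + 1) → ℝ) →L[ℝ] ℝ => e (Pi.single i 1)) this
      exact h2
    have hmain := sum_wt_deriv_le hγ (hgasU J) hgas heul hG (add_nonneg hS0 hS0)
      (div_pos hk hK) (temp_bounds hγ hk hmemW).1 (by
        have h1 := (abs_le.1 (hS _ hmemW)).2
        have h2 := hent t htI J
        linarith) fun i a => by
          rw [← hcompx (contDiffAt_wt hgas a) i]
          exact abs_fderiv_single_le (hfL a J) hxJ i
    rw [← hc] at hmain
    refine le_trans (le_of_eq ?_) hmain
    have hpt : fderiv ℝ (fun z => (W z).1 * temp γ (W z)) (t, x) (dirT (n + 1))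
        = (fderiv ℝ W (t, x) (dirT (n + 1))).1 * temp γ (W (t, x))
          + (W (t, x)).1 * dtemp γ (W (t, x)) (fderiv ℝ W (t, x) (dirT (n + 1))) := by
      have hF1 : ContDiffAt ℝ 1 (fun X : State (n + 1) => X.1 * temp γ X) (W (t, x)) :=
        contDiffAt_fst.mul (contDiffAt_temp hgas.1.ne')
      rw [(hcompt hF1).fderiv]
      simpa [dtemp] using (hasDerivAt_line hF1 (fderiv ℝ W (t, x) (dirT (n + 1)))).unique
        ((hasDerivAt_line_fst _ _).mul (hasDerivAt_line (contDiffAt_temp (γ := γ) hgas.1.ne') _))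
    have hwt : ∀ a, fderiv ℝ (fun z => wt γ a (W z)) (t, x) (dirT (n + 1))
        = fderiv ℝ (wt γ a) (W (t, x)) (fderiv ℝ W (t, x) (dirT (n + 1))) := fun a => by
      rw [(hcompt (contDiffAt_wt hgas a)).fderiv]; rfl
    have hdf' : ∀ i a, df i a x
        = fderiv ℝ (wt γ a) (W (t, x)) (fderiv ℝ W (t, x) (dirX i)) := fun i a =>
      hcompx (contDiffAt_wt hgas a) i
    have hdq' : ∀ i, dq i x = fderiv ℝ (fun X : State (n + 1) => X.1 * temp γ X * vel X i)
        (W (t, x)) (fderiv ℝ W (t, x) (dirX i)) := fun i =>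
      hcompx (F := fun X : State (n + 1) => X.1 * temp γ X * vel X i)
        ((contDiffAt_fst.mul (contDiffAt_temp hgas.1.ne')).mul (contDiffAt_vel hgas.1.ne' i)) i
    simp only [hZ, hP, hN, relRate, hpt, hwt, hdf', hdq', Finset.sum_add_distrib,
      Finset.sum_sub_distrib, Finset.sum_neg_distrib]
    simp only [hf, hDd, hgdef, mul_comm (densFlux _ _ _ _)]
    ring
  have hq0 : ∀ i, ∑ J, ∫ x in I J, dq i x = 0 := fun i =>
    𝒯.sum_integral_fderiv_eq_zero hΩ i (hqL i) fun x hx hn => by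
      simp only [hq, hF.wall t htI x hx i hn, mul_zero]
  have hsplit : ∑ J, ∫ x in I J, relRate γ 𝒯 U U' W t J x
      = ∑ J, (∫ x in I J, N J x) + ∑ J, (∫ x in I J, Z J x)
        + ∑ a, ∑ i, ∑ J, g i a J * ∫ x in I J, df i a x := by
    have h1 : ∀ J, ∫ x in I J, relRate γ 𝒯 U U' W t J x
        = (∫ x in I J, N J x) + ∫ x in I J, P J x := fun J => by
      rw [hP, integral_sub (hint J) (hNi J)]
      ring
    simp only [h1, hZint, Finset.sum_add_distrib, Finset.sum_sub_distrib]
    have h2 : ∑ J, ∑ i, ∫ x in I J, dq i x = 0 := by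
      rw [Finset.sum_comm]
      exact Finset.sum_eq_zero fun i _ => hq0 i
    have h3 : ∑ J, ∑ i, ∑ a, g i a J * ∫ x in I J, df i a x
        = ∑ a, ∑ i, ∑ J, g i a J * ∫ x in I J, df i a x := by
      rw [Finset.sum_comm, Finset.sum_comm (s := (Finset.univ : Finset (Option _)))]
      exact Finset.sum_congr rfl fun i _ => Finset.sum_comm
    rw [h2, h3]
    ring
  rw [hsplit]
  have hZsum := Finset.sum_le_sum fun J (_ : J ∈ Finset.univ) => hZle J
  rw [← Finset.mul_sum] at hZsum
  simp only [Finset.sum_sub_distrib] at hNsum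
  rw [Finset.sum_mul]
  simp only [Finset.sum_mul]
  unfold totalRel
  linarith

end RectMesh

/-! ### Integration of the differential inequality and the error bounds -/

theorem le_of_ae_deriv_le {y : ℝ → ℝ} {T c A : ℝ} (hc : 0 ≤ c) (hA : 0 ≤ A) {C : NNReal}
    (hy : LipschitzOnWith C y (Icc 0 T))
    (h : ∀ᵐ t, t ∈ Ioo 0 T → ∃ y', HasDerivAt y y' t ∧ y' ≤ c * y t + A) {τ : ℝ}
    (hτ : τ ∈ Icc 0 T) : y τ ≤ (y 0 + A * τ) * Real.exp (c * τ) := by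
  have hac : AbsolutelyContinuousOnInterval
      (fun t => Real.exp (-(c * t)) * y t - A * t) 0 τ := by
    refine AbsolutelyContinuousOnInterval.sub (AbsolutelyContinuousOnInterval.mul ?_ ?_) ?_
    · exact ContDiffOn.absolutelyContinuousOnInterval (by fun_prop)
    · refine LipschitzOnWith.absolutelyContinuousOnInterval (K := C) (hy.mono ?_)
      rw [uIcc_of_le hτ.1]
      exact Icc_subset_Icc_right hτ.2
    · exact ContDiffOn.absolutelyContinuousOnInterval (by fun_prop)
  have h1 := hac.integral_deriv_eq_sub
  have h2 : ∫ t in (0 : ℝ)..τ, deriv (fun t => Real.exp (-(c * t)) * y t - A * t) t ≤ 0 := by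
    rw [intervalIntegral.integral_of_le hτ.1, integral_Ioc_eq_integral_Ioo]
    refine integral_nonpos_of_ae ?_
    filter_upwards [ae_restrict_of_ae h, ae_restrict_mem measurableSet_Ioo] with t ht htI
    obtain ⟨y', hy', hle⟩ := ht ⟨htI.1, htI.2.trans_le hτ.2⟩
    have hd : HasDerivAt (fun t => Real.exp (-(c * t)) * y t - A * t)
        (Real.exp (-(c * t)) * (-(c * 1)) * y t + Real.exp (-(c * t)) * y' - A * 1) t :=
      ((((hasDerivAt_id t).const_mul c).fun_neg.exp).mul hy').sub ((hasDerivAt_id t).const_mul A)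
    rw [hd.deriv]
    have h3 : Real.exp (-(c * t)) ≤ 1 :=
      Real.exp_le_one_iff.2 (neg_nonpos.2 (mul_nonneg hc htI.1.le))
    have h4 := mul_le_mul_of_nonneg_left hle (Real.exp_pos (-(c * t))).le
    have h5 := mul_le_mul_of_nonneg_right h3 hA
    show _ ≤ (0 : ℝ)
    linarith
  rw [h1] at h2
  have h3 : Real.exp (-(c * τ)) * y τ ≤ y 0 + A * τ := by simpa using h2
  have h4 := mul_le_mul_of_nonneg_right h3 (Real.exp_pos (c * τ)).le
  rwa [mul_right_comm, ← Real.exp_add, neg_add_cancel, Real.exp_zero, one_mul] at h4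

theorem exists_norm_sub_sq_le {d : ℕ} {γ k K : ℝ} (hγ : 1 < γ) (hk : 0 < k) : ∃ C : ℝ, 0 ≤ C ∧
    ∀ U ∈ rangeSet d γ k K, ∀ V ∈ rangeSet d γ k K, ‖U - V‖ ^ 2 ≤ C * cellRel γ U V := by
  obtain ⟨R, hR0, hR⟩ := exists_norm_le (d := d) (K := K) hγ hk
  obtain ⟨D, hD0, hD⟩ := exists_relLin_le (d := d) (K := K) hγ hk
  obtain ⟨C, hC0, hC⟩ := exists_abs_sub_le (d := d) (K := K) hγ hk (√(D * (2 * R) ^ 2) + 1)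
  refine ⟨(2 * C) ^ 2, sq_nonneg _, fun U hU V hV => ?_⟩
  have hgU := isGas_of_mem hk hU
  have hgV := isGas_of_mem hk hV
  have hE0 : 0 ≤ cellRel γ U V := relLin_nonneg hγ hgU.admissible hgV.1 hgV.temp_pos _
  have hE : cellRel γ U V ≤ D * (2 * R) ^ 2 := (hD U hU V hV).trans (by
    have := norm_sub_le U V
    have := hR U hU
    have := hR V hV
    gcongr
    linarith)
  have hle : ‖U - V‖ ≤ 2 * C * √(cellRel γ U V) := by
    refine le_of_forall_pos_le_add fun ε hε => ?_
    obtain ⟨δ, hδ0, hδ1, hδ2⟩ : ∃ δ : ℝ, 0 < δ ∧ δ ≤ 1 ∧ C * δ ≤ ε := by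
      refine ⟨min 1 (ε / (C + 1)), by positivity, min_le_left _ _, ?_⟩
      have h1 : C * min 1 (ε / (C + 1)) ≤ (C + 1) * (ε / (C + 1)) :=
        mul_le_mul (by linarith) (min_le_right _ _) (by positivity) (by positivity)
      rwa [mul_div_cancel₀ _ (by positivity)] at h1
    obtain ⟨h1, h2, h3⟩ := hC U hgU.admissible V hV (√(cellRel γ U V) + δ) (by positivity)
      (add_le_add (Real.sqrt_le_sqrt hE) hδ1)
    have h4 : cellRel γ U V / (√(cellRel γ U V) + δ) ≤ √(cellRel γ U V) := by
      rw [div_le_iff₀ (by positivity)]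
      nlinarith [Real.mul_self_sqrt hE0, Real.sqrt_nonneg (cellRel γ U V)]
    have h5 : C * (√(cellRel γ U V) + δ + cellRel γ U V / (√(cellRel γ U V) + δ))
        ≤ 2 * C * √(cellRel γ U V) + ε := by
      have := mul_le_mul_of_nonneg_left h4 hC0
      linarith
    exact norm_state_le (by positivity) (h1.trans h5) (fun j => (h2 j).trans h5) (h3.trans h5)
  calc ‖U - V‖ ^ 2 ≤ (2 * C * √(cellRel γ U V)) ^ 2 := by gcongr
    _ = _ := by rw [mul_pow, Real.sq_sqrt hE0]

theorem eLpNorm_two_le_iff {α : Type*} [MeasurableSpace α] {μ : Measure α} {f : α → ℝ} {a : ℝ}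
    (ha : 0 ≤ a) : eLpNorm f 2 μ ≤ ENNReal.ofReal a ↔
      ∫⁻ x, ENNReal.ofReal (f x ^ 2) ∂μ ≤ ENNReal.ofReal (a ^ 2) := by
  have h1 := eLpNorm_nnreal_pow_eq_lintegral (f := f) (μ := μ) (p := 2) two_ne_zero
  have h2 : ∀ x, ‖f x‖ₑ ^ (((2 : NNReal) : ℝ)) = ENNReal.ofReal (f x ^ 2) := fun x => by
    rw [← sq_abs, ENNReal.ofReal_pow (abs_nonneg _), ← Real.enorm_eq_ofReal_abs]
    norm_num
  simp only [h2] at h1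
  rw [← h1, ENNReal.ofReal_pow ha]
  norm_num
  exact (ENNReal.pow_le_pow_left_iff two_ne_zero).symm

namespace RectMesh

section Cells

variable {d : ℕ} {Ω : Set (Fin d → ℝ)} (𝒯 : RectMesh d Ω)

theorem toFun_eq {V : Type*} [AddCommMonoid V] (v : Fin 𝒯.n → V) {J : Fin 𝒯.n} {x : Fin d → ℝ}
    (hx : x ∈ 𝒯.cell J) : 𝒯.toFun v x = v J := by
  rw [toFun, Finset.sum_eq_single J]
  · exact indicator_of_mem hx _
  · exact fun K _ hK => indicator_of_notMem (fun h => hK (𝒯.cell_disjoint h hx)) _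
  · simp

theorem iUnion_cell_ae_eq (hΩr : interior (closure Ω) = Ω) :
    (⋃ J, 𝒯.cell J : Set (Fin d → ℝ)) =ᵐ[volume] Ω := by
  have h1 : ∀ᵐ x, ∀ J, x ∈ 𝒯.cell J ↔ x ∈ Icc (𝒯.lo J) (𝒯.hi J) :=
    ae_all_iff.2 fun J => (openBox_ae_eq_Icc _ _).mem_iff
  filter_upwards [h1] with x hx
  refine propext ⟨fun h => ?_, fun h => ?_⟩
  · obtain ⟨J, hJ⟩ := mem_iUnion.1 h
    exact 𝒯.cell_subset hΩr J hJ
  · have h2 : x ∈ closure Ω := subset_closure h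
    rw [← 𝒯.cover] at h2
    obtain ⟨J, hJ⟩ := mem_iUnion.1 h2
    exact mem_iUnion.2 ⟨J, (hx J).2 hJ⟩

theorem ae_mem_cell (hΩr : interior (closure Ω) = Ω) :
    ∀ᵐ x ∂(volume.restrict Ω), ∃ J, x ∈ 𝒯.cell J := by
  rw [← Measure.restrict_congr_set (𝒯.iUnion_cell_ae_eq hΩr)]
  filter_upwards [ae_restrict_mem
    (MeasurableSet.iUnion fun J => (isOpen_openBox (𝒯.lo J) (𝒯.hi J)).measurableSet)] with x hx
  exact mem_iUnion.1 hx

theorem lintegral_eq_sum_cells (hΩr : interior (closure Ω) = Ω) (f : (Fin d → ℝ) → ENNReal) :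
    ∫⁻ x in Ω, f x = ∑ J, ∫⁻ x in 𝒯.cell J, f x := by
  rw [← Measure.restrict_congr_set (𝒯.iUnion_cell_ae_eq hΩr), lintegral_iUnion
    (fun J => (isOpen_openBox (𝒯.lo J) (𝒯.hi J)).measurableSet)
    (fun K L h => 𝒯.disjoint K L h), tsum_fintype]

end Cells

variable {n : ℕ} {γ T k K k' K' : ℝ} {L : NNReal} {Ω : Set (Fin (n + 1) → ℝ)}
  {𝒯 : RectMesh (n + 1) Ω} {W : ℝ × (Fin (n + 1) → ℝ) → State (n + 1)}
  {U : ℝ → Fin 𝒯.n → State (n + 1)}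

theorem lintegral_cellRel (hγ : 1 < γ) (hΩr : interior (closure Ω) = Ω) (hk : 0 < k)
    (hk' : 0 < k') (hF : IsLipschitzFlow γ T k K L 𝒯 W)
    {t : ℝ} (ht : t ∈ Icc 0 T) (hU : ∀ J, U t J ∈ rangeSet (n + 1) γ k' K') :
    ∫⁻ x in Ω, ENNReal.ofReal (cellRel γ (𝒯.toFun (U t) x) (W (t, x)))
      = ENNReal.ofReal (totalRel γ 𝒯 U W t) := by
  have hnn : ∀ J, ∀ x ∈ Icc (𝒯.lo J) (𝒯.hi J), 0 ≤ cellRel γ (U t J) (W (t, x)) := fun J x hx =>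
    have hg := isGas_of_mem hk (hF.mem_cell ht hx)
    relLin_nonneg hγ (isGas_of_mem hk' (hU J)).admissible hg.1 hg.temp_pos _
  rw [totalRel, ENNReal.ofReal_sum_of_nonneg fun J _ =>
    setIntegral_nonneg measurableSet_Icc (hnn J), 𝒯.lintegral_eq_sum_cells hΩr]
  refine Finset.sum_congr rfl fun J _ => ?_
  rw [ofReal_integral_eq_lintegral_ofReal ((hF.continuousOn_slice hk ht J fun X hX =>
      contDiffAt_cellRel_right _ hX).integrableOn_compact isCompact_Icc)
    ((ae_restrict_iff' measurableSet_Icc).2 (ae_of_all _ (hnn J))),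
    ← Measure.restrict_congr_set (openBox_ae_eq_Icc (𝒯.lo J) (𝒯.hi J))]
  exact setLIntegral_congr_fun (isOpen_openBox _ _).measurableSet fun x hx => by
    simp only [𝒯.toFun_eq (U t) hx]

theorem lintegral_le_of_cellRel (hγ : 1 < γ) (hΩr : interior (closure Ω) = Ω) (hk : 0 < k)
    (hk' : 0 < k') (hF : IsLipschitzFlow γ T k K L 𝒯 W) {t : ℝ} (ht : t ∈ Icc 0 T)
    (hU : ∀ J, U t J ∈ rangeSet (n + 1) γ k' K') {A : ℝ} (hA : 0 ≤ A)
    {f : State (n + 1) → State (n + 1) → ℝ}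
    (hf : ∀ X ∈ rangeSet (n + 1) γ k' K', ∀ Y ∈ rangeSet (n + 1) γ k K,
      f X Y ≤ A * cellRel γ X Y) :
    ∫⁻ x in Ω, ENNReal.ofReal (f (𝒯.toFun (U t) x) (W (t, x)))
      ≤ ENNReal.ofReal (A * totalRel γ 𝒯 U W t) := by
  rw [ENNReal.ofReal_mul hA, ← lintegral_cellRel hγ hΩr hk hk' hF ht hU,
    ← lintegral_const_mul' _ _ ENNReal.ofReal_ne_top]
  refine lintegral_mono_ae ?_
  filter_upwards [𝒯.ae_mem_cell hΩr] with x ⟨J, hx⟩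
  rw [𝒯.toFun_eq (U t) hx, ← ENNReal.ofReal_mul hA]
  exact ENNReal.ofReal_le_ofReal (hf _ (hU J) _ (hF.mem_cell ht (openBox_subset_Icc _ _ hx)))

theorem totalRel_le_of_eLpNorm (hγ : 1 < γ) (hΩr : interior (closure Ω) = Ω) (hk : 0 < k)
    (hk' : 0 < k') (hF : IsLipschitzFlow γ T k K L 𝒯 W) {t : ℝ} (ht : t ∈ Icc 0 T)
    (hU : ∀ J, U t J ∈ rangeSet (n + 1) γ k' K') {A a : ℝ} (hA : 0 ≤ A) (ha : 0 ≤ a)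
    (hf : ∀ X ∈ rangeSet (n + 1) γ k' K', ∀ Y ∈ rangeSet (n + 1) γ k K,
      cellRel γ X Y ≤ A * ‖X - Y‖ ^ 2)
    (h : eLpNorm (fun x => stateNorm (𝒯.toFun (U t) x - W (t, x))) 2 (volume.restrict Ω)
      ≤ ENNReal.ofReal a) : totalRel γ 𝒯 U W t ≤ A * a ^ 2 := by
  rw [eLpNorm_two_le_iff ha] at h
  rw [← ENNReal.ofReal_le_ofReal_iff (by positivity), ← lintegral_cellRel hγ hΩr hk hk' hF ht hU,
    ENNReal.ofReal_mul hA]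
  refine le_trans ?_ (mul_le_mul_right h _)
  rw [← lintegral_const_mul' _ _ ENNReal.ofReal_ne_top]
  refine lintegral_mono_ae ?_
  filter_upwards [𝒯.ae_mem_cell hΩr] with x ⟨J, hx⟩
  rw [𝒯.toFun_eq (U t) hx, ← ENNReal.ofReal_mul hA]
  refine ENNReal.ofReal_le_ofReal
    ((hf _ (hU J) _ (hF.mem_cell ht (openBox_subset_Icc _ _ hx))).trans ?_)
  gcongr
  exact norm_le_stateNorm _

theorem pos_of_sizeLE (hΩ : Ω.Nonempty) {h : ℝ} (hs : 𝒯.SizeLE h) : 0 < h := by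
  obtain ⟨x, hx⟩ := hΩ.closure
  rw [← 𝒯.cover] at hx
  obtain ⟨J, -⟩ := mem_iUnion.1 hx
  linarith [hs J 0, 𝒯.lo_lt_hi J 0]

end RectMesh

namespace RectMesh

variable {n : ℕ} {γ : ℝ} {Ω : Set (Fin (n + 1) → ℝ)}

/-- The total relative energy of a Godunov solution is of first order. -/
theorem exists_totalRel_le (hγ : 1 < γ) (hΩo : IsOpen Ω) (hΩ : Ω.Nonempty)
    (hΩr : interior (closure Ω) = Ω) {M r : ℝ} (hM : 0 < M) (hr : 0 < r) :
    ∃ c : ℝ, 0 ≤ c ∧ ∀ ρmin Emax C₀ B : ℝ, 0 < ρmin → 0 < Emax →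
    ∃ k' K' A : ℝ, 0 < k' ∧ 0 ≤ A ∧ ∀ (T : ℝ), 0 < T →
    ∀ (ρ : ℝ × (Fin (n + 1) → ℝ) → ℝ) (u : ℝ × (Fin (n + 1) → ℝ) → Fin (n + 1) → ℝ)
      (η : ℝ × (Fin (n + 1) → ℝ) → ℝ), IsStrongSolution γ T Ω ρ u η →
    W1InfNormLE T Ω (fun z => conserved γ (ρ z) (u z) (η z)) M →
    (∀ z ∈ Icc 0 T ×ˢ closure Ω, r ≤ ρ z ∧ r ≤ temperature γ (ρ z) (η z)) →
    ∀ (h : ℝ) (𝒯 : RectMesh (n + 1) Ω), 𝒯.SizeLE h →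
    ∀ U : ℝ → Fin 𝒯.n → State (n + 1),
    𝒯.IsGodunovSolution γ T (fun x => conserved γ (ρ (0, x)) (u (0, x)) (η (0, x))) U →
    (∀ t ∈ Icc 0 T, ∀ K, ρmin ≤ (U t K).1 ∧ 0 < (U t K).2.2 ∧ (U t K).2.2 ≤ Emax) →
    eLpNorm (fun x => stateNorm (𝒯.toFun (U 0) x
        - conserved γ (ρ (0, x)) (u (0, x)) (η (0, x)))) 2 (volume.restrict Ω)
      ≤ ENNReal.ofReal (C₀ * √h) →
    (∀ t ∈ Icc 0 T, 𝒯.totalJump (U t) ≤ B) →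
    ∃ L, IsLipschitzFlow γ T (min r (r * r)) M L 𝒯 (fun z => conserved γ (ρ z) (u z) (η z)) ∧
    ∀ τ ∈ Icc 0 T, (∀ J, U τ J ∈ rangeSet (n + 1) γ k' K') ∧
      totalRel γ 𝒯 U (fun z => conserved γ (ρ z) (u z) (η z)) τ
        ≤ A * h * Real.exp (τ * c) := by
  have hk : 0 < min r (r * r) := lt_min hr (mul_pos hr hr)
  obtain ⟨S₀, hS0, hS⟩ := exists_bound_rangeSet (d := n + 1) (K := M) hγ hk
    (f := fun X : State (n + 1) => spEntropy γ X.1 (temp γ X))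
    fun X hX => (contDiffAt_spEntropy hX).continuousAt
  obtain ⟨c, hc, hrate⟩ := exists_rate hγ hΩr hk hM
    ⟨M * (1 + (n + 1 : ℕ)), by positivity⟩ hS0 hS
  refine ⟨c + 1, by linarith, fun ρmin Emax C₀ B hρmin hEmax => ?_⟩
  obtain ⟨k', K', hk', hK', hmem⟩ := exists_mem_rangeSet (d := n + 1) hγ (-S₀) hρmin hEmax
  obtain ⟨C, hC, hrate⟩ := hrate k' K' B hk'
  obtain ⟨D, hD0, hD⟩ := exists_relLin_le (d := n + 1) (K := max K' M) hγ (lt_min hk' hk)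
  refine ⟨k', K', D * max C₀ 0 ^ 2 + C, hk', by positivity, fun T hT ρ u η hsol hnorm hlow h 𝒯
    hsize U hU hbd hinit hjump => ?_⟩
  have hh := pos_of_sizeLE hΩ hsize
  have hF := hsol.isLipschitzFlow hγ hT hΩo hΩr hM.le hr hnorm hlow 𝒯
  set W := fun z => conserved γ (ρ z) (u z) (η z) with hW
  have h0 : (0 : ℝ) ∈ Icc 0 T := ⟨le_rfl, hT.le⟩
  obtain ⟨U', V, VR, VL, hG, hent⟩ := hU.exists_bounded hγ hT.le (s₀ := -S₀) (k := k') (K := K')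
    (fun K x hx => by
      have := (hF.lipschitz K).continuousOn.comp (f := fun x => ((0 : ℝ), x))
        (s := Icc (𝒯.lo K) (𝒯.hi K)) (by fun_prop) fun y hy => ⟨h0, hy⟩
      exact this x hx)
    (fun K x hx => ⟨isGas_of_mem hk (hF.mem_cell h0 hx),
      (abs_le.1 (hS _ (hF.mem_cell h0 hx))).1⟩)
    (fun t ht K => hρmin.trans_le (hbd t ht K).1)
    fun t ht K hg hs => hmem _ hg (hbd t ht K).1 (hbd t ht K).2.2 hs
  refine ⟨_, hF, fun τ hτ => ⟨hG.mem τ hτ, ?_⟩⟩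
  have hy0 : totalRel γ 𝒯 U W 0 ≤ D * max C₀ 0 ^ 2 * h := by
    refine (totalRel_le_of_eLpNorm (a := max C₀ 0 * √h) hγ hΩr hk hk' hF h0 (hG.mem 0 h0) hD0
      (by positivity) (fun X hX Y hY => hD X (rangeSet_mono (min_le_left _ _) (le_max_left _ _) hX)
        Y (rangeSet_mono (min_le_right _ _) (le_max_right _ _) hY))
      (hinit.trans (ENNReal.ofReal_le_ofReal ?_))).trans_eq ?_
    · exact mul_le_mul_of_nonneg_right (le_max_left _ _) (Real.sqrt_nonneg _)
    · rw [mul_pow, Real.sq_sqrt hh.le, mul_assoc]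
  obtain ⟨Λ, hΛ⟩ := exists_totalRel_lipschitz hγ hk hk' hF hG
  refine (le_of_ae_deriv_le hc (mul_nonneg hC hh.le) hΛ
    (hrate T h 𝒯 W U U' V VR VL hF hG hh.le hsize hent hjump) hτ).trans ?_
  have h1 : τ ≤ Real.exp τ := by linarith [Real.add_one_le_exp τ]
  have h2 : 1 ≤ Real.exp τ := Real.one_le_exp hτ.1
  have h3 : totalRel γ 𝒯 U W 0 + C * h * τ ≤ (D * max C₀ 0 ^ 2 + C) * h * Real.exp τ := by
    have h4 := mul_le_mul_of_nonneg_left h1 (mul_nonneg hC hh.le)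
    have h5 : D * max C₀ 0 ^ 2 * h * 1 ≤ D * max C₀ 0 ^ 2 * h * Real.exp τ := by gcongr
    linarith
  refine (mul_le_mul_of_nonneg_right h3 (Real.exp_pos _).le).trans_eq ?_
  rw [mul_assoc, ← Real.exp_add]
  ring_nf

end RectMesh

end GodunovEuler

end


/-- First-order rate of the relative energy for the Godunov method under bounded variation. -/
theorem mainTheorem2 (d : ℕ) (hd : 1 ≤ d ∧ d ≤ 3) (γ : ℝ) (hγ : 1 < γ ∧ γ ≤ 2)
    (Ω : Set (Fin d → ℝ)) (hΩo : IsOpen Ω) (hΩc : IsConnected Ω) (hΩb : Bornology.IsBounded Ω)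
    (hΩr : interior (closure Ω) = Ω)
    -- bounds for the strong solution: `W^{1,∞}` norm and positive lower bound
    (M r : ℝ) (hr : 0 < r) :
    ∃ c : ℝ, 0 ≤ c ∧
    -- bounds for the numerical solutions, uniform in the mesh
    ∀ ρmin Emax C₀ B : ℝ, 0 < ρmin → 0 < Emax →
    ∃ C : ℝ, 0 < C ∧
    ∀ (T : ℝ), 0 < T →
    ∀ (ρ : ℝ × (Fin d → ℝ) → ℝ) (u : ℝ × (Fin d → ℝ) → Fin d → ℝ) (η : ℝ × (Fin d → ℝ) → ℝ),
    IsStrongSolution γ T Ω ρ u η →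
    W1InfNormLE T Ω (fun z => conserved γ (ρ z) (u z) (η z)) M →
    (∀ z ∈ Set.Icc 0 T ×ˢ closure Ω, r ≤ ρ z ∧ r ≤ temperature γ (ρ z) (η z)) →
    ∀ (h : ℝ) (𝒯 : RectMesh d Ω), 𝒯.SizeLE h →
    ∀ U : ℝ → Fin 𝒯.n → State d,
    𝒯.IsGodunovSolution γ T (fun x => conserved γ (ρ (0, x)) (u (0, x)) (η (0, x))) U →
    (∀ t ∈ Set.Icc 0 T, ∀ K, ρmin ≤ (U t K).1 ∧ 0 < (U t K).2.2 ∧ (U t K).2.2 ≤ Emax) →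
    eLpNorm (fun x => stateNorm (𝒯.toFun (U 0) x
        - conserved γ (ρ (0, x)) (u (0, x)) (η (0, x)))) 2 (volume.restrict Ω)
      ≤ ENNReal.ofReal (C₀ * √h) →
    (∀ t ∈ Set.Icc 0 T, 𝒯.totalJump (U t) ≤ B) →
    ∀ τ ∈ Set.Icc 0 T,
      eLpNorm (fun x => relEnergy γ (𝒯.toFun (U τ) x).1 (𝒯.toFun (U τ) x).2.1
          (entropy γ (𝒯.toFun (U τ) x)) (ρ (τ, x)) (u (τ, x)) (η (τ, x))) 1 (volume.restrict Ω)
        ≤ ENNReal.ofReal (C * h * Real.exp (τ * c)) ∧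
      eLpNorm (fun x => (𝒯.toFun (U τ) x).1 - ρ (τ, x)) 2 (volume.restrict Ω)
        ≤ ENNReal.ofReal (C * √h * Real.exp (τ * c / 2)) ∧
      eLpNorm (fun x => √(∑ j, ((𝒯.toFun (U τ) x).2.1 j - ρ (τ, x) * u (τ, x) j) ^ 2)) 2
          (volume.restrict Ω)
        ≤ ENNReal.ofReal (C * √h * Real.exp (τ * c / 2)) ∧
      eLpNorm (fun x => entropy γ (𝒯.toFun (U τ) x) - η (τ, x)) 2 (volume.restrict Ω)
        ≤ ENNReal.ofReal (C * √h * Real.exp (τ * c / 2)) := by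
  obtain ⟨n, rfl⟩ : ∃ n, d = n + 1 := ⟨d - 1, by omega⟩
  have hγ1 := hγ.1
  rcases le_or_gt M 0 with hM | hM
  · refine ⟨0, le_rfl, fun _ _ _ _ _ _ => ⟨1, one_pos, fun T hT ρ u η _ hnorm hlow => ?_⟩⟩
    exfalso
    obtain ⟨x, hx⟩ := hΩc.nonempty
    have h1 := hnorm.2.1 (T / 2, x) ⟨⟨by linarith, by linarith⟩, hx⟩
    have h2 := (norm_fst_le _).trans h1
    have h3 := (hlow (T / 2, x) ⟨⟨by linarith, by linarith⟩, subset_closure hx⟩).1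
    have h4 : ρ (T / 2, x) ≤ M := (le_abs_self _).trans h2
    linarith
  obtain ⟨c, hc, hrel⟩ := RectMesh.exists_totalRel_le hγ1 hΩo hΩc.nonempty hΩr hM hr
  refine ⟨c, hc, fun ρmin Emax C₀ B hρmin hEmax => ?_⟩
  obtain ⟨k', K', A, hk', hA, hrel⟩ := hrel ρmin Emax C₀ B hρmin hEmax
  have hk : 0 < min r (r * r) := lt_min hr (mul_pos hr hr)
  obtain ⟨D, hD0, hD⟩ := exists_norm_sub_sq_le (d := n + 1) (K := max K' M) hγ1 (lt_min hk' hk)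
  obtain ⟨E, hE0, hE⟩ := exists_lipschitz_rangeSet (d := n + 1) (K := max K' M) hγ1
    (lt_min hk' hk) (f := entropy γ) fun X hX => contDiffAt_entropy hγ1 hX
  have hm1 : rangeSet (n + 1) γ k' K' ⊆ rangeSet (n + 1) γ (min k' (min r (r * r))) (max K' M) :=
    rangeSet_mono (min_le_left _ _) (le_max_left _ _)
  have hm2 : rangeSet (n + 1) γ (min r (r * r)) M
      ⊆ rangeSet (n + 1) γ (min k' (min r (r * r))) (max K' M) :=
    rangeSet_mono (min_le_right _ _) (le_max_right _ _)
  refine ⟨A + √(((n + 1 : ℕ) + E ^ 2) * D * A) + 1, by positivity, fun T hT ρ u η hsol hnorm hlow h 𝒯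
    hsize U hU hbd hinit hjump τ hτ => ?_⟩
  obtain ⟨L, hF, hrel⟩ := hrel T hT ρ u η hsol hnorm hlow h 𝒯 hsize U hU hbd hinit hjump
  obtain ⟨hmem, hle⟩ := hrel τ hτ
  have hh := RectMesh.pos_of_sizeLE hΩc.nonempty hsize
  have hρ : ∀ {J x}, x ∈ 𝒯.cell J → 0 < ρ (τ, x) := fun {J x} hx =>
    hr.trans_le (hlow (τ, x) ⟨hτ, subset_closure (𝒯.cell_subset hΩr J hx)⟩).1
  have hone : A * h * Real.exp (τ * c)
      ≤ (A + √(((n + 1 : ℕ) + E ^ 2) * D * A) + 1) * h * Real.exp (τ * c) := by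
    gcongr
    linarith [Real.sqrt_nonneg (((n + 1 : ℕ) + E ^ 2) * D * A)]
  have htwo : ∀ (f : State (n + 1) → State (n + 1) → ℝ) (g : (Fin (n + 1) → ℝ) → ℝ),
      (∀ X ∈ rangeSet (n + 1) γ k' K', ∀ Y ∈ rangeSet (n + 1) γ (min r (r * r)) M,
        f X Y ^ 2 ≤ ((n + 1 : ℕ) + E ^ 2) * ‖X - Y‖ ^ 2) →
      (∀ J, ∀ x ∈ 𝒯.cell J, |g x| = f (U τ J) (conserved γ (ρ (τ, x)) (u (τ, x)) (η (τ, x)))) →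
      eLpNorm g 2 (volume.restrict Ω) ≤ ENNReal.ofReal
        ((A + √(((n + 1 : ℕ) + E ^ 2) * D * A) + 1) * √h * Real.exp (τ * c / 2)) := by
    intro f g hf hg
    rw [eLpNorm_two_le_iff (by positivity)]
    have h1 := RectMesh.lintegral_le_of_cellRel hγ1 hΩr hk hk' hF hτ hmem
      (A := ((n + 1 : ℕ) + E ^ 2) * D) (by positivity) (f := fun X Y => f X Y ^ 2)
      fun X hX Y hY => (hf X hX Y hY).trans (by
        rw [mul_assoc]
        exact mul_le_mul_of_nonneg_left (hD X (hm1 hX) Y (hm2 hY)) (by positivity))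
    refine le_trans (le_of_eq (lintegral_congr_ae ?_))
      (h1.trans (ENNReal.ofReal_le_ofReal ?_))
    · filter_upwards [𝒯.ae_mem_cell hΩr] with x ⟨J, hx⟩
      rw [𝒯.toFun_eq (U τ) hx, ← hg J x hx, sq_abs]
    · have h2 : Real.exp (τ * c / 2) ^ 2 = Real.exp (τ * c) := by
        rw [← Real.exp_nat_mul]
        congr 1
        push_cast
        ring
      have h3 : ((n + 1 : ℕ) + E ^ 2) * D * A
          ≤ (A + √(((n + 1 : ℕ) + E ^ 2) * D * A) + 1) ^ 2 := by
        have h4 : (0 : ℝ) ≤ ((n + 1 : ℕ) + E ^ 2) * D * A := by positivity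
        calc ((n + 1 : ℕ) + E ^ 2) * D * A = √(((n + 1 : ℕ) + E ^ 2) * D * A) ^ 2 :=
            (Real.sq_sqrt h4).symm
          _ ≤ _ := by
            gcongr
            linarith
      rw [mul_pow, mul_pow, Real.sq_sqrt hh.le, h2]
      refine (mul_le_mul_of_nonneg_left hle (by positivity)).trans ?_
      have h5 := mul_le_mul_of_nonneg_right h3 (mul_nonneg hh.le (Real.exp_pos (τ * c)).le)
      linarith
  refine ⟨?_, htwo (fun X Y => |X.1 - Y.1|) _ ?_ ?_,
    htwo (fun X Y => √(∑ j, (X.2.1 j - Y.2.1 j) ^ 2)) _ ?_ ?_,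
    htwo (fun X Y => |entropy γ X - entropy γ Y|) _ ?_ ?_⟩
  · rw [eLpNorm_one_eq_lintegral_enorm]
    refine le_trans ?_ ((RectMesh.lintegral_le_of_cellRel hγ1 hΩr hk hk' hF hτ hmem
      zero_le_one (f := cellRel γ) fun X _ Y _ => (one_mul _).ge).trans (ENNReal.ofReal_le_ofReal
        ((one_mul _).le.trans (hle.trans hone))))
    refine lintegral_mono_ae ?_
    filter_upwards [𝒯.ae_mem_cell hΩr] with x ⟨J, hx⟩
    have hg := isGas_of_mem hk' (hmem J)
    rw [𝒯.toFun_eq (U τ) hx, relEnergy_eq hγ1 hg (hρ hx), Real.enorm_eq_ofReal_abs,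
      abs_of_nonneg (relLin_nonneg hγ1 hg.admissible (hρ hx) (temperature_pos hγ1 _ (hρ hx)) _),
      cellRel, vel_conserved (hρ hx).ne', temp_conserved hγ1 (hρ hx)]
    exact le_rfl
  · intro X _ Y _
    have h1 : |X.1 - Y.1| ≤ ‖X - Y‖ := norm_fst_le (X - Y)
    have h2 : (1 : ℝ) ≤ (n + 1 : ℕ) + E ^ 2 := by
      have : (0 : ℝ) ≤ n := n.cast_nonneg
      push_cast
      nlinarith [sq_nonneg E]
    calc |X.1 - Y.1| ^ 2 ≤ 1 * ‖X - Y‖ ^ 2 := by rw [one_mul]; gcongr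
      _ ≤ _ := by gcongr
  · intro J x hx
    rw [𝒯.toFun_eq (U τ) hx]
    rfl
  · intro X _ Y _
    rw [Real.sq_sqrt (Finset.sum_nonneg fun _ _ => sq_nonneg _)]
    have h1 : ∀ j, (X.2.1 j - Y.2.1 j) ^ 2 ≤ ‖X - Y‖ ^ 2 := fun j => by
      rw [← sq_abs]
      have : |X.2.1 j - Y.2.1 j| ≤ ‖X - Y‖ := (norm_le_pi_norm (X - Y).2.1 j).trans
        ((norm_fst_le (X - Y).2).trans (norm_snd_le (X - Y)))
      gcongr
    refine (Finset.sum_le_sum fun j _ => h1 j).trans ?_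
    rw [Finset.sum_const, Finset.card_univ, Fintype.card_fin, nsmul_eq_mul]
    gcongr
    linarith [sq_nonneg E]
  · intro J x hx
    rw [𝒯.toFun_eq (U τ) hx, abs_of_nonneg (Real.sqrt_nonneg _)]
    rfl
  · intro X hX Y hY
    have h1 := hE X (hm1 hX) Y (hm2 hY)
    calc |entropy γ X - entropy γ Y| ^ 2 ≤ (E * ‖X - Y‖) ^ 2 := by gcongr
      _ = E ^ 2 * ‖X - Y‖ ^ 2 := by ring
      _ ≤ _ := by
        gcongr
        linarith [(n + 1 : ℕ).cast_nonneg (α := ℝ)]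
  · intro J x hx
    rw [𝒯.toFun_eq (U τ) hx, entropy_conserved hγ1 (hρ hx)]
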